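/- Let $\mathbb K$ be a field of characteristic $0$. A *cochain 2-category* is a category enriched in cochain complexes of modules concentrated in degrees $-1,0$, where the monoidal structure on such complexes is the tensor product truncated in degree $-1$, i.e. modulo the relations $q\otimes\partial p=\partial q\otimes p$ for $q,p$ of degree $-1$, and without degree $-2$ part. Degree $0$ elements of hom complexes are 1-cells, degree $-1$ elements are homotopies, and $\mathbf C\boxtimes\mathbf D$ has pairs as objects and truncated tensor products as hom complexes. A pseudonatural transformation $\xi:F\Rightarrow G$ between enriched functors consists of 1-cells $\xi_U:FU\to GU$ and homotopies $\xi_f:FU\to GU'$, linear in the 1-cell $f:U\to U'$, with $G(f)\xi_U-\xi_{U'}F(f)=\partial\xi_f$, $G(q)\xi_U-\xi_{U'}F(q)=\xi_{\partial q}$ for homotopies $q$, $\xi_{1_U}=0$, $\xi_{f'f}=\xi_{f'}F(f)+G(f')\xi_f$; the vertical composite is $(\theta\xi)_U=\theta_U\xi_U$, $(\theta\xi)_f=\theta_f\xi_U+\theta_{U'}\xi_f$. A modification $\Xi:\xi\Rrightarrow\xi'$ consists of homotopies $\Xi_U:FU\to GU$ with $\xi_U-\xi'_U=\partial\Xi_U$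 and $\Xi_{U'}F(f)+\xi_f=\xi'_f+G(f)\Xi_U$. Let $(\mathbf C,\otimes,I,\gamma)$ be a symmetric strict monoidal cochain 2-category over $\mathbb K$: $\otimes:\mathbf C\boxtimes\mathbf C\to\mathbf C$ is an enriched functor that is strictly associative and strictly unital, and $\gamma_{UV}:UV\to VU$ is natural (zero homotopy components) with $\gamma_{VU}\gamma_{UV}=1$ and $\gamma_{U(VW)}=(1_V\otimes\gamma_{UW})(\gamma_{UV}\otimes1_W)$. Let $t:\otimes\Rightarrow\otimes$ be a pseudonatural transformation that is * *strict*: for all objects and all 1-cells $f:U\to U'$, $g:V\to V'$, $k:W\to W'$, $t_{U(VW)}=t_{UV}\otimes1_W+(\gamma_{VU}\otimes1_W)(1_V\otimes t_{UW})(\gamma_{UV}\otimes1_W)$, $t_{f\boxtimes(g\otimes k)}=t_{f\boxtimes g}\otimes k+(\gamma_{V'U'}\otimes1_{W'})(g\otimes t_{f\boxtimes k})(\gamma_{UV}\otimes1_W)$, $t_{(UV)W}=1_U\otimes t_{VW}+(1_U\otimes\gamma_{WV})(t_{UW}\otimes1_V)(1_U\otimes\gamma_{VW})$, $t_{(f\otimes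 g)\boxtimes k}=f\otimes t_{g\boxtimes k}+(1_{U'}\otimes\gamma_{W'V'})(t_{f\boxtimes k}\otimes g)(1_U\otimes\gamma_{VW})$; * *totally symmetric*: $\gamma_{UV}t_{UV}=t_{VU}\gamma_{UV}$, $\gamma_{U'V'}t_{f\boxtimes g}=t_{g\boxtimes f}\gamma_{UV}$ and $t_{\gamma_{UV}\boxtimes1_W}=0$. Put $\mathcal L_{UVW}=t_{t_{UV}\boxtimes1_W}$ and $\mathcal R_{UVW}=t_{1_U\boxtimes t_{VW}}$, write $t_{12}=t\otimes1$, $t_{23}=1\otimes t$, and extend scalars from $\mathbb K$ to $\mathbb K[h]/(h^3)$. Then over $\mathbb K[h]/(h^3)$ the formulas $$\alpha=1+\tfrac{h^2}{24}[t_{12},t_{23}],\quad\Pi=0,\quad\sigma=\gamma e^{\frac h2t}=\gamma\bigl(1+\tfrac h2t+\tfrac{h^2}8t^2\bigr),$$ $$\mathcal H^L_{UVW}=\tfrac{h^2}{24}\gamma_{U(VW)}(2\mathcal L+\mathcal R)_{UVW},\quad\mathcal H^R_{UVW}=\tfrac{h^2}{24}\gamma_{(UV)W}(\mathcal L+2\mathcal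 R)_{UVW}$$ define pseudonatural isomorphisms $\alpha_{UVW}:(UV)W\to U(VW)$ and $\sigma_{UV}:UV\to VU$ and modifications $\Pi_{UVWX}:(1_U\otimes\alpha_{VWX})\alpha_{U(VW)X}(\alpha_{UVW}\otimes1_X)\Rrightarrow\alpha_{UV(WX)}\alpha_{(UV)WX}$, $\mathcal H^L_{UVW}:\alpha_{VWU}\sigma_{U(VW)}\alpha_{UVW}\Rrightarrow(1_V\otimes\sigma_{UW})\alpha_{VUW}(\sigma_{UV}\otimes1_W)$, $\mathcal H^R_{UVW}:\alpha^{-1}_{WUV}\sigma_{(UV)W}\alpha^{-1}_{UVW}\Rrightarrow(\sigma_{UW}\otimes1_V)\alpha^{-1}_{UWV}(1_U\otimes\sigma_{VW})$, and these satisfy the left tetrahedron, right tetrahedron and hexahedron axioms of a braided monoidal bicategory, i.e. (the terms in $\Pi$ being zero) for all objects $U,V,W,X$: (left tetrahedron) $$(1_V\otimes\alpha_{WXU})\alpha_{V(WX)U}\sigma_{1_U\boxtimes\alpha_{VWX}}\alpha_{U(VW)X}(\alpha_{UVW}\otimes1_X)+(1_V\otimes\alpha_{WXU})\mathcal H^L_{UV(WX)}\alpha_{(UV)WX}$$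 $$+(1_V\otimes\alpha_{WXU}\sigma_{U(WX)})\alpha_{VU(WX)}\alpha_{\sigma_{UV}\boxtimes1_W\boxtimes1_X}$$ $$=\alpha_{VW(XU)}\mathcal H^L_{U(VW)X}(\alpha_{UVW}\otimes1_X)-(1_V\otimes(1_W\otimes\sigma_{UX})\alpha_{WUX})\alpha_{1_V\boxtimes\sigma_{UW}\boxtimes1_X}(\alpha_{VUW}(\sigma_{UV}\otimes1_W)\otimes1_X)$$ $$-\alpha_{1_V\boxtimes1_W\boxtimes\sigma_{UX}}\alpha_{(VW)UX}(\sigma_{U(VW)}\alpha_{UVW}\otimes1_X)+(1_V\otimes(1_W\otimes\sigma_{UX})\alpha_{WUX})\alpha_{V(WU)X}(\mathcal H^L_{UVW}\otimes1_X)$$ $$-(1_V\otimes\mathcal H^L_{UWX})\alpha_{V(UW)X}(\alpha_{VUW}(\sigma_{UV}\otimes1_W)\otimes1_X);$$ (right tetrahedron) $$(\alpha^{-1}_{XUV}\otimes1_W)\alpha^{-1}_{X(UV)W}\sigma_{\alpha^{-1}_{UVW}\boxtimes1_X}\alpha^{-1}_{U(VW)X}(1_U\otimes\alpha^{-1}_{VWX})+(\alpha^{-1}_{XUV}\otimes1_W)\mathcal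 H^R_{(UV)WX}\alpha^{-1}_{UV(WX)}$$ $$+(\alpha^{-1}_{XUV}\sigma_{(UV)X}\otimes1_W)\alpha^{-1}_{(UV)XW}\alpha^{-1}_{1_U\boxtimes1_V\boxtimes\sigma_{WX}}$$ $$=\alpha^{-1}_{(XU)VW}\mathcal H^R_{U(VW)X}(1_U\otimes\alpha^{-1}_{VWX})-((\sigma_{UX}\otimes1_V)\alpha^{-1}_{UXV}\otimes1_W)\alpha^{-1}_{1_U\boxtimes\sigma_{VX}\boxtimes1_W}(1_U\otimes\alpha^{-1}_{VXW}(1_V\otimes\sigma_{WX}))$$ $$-\alpha^{-1}_{\sigma_{UX}\boxtimes1_V\boxtimes1_W}\alpha^{-1}_{UX(VW)}(1_U\otimes\sigma_{(VW)X}\alpha^{-1}_{VWX})+((\sigma_{UX}\otimes1_V)\alpha^{-1}_{UXV}\otimes1_W)\alpha^{-1}_{U(XV)W}(1_U\otimes\mathcal H^R_{VWX})$$ $$-(\mathcal H^R_{UVX}\otimes1_W)\alpha^{-1}_{U(VX)W}(1_U\otimes\alpha^{-1}_{VXW}(1_V\otimes\sigma_{WX}));$$ (hexahedron) $$\alpha_{W(XU)V}(\alpha_{WXU}\otimes1_V)\mathcal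 H^R_{UV(WX)}(1_U\otimes\alpha_{VWX})\alpha_{U(VW)X}-(1_W\otimes\alpha^{-1}_{XUV})\mathcal H^L_{(UV)WX}(\alpha^{-1}_{UVW}\otimes1_X)$$ $$=(1_W\otimes\mathcal H^R_{UVX})\alpha_{WU(VX)}\alpha_{(WU)VX}(\alpha^{-1}_{WUV}\sigma_{(UV)W}\alpha^{-1}_{UVW}\otimes1_X)$$ $$+[1_W\otimes(\sigma_{UX}\otimes1_V)\alpha^{-1}_{UXV}(1_U\otimes\sigma_{VX})]\alpha_{WU(VX)}[\alpha_{(WU)VX}(\mathcal H^R_{UVW}\otimes1_X)-\alpha_{\sigma_{UW}\boxtimes1_V\boxtimes1_X}(\alpha^{-1}_{UWV}(1_U\otimes\sigma_{VW})\otimes1_X)]$$ $$+(1_W\otimes(\sigma_{UX}\otimes1_V)\alpha^{-1}_{UXV})\alpha_{1_W\boxtimes1_U\boxtimes\sigma_{VX}}(\sigma_{UW}\otimes1_{VX})\alpha_{(UW)VX}(\alpha^{-1}_{UWV}(1_U\otimes\sigma_{VW})\otimes1_X)$$ $$+\alpha_{1_W\boxtimes\sigma_{UX}\boxtimes1_V}(\alpha_{WUX}\otimes1_V)\alpha^{-1}_{(WU)XV}(\sigma_{UW}\otimes\sigma_{VX})\alpha_{(UW)VX}(\alpha^{-1}_{UWV}(1_U\otimes\sigma_{VW})\otimes1_X)$$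 $$-\alpha_{W(XU)V}[(1_W\otimes\sigma_{UX})\alpha_{WUX}\otimes1_V]\alpha^{-1}_{(WU)XV}(\sigma_{UW}\otimes\sigma_{VX})\alpha^{-1}_{UW(VX)}(1_U\otimes\alpha_{WVX})\alpha_{1_U\boxtimes\sigma_{VW}\boxtimes1_X}$$ $$-\alpha_{W(XU)V}[(1_W\otimes\sigma_{UX})\alpha_{WUX}\otimes1_V]\alpha^{-1}_{\sigma_{UW}\boxtimes1_X\boxtimes1_V}(1_{UW}\otimes\sigma_{VX})\alpha^{-1}_{UW(VX)}[1_U\otimes\alpha_{WVX}(\sigma_{VW}\otimes1_X)]\alpha_{U(VW)X}$$ $$+\alpha_{W(XU)V}[(1_W\otimes\sigma_{UX})\alpha_{WUX}(\sigma_{UW}\otimes1_X)\otimes1_V]\alpha^{-1}_{(UW)XV}\alpha^{-1}_{1_U\boxtimes1_W\boxtimes\sigma_{VX}}[1_U\otimes\alpha_{WVX}(\sigma_{VW}\otimes1_X)]\alpha_{U(VW)X}$$ $$-\alpha_{W(XU)V}(\mathcal H^L_{UWX}\otimes1_V)\alpha^{-1}_{(UW)XV}\alpha^{-1}_{UW(XV)}[1_U\otimes(1_W\otimes\sigma_{VX})\alpha_{WVX}(\sigma_{VW}\otimes1_X)]\alpha_{U(VW)X}$$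 $$-\alpha_{W(XU)V}(\alpha_{WXU}\sigma_{U(WX)}\alpha_{UWX}\otimes1_V)\alpha^{-1}_{(UW)XV}\alpha^{-1}_{UW(XV)}(1_U\otimes\mathcal H^L_{VWX})\alpha_{U(VW)X}.$$ -/

import Mathlib

open scoped TensorProduct Polynomial

universe u v w v' w' v'' w''

set_option linter.checkUnivs false in
/-- A category enriched in cochain complexes of `R`-modules concentrated in degrees `-1, 0`, with the
truncated tensor product as monoidal structure (a "cochain 2-category").  `H0 X Y` and `H1 X Y` are
the degree `0` part (1-cells) and the degree `-1` part (2-cells, "homotopies") of the hom complex, `d`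
is the differential, and `c00`, `c01`, `c10` are the three non-zero components of the composition
(written in the order of composition of maps).  A composite of two homotopies has degree `-2` and so
is zero; compatibility of composition with the truncated tensor product is the axiom `trunc`. -/
structure CochCat (R : Type u) [CommRing R] where
  Obj : Type v
  H0 : Obj → Obj → Type w
  H1 : Obj → Obj → Type w
  [addCommGroup0 : ∀ X Y, AddCommGroup (H0 X Y)]
  [addCommGroup1 : ∀ X Y, AddCommGroup (H1 X Y)]
  [module0 : ∀ X Y, Module R (H0 X Y)]
  [module1 : ∀ X Y, Module R (H1 X Y)]
  d : ∀ {X Y : Obj}, H1 X Y →ₗ[R] H0 X Y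
  one : ∀ X : Obj, H0 X X
  c00 : ∀ {X Y Z : Obj}, H0 Y Z →ₗ[R] H0 X Y →ₗ[R] H0 X Z
  c01 : ∀ {X Y Z : Obj}, H0 Y Z →ₗ[R] H1 X Y →ₗ[R] H1 X Z
  c10 : ∀ {X Y Z : Obj}, H1 Y Z →ₗ[R] H0 X Y →ₗ[R] H1 X Z
  one_c00 : ∀ {X Y : Obj} (f : H0 X Y), c00 (one Y) f = f
  c00_one : ∀ {X Y : Obj} (f : H0 X Y), c00 f (one X) = f
  one_c01 : ∀ {X Y : Obj} (q : H1 X Y), c01 (one Y) q = q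
  c10_one : ∀ {X Y : Obj} (q : H1 X Y), c10 q (one X) = q
  assoc000 : ∀ {W X Y Z : Obj} (f : H0 Y Z) (g : H0 X Y) (k : H0 W X),
    c00 (c00 f g) k = c00 f (c00 g k)
  assoc001 : ∀ {W X Y Z : Obj} (f : H0 Y Z) (g : H0 X Y) (q : H1 W X),
    c01 (c00 f g) q = c01 f (c01 g q)
  assoc010 : ∀ {W X Y Z : Obj} (f : H0 Y Z) (q : H1 X Y) (k : H0 W X),
    c10 (c01 f q) k = c01 f (c10 q k)
  assoc100 : ∀ {W X Y Z : Obj} (q : H1 Y Z) (g : H0 X Y) (k : H0 W X),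
    c10 (c10 q g) k = c10 q (c00 g k)
  d_c01 : ∀ {X Y Z : Obj} (f : H0 Y Z) (q : H1 X Y), d (c01 f q) = c00 f (d q)
  d_c10 : ∀ {X Y Z : Obj} (q : H1 Y Z) (f : H0 X Y), d (c10 q f) = c00 (d q) f
  trunc : ∀ {X Y Z : Obj} (q : H1 Y Z) (p : H1 X Y), c01 (d q) p = c10 q (d p)

attribute [instance] CochCat.addCommGroup0 CochCat.addCommGroup1 CochCat.module0 CochCat.module1

namespace CochCat

section Basic

variable {R : Type u} [CommRing R]

/-- The identity 1-cell, regarded as a 1-cell between two equal objects. -/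
def idOfEq (C : CochCat.{u, v, w} R) {X Y : C.Obj} (h : X = Y) : C.H0 X Y := h ▸ C.one X

/-- A functor enriched in cochain complexes concentrated in degrees `-1, 0`. -/
structure Func (C : CochCat.{u, v, w} R) (D : CochCat.{u, v', w'} R) where
  obj : C.Obj → D.Obj
  map0 : ∀ {X Y : C.Obj}, C.H0 X Y →ₗ[R] D.H0 (obj X) (obj Y)
  map1 : ∀ {X Y : C.Obj}, C.H1 X Y →ₗ[R] D.H1 (obj X) (obj Y)
  map_d : ∀ {X Y : C.Obj} (q : C.H1 X Y), map0 (C.d q) = D.d (map1 q)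
  map_one : ∀ X : C.Obj, map0 (C.one X) = D.one (obj X)
  map_c00 : ∀ {X Y Z : C.Obj} (f : C.H0 Y Z) (g : C.H0 X Y),
    map0 (C.c00 f g) = D.c00 (map0 f) (map0 g)
  map_c01 : ∀ {X Y Z : C.Obj} (f : C.H0 Y Z) (q : C.H1 X Y),
    map1 (C.c01 f q) = D.c01 (map0 f) (map1 q)
  map_c10 : ∀ {X Y Z : C.Obj} (q : C.H1 Y Z) (f : C.H0 X Y),
    map1 (C.c10 q f) = D.c10 (map1 q) (map0 f)

/-- The identity functor. -/
def Func.id (C : CochCat.{u, v, w} R) : Func C C where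
  obj X := X
  map0 := LinearMap.id
  map1 := LinearMap.id
  map_d _ := rfl
  map_one _ := rfl
  map_c00 _ _ := rfl
  map_c01 _ _ := rfl
  map_c10 _ _ := rfl

/-- The composite functor, first `F` and then `G`. -/
def Func.comp {C : CochCat.{u, v, w} R} {D : CochCat.{u, v', w'} R} {E : CochCat.{u, v'', w''} R}
    (F : Func C D) (G : Func D E) : Func C E where
  obj X := G.obj (F.obj X)
  map0 := G.map0 ∘ₗ F.map0
  map1 := G.map1 ∘ₗ F.map1
  map_d q := by simp [F.map_d, G.map_d]
  map_one X := by simp [F.map_one, G.map_one]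
  map_c00 f g := by simp [F.map_c00, G.map_c00]
  map_c01 f g := by simp [F.map_c01, G.map_c01]
  map_c10 f g := by simp [F.map_c10, G.map_c10]

/-- The relations that define the degree `-1` part of the truncated tensor product: the
differential of a product of two homotopies is set to zero. -/
def boxRel (C : CochCat.{u, v, w} R) (D : CochCat.{u, v', w'} R) (U U' : C.Obj) (V V' : D.Obj) :
    C.H1 U U' ⊗[R] D.H1 V V' →ₗ[R]
      (C.H1 U U' ⊗[R] D.H0 V V') × (C.H0 U U' ⊗[R] D.H1 V V') :=
  LinearMap.prod (-(TensorProduct.map (LinearMap.id : C.H1 U U' →ₗ[R] C.H1 U U')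
      (D.d : D.H1 V V' →ₗ[R] D.H0 V V')))
    (TensorProduct.map (C.d : C.H1 U U' →ₗ[R] C.H0 U U')
      (LinearMap.id : D.H1 V V' →ₗ[R] D.H1 V V'))

/-- The degree `-1` part of the truncated tensor product of two hom complexes. -/
def BoxH1 (C : CochCat.{u, v, w} R) (D : CochCat.{u, v', w'} R) (U U' : C.Obj) (V V' : D.Obj) :
    Type (max w w') :=
  ((C.H1 U U' ⊗[R] D.H0 V V') × (C.H0 U U' ⊗[R] D.H1 V V')) ⧸
    LinearMap.range (boxRel C D U U' V V')

namespace BoxH1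

variable {C : CochCat.{u, v, w} R} {D : CochCat.{u, v', w'} R} {U U' : C.Obj} {V V' : D.Obj}

instance : AddCommGroup (BoxH1 C D U U' V V') :=
  inferInstanceAs (AddCommGroup (_ ⧸ LinearMap.range (boxRel C D U U' V V')))

instance : Module R (BoxH1 C D U U' V V') :=
  inferInstanceAs (Module R (_ ⧸ LinearMap.range (boxRel C D U U' V V')))

/-- The quotient map. -/
def mk : ((C.H1 U U' ⊗[R] D.H0 V V') × (C.H0 U U' ⊗[R] D.H1 V V')) →ₗ[R] BoxH1 C D U U' V V' :=
  Submodule.mkQ _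

/-- `q ⊗ g ↦ q ⊠ g` for `q` of degree `-1` and `g` of degree `0`. -/
def inl : C.H1 U U' ⊗[R] D.H0 V V' →ₗ[R] BoxH1 C D U U' V V' := mk ∘ₗ LinearMap.inl R _ _

/-- `f ⊗ p ↦ f ⊠ p` for `f` of degree `0` and `p` of degree `-1`. -/
def inr : C.H0 U U' ⊗[R] D.H1 V V' →ₗ[R] BoxH1 C D U U' V V' := mk ∘ₗ LinearMap.inr R _ _

theorem inl_d (q : C.H1 U U') (p : D.H1 V V') :
    (inl (q ⊗ₜ[R] D.d p) : BoxH1 C D U U' V V') = inr (C.d q ⊗ₜ[R] p) := by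
  symm
  rw [← sub_eq_zero]
  have : (inr (C.d q ⊗ₜ[R] p) - inl (q ⊗ₜ[R] D.d p) : BoxH1 C D U U' V V')
      = mk (boxRel C D U U' V V' (q ⊗ₜ p)) := by
    simp only [inl, inr, LinearMap.comp_apply, ← map_sub]
    simp [boxRel]
  rw [this]
  exact (Submodule.Quotient.mk_eq_zero _).2 ⟨_, rfl⟩

/-- Linear maps out of the truncated tensor product. -/
def lift {M : Type*} [AddCommGroup M] [Module R M]
    (a : C.H1 U U' ⊗[R] D.H0 V V' →ₗ[R] M) (b : C.H0 U U' ⊗[R] D.H1 V V' →ₗ[R] M)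
    (h : ∀ q p, a (q ⊗ₜ D.d p) = b (C.d q ⊗ₜ p)) : BoxH1 C D U U' V V' →ₗ[R] M :=
  Submodule.liftQ _ (a.coprod b) (by
    rintro _ ⟨x, rfl⟩
    induction x with
    | zero => simp
    | tmul q p => simp [boxRel, h]
    | add x y hx hy => rw [map_add]; exact add_mem hx hy)

@[simp] theorem lift_inl {M : Type*} [AddCommGroup M] [Module R M]
    (a : C.H1 U U' ⊗[R] D.H0 V V' →ₗ[R] M) (b : C.H0 U U' ⊗[R] D.H1 V V' →ₗ[R] M)
    (h : ∀ q p, a (q ⊗ₜ D.d p) = b (C.d q ⊗ₜ p)) (x) : lift a b h (inl x) = a x := by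
  have : lift a b h (inl x) = (a.coprod b) (x, 0) := rfl
  simp [this]

@[simp] theorem lift_inr {M : Type*} [AddCommGroup M] [Module R M]
    (a : C.H1 U U' ⊗[R] D.H0 V V' →ₗ[R] M) (b : C.H0 U U' ⊗[R] D.H1 V V' →ₗ[R] M)
    (h : ∀ q p, a (q ⊗ₜ D.d p) = b (C.d q ⊗ₜ p)) (x) : lift a b h (inr x) = b x := by
  have : lift a b h (inr x) = (a.coprod b) (0, x) := rfl
  simp [this]

theorem ind {P : BoxH1 C D U U' V V' → Prop}
    (hl : ∀ q g, P (inl (q ⊗ₜ g))) (hr : ∀ f p, P (inr (f ⊗ₜ p)))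
    (ha : ∀ x y, P x → P y → P (x + y)) (x : BoxH1 C D U U' V V') : P x := by
  obtain ⟨⟨x, y⟩, rfl⟩ := Submodule.Quotient.mk_surjective _ x
  have e : (Submodule.Quotient.mk (x, y) : BoxH1 C D U U' V V') = inl x + inr y := by
    simp only [inl, inr, LinearMap.comp_apply, ← map_add]
    simp [mk]
    rfl
  have h0 : P 0 := by simpa using hl 0 0
  have h1 : ∀ x, P (inl x) := fun x => by
    induction x with
    | zero => simpa using h0
    | tmul q p => exact hl _ _
    | add x y hx hy => rw [map_add]; exact ha _ _ hx hy
  have h2 : ∀ x, P (inr x) := fun x => by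
    induction x with
    | zero => simpa using h0
    | tmul q p => exact hr _ _
    | add x y hx hy => rw [map_add]; exact ha _ _ hx hy
  rw [e]
  exact ha _ _ (h1 x) (h2 y)

end BoxH1

section BoxOps

variable (C : CochCat.{u, v, w} R) (D : CochCat.{u, v', w'} R)

/-- The differential of the truncated tensor product. -/
def boxD (U U' : C.Obj) (V V' : D.Obj) :
    BoxH1 C D U U' V V' →ₗ[R] C.H0 U U' ⊗[R] D.H0 V V' :=
  BoxH1.lift (TensorProduct.map C.d LinearMap.id) (TensorProduct.map LinearMap.id D.d)
    (fun q p => by simp)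

@[simp] theorem boxD_inl {U U' : C.Obj} {V V' : D.Obj} (q : C.H1 U U') (g : D.H0 V V') :
    boxD C D U U' V V' (BoxH1.inl (q ⊗ₜ g)) = C.d q ⊗ₜ g :=
  (BoxH1.lift_inl _ _ _ _).trans (by simp)

@[simp] theorem boxD_inr {U U' : C.Obj} {V V' : D.Obj} (f : C.H0 U U') (p : D.H1 V V') :
    boxD C D U U' V V' (BoxH1.inr (f ⊗ₜ p)) = f ⊗ₜ D.d p :=
  (BoxH1.lift_inr _ _ _ _).trans (by simp)

/-- Middle-four exchange `(f' ⊠ g') (q ⊠ g) = f' q ⊠ g' g`, `(f' ⊠ g') (f ⊠ p) = f' f ⊠ g' p`. -/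
def boxC01 (U U' U'' : C.Obj) (V V' V'' : D.Obj) :
    C.H0 U' U'' ⊗[R] D.H0 V' V'' →ₗ[R] BoxH1 C D U U' V V' →ₗ[R] BoxH1 C D U U'' V V'' :=
  (BoxH1.lift ((TensorProduct.map₂ C.c01.flip D.c00.flip).compr₂ BoxH1.inl)
    ((TensorProduct.map₂ C.c00.flip D.c01.flip).compr₂ BoxH1.inr) (fun q p => by
      ext f g
      simp [← D.d_c01, BoxH1.inl_d, C.d_c01])).flip

@[simp] theorem boxC01_inl {U U' U'' : C.Obj} {V V' V'' : D.Obj} (f' : C.H0 U' U'')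
    (g' : D.H0 V' V'') (q : C.H1 U U') (g : D.H0 V V') :
    boxC01 C D U U' U'' V V' V'' (f' ⊗ₜ g') (BoxH1.inl (q ⊗ₜ g))
      = BoxH1.inl (C.c01 f' q ⊗ₜ D.c00 g' g) := by simp [boxC01]

@[simp] theorem boxC01_inr {U U' U'' : C.Obj} {V V' V'' : D.Obj} (f' : C.H0 U' U'')
    (g' : D.H0 V' V'') (f : C.H0 U U') (p : D.H1 V V') :
    boxC01 C D U U' U'' V V' V'' (f' ⊗ₜ g') (BoxH1.inr (f ⊗ₜ p))
      = BoxH1.inr (C.c00 f' f ⊗ₜ D.c01 g' p) := by simp [boxC01]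

/-- Middle-four exchange `(q ⊠ g) (f' ⊠ g') = q f' ⊠ g g'`, `(f ⊠ p) (f' ⊠ g') = f f' ⊠ p g'`. -/
def boxC10 (U U' U'' : C.Obj) (V V' V'' : D.Obj) :
    BoxH1 C D U' U'' V' V'' →ₗ[R] C.H0 U U' ⊗[R] D.H0 V V' →ₗ[R] BoxH1 C D U U'' V V'' :=
  BoxH1.lift ((TensorProduct.map₂ C.c10 D.c00).compr₂ BoxH1.inl)
    ((TensorProduct.map₂ C.c00 D.c10).compr₂ BoxH1.inr) (fun q p => by
      ext f g
      simp [← D.d_c10, BoxH1.inl_d, C.d_c10])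

@[simp] theorem boxC10_inl {U U' U'' : C.Obj} {V V' V'' : D.Obj} (f' : C.H0 U U')
    (g' : D.H0 V V') (q : C.H1 U' U'') (g : D.H0 V' V'') :
    boxC10 C D U U' U'' V V' V'' (BoxH1.inl (q ⊗ₜ g)) (f' ⊗ₜ g')
      = BoxH1.inl (C.c10 q f' ⊗ₜ D.c00 g g') := by simp [boxC10]

@[simp] theorem boxC10_inr {U U' U'' : C.Obj} {V V' V'' : D.Obj} (f' : C.H0 U U')
    (g' : D.H0 V V') (f : C.H0 U' U'') (p : D.H1 V' V'') :
    boxC10 C D U U' U'' V V' V'' (BoxH1.inr (f ⊗ₜ p)) (f' ⊗ₜ g')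
      = BoxH1.inr (C.c00 f f' ⊗ₜ D.c10 p g') := by simp [boxC10]

end BoxOps

/-- The product `C ⊠ D`: objects are pairs, hom complexes are truncated tensor products. -/
@[reducible] def box (C : CochCat.{u, v, w} R) (D : CochCat.{u, v', w'} R) :
    CochCat.{u, max v v', max w w'} R where
  Obj := C.Obj × D.Obj
  H0 X Y := C.H0 X.1 Y.1 ⊗[R] D.H0 X.2 Y.2
  H1 X Y := BoxH1 C D X.1 Y.1 X.2 Y.2
  d := boxD C D _ _ _ _
  one X := C.one X.1 ⊗ₜ D.one X.2
  c00 := TensorProduct.map₂ C.c00 D.c00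
  c01 := boxC01 C D _ _ _ _ _ _
  c10 := boxC10 C D _ _ _ _ _ _
  one_c00 f := by
    induction f with
    | zero => simp
    | tmul f g => simp [C.one_c00, D.one_c00]
    | add x y hx hy => rw [map_add, hx, hy]
  c00_one f := by
    induction f with
    | zero => simp
    | tmul f g => simp [C.c00_one, D.c00_one]
    | add x y hx hy => rw [map_add, LinearMap.add_apply, hx, hy]
  one_c01 q := by
    induction q using BoxH1.ind with
    | hl q g => simp [C.one_c01, D.one_c00]
    | hr q g => simp [C.one_c00, D.one_c01]
    | ha x y hx hy => rw [map_add, hx, hy]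
  c10_one q := by
    induction q using BoxH1.ind with
    | hl q g => simp [C.c10_one, D.c00_one]
    | hr q g => simp [C.c00_one, D.c10_one]
    | ha x y hx hy => rw [map_add, LinearMap.add_apply, hx, hy]
  assoc000 f g k := by
    induction f with
    | zero => simp
    | add x y hx hy => simp only [map_add, LinearMap.add_apply, hx, hy]
    | tmul f f' =>
      induction g with
      | zero => simp
      | add x y hx hy => simp only [map_add, LinearMap.add_apply, hx, hy]
      | tmul g g' =>
        induction k with
        | zero => simp
        | add x y hx hy => simp only [map_add, hx, hy]
        | tmul k k' => simp [C.assoc000, D.assoc000]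
  assoc001 f g q := by
    induction f with
    | zero => simp
    | add x y hx hy => simp only [map_add, LinearMap.add_apply, hx, hy]
    | tmul f f' =>
      induction g with
      | zero => simp
      | add x y hx hy => simp only [map_add, LinearMap.add_apply, hx, hy]
      | tmul g g' =>
        induction q using BoxH1.ind with
        | hl q k => simp [C.assoc001, D.assoc000]
        | hr k q => simp [C.assoc000, D.assoc001]
        | ha x y hx hy => simp only [map_add, hx, hy]
  assoc010 f q k := by
    induction f with
    | zero => simp
    | add x y hx hy => simp only [map_add, LinearMap.add_apply, hx, hy]
    | tmul f f' =>
      induction k with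
      | zero => simp
      | add x y hx hy => simp only [map_add, hx, hy]
      | tmul g g' =>
        induction q using BoxH1.ind with
        | hl q k => simp [C.assoc010, D.assoc000]
        | hr k q => simp [C.assoc000, D.assoc010]
        | ha x y hx hy => simp only [map_add, LinearMap.add_apply, hx, hy]
  assoc100 q g k := by
    induction g with
    | zero => simp
    | add x y hx hy => simp only [map_add, LinearMap.add_apply, hx, hy]
    | tmul f f' =>
      induction k with
      | zero => simp
      | add x y hx hy => simp only [map_add, hx, hy]
      | tmul g g' =>
        induction q using BoxH1.ind with
        | hl q k => simp [C.assoc100, D.assoc000]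
        | hr k q => simp [C.assoc000, D.assoc100]
        | ha x y hx hy => simp only [map_add, LinearMap.add_apply, hx, hy]
  d_c01 f q := by
    induction f with
    | zero => simp
    | add x y hx hy => simp only [map_add, LinearMap.add_apply, hx, hy]
    | tmul f f' =>
      induction q using BoxH1.ind with
      | hl q k => simp [C.d_c01]
      | hr k q => simp [D.d_c01]
      | ha x y hx hy => simp only [map_add, hx, hy]
  d_c10 q f := by
    induction f with
    | zero => simp
    | add x y hx hy => simp only [map_add, hx, hy]
    | tmul f f' =>
      induction q using BoxH1.ind with
      | hl q k => simp [C.d_c10]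
      | hr k q => simp [D.d_c10]
      | ha x y hx hy => simp only [map_add, LinearMap.add_apply, hx, hy]
  trunc q p := by
    induction q using BoxH1.ind with
    | ha x y hx hy => simp only [map_add, LinearMap.add_apply, hx, hy]
    | hl q g =>
      induction p using BoxH1.ind with
      | ha x y hx hy => simp only [map_add, hx, hy]
      | hl p k => simp [C.trunc]
      | hr k p => simp [← D.d_c01, BoxH1.inl_d, C.d_c10]
    | hr g q =>
      induction p using BoxH1.ind with
      | ha x y hx hy => simp only [map_add, hx, hy]
      | hl p k => simp [← D.d_c10, BoxH1.inl_d, C.d_c01]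
      | hr k p => simp [D.trunc]

section BoxFunc

variable {C : CochCat.{u, v, w} R} {D : CochCat.{u, v', w'} R} {E : CochCat.{u, v'', w''} R}

/-- A functor on `C ⊠ D` may be given by linear maps that respect the structure on generators. -/
def Func.ofBox (obj : C.Obj × D.Obj → E.Obj)
    (map0 : ∀ X Y : C.Obj × D.Obj,
      C.H0 X.1 Y.1 ⊗[R] D.H0 X.2 Y.2 →ₗ[R] E.H0 (obj X) (obj Y))
    (map1 : ∀ X Y : C.Obj × D.Obj, BoxH1 C D X.1 Y.1 X.2 Y.2 →ₗ[R] E.H1 (obj X) (obj Y))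
    (hdl : ∀ (X Y : C.Obj × D.Obj) (q : C.H1 X.1 Y.1) (g : D.H0 X.2 Y.2),
      map0 X Y (C.d q ⊗ₜ g) = E.d (map1 X Y (BoxH1.inl (q ⊗ₜ g))))
    (hdr : ∀ (X Y : C.Obj × D.Obj) (f : C.H0 X.1 Y.1) (p : D.H1 X.2 Y.2),
      map0 X Y (f ⊗ₜ D.d p) = E.d (map1 X Y (BoxH1.inr (f ⊗ₜ p))))
    (hone : ∀ X : C.Obj × D.Obj, map0 X X (C.one X.1 ⊗ₜ D.one X.2) = E.one (obj X))
    (h00 : ∀ (X Y Z : C.Obj × D.Obj) (f : C.H0 Y.1 Z.1) (g : D.H0 Y.2 Z.2) (f' : C.H0 X.1 Y.1)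
      (g' : D.H0 X.2 Y.2),
      map0 X Z (C.c00 f f' ⊗ₜ D.c00 g g') = E.c00 (map0 Y Z (f ⊗ₜ g)) (map0 X Y (f' ⊗ₜ g')))
    (h01l : ∀ (X Y Z : C.Obj × D.Obj) (f : C.H0 Y.1 Z.1) (g : D.H0 Y.2 Z.2) (q : C.H1 X.1 Y.1)
      (g' : D.H0 X.2 Y.2),
      map1 X Z (BoxH1.inl (C.c01 f q ⊗ₜ D.c00 g g'))
        = E.c01 (map0 Y Z (f ⊗ₜ g)) (map1 X Y (BoxH1.inl (q ⊗ₜ g'))))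
    (h01r : ∀ (X Y Z : C.Obj × D.Obj) (f : C.H0 Y.1 Z.1) (g : D.H0 Y.2 Z.2) (f' : C.H0 X.1 Y.1)
      (p : D.H1 X.2 Y.2),
      map1 X Z (BoxH1.inr (C.c00 f f' ⊗ₜ D.c01 g p))
        = E.c01 (map0 Y Z (f ⊗ₜ g)) (map1 X Y (BoxH1.inr (f' ⊗ₜ p))))
    (h10l : ∀ (X Y Z : C.Obj × D.Obj) (q : C.H1 Y.1 Z.1) (g : D.H0 Y.2 Z.2) (f' : C.H0 X.1 Y.1)
      (g' : D.H0 X.2 Y.2),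
      map1 X Z (BoxH1.inl (C.c10 q f' ⊗ₜ D.c00 g g'))
        = E.c10 (map1 Y Z (BoxH1.inl (q ⊗ₜ g))) (map0 X Y (f' ⊗ₜ g')))
    (h10r : ∀ (X Y Z : C.Obj × D.Obj) (f : C.H0 Y.1 Z.1) (p : D.H1 Y.2 Z.2) (f' : C.H0 X.1 Y.1)
      (g' : D.H0 X.2 Y.2),
      map1 X Z (BoxH1.inr (C.c00 f f' ⊗ₜ D.c10 p g'))
        = E.c10 (map1 Y Z (BoxH1.inr (f ⊗ₜ p))) (map0 X Y (f' ⊗ₜ g'))) :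
    Func (C.box D) E where
  obj := obj
  map0 {X Y} := map0 X Y
  map1 {X Y} := map1 X Y
  map_d q := by
    induction q using BoxH1.ind with
    | hl q g => simpa using hdl _ _ q g
    | hr f p => simpa using hdr _ _ f p
    | ha x y hx hy => simp only [map_add, hx, hy]
  map_one X := hone X
  map_c00 f g := by
    induction f using TensorProduct.induction_on with
    | zero => simp
    | add x y hx hy => simp only [map_add, LinearMap.add_apply, hx, hy]
    | tmul f f' =>
      induction g using TensorProduct.induction_on with
      | zero => simp
      | add x y hx hy => simp only [map_add, hx, hy]
      | tmul g g' => simpa using h00 _ _ _ f f' g g'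
  map_c01 f q := by
    induction f using TensorProduct.induction_on with
    | zero => simp
    | add x y hx hy => simp only [map_add, LinearMap.add_apply, hx, hy]
    | tmul f f' =>
      induction q using BoxH1.ind with
      | hl q g => simpa using h01l _ _ _ f f' q g
      | hr k p => simpa using h01r _ _ _ f f' k p
      | ha x y hx hy => simp only [map_add, hx, hy]
  map_c10 q f := by
    induction f using TensorProduct.induction_on with
    | zero => simp
    | add x y hx hy => simp only [map_add, hx, hy]
    | tmul f f' =>
      induction q using BoxH1.ind with
      | hl q g => simpa using h10l _ _ _ q g f f'
      | hr k p => simpa using h10r _ _ _ k p f f'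
      | ha x y hx hy => simp only [map_add, LinearMap.add_apply, hx, hy]

/-- The degree `-1` part of the product of two functors. -/
def boxMap1 {C' : CochCat.{u, v, w} R} {D' : CochCat.{u, v', w'} R} (F : Func C C') (G : Func D D')
    (U U' : C.Obj) (V V' : D.Obj) :
    BoxH1 C D U U' V V' →ₗ[R] BoxH1 C' D' (F.obj U) (F.obj U') (G.obj V) (G.obj V') :=
  BoxH1.lift (BoxH1.inl ∘ₗ TensorProduct.map F.map1 G.map0)
    (BoxH1.inr ∘ₗ TensorProduct.map F.map0 G.map1)
    (fun q p => by simp [G.map_d, F.map_d, BoxH1.inl_d])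

/-- The product functor `F ⊠ G`. -/
def Func.box {C' : CochCat.{u, v, w} R} {D' : CochCat.{u, v', w'} R} (F : Func C C')
    (G : Func D D') : Func (C.box D) (C'.box D') :=
  Func.ofBox (E := C'.box D') (fun X => (F.obj X.1, G.obj X.2))
    (fun _ _ => TensorProduct.map F.map0 G.map0) (fun _ _ => boxMap1 F G _ _ _ _)
    (fun _ _ q g => by simp [boxMap1, F.map_d])
    (fun _ _ f p => by simp [boxMap1, G.map_d])
    (fun X => by simp [F.map_one, G.map_one])
    (fun _ _ _ f g f' g' => by simp [F.map_c00, G.map_c00])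
    (fun _ _ _ f g q g' => by simp [boxMap1, F.map_c01, G.map_c00])
    (fun _ _ _ f g f' p => by simp [boxMap1, F.map_c00, G.map_c01])
    (fun _ _ _ q g f' g' => by simp [boxMap1, F.map_c10, G.map_c00])
    (fun _ _ _ f p f' g' => by simp [boxMap1, F.map_c00, G.map_c10])

/-- The degree `-1` part of the interchange functor. -/
def boxSwap1 (U U' : C.Obj) (V V' : D.Obj) : BoxH1 C D U U' V V' →ₗ[R] BoxH1 D C V V' U U' :=
  BoxH1.lift (BoxH1.inr ∘ₗ (TensorProduct.comm R _ _).toLinearMap)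
    (BoxH1.inl ∘ₗ (TensorProduct.comm R _ _).toLinearMap)
    (fun q p => by simp [BoxH1.inl_d])

@[simp] theorem boxSwap1_inl {U U' : C.Obj} {V V' : D.Obj} (q : C.H1 U U') (g : D.H0 V V') :
    boxSwap1 U U' V V' (BoxH1.inl (q ⊗ₜ g)) = BoxH1.inr (g ⊗ₜ q) :=
  (BoxH1.lift_inl _ _ _ _).trans (by simp)

@[simp] theorem boxSwap1_inr {U U' : C.Obj} {V V' : D.Obj} (f : C.H0 U U') (p : D.H1 V V') :
    boxSwap1 U U' V V' (BoxH1.inr (f ⊗ₜ p)) = BoxH1.inl (p ⊗ₜ f) :=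
  (BoxH1.lift_inr _ _ _ _).trans (by simp)

variable (C D E)

/-- The interchange functor `τ : C ⊠ D → D ⊠ C`. -/
def boxSwap : Func (C.box D) (D.box C) :=
  Func.ofBox (E := D.box C) (fun X => (X.2, X.1))
    (fun _ _ => (TensorProduct.comm R _ _).toLinearMap) (fun _ _ => boxSwap1 _ _ _ _)
    (fun _ _ q g => by simp)
    (fun _ _ f p => by simp)
    (fun X => by simp)
    (fun _ _ _ f g f' g' => by simp)
    (fun _ _ _ f g q g' => by simp)
    (fun _ _ _ f g f' p => by simp)
    (fun _ _ _ q g f' g' => by simp)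
    (fun _ _ _ f p f' g' => by simp)

/-- The degree `-1` part of the rebracketing functor. -/
def boxAssoc1 (X X' : C.Obj × D.Obj) (W W' : E.Obj) :
    BoxH1 (C.box D) E X X' W W' →ₗ[R] BoxH1 C (D.box E) X.1 X'.1 (X.2, W) (X'.2, W') :=
  BoxH1.lift
    (TensorProduct.lift (BoxH1.lift (C := C) (D := D)
      (TensorProduct.curry ((BoxH1.inl (C := C) (D := D.box E) (V := (X.2, W)) (V' := (X'.2, W'))) ∘ₗ
        (TensorProduct.assoc R (C.H1 X.1 X'.1) (D.H0 X.2 X'.2) (E.H0 W W')).toLinearMap))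
      (TensorProduct.curry ((BoxH1.inr (C := C) (D := D.box E) (V := (X.2, W)) (V' := (X'.2, W'))) ∘ₗ
        (LinearMap.lTensor (C.H0 X.1 X'.1) (BoxH1.inl (C := D) (D := E))) ∘ₗ
          (TensorProduct.assoc R (C.H0 X.1 X'.1) (D.H1 X.2 X'.2) (E.H0 W W')).toLinearMap))
      (fun q p => by
        ext k
        have := BoxH1.inl_d (C := C) (D := D.box E) (V := (X.2, W)) (V' := (X'.2, W')) q
          (BoxH1.inl (p ⊗ₜ k))
        simpa using this)))
    ((BoxH1.inr (C := C) (D := D.box E) (V := (X.2, W)) (V' := (X'.2, W'))) ∘ₗ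
      (LinearMap.lTensor (C.H0 X.1 X'.1) (BoxH1.inr (C := D) (D := E))) ∘ₗ
        (TensorProduct.assoc R (C.H0 X.1 X'.1) (D.H0 X.2 X'.2) (E.H1 W W')).toLinearMap)
    (fun q r => by
      induction q using BoxH1.ind with
      | hl q g =>
        have := BoxH1.inl_d (C := C) (D := D.box E) (V := (X.2, W)) (V' := (X'.2, W')) q
          (BoxH1.inr (g ⊗ₜ r))
        simpa using this
      | hr f p => simp [BoxH1.inl_d]
      | ha x y hx hy => simp only [map_add, TensorProduct.add_tmul, hx, hy])

variable {C D E} in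
@[simp] theorem boxAssoc1_inl_inl {X X' : C.Obj × D.Obj} {W W' : E.Obj} (q : C.H1 X.1 X'.1)
    (g : D.H0 X.2 X'.2) (k : E.H0 W W') :
    boxAssoc1 C D E X X' W W' (BoxH1.inl (BoxH1.inl (q ⊗ₜ g) ⊗ₜ k))
      = BoxH1.inl (q ⊗ₜ (g ⊗ₜ k)) := by
  refine (BoxH1.lift_inl _ _ _ _).trans ?_
  refine (TensorProduct.lift.tmul _ _).trans ?_
  exact LinearMap.congr_fun (BoxH1.lift_inl _ _ _ (q ⊗ₜ g)) k

variable {C D E} in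
@[simp] theorem boxAssoc1_inl_inr {X X' : C.Obj × D.Obj} {W W' : E.Obj} (f : C.H0 X.1 X'.1)
    (p : D.H1 X.2 X'.2) (k : E.H0 W W') :
    boxAssoc1 C D E X X' W W' (BoxH1.inl (BoxH1.inr (f ⊗ₜ p) ⊗ₜ k))
      = BoxH1.inr (f ⊗ₜ BoxH1.inl (p ⊗ₜ k)) := by
  refine (BoxH1.lift_inl _ _ _ _).trans ?_
  refine (TensorProduct.lift.tmul _ _).trans ?_
  exact LinearMap.congr_fun (BoxH1.lift_inr _ _ _ (f ⊗ₜ p)) k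

variable {C D E} in
@[simp] theorem boxAssoc1_inr {X X' : C.Obj × D.Obj} {W W' : E.Obj} (f : C.H0 X.1 X'.1)
    (g : D.H0 X.2 X'.2) (r : E.H1 W W') :
    boxAssoc1 C D E X X' W W' (BoxH1.inr ((f ⊗ₜ g) ⊗ₜ r))
      = BoxH1.inr (f ⊗ₜ BoxH1.inr (g ⊗ₜ r)) :=
  BoxH1.lift_inr _ _ _ _

/-- The rebracketing functor `(C ⊠ D) ⊠ E → C ⊠ (D ⊠ E)`. -/
def boxAssoc : Func ((C.box D).box E) (C.box (D.box E)) :=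
  Func.ofBox (C := C.box D) (E := C.box (D.box E)) (fun X => (X.1.1, (X.1.2, X.2)))
    (fun _ _ => (TensorProduct.assoc R _ _ _).toLinearMap)
    (fun _ _ => boxAssoc1 C D E _ _ _ _)
    (fun X Y q k => by
      induction q using BoxH1.ind with
      | hl q g =>
        rw [boxAssoc1_inl_inl, boxD_inl]
        exact (boxD_inl C (D.box E) (V := (X.1.2, X.2)) (V' := (Y.1.2, Y.2)) q (g ⊗ₜ k)).symm
      | hr f p =>
        rw [boxAssoc1_inl_inr, boxD_inr]
        refine Eq.trans ?_ (boxD_inr C (D.box E) (V := (X.1.2, X.2)) (V' := (Y.1.2, Y.2)) f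
          (BoxH1.inl (p ⊗ₜ k))).symm
        exact congrArg (fun x => f ⊗ₜ[R] x) (boxD_inl D E p k).symm
      | ha x y hx hy => simp only [map_add, TensorProduct.add_tmul, hx, hy])
    (fun X Y f r => by
      induction f using TensorProduct.induction_on with
      | zero => simp
      | tmul f g =>
        rw [boxAssoc1_inr]
        refine Eq.trans ?_ (boxD_inr C (D.box E) (V := (X.1.2, X.2)) (V' := (Y.1.2, Y.2)) f
          (BoxH1.inr (g ⊗ₜ r))).symm
        exact congrArg (fun x => f ⊗ₜ[R] x) (boxD_inr D E g r).symm
      | add x y hx hy => simp only [map_add, TensorProduct.add_tmul, hx, hy])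
    (fun X => by simp)
    (fun _ _ _ f k f' k' => by
      induction f using TensorProduct.induction_on with
      | zero => simp
      | add x y hx hy => simp only [map_add, LinearMap.add_apply, TensorProduct.add_tmul, hx, hy]
      | tmul f g =>
        induction f' using TensorProduct.induction_on with
        | zero => simp
        | add x y hx hy => simp only [map_add, TensorProduct.add_tmul, hx, hy]
        | tmul f' g' => simp)
    (fun X Y Z f k q k' => by
      induction f using TensorProduct.induction_on with
      | zero => simp
      | add x y hx hy => simp only [map_add, LinearMap.add_apply, TensorProduct.add_tmul, hx, hy]
      | tmul f g =>
        induction q using BoxH1.ind with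
        | hl q g' =>
          rw [boxC01_inl, boxAssoc1_inl_inl, boxAssoc1_inl_inl]
          exact (boxC01_inl C (D.box E) (V := (X.1.2, X.2)) (V' := (Y.1.2, Y.2))
            (V'' := (Z.1.2, Z.2)) f (g ⊗ₜ k) q (g' ⊗ₜ k')).symm
        | hr f' p =>
          rw [boxC01_inr, boxAssoc1_inl_inr, boxAssoc1_inl_inr]
          refine Eq.trans ?_ (boxC01_inr C (D.box E) (V := (X.1.2, X.2)) (V' := (Y.1.2, Y.2))
            (V'' := (Z.1.2, Z.2)) f (g ⊗ₜ k) f' (BoxH1.inl (p ⊗ₜ k'))).symm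
          exact congrArg (fun x => BoxH1.inr (C.c00 f f' ⊗ₜ[R] x)) (boxC01_inl D E g k p k').symm
        | ha x y hx hy => simp only [map_add, TensorProduct.add_tmul, hx, hy])
    (fun X Y Z f k f' r => by
      induction f using TensorProduct.induction_on with
      | zero => simp
      | add x y hx hy => simp only [map_add, LinearMap.add_apply, TensorProduct.add_tmul, hx, hy]
      | tmul f g =>
        induction f' using TensorProduct.induction_on with
        | zero => simp
        | add x y hx hy => simp only [map_add, TensorProduct.add_tmul, hx, hy]
        | tmul f' g' =>
          rw [TensorProduct.map₂_apply_tmul, TensorProduct.map_tmul, boxAssoc1_inr, boxAssoc1_inr]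
          refine Eq.trans ?_ (boxC01_inr C (D.box E) (V := (X.1.2, X.2)) (V' := (Y.1.2, Y.2))
            (V'' := (Z.1.2, Z.2)) f (g ⊗ₜ k) f' (BoxH1.inr (g' ⊗ₜ r))).symm
          exact congrArg (fun x => BoxH1.inr (C.c00 f f' ⊗ₜ[R] x)) (boxC01_inr D E g k g' r).symm)
    (fun X Y Z q k f k' => by
      induction f using TensorProduct.induction_on with
      | zero => simp
      | add x y hx hy => simp only [map_add, TensorProduct.add_tmul, hx, hy]
      | tmul f g =>
        induction q using BoxH1.ind with
        | hl q g' =>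
          rw [boxC10_inl, boxAssoc1_inl_inl, boxAssoc1_inl_inl]
          exact (boxC10_inl C (D.box E) (V := (X.1.2, X.2)) (V' := (Y.1.2, Y.2))
            (V'' := (Z.1.2, Z.2)) f (g ⊗ₜ k') q (g' ⊗ₜ k)).symm
        | hr f' p =>
          rw [boxC10_inr, boxAssoc1_inl_inr, boxAssoc1_inl_inr]
          refine Eq.trans ?_ (boxC10_inr C (D.box E) (V := (X.1.2, X.2)) (V' := (Y.1.2, Y.2))
            (V'' := (Z.1.2, Z.2)) f (g ⊗ₜ k') f' (BoxH1.inl (p ⊗ₜ k))).symm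
          exact congrArg (fun x => BoxH1.inr (C.c00 f' f ⊗ₜ[R] x)) (boxC10_inl D E g k' p k).symm
        | ha x y hx hy =>
          simp only [map_add, LinearMap.add_apply, TensorProduct.add_tmul, hx, hy])
    (fun X Y Z f r f' k' => by
      induction f using TensorProduct.induction_on with
      | zero => simp
      | add x y hx hy => simp only [map_add, LinearMap.add_apply, TensorProduct.add_tmul, hx, hy]
      | tmul f g =>
        induction f' using TensorProduct.induction_on with
        | zero => simp
        | add x y hx hy => simp only [map_add, TensorProduct.add_tmul, hx, hy]
        | tmul f' g' =>
          rw [TensorProduct.map₂_apply_tmul, TensorProduct.map_tmul, boxAssoc1_inr, boxAssoc1_inr]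
          refine Eq.trans ?_ (boxC10_inr C (D.box E) (V := (X.1.2, X.2)) (V' := (Y.1.2, Y.2))
            (V'' := (Z.1.2, Z.2)) f' (g' ⊗ₜ k') f (BoxH1.inr (g ⊗ₜ r))).symm
          exact congrArg (fun x => BoxH1.inr (C.c00 f f' ⊗ₜ[R] x)) (boxC10_inr D E g' k' g r).symm)

variable {C} in
/-- The functor `D → C ⊠ D`, `f ↦ 1_I ⊠ f`. -/
def insLeft (I : C.Obj) : Func D (C.box D) where
  obj X := (I, X)
  map0 := TensorProduct.mk R _ _ (C.one I)
  map1 := BoxH1.inr ∘ₗ TensorProduct.mk R _ _ (C.one I)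
  map_d q := by simp
  map_one X := by simp
  map_c00 f g := by simp [C.one_c00]
  map_c01 f q := by simp [C.one_c00]
  map_c10 q f := by simp [C.one_c00]

variable {D} in
/-- The functor `C → C ⊠ D`, `f ↦ f ⊠ 1_I`. -/
def insRight (I : D.Obj) : Func C (C.box D) where
  obj X := (X, I)
  map0 := (TensorProduct.mk R _ _).flip (D.one I)
  map1 := BoxH1.inl ∘ₗ (TensorProduct.mk R _ _).flip (D.one I)
  map_d q := by simp
  map_one X := by simp
  map_c00 f g := by simp [D.one_c00]
  map_c01 f q := by simp [D.one_c00]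
  map_c10 q f := by simp [D.one_c00]

end BoxFunc

section Transformations

/-- The rebracketing functor `C ⊠ (D ⊠ E) → (C ⊠ D) ⊠ E`. -/
def boxAssocInv (C : CochCat.{u, v, w} R) (D : CochCat.{u, v', w'} R) (E : CochCat.{u, v'', w''} R) :
    Func (C.box (D.box E)) ((C.box D).box E) :=
  ((((boxSwap C (D.box E)).comp (boxAssoc D E C)).comp (boxSwap D (E.box C))).comp
    (boxAssoc E C D)).comp (boxSwap E (C.box D))

/-- The data of a transformation: a 1-cell `app X` for every object `X` and a homotopy `hty f` for
every 1-cell `f`, linear in `f`.  Only the effect on objects of the source and target functors is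
recorded; the laws are in `IsPseudonat`. -/
@[ext] structure PreTrans (C : CochCat.{u, v, w} R) (D : CochCat.{u, v', w'} R)
    (F G : C.Obj → D.Obj) where
  app : ∀ X : C.Obj, D.H0 (F X) (G X)
  hty : ∀ X Y : C.Obj, C.H0 X Y →ₗ[R] D.H1 (F X) (G Y)

/-- `ξ` is a pseudonatural transformation from `F` to `G`. -/
structure IsPseudonat {C : CochCat.{u, v, w} R} {D : CochCat.{u, v', w'} R} (F G : Func C D)
    (ξ : PreTrans C D F.obj G.obj) : Prop where
  d_hty : ∀ {X Y : C.Obj} (f : C.H0 X Y),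
    D.c00 (G.map0 f) (ξ.app X) - D.c00 (ξ.app Y) (F.map0 f) = D.d (ξ.hty X Y f)
  hty_d : ∀ {X Y : C.Obj} (q : C.H1 X Y),
    D.c10 (G.map1 q) (ξ.app X) - D.c01 (ξ.app Y) (F.map1 q) = ξ.hty X Y (C.d q)
  hty_one : ∀ X : C.Obj, ξ.hty X X (C.one X) = 0
  hty_comp : ∀ {X Y Z : C.Obj} (g : C.H0 Y Z) (f : C.H0 X Y),
    ξ.hty X Z (C.c00 g f) = D.c10 (ξ.hty Y Z g) (F.map0 f) + D.c01 (G.map0 g) (ξ.hty X Y f)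

namespace PreTrans

variable {B : CochCat.{u, v, w} R} {C : CochCat.{u, v, w} R} {D : CochCat.{u, v, w} R}
variable {F G K : C.Obj → D.Obj}

/-- The identity transformation. -/
def one (F : C.Obj → D.Obj) : PreTrans C D F F where
  app X := D.one (F X)
  hty _ _ := 0

/-- The transformation with identity 1-cells as components, between two functors that agree. -/
def ofEq (h : ∀ X, F X = G X) : PreTrans C D F G where
  app X := D.idOfEq (h X)
  hty _ _ := 0

variable (C D) in
/-- Vertical composition `θ ξ`, first `ξ` and then `θ`.  Homotopy components of a composite need
the action of neither functor: `(θ ξ)_f = θ_f ξ_U + θ_{U'} ξ_f`. -/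
def comp (θ : PreTrans C D G K) (ξ : PreTrans C D F G) : PreTrans C D F K where
  app X := D.c00 (θ.app X) (ξ.app X)
  hty X Y := D.c10.flip (ξ.app X) ∘ₗ θ.hty X Y + D.c01 (θ.app Y) ∘ₗ ξ.hty X Y

instance : Add (PreTrans C D F G) :=
  ⟨fun ξ θ => ⟨fun X => ξ.app X + θ.app X, fun X Y => ξ.hty X Y + θ.hty X Y⟩⟩

instance : Sub (PreTrans C D F G) :=
  ⟨fun ξ θ => ⟨fun X => ξ.app X - θ.app X, fun X Y => ξ.hty X Y - θ.hty X Y⟩⟩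

instance : SMul R (PreTrans C D F G) :=
  ⟨fun r ξ => ⟨fun X => r • ξ.app X, fun X Y => r • ξ.hty X Y⟩⟩

/-- Whiskering `ξ_P` with a functor `P` applied first. -/
def pre (ξ : PreTrans C D F G) (P : Func B C) :
    PreTrans B D (fun X => F (P.obj X)) (fun X => G (P.obj X)) where
  app X := ξ.app (P.obj X)
  hty X Y := ξ.hty (P.obj X) (P.obj Y) ∘ₗ P.map0

/-- Whiskering `Q(ξ)` with a functor `Q` applied last. -/
def post {E : CochCat.{u, v, w} R} (Q : Func D E) (ξ : PreTrans C D F G) :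
    PreTrans C E (fun X => Q.obj (F X)) (fun X => Q.obj (G X)) where
  app X := Q.map0 (ξ.app X)
  hty X Y := Q.map1 ∘ₗ ξ.hty X Y

variable (B) in
/-- The product `ξ ⊠ 1` with the identity of the identity functor of `B`. -/
def boxOne (ξ : PreTrans C D F G) :
    PreTrans (C.box B) (D.box B) (fun X => (F X.1, X.2)) (fun X => (G X.1, X.2)) where
  app X := ξ.app X.1 ⊗ₜ B.one X.2
  hty X Y := BoxH1.inl ∘ₗ TensorProduct.map (ξ.hty X.1 Y.1) LinearMap.id

variable (B) in
/-- The product `1 ⊠ ξ` with the identity of the identity functor of `B`. -/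
def oneBox (ξ : PreTrans C D F G) :
    PreTrans (B.box C) (B.box D) (fun X => (X.1, F X.2)) (fun X => (X.1, G X.2)) where
  app X := B.one X.1 ⊗ₜ ξ.app X.2
  hty X Y := BoxH1.inr ∘ₗ TensorProduct.map LinearMap.id (ξ.hty X.2 Y.2)

end PreTrans

/-- A pseudonatural isomorphism from `F` to `G`: a pseudonatural transformation with a
pseudonatural two-sided inverse under vertical composition. -/
structure PseudonatIso {C : CochCat.{u, v, w} R} {D : CochCat.{u, v, w} R} (F G : Func C D) where
  hom : PreTrans C D F.obj G.obj
  inv : PreTrans C D G.obj F.obj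
  hom_pseudonat : IsPseudonat F G hom
  inv_pseudonat : IsPseudonat G F inv
  inv_hom : PreTrans.comp C D inv hom = PreTrans.one F.obj
  hom_inv : PreTrans.comp C D hom inv = PreTrans.one G.obj

/-- A modification `ξ ⇛ ξ'` between pseudonatural transformations from `F` to `G`. -/
structure Modification {C : CochCat.{u, v, w} R} {D : CochCat.{u, v, w} R} (F G : Func C D)
    (ξ ξ' : PreTrans C D F.obj G.obj) where
  app : ∀ X : C.Obj, D.H1 (F.obj X) (G.obj X)
  d_app : ∀ X : C.Obj, ξ.app X - ξ'.app X = D.d (app X)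
  app_hty : ∀ {X Y : C.Obj} (f : C.H0 X Y),
    D.c10 (app Y) (F.map0 f) + ξ.hty X Y f = ξ'.hty X Y f + D.c01 (G.map0 f) (app X)

end Transformations

section Products

variable {C : CochCat.{u, v, w} R} (T : Func (C.box C) C)

namespace Func

/-- The product `U V` of objects. -/
@[reducible] def o (U V : C.Obj) : C.Obj := T.obj (U, V)

/-- The product `f ⊗ g` of 1-cells. -/
def t00 {U U' V V' : C.Obj} (f : C.H0 U U') (g : C.H0 V V') : C.H0 (T.o U V) (T.o U' V') :=
  T.map0 (X := (U, V)) (Y := (U', V')) (f ⊗ₜ[R] g)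

/-- The product `q ⊗ g` of a homotopy and a 1-cell. -/
def t10 {U U' V V' : C.Obj} (q : C.H1 U U') (g : C.H0 V V') : C.H1 (T.o U V) (T.o U' V') :=
  T.map1 (X := (U, V)) (Y := (U', V')) (BoxH1.inl (q ⊗ₜ[R] g))

/-- The product `f ⊗ p` of a 1-cell and a homotopy. -/
def t01 {U U' V V' : C.Obj} (f : C.H0 U U') (p : C.H1 V V') : C.H1 (T.o U V) (T.o U' V') :=
  T.map1 (X := (U, V)) (Y := (U', V')) (BoxH1.inr (f ⊗ₜ[R] p))

/-- The functor `(U, V, W) ↦ (U V) W` on `(C ⊠ C) ⊠ C`. -/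
def left3 : Func ((C.box C).box C) C := (T.box (Func.id C)).comp T

/-- The functor `(U, V, W) ↦ U (V W)` on `(C ⊠ C) ⊠ C`. -/
def right3 : Func ((C.box C).box C) C :=
  (boxAssoc C C C).comp (((Func.id C).box T).comp T)

end Func

section Permutations

variable (C)

/-- `(U, V, W) ↦ (V, W, U)`. -/
def perm231 : Func ((C.box C).box C) ((C.box C).box C) :=
  (boxAssoc C C C).comp (boxSwap C (C.box C))

/-- `(U, V, W) ↦ (V, U, W)`. -/
def perm213 : Func ((C.box C).box C) ((C.box C).box C) := (boxSwap C C).box (Func.id C)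

/-- `(U, V, W) ↦ (W, U, V)`. -/
def perm312 : Func ((C.box C).box C) ((C.box C).box C) :=
  (boxSwap (C.box C) C).comp (boxAssocInv C C C)

/-- `(U, V, W) ↦ (U, W, V)`. -/
def perm132 : Func ((C.box C).box C) ((C.box C).box C) :=
  (boxAssoc C C C).comp (((Func.id C).box (boxSwap C C)).comp (boxAssocInv C C C))

end Permutations

variable {T}

/-- The side `(1_U ⊗ α_{VWX}) α_{U(VW)X} (α_{UVW} ⊗ 1_X)` of the pentagon, from `((U V) W) X` to
`U (V (W X))`. -/
def pentagonSource (α : PreTrans ((C.box C).box C) C T.left3.obj T.right3.obj) :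
    PreTrans (((C.box C).box C).box C) C ((T.left3.box (Func.id C)).comp T).obj
      (((boxAssoc (C.box C) C C).comp ((Func.id (C.box C)).box T)).comp T.right3).obj :=
  PreTrans.comp _ _
    (((α.oneBox C).post T).pre (((boxAssoc C C C).box (Func.id C)).comp (boxAssoc C (C.box C) C)))
    (PreTrans.comp _ _
      (α.pre (((boxAssoc C C C).comp ((Func.id C).box T)).box (Func.id C)))
      ((α.boxOne C).post T))

/-- The side `α_{UV(WX)} α_{(UV)WX}` of the pentagon, from `((U V) W) X` to `U (V (W X))`. -/
def pentagonTarget (α : PreTrans ((C.box C).box C) C T.left3.obj T.right3.obj) :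
    PreTrans (((C.box C).box C).box C) C ((T.left3.box (Func.id C)).comp T).obj
      (((boxAssoc (C.box C) C C).comp ((Func.id (C.box C)).box T)).comp T.right3).obj :=
  PreTrans.comp _ _
    (α.pre ((boxAssoc (C.box C) C C).comp ((Func.id (C.box C)).box T)))
    (α.pre ((T.box (Func.id C)).box (Func.id C)))

/-- The side `α_{VWU} σ_{U(VW)} α_{UVW}` of the left hexagon, from `(U V) W` to `V (W U)`. -/
def hexLSource (α : PreTrans ((C.box C).box C) C T.left3.obj T.right3.obj)
    (σ : PreTrans (C.box C) C T.obj ((boxSwap C C).comp T).obj) :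
    PreTrans ((C.box C).box C) C T.left3.obj ((perm231 C).comp T.right3).obj :=
  PreTrans.comp _ _ (α.pre (perm231 C))
    (PreTrans.comp _ _ (σ.pre ((boxAssoc C C C).comp ((Func.id C).box T))) α)

/-- The side `(1_V ⊗ σ_{UW}) α_{VUW} (σ_{UV} ⊗ 1_W)` of the left hexagon, from `(U V) W` to
`V (W U)`. -/
def hexLTarget (α : PreTrans ((C.box C).box C) C T.left3.obj T.right3.obj)
    (σ : PreTrans (C.box C) C T.obj ((boxSwap C C).comp T).obj) :
    PreTrans ((C.box C).box C) C T.left3.obj ((perm231 C).comp T.right3).obj :=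
  PreTrans.comp _ _ (((σ.oneBox C).post T).pre ((perm213 C).comp (boxAssoc C C C)))
    (PreTrans.comp _ _ (α.pre (perm213 C)) ((σ.boxOne C).post T))

/-- The side `α⁻¹_{WUV} σ_{(UV)W} α⁻¹_{UVW}` of the right hexagon, from `U (V W)` to `(W U) V`.
Here `α'` stands for `α⁻¹`. -/
def hexRSource (α' : PreTrans ((C.box C).box C) C T.right3.obj T.left3.obj)
    (σ : PreTrans (C.box C) C T.obj ((boxSwap C C).comp T).obj) :
    PreTrans ((C.box C).box C) C T.right3.obj ((perm312 C).comp T.left3).obj :=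
  PreTrans.comp _ _ (α'.pre (perm312 C))
    (PreTrans.comp _ _ (σ.pre (T.box (Func.id C))) α')

/-- The side `(σ_{UW} ⊗ 1_V) α⁻¹_{UWV} (1_U ⊗ σ_{VW})` of the right hexagon, from `U (V W)` to
`(W U) V`.  Here `α'` stands for `α⁻¹`. -/
def hexRTarget (α' : PreTrans ((C.box C).box C) C T.right3.obj T.left3.obj)
    (σ : PreTrans (C.box C) C T.obj ((boxSwap C C).comp T).obj) :
    PreTrans ((C.box C).box C) C T.right3.obj ((perm312 C).comp T.left3).obj :=
  PreTrans.comp _ _ (((σ.boxOne C).post T).pre (perm132 C))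
    (PreTrans.comp _ _ (α'.pre (perm132 C)) (((σ.oneBox C).post T).pre (boxAssoc C C C)))

variable (T) in
/-- The data of a braided monoidal structure for the product `T` (written `⊗`): an associator, a
pentagonator, a braiding, a left and a right hexagonator. -/
structure BraidedData where
  assoc : PseudonatIso T.left3 T.right3
  pent : Modification ((T.left3.box (Func.id C)).comp T)
    (((boxAssoc (C.box C) C C).comp ((Func.id (C.box C)).box T)).comp T.right3)
    (pentagonSource assoc.hom) (pentagonTarget assoc.hom)
  braid : PseudonatIso T ((boxSwap C C).comp T)
  hexL : Modification T.left3 ((perm231 C).comp T.right3)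
    (hexLSource assoc.hom braid.hom) (hexLTarget assoc.hom braid.hom)
  hexR : Modification T.right3 ((perm312 C).comp T.left3)
    (hexRSource assoc.inv braid.hom) (hexRTarget assoc.inv braid.hom)

namespace BraidedData

variable (B : BraidedData T)

/-- The component `α_{UVW}`. -/
def a (U V W : C.Obj) : C.H0 (T.o (T.o U V) W) (T.o U (T.o V W)) := B.assoc.hom.app ((U, V), W)

/-- The component `α⁻¹_{UVW}`. -/
def a' (U V W : C.Obj) : C.H0 (T.o U (T.o V W)) (T.o (T.o U V) W) := B.assoc.inv.app ((U, V), W)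

/-- The homotopy component `α_{f ⊠ g ⊠ k}`. -/
def ah {U V W U' V' W' : C.Obj} (f : C.H0 U U') (g : C.H0 V V') (k : C.H0 W W') :
    C.H1 (T.o (T.o U V) W) (T.o U' (T.o V' W')) :=
  B.assoc.hom.hty ((U, V), W) ((U', V'), W') ((f ⊗ₜ[R] g) ⊗ₜ[R] k)

/-- The homotopy component `α⁻¹_{f ⊠ g ⊠ k}`. -/
def a'h {U V W U' V' W' : C.Obj} (f : C.H0 U U') (g : C.H0 V V') (k : C.H0 W W') :
    C.H1 (T.o U (T.o V W)) (T.o (T.o U' V') W') :=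
  B.assoc.inv.hty ((U, V), W) ((U', V'), W') ((f ⊗ₜ[R] g) ⊗ₜ[R] k)

/-- The component `σ_{UV}`. -/
def s (U V : C.Obj) : C.H0 (T.o U V) (T.o V U) := B.braid.hom.app (U, V)

/-- The homotopy component `σ_{f ⊠ g}`. -/
def sh {U V U' V' : C.Obj} (f : C.H0 U U') (g : C.H0 V V') : C.H1 (T.o U V) (T.o V' U') :=
  B.braid.hom.hty (U, V) (U', V') (f ⊗ₜ[R] g)

/-- The component `Π_{UVWX}`. -/
def p (U V W X : C.Obj) : C.H1 (T.o (T.o (T.o U V) W) X) (T.o U (T.o V (T.o W X))) :=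
  B.pent.app (((U, V), W), X)

/-- The component `H^L_{UVW}`. -/
def hL (U V W : C.Obj) : C.H1 (T.o (T.o U V) W) (T.o V (T.o W U)) := B.hexL.app ((U, V), W)

/-- The component `H^R_{UVW}`. -/
def hR (U V W : C.Obj) : C.H1 (T.o U (T.o V W)) (T.o (T.o W U) V) := B.hexR.app ((U, V), W)

local notation "𝐢" => CochCat.one C
local notation:80 f:81 " ⬝ " g:80 => CochCat.c00 C f g
local notation:80 f:81 " ◁ " q:80 => CochCat.c01 C f q
local notation:80 q:81 " ▷ " f:80 => CochCat.c10 C q f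
local notation:90 U:90 " ⋆ " V:91 => Func.o T U V
local notation:90 f:90 " ⊛ " g:91 => Func.t00 T f g
local notation:90 q:90 " ⊛l " g:91 => Func.t10 T q g
local notation:90 f:90 " ⊛r " q:91 => Func.t01 T f q

/-- The component at `U, V, W, X` of the inverse
`Π⁻¹ = - (ξ⁻¹ Π ξ'⁻¹) : ξ⁻¹ ⇛ ξ'⁻¹` of the pentagonator `Π : ξ ⇛ ξ'`, where
`ξ = (1_U ⊗ α_{VWX}) α_{U(VW)X} (α_{UVW} ⊗ 1_X)` and `ξ' = α_{UV(WX)} α_{(UV)WX}`. -/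
def p' (U V W X : C.Obj) : C.H1 (T.o U (T.o V (T.o W X))) (T.o (T.o (T.o U V) W) X) :=
  -(((B.a' U V W ⊛ 𝐢 X) ⬝ B.a' U (V ⋆ W) X ⬝ (𝐢 U ⊛ B.a' V W X)) ◁
    (B.p U V W X ▷ (B.a' (U ⋆ V) W X ⬝ B.a' U V (W ⋆ X))))

/-- The left tetrahedron axiom. -/
def LeftTetrahedron : Prop := ∀ U V W X : C.Obj,
  ((𝐢 V ⊛ B.a W X U) ⬝ B.a V (W ⋆ X) U) ◁
      (B.sh (𝐢 U) (B.a V W X) ▷ (B.a U (V ⋆ W) X ⬝ (B.a U V W ⊛ 𝐢 X)))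
    - B.p V W X U ▷ (B.s U ((V ⋆ W) ⋆ X) ⬝ B.a U (V ⋆ W) X ⬝ (B.a U V W ⊛ 𝐢 X))
    + (𝐢 V ⊛ B.a W X U) ◁ (B.hL U V (W ⋆ X) ▷ B.a (U ⋆ V) W X)
    + ((𝐢 V ⊛ (B.a W X U ⬝ B.s U (W ⋆ X))) ⬝ B.a V U (W ⋆ X)) ◁ B.ah (B.s U V) (𝐢 W) (𝐢 X)
    + ((𝐢 V ⊛ B.a W X U) ⬝ B.a V (W ⋆ X) U ⬝ B.s U (V ⋆ (W ⋆ X))) ◁ B.p U V W X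
    - (𝐢 V ⊛ (B.a W X U ⬝ B.s U (W ⋆ X))) ◁ (B.p V U W X ▷ ((B.s U V ⊛ 𝐢 W) ⊛ 𝐢 X))
  = B.a V W (X ⋆ U) ◁ (B.hL U (V ⋆ W) X ▷ (B.a U V W ⊛ 𝐢 X))
    - (𝐢 V ⊛ ((𝐢 W ⊛ B.s U X) ⬝ B.a W U X)) ◁
      (B.ah (𝐢 V) (B.s U W) (𝐢 X) ▷ ((B.a V U W ⬝ (B.s U V ⊛ 𝐢 W)) ⊛ 𝐢 X))
    - (𝐢 V ⊛ (𝐢 W ⊛ B.s U X)) ◁ (B.p V W U X ▷ ((B.s U (V ⋆ W) ⬝ B.a U V W) ⊛ 𝐢 X))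
    - B.ah (𝐢 V) (𝐢 W) (B.s U X) ▷
      (B.a (V ⋆ W) U X ⬝ ((B.s U (V ⋆ W) ⬝ B.a U V W) ⊛ 𝐢 X))
    + ((𝐢 V ⊛ ((𝐢 W ⊛ B.s U X) ⬝ B.a W U X)) ⬝ B.a V (W ⋆ U) X) ◁ (B.hL U V W ⊛l 𝐢 X)
    - (𝐢 V ⊛r B.hL U W X) ▷ (B.a V (U ⋆ W) X ⬝ ((B.a V U W ⬝ (B.s U V ⊛ 𝐢 W)) ⊛ 𝐢 X))

/-- The right tetrahedron axiom. -/
def RightTetrahedron : Prop := ∀ U V W X : C.Obj,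
  ((B.a' X U V ⊛ 𝐢 W) ⬝ B.a' X (U ⋆ V) W) ◁
      (B.sh (B.a' U V W) (𝐢 X) ▷ (B.a' U (V ⋆ W) X ⬝ (𝐢 U ⊛ B.a' V W X)))
    - B.p' X U V W ▷ (B.s (U ⋆ (V ⋆ W)) X ⬝ B.a' U (V ⋆ W) X ⬝ (𝐢 U ⊛ B.a' V W X))
    + (B.a' X U V ⊛ 𝐢 W) ◁ (B.hR (U ⋆ V) W X ▷ B.a' U V (W ⋆ X))
    + (((B.a' X U V ⬝ B.s (U ⋆ V) X) ⊛ 𝐢 W) ⬝ B.a' (U ⋆ V) X W) ◁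
      B.a'h (𝐢 U) (𝐢 V) (B.s W X)
    + ((B.a' X U V ⊛ 𝐢 W) ⬝ B.a' X (U ⋆ V) W ⬝ B.s ((U ⋆ V) ⋆ W) X) ◁ B.p' U V W X
    - ((B.a' X U V ⬝ B.s (U ⋆ V) X) ⊛ 𝐢 W) ◁ (B.p' U V X W ▷ (𝐢 U ⊛ (𝐢 V ⊛ B.s W X)))
  = B.a' (X ⋆ U) V W ◁ (B.hR U (V ⋆ W) X ▷ (𝐢 U ⊛ B.a' V W X))
    - (((B.s U X ⊛ 𝐢 V) ⬝ B.a' U X V) ⊛ 𝐢 W) ◁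
      (B.a'h (𝐢 U) (B.s V X) (𝐢 W) ▷ (𝐢 U ⊛ (B.a' V X W ⬝ (𝐢 V ⊛ B.s W X))))
    - ((B.s U X ⊛ 𝐢 V) ⊛ 𝐢 W) ◁ (B.p' U X V W ▷ (𝐢 U ⊛ (B.s (V ⋆ W) X ⬝ B.a' V W X)))
    - B.a'h (B.s U X) (𝐢 V) (𝐢 W) ▷
      (B.a' U X (V ⋆ W) ⬝ (𝐢 U ⊛ (B.s (V ⋆ W) X ⬝ B.a' V W X)))
    + ((((B.s U X ⊛ 𝐢 V) ⬝ B.a' U X V) ⊛ 𝐢 W) ⬝ B.a' U (X ⋆ V) W) ◁ (𝐢 U ⊛r B.hR V W X)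
    - (B.hR U V X ⊛l 𝐢 W) ▷ (B.a' U (V ⋆ X) W ⬝ (𝐢 U ⊛ (B.a' V X W ⬝ (𝐢 V ⊛ B.s W X))))

/-- The hexahedron axiom. -/
def Hexahedron : Prop := ∀ U V W X : C.Obj,
  (B.a W (X ⋆ U) V ⬝ (B.a W X U ⊛ 𝐢 V)) ◁
      (B.hR U V (W ⋆ X) ▷ ((𝐢 U ⊛ B.a V W X) ⬝ B.a U (V ⋆ W) X)
        - (B.a' (W ⋆ X) U V ⬝ B.s (U ⋆ V) (W ⋆ X) ⬝ B.a' U V (W ⋆ X)) ◁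
          (B.p U V W X ▷ (B.a' U V W ⊛ 𝐢 X)))
    - (𝐢 W ⊛ B.a' X U V) ◁
      ((B.p W X U V ▷ (B.a' (W ⋆ X) U V ⬝ B.s (U ⋆ V) (W ⋆ X) ⬝ B.a (U ⋆ V) W X)
        + B.hL (U ⋆ V) W X) ▷ (B.a' U V W ⊛ 𝐢 X))
  = ((𝐢 W ⊛ (B.a' X U V ⬝ B.s (U ⋆ V) X ⬝ B.a' U V X)) ◁ B.p W U V X
      + (𝐢 W ⊛r B.hR U V X) ▷ (B.a W U (V ⋆ X) ⬝ B.a (W ⋆ U) V X)) ▷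
        ((B.a' W U V ⬝ B.s (U ⋆ V) W ⬝ B.a' U V W) ⊛ 𝐢 X)
    + ((𝐢 W ⊛ ((B.s U X ⊛ 𝐢 V) ⬝ B.a' U X V ⬝ (𝐢 U ⊛ B.s V X))) ⬝ B.a W U (V ⋆ X)) ◁
      (B.a (W ⋆ U) V X ◁ (B.hR U V W ⊛l 𝐢 X)
        - B.ah (B.s U W) (𝐢 V) (𝐢 X) ▷ ((B.a' U W V ⬝ (𝐢 U ⊛ B.s V W)) ⊛ 𝐢 X))
    + (𝐢 W ⊛ ((B.s U X ⊛ 𝐢 V) ⬝ B.a' U X V)) ◁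
      (B.ah (𝐢 W) (𝐢 U) (B.s V X) ▷ ((B.s U W ⊛ 𝐢 (V ⋆ X)) ⬝ B.a (U ⋆ W) V X ⬝
        ((B.a' U W V ⬝ (𝐢 U ⊛ B.s V W)) ⊛ 𝐢 X)))
    + B.ah (𝐢 W) (B.s U X) (𝐢 V) ▷ ((B.a W U X ⊛ 𝐢 V) ⬝ B.a' (W ⋆ U) X V ⬝
        (B.s U W ⊛ B.s V X) ⬝ B.a (U ⋆ W) V X ⬝ ((B.a' U W V ⬝ (𝐢 U ⊛ B.s V W)) ⊛ 𝐢 X))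
    - (𝐢 W ⊛ ((B.s U X ⊛ 𝐢 V) ⬝ B.a' U X V)) ◁
      (B.p W U X V ▷ (B.a' (W ⋆ U) X V ⬝ (B.s U W ⊛ B.s V X) ⬝ B.a (U ⋆ W) V X ⬝
        ((B.a' U W V ⬝ (𝐢 U ⊛ B.s V W)) ⊛ 𝐢 X)))
    - (B.a W (X ⋆ U) V ⬝ (((𝐢 W ⊛ B.s U X) ⬝ B.a W U X) ⊛ 𝐢 V) ⬝ B.a' (W ⋆ U) X V ⬝
        (B.s U W ⊛ B.s V X) ⬝ B.a' U W (V ⋆ X)) ◁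
      (B.p U W V X ▷ ((B.a' U W V ⬝ (𝐢 U ⊛ B.s V W)) ⊛ 𝐢 X))
    - (B.a W (X ⋆ U) V ⬝ (((𝐢 W ⊛ B.s U X) ⬝ B.a W U X) ⊛ 𝐢 V) ⬝ B.a' (W ⋆ U) X V ⬝
        (B.s U W ⊛ B.s V X) ⬝ B.a' U W (V ⋆ X) ⬝ (𝐢 U ⊛ B.a W V X)) ◁
      B.ah (𝐢 U) (B.s V W) (𝐢 X)
    - (B.a W (X ⋆ U) V ⬝ (((𝐢 W ⊛ B.s U X) ⬝ B.a W U X) ⊛ 𝐢 V)) ◁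
      (B.a'h (B.s U W) (𝐢 X) (𝐢 V) ▷ ((𝐢 (U ⋆ W) ⊛ B.s V X) ⬝ B.a' U W (V ⋆ X) ⬝
        (𝐢 U ⊛ (B.a W V X ⬝ (B.s V W ⊛ 𝐢 X))) ⬝ B.a U (V ⋆ W) X))
    + (B.a W (X ⋆ U) V ⬝ (((𝐢 W ⊛ B.s U X) ⬝ B.a W U X ⬝ (B.s U W ⊛ 𝐢 X)) ⊛ 𝐢 V) ⬝
        B.a' (U ⋆ W) X V) ◁
      (B.a'h (𝐢 U) (𝐢 W) (B.s V X) ▷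
        ((𝐢 U ⊛ (B.a W V X ⬝ (B.s V W ⊛ 𝐢 X))) ⬝ B.a U (V ⋆ W) X))
    - B.a W (X ⋆ U) V ◁ ((B.hL U W X ⊛l 𝐢 V) ▷ (B.a' (U ⋆ W) X V ⬝ B.a' U W (X ⋆ V) ⬝
        (𝐢 U ⊛ ((𝐢 W ⊛ B.s V X) ⬝ B.a W V X ⬝ (B.s V W ⊛ 𝐢 X))) ⬝ B.a U (V ⋆ W) X))
    - (B.a W (X ⋆ U) V ⬝ ((B.a W X U ⬝ B.s U (W ⋆ X) ⬝ B.a U W X) ⊛ 𝐢 V) ⬝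
        B.a' (U ⋆ W) X V ⬝ B.a' U W (X ⋆ V)) ◁
      ((𝐢 U ⊛r B.hL V W X) ▷ B.a U (V ⋆ W) X)
    - (B.a W (X ⋆ U) V ⬝ ((B.a W X U ⬝ B.s U (W ⋆ X) ⬝ B.a U W X) ⊛ 𝐢 V)) ◁
      (B.p' U W X V ▷
        ((𝐢 U ⊛ (B.a W X V ⬝ B.s V (W ⋆ X) ⬝ B.a V W X)) ⬝ B.a U (V ⋆ W) X))

end BraidedData

end Products

section BaseChange

/-- The `A`-bilinear extension `(a ⊗ m, a' ⊗ n) ↦ a a' ⊗ b(m, n)` of a bilinear map `b`. -/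
def bilinBC (A : Type u) [CommRing A] [Algebra R A] {M N P : Type w} [AddCommGroup M]
    [AddCommGroup N] [AddCommGroup P] [Module R M] [Module R N] [Module R P]
    (b : M →ₗ[R] N →ₗ[R] P) : (A ⊗[R] M) →ₗ[A] (A ⊗[R] N) →ₗ[A] (A ⊗[R] P) :=
  LinearMap.liftBaseChange A (LinearMap.baseChangeHom R A N P ∘ₗ b)

@[simp] theorem bilinBC_tmul (A : Type u) [CommRing A] [Algebra R A] {M N P : Type w}
    [AddCommGroup M] [AddCommGroup N] [AddCommGroup P] [Module R M] [Module R N] [Module R P]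
    (b : M →ₗ[R] N →ₗ[R] P) (a a' : A) (m : M) (n : N) :
    bilinBC A b (a ⊗ₜ m) (a' ⊗ₜ n) = (a * a') ⊗ₜ b m n := by
  simp [bilinBC, TensorProduct.smul_tmul']

variable (A : Type u) [CommRing A] [Algebra R A]

/-- Extension of scalars: the same objects, and hom complexes `A ⊗ C[X, Y]`. -/
@[reducible] def baseChange (C : CochCat.{u, v, w} R) : CochCat.{u, v, max u w} A where
  Obj := C.Obj
  H0 X Y := A ⊗[R] C.H0 X Y
  H1 X Y := A ⊗[R] C.H1 X Y
  d := LinearMap.baseChange A C.d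
  one X := 1 ⊗ₜ C.one X
  c00 := bilinBC A C.c00
  c01 := bilinBC A C.c01
  c10 := bilinBC A C.c10
  one_c00 f := by
    induction f using TensorProduct.induction_on with
    | zero => simp
    | add x y hx hy => simp only [map_add, hx, hy]
    | tmul a f => simp [C.one_c00]
  c00_one f := by
    induction f using TensorProduct.induction_on with
    | zero => simp
    | add x y hx hy => simp only [map_add, LinearMap.add_apply, hx, hy]
    | tmul a f => simp [C.c00_one]
  one_c01 f := by
    induction f using TensorProduct.induction_on with
    | zero => simp
    | add x y hx hy => simp only [map_add, hx, hy]
    | tmul a f => simp [C.one_c01]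
  c10_one f := by
    induction f using TensorProduct.induction_on with
    | zero => simp
    | add x y hx hy => simp only [map_add, LinearMap.add_apply, hx, hy]
    | tmul a f => simp [C.c10_one]
  assoc000 f g k := by
    induction f using TensorProduct.induction_on with
    | zero => simp
    | add x y hx hy => simp only [map_add, LinearMap.add_apply, hx, hy]
    | tmul a f =>
      induction g using TensorProduct.induction_on with
      | zero => simp
      | add x y hx hy => simp only [map_add, LinearMap.add_apply, hx, hy]
      | tmul b g =>
        induction k using TensorProduct.induction_on with
        | zero => simp
        | add x y hx hy => simp only [map_add, hx, hy]
        | tmul c k => simp [C.assoc000, mul_assoc]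
  assoc001 f g k := by
    induction f using TensorProduct.induction_on with
    | zero => simp
    | add x y hx hy => simp only [map_add, LinearMap.add_apply, hx, hy]
    | tmul a f =>
      induction g using TensorProduct.induction_on with
      | zero => simp
      | add x y hx hy => simp only [map_add, LinearMap.add_apply, hx, hy]
      | tmul b g =>
        induction k using TensorProduct.induction_on with
        | zero => simp
        | add x y hx hy => simp only [map_add, hx, hy]
        | tmul c k => simp [C.assoc001, mul_assoc]
  assoc010 f g k := by
    induction f using TensorProduct.induction_on with
    | zero => simp
    | add x y hx hy => simp only [map_add, LinearMap.add_apply, hx, hy]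
    | tmul a f =>
      induction g using TensorProduct.induction_on with
      | zero => simp
      | add x y hx hy => simp only [map_add, LinearMap.add_apply, hx, hy]
      | tmul b g =>
        induction k using TensorProduct.induction_on with
        | zero => simp
        | add x y hx hy => simp only [map_add, hx, hy]
        | tmul c k => simp [C.assoc010, mul_assoc]
  assoc100 f g k := by
    induction f using TensorProduct.induction_on with
    | zero => simp
    | add x y hx hy => simp only [map_add, LinearMap.add_apply, hx, hy]
    | tmul a f =>
      induction g using TensorProduct.induction_on with
      | zero => simp
      | add x y hx hy => simp only [map_add, LinearMap.add_apply, hx, hy]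
      | tmul b g =>
        induction k using TensorProduct.induction_on with
        | zero => simp
        | add x y hx hy => simp only [map_add, hx, hy]
        | tmul c k => simp [C.assoc100, mul_assoc]
  d_c01 f q := by
    induction f using TensorProduct.induction_on with
    | zero => simp
    | add x y hx hy => simp only [map_add, LinearMap.add_apply, hx, hy]
    | tmul a f =>
      induction q using TensorProduct.induction_on with
      | zero => simp
      | add x y hx hy => simp only [map_add, hx, hy]
      | tmul b q => simp [C.d_c01]
  d_c10 q f := by
    induction f using TensorProduct.induction_on with
    | zero => simp
    | add x y hx hy => simp only [map_add, hx, hy]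
    | tmul a f =>
      induction q using TensorProduct.induction_on with
      | zero => simp
      | add x y hx hy => simp only [map_add, LinearMap.add_apply, hx, hy]
      | tmul b q => simp [C.d_c10]
  trunc q p := by
    induction q using TensorProduct.induction_on with
    | zero => simp
    | add x y hx hy => simp only [map_add, LinearMap.add_apply, hx, hy]
    | tmul a q =>
      induction p using TensorProduct.induction_on with
      | zero => simp
      | add x y hx hy => simp only [map_add, hx, hy]
      | tmul b p => simp [C.trunc]

variable {C : CochCat.{u, v, w} R} (T : Func (C.box C) C)

/-- The degree `-1` part of the extension of scalars of a functor `C ⊠ C → C`. -/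
def tensorBC1 (U U' V V' : C.Obj) :
    BoxH1 (C.baseChange A) (C.baseChange A) U U' V V' →ₗ[A]
      A ⊗[R] C.H1 (T.obj (U, V)) (T.obj (U', V')) :=
  BoxH1.lift
    (TensorProduct.lift (bilinBC A (TensorProduct.curry
      (T.map1 (X := (U, V)) (Y := (U', V')) ∘ₗ BoxH1.inl))))
    (TensorProduct.lift (bilinBC A (TensorProduct.curry
      (T.map1 (X := (U, V)) (Y := (U', V')) ∘ₗ BoxH1.inr))))
    (fun q p => by
      induction q using TensorProduct.induction_on with
      | zero => simp
      | add x y hx hy => simp only [map_add, TensorProduct.add_tmul, hx, hy]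
      | tmul a q =>
        induction p using TensorProduct.induction_on with
        | zero => simp
        | add x y hx hy => simp only [map_add, TensorProduct.tmul_add, hx, hy]
        | tmul b p => simp [BoxH1.inl_d])

@[simp] theorem tensorBC1_inl {U U' V V' : C.Obj} (a b : A) (q : C.H1 U U') (g : C.H0 V V') :
    tensorBC1 A T U U' V V' (BoxH1.inl ((a ⊗ₜ[R] q) ⊗ₜ[A] (b ⊗ₜ[R] g)))
      = (a * b) ⊗ₜ T.map1 (X := (U, V)) (Y := (U', V')) (BoxH1.inl (q ⊗ₜ g)) :=
  (BoxH1.lift_inl _ _ _ _).trans (by simp)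

@[simp] theorem tensorBC1_inr {U U' V V' : C.Obj} (a b : A) (f : C.H0 U U') (p : C.H1 V V') :
    tensorBC1 A T U U' V V' (BoxH1.inr ((a ⊗ₜ[R] f) ⊗ₜ[A] (b ⊗ₜ[R] p)))
      = (a * b) ⊗ₜ T.map1 (X := (U, V)) (Y := (U', V')) (BoxH1.inr (f ⊗ₜ p)) :=
  (BoxH1.lift_inr _ _ _ _).trans (by simp)

set_option linter.unusedSimpArgs false in
/-- The extension of scalars of a functor `C ⊠ C → C`. -/
def tensorBC : Func ((C.baseChange A).box (C.baseChange A)) (C.baseChange A) :=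
  Func.ofBox (C := C.baseChange A) (D := C.baseChange A) (E := C.baseChange A) T.obj
    (fun X Y => TensorProduct.lift (bilinBC A (TensorProduct.curry (T.map0 (X := X) (Y := Y)))))
    (fun X Y => tensorBC1 A T X.1 Y.1 X.2 Y.2)
    (fun X Y q g => by
      induction q using TensorProduct.induction_on with
      | zero => simp
      | add x y hx hy =>
        simp only [map_add, LinearMap.add_apply, TensorProduct.add_tmul,
            TensorProduct.tmul_add, hx, hy]
      | tmul a q =>
        induction g using TensorProduct.induction_on with
        | zero => simp
        | add x y hx hy =>
          simp only [map_add, LinearMap.add_apply, TensorProduct.add_tmul,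
            TensorProduct.tmul_add, hx, hy]
        | tmul b g =>
          rw [tensorBC1_inl]
          simpa using
            congrArg (fun x => (a * b) ⊗ₜ[R] x) (T.map_d (BoxH1.inl (q ⊗ₜ g))))
    (fun X Y f p => by
      induction f using TensorProduct.induction_on with
      | zero => simp
      | add x y hx hy =>
        simp only [map_add, LinearMap.add_apply, TensorProduct.add_tmul,
            TensorProduct.tmul_add, hx, hy]
      | tmul a f =>
        induction p using TensorProduct.induction_on with
        | zero => simp
        | add x y hx hy =>
          simp only [map_add, LinearMap.add_apply, TensorProduct.add_tmul,
            TensorProduct.tmul_add, hx, hy]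
        | tmul b p =>
          rw [tensorBC1_inr]
          simpa using
            congrArg (fun x => (a * b) ⊗ₜ[R] x) (T.map_d (BoxH1.inr (f ⊗ₜ p))))
    (fun X => by simpa using congrArg (fun x => (1 : A) ⊗ₜ[R] x) (T.map_one X))
    (fun X Y Z f g f' g' => by
      induction f using TensorProduct.induction_on with
      | zero => simp
      | add x y hx hy =>
        simp only [map_add, LinearMap.add_apply, TensorProduct.add_tmul,
            TensorProduct.tmul_add, hx, hy]
      | tmul a f =>
        induction g using TensorProduct.induction_on with
        | zero => simp
        | add x y hx hy =>
          simp only [map_add, LinearMap.add_apply, TensorProduct.add_tmul,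
            TensorProduct.tmul_add, hx, hy]
        | tmul b g =>
          induction f' using TensorProduct.induction_on with
          | zero => simp
          | add x y hx hy =>
            simp only [map_add, LinearMap.add_apply, TensorProduct.add_tmul,
            TensorProduct.tmul_add, hx, hy]
          | tmul c f' =>
            induction g' using TensorProduct.induction_on with
            | zero => simp
            | add x y hx hy =>
              simp only [map_add, LinearMap.add_apply, TensorProduct.add_tmul,
            TensorProduct.tmul_add, hx, hy]
            | tmul e g' =>
              simpa [mul_mul_mul_comm] using
                congrArg (fun x => (a * b * (c * e)) ⊗ₜ[R] x)
                  (T.map_c00 (X := X) (Y := Y) (Z := Z) (f ⊗ₜ g) (f' ⊗ₜ g')))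
    (fun X Y Z f g q g' => by
      induction f using TensorProduct.induction_on with
      | zero => simp
      | add x y hx hy =>
        simp only [map_add, LinearMap.add_apply, TensorProduct.add_tmul,
            TensorProduct.tmul_add, hx, hy]
      | tmul a f =>
        induction g using TensorProduct.induction_on with
        | zero => simp
        | add x y hx hy =>
          simp only [map_add, LinearMap.add_apply, TensorProduct.add_tmul,
            TensorProduct.tmul_add, hx, hy]
        | tmul b g =>
          induction q using TensorProduct.induction_on with
          | zero => simp
          | add x y hx hy =>
            simp only [map_add, LinearMap.add_apply, TensorProduct.add_tmul,
            TensorProduct.tmul_add, hx, hy]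
          | tmul c q =>
            induction g' using TensorProduct.induction_on with
            | zero => simp
            | add x y hx hy =>
              simp only [map_add, LinearMap.add_apply, TensorProduct.add_tmul,
            TensorProduct.tmul_add, hx, hy]
            | tmul e g' =>
              rw [bilinBC_tmul, bilinBC_tmul, tensorBC1_inl, tensorBC1_inl, mul_mul_mul_comm]
              simpa using
                congrArg (fun x => (a * b * (c * e)) ⊗ₜ[R] x)
                  (T.map_c01 (X := X) (Y := Y) (Z := Z) (f ⊗ₜ g) (BoxH1.inl (q ⊗ₜ g'))))
    (fun X Y Z f g f' p => by
      induction f using TensorProduct.induction_on with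
      | zero => simp
      | add x y hx hy =>
        simp only [map_add, LinearMap.add_apply, TensorProduct.add_tmul,
            TensorProduct.tmul_add, hx, hy]
      | tmul a f =>
        induction g using TensorProduct.induction_on with
        | zero => simp
        | add x y hx hy =>
          simp only [map_add, LinearMap.add_apply, TensorProduct.add_tmul,
            TensorProduct.tmul_add, hx, hy]
        | tmul b g =>
          induction f' using TensorProduct.induction_on with
          | zero => simp
          | add x y hx hy =>
            simp only [map_add, LinearMap.add_apply, TensorProduct.add_tmul,
            TensorProduct.tmul_add, hx, hy]
          | tmul c f' =>
            induction p using TensorProduct.induction_on with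
            | zero => simp
            | add x y hx hy =>
              simp only [map_add, LinearMap.add_apply, TensorProduct.add_tmul,
            TensorProduct.tmul_add, hx, hy]
            | tmul e p =>
              rw [bilinBC_tmul, bilinBC_tmul, tensorBC1_inr, tensorBC1_inr, mul_mul_mul_comm]
              simpa using
                congrArg (fun x => (a * b * (c * e)) ⊗ₜ[R] x)
                  (T.map_c01 (X := X) (Y := Y) (Z := Z) (f ⊗ₜ g) (BoxH1.inr (f' ⊗ₜ p))))
    (fun X Y Z q g f' g' => by
      induction q using TensorProduct.induction_on with
      | zero => simp
      | add x y hx hy =>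
        simp only [map_add, LinearMap.add_apply, TensorProduct.add_tmul,
            TensorProduct.tmul_add, hx, hy]
      | tmul a q =>
        induction g using TensorProduct.induction_on with
        | zero => simp
        | add x y hx hy =>
          simp only [map_add, LinearMap.add_apply, TensorProduct.add_tmul,
            TensorProduct.tmul_add, hx, hy]
        | tmul b g =>
          induction f' using TensorProduct.induction_on with
          | zero => simp
          | add x y hx hy =>
            simp only [map_add, LinearMap.add_apply, TensorProduct.add_tmul,
            TensorProduct.tmul_add, hx, hy]
          | tmul c f' =>
            induction g' using TensorProduct.induction_on with
            | zero => simp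
            | add x y hx hy =>
              simp only [map_add, LinearMap.add_apply, TensorProduct.add_tmul,
            TensorProduct.tmul_add, hx, hy]
            | tmul e g' =>
              rw [bilinBC_tmul, bilinBC_tmul, tensorBC1_inl, tensorBC1_inl, mul_mul_mul_comm]
              simpa using
                congrArg (fun x => (a * b * (c * e)) ⊗ₜ[R] x)
                  (T.map_c10 (X := X) (Y := Y) (Z := Z) (BoxH1.inl (q ⊗ₜ g)) (f' ⊗ₜ g')))
    (fun X Y Z f p f' g' => by
      induction f using TensorProduct.induction_on with
      | zero => simp
      | add x y hx hy =>
        simp only [map_add, LinearMap.add_apply, TensorProduct.add_tmul,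
            TensorProduct.tmul_add, hx, hy]
      | tmul a f =>
        induction p using TensorProduct.induction_on with
        | zero => simp
        | add x y hx hy =>
          simp only [map_add, LinearMap.add_apply, TensorProduct.add_tmul,
            TensorProduct.tmul_add, hx, hy]
        | tmul b p =>
          induction f' using TensorProduct.induction_on with
          | zero => simp
          | add x y hx hy =>
            simp only [map_add, LinearMap.add_apply, TensorProduct.add_tmul,
            TensorProduct.tmul_add, hx, hy]
          | tmul c f' =>
            induction g' using TensorProduct.induction_on with
            | zero => simp
            | add x y hx hy =>
              simp only [map_add, LinearMap.add_apply, TensorProduct.add_tmul,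
            TensorProduct.tmul_add, hx, hy]
            | tmul e g' =>
              rw [bilinBC_tmul, bilinBC_tmul, tensorBC1_inr, tensorBC1_inr, mul_mul_mul_comm]
              simpa using
                congrArg (fun x => (a * b * (c * e)) ⊗ₜ[R] x)
                  (T.map_c10 (X := X) (Y := Y) (Z := Z) (BoxH1.inr (f ⊗ₜ p)) (f' ⊗ₜ g')))

end BaseChange

section TransBC

variable {C : CochCat.{u, v, w} R} (A : Type u) [CommRing A] [Algebra R A]

/-- The extension of scalars of a transformation between functors `C ⊠ C → C`:
`(a f) ⊠ (b g) ↦ a b ξ_{f ⊠ g}` on homotopy components. -/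
def PreTrans.baseChange₂ {F G : C.Obj × C.Obj → C.Obj} (ξ : PreTrans (C.box C) C F G) :
    PreTrans ((C.baseChange A).box (C.baseChange A)) (C.baseChange A) F G where
  app X := 1 ⊗ₜ ξ.app X
  hty X Y := TensorProduct.lift (bilinBC A (TensorProduct.curry (ξ.hty X Y)))

end TransBC

end Basic

end CochCat

open CochCat

set_option linter.checkUnivs false in
/-- A symmetric strict monoidal category enriched in cochain complexes concentrated in degrees
`-1, 0`.  The associator and the unitors are identities; the identity 1-cells `(U V) W → U (V W)`
and back are `ac` and `ac'` below. -/
structure SymStrictMon (R : Type u) [CommRing R] where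
  C : CochCat.{u, v, w} R
  T : Func (C.box C) C
  I : C.Obj
  assoc : T.left3 = T.right3
  left_unit : (insLeft C I).comp T = Func.id C
  right_unit : (insRight C I).comp T = Func.id C
  braid : PreTrans (C.box C) C T.obj ((boxSwap C C).comp T).obj
  braid_pseudonat : IsPseudonat T ((boxSwap C C).comp T) braid
  braid_hty : ∀ X Y, braid.hty X Y = 0
  braid_braid : ∀ U V : C.Obj, C.c00 (braid.app (V, U)) (braid.app (U, V)) = C.one (T.o U V)
  hexagon :
    hexLSource (PreTrans.ofEq fun X =>
      congrArg (fun F : Func ((C.box C).box C) C => F.obj X) assoc) braid =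
    hexLTarget (PreTrans.ofEq fun X =>
      congrArg (fun F : Func ((C.box C).box C) C => F.obj X) assoc) braid

namespace SymStrictMon

variable {R : Type u} [CommRing R] (S : SymStrictMon.{u, v, w} R)

theorem assoc_obj (X : (S.C.Obj × S.C.Obj) × S.C.Obj) :
    S.T.obj (S.T.obj (X.1.1, X.1.2), X.2) = S.T.obj (X.1.1, S.T.obj (X.1.2, X.2)) :=
  congrArg (fun F : Func ((S.C.box S.C).box S.C) S.C => F.obj X) S.assoc

/-- The identity 1-cell `(U V) W → U (V W)`. -/
def ac (U V W : S.C.Obj) : S.C.H0 (S.T.o (S.T.o U V) W) (S.T.o U (S.T.o V W)) :=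
  S.C.idOfEq (S.assoc_obj ((U, V), W))

/-- The identity 1-cell `U (V W) → (U V) W`. -/
def ac' (U V W : S.C.Obj) : S.C.H0 (S.T.o U (S.T.o V W)) (S.T.o (S.T.o U V) W) :=
  S.C.idOfEq (S.assoc_obj ((U, V), W)).symm

/-- The component `γ_{UV}` of the symmetric braiding. -/
def γ (U V : S.C.Obj) : S.C.H0 (S.T.o U V) (S.T.o V U) := S.braid.app (U, V)

section Infinitesimal

variable (t : PreTrans (S.C.box S.C) S.C S.T.obj S.T.obj)

/-- The component `t_{UV}`. -/
def ta (U V : S.C.Obj) : S.C.H0 (S.T.o U V) (S.T.o U V) := t.app (U, V)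

/-- The homotopy component `t_{f ⊠ g}`. -/
def th {U V U' V' : S.C.Obj} (f : S.C.H0 U U') (g : S.C.H0 V V') :
    S.C.H1 (S.T.o U V) (S.T.o U' V') :=
  t.hty (U, V) (U', V') (f ⊗ₜ[R] g)

local notation "𝐢" => CochCat.one (SymStrictMon.C S)
local notation:80 f:81 " ⬝ " g:80 => CochCat.c00 (SymStrictMon.C S) f g
local notation:80 f:81 " ◁ " q:80 => CochCat.c01 (SymStrictMon.C S) f q
local notation:80 q:81 " ▷ " f:80 => CochCat.c10 (SymStrictMon.C S) q f
local notation:90 U:90 " ⋆ " V:91 => Func.o (SymStrictMon.T S) U V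
local notation:90 f:90 " ⊛ " g:91 => Func.t00 (SymStrictMon.T S) f g
local notation:90 q:90 " ⊛l " g:91 => Func.t10 (SymStrictMon.T S) q g
local notation:90 f:90 " ⊛r " q:91 => Func.t01 (SymStrictMon.T S) f q

/-- The left and right infinitesimal hexagon relations hold on the nose:
`t_{U(VW)} = t_{UV} ⊗ 1_W + (γ_{VU} ⊗ 1_W) (1_V ⊗ t_{UW}) (γ_{UV} ⊗ 1_W)`,
`t_{(UV)W} = 1_U ⊗ t_{VW} + (1_U ⊗ γ_{WV}) (t_{UW} ⊗ 1_V) (1_U ⊗ γ_{VW})`,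
and likewise for the homotopy components. -/
structure IsStrict : Prop where
  left_app : ∀ U V W : S.C.Obj,
    S.ac' U V W ⬝ S.ta t U (V ⋆ W) ⬝ S.ac U V W =
      S.ta t U V ⊛ 𝐢 W + (S.γ V U ⊛ 𝐢 W) ⬝ S.ac' V U W ⬝ (𝐢 V ⊛ S.ta t U W) ⬝ S.ac V U W ⬝
        (S.γ U V ⊛ 𝐢 W)
  left_hty : ∀ {U V W U' V' W' : S.C.Obj} (f : S.C.H0 U U') (g : S.C.H0 V V') (k : S.C.H0 W W'),
    S.ac' U' V' W' ◁ (S.th t f (g ⊛ k) ▷ S.ac U V W) =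
      S.th t f g ⊛l k + ((S.γ V' U' ⊛ 𝐢 W') ⬝ S.ac' V' U' W') ◁
        ((g ⊛r S.th t f k) ▷ (S.ac V U W ⬝ (S.γ U V ⊛ 𝐢 W)))
  right_app : ∀ U V W : S.C.Obj,
    S.ac U V W ⬝ S.ta t (U ⋆ V) W ⬝ S.ac' U V W =
      𝐢 U ⊛ S.ta t V W + (𝐢 U ⊛ S.γ W V) ⬝ S.ac U W V ⬝ (S.ta t U W ⊛ 𝐢 V) ⬝ S.ac' U W V ⬝
        (𝐢 U ⊛ S.γ V W)
  right_hty : ∀ {U V W U' V' W' : S.C.Obj} (f : S.C.H0 U U') (g : S.C.H0 V V') (k : S.C.H0 W W'),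
    S.ac U' V' W' ◁ (S.th t (f ⊛ g) k ▷ S.ac' U V W) =
      f ⊛r S.th t g k + ((𝐢 U' ⊛ S.γ W' V') ⬝ S.ac U' W' V') ◁
        ((S.th t f k ⊛l g) ▷ (S.ac' U W V ⬝ (𝐢 U ⊛ S.γ V W)))

/-- `t` commutes with the symmetric braiding, and its homotopy components at the symmetric braiding
vanish. -/
structure IsTotallySymmetric : Prop where
  symm_app : ∀ U V : S.C.Obj, S.γ U V ⬝ S.ta t U V = S.ta t V U ⬝ S.γ U V
  symm_hty : ∀ {U V U' V' : S.C.Obj} (f : S.C.H0 U U') (g : S.C.H0 V V'),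
    S.γ U' V' ◁ S.th t f g = S.th t g f ▷ S.γ U V
  total : ∀ U V W : S.C.Obj, S.th t (S.γ U V) (𝐢 W) = 0

/-- `L_{UVW} = t_{t_{UV} ⊠ 1_W}`, on `(U V) W`. -/
def relL (U V W : S.C.Obj) : S.C.H1 ((U ⋆ V) ⋆ W) ((U ⋆ V) ⋆ W) := S.th t (S.ta t U V) (𝐢 W)

/-- `R_{UVW} = t_{1_U ⊠ t_{VW}}`, on `U (V W)`. -/
def relR (U V W : S.C.Obj) : S.C.H1 (U ⋆ (V ⋆ W)) (U ⋆ (V ⋆ W)) := S.th t (𝐢 U) (S.ta t V W)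

/-- `γ_{U(VW)} (2 L + R)_{UVW}`, as a homotopy from `(U V) W` to `V (W U)`. -/
def infHexL (U V W : S.C.Obj) : S.C.H1 ((U ⋆ V) ⋆ W) (V ⋆ (W ⋆ U)) :=
  (S.ac V W U ⬝ S.γ U (V ⋆ W) ⬝ S.ac U V W) ◁
    ((2 : R) • S.relL t U V W + S.ac' U V W ◁ (S.relR t U V W ▷ S.ac U V W))

/-- `γ_{(UV)W} (L + 2 R)_{UVW}`, as a homotopy from `U (V W)` to `(W U) V`. -/
def infHexR (U V W : S.C.Obj) : S.C.H1 (U ⋆ (V ⋆ W)) ((W ⋆ U) ⋆ V) :=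
  (S.ac' W U V ⬝ S.γ (U ⋆ V) W ⬝ S.ac' U V W) ◁
    (S.ac U V W ◁ (S.relL t U V W ▷ S.ac' U V W) + (2 : R) • S.relR t U V W)

end Infinitesimal

end SymStrictMon

noncomputable section Deformation

variable {K : Type u} [Field K] (S : SymStrictMon.{u, v, w} K)

/-- The ring `K[h] / (h³)`. -/
abbrev Trunc3 (K : Type u) [Field K] : Type u := K[X] ⧸ Ideal.span {(Polynomial.X : K[X]) ^ 3}

/-- The class of `h` in `K[h] / (h³)`. -/
def hbar (K : Type u) [Field K] : Trunc3 K := Ideal.Quotient.mk _ Polynomial.X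

namespace SymStrictMon

/-- The extension of scalars of the underlying category to `K[h] / (h³)`. -/
abbrev C3 : CochCat.{u, v, max u w} (Trunc3 K) := S.C.baseChange (Trunc3 K)

/-- The extension of scalars of the monoidal product to `K[h] / (h³)`. -/
abbrev T3 : Func (S.C3.box S.C3) S.C3 := tensorBC (Trunc3 K) S.T

variable (t : PreTrans (S.C.box S.C) S.C S.T.obj S.T.obj)

/-- The extension of scalars of `t` to `K[h] / (h³)`. -/
abbrev t3 : PreTrans (S.C3.box S.C3) S.C3 S.T3.obj S.T3.obj := t.baseChange₂ (Trunc3 K)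

/-- `t₁₂ = t ⊗ 1`, on `(U V) W`. -/
def t12 : PreTrans ((S.C3.box S.C3).box S.C3) S.C3 S.T3.left3.obj S.T3.left3.obj :=
  ((S.t3 t).boxOne S.C3).post S.T3

/-- The identity transformation from `(U V) W` to `U (V W)`. -/
def ac3 : PreTrans ((S.C3.box S.C3).box S.C3) S.C3 S.T3.left3.obj S.T3.right3.obj :=
  PreTrans.ofEq S.assoc_obj

/-- The identity transformation from `U (V W)` to `(U V) W`. -/
def ac3' : PreTrans ((S.C3.box S.C3).box S.C3) S.C3 S.T3.right3.obj S.T3.left3.obj :=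
  PreTrans.ofEq fun X => (S.assoc_obj X).symm

/-- `t₂₃ = 1 ⊗ t`, on `(U V) W`. -/
def t23 : PreTrans ((S.C3.box S.C3).box S.C3) S.C3 S.T3.left3.obj S.T3.left3.obj :=
  PreTrans.comp _ _ S.ac3'
    (PreTrans.comp _ _ ((((S.t3 t).oneBox S.C3).post S.T3).pre (boxAssoc S.C3 S.C3 S.C3)) S.ac3)

/-- The associator `1 + (h² / 24) [t₁₂, t₂₃]`, from `(U V) W` to `U (V W)`. -/
def assocOrder2 : PreTrans ((S.C3.box S.C3).box S.C3) S.C3 S.T3.left3.obj S.T3.right3.obj :=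
  PreTrans.comp _ _ S.ac3 (PreTrans.one _ + (algebraMap K (Trunc3 K) (1 / 24) * hbar K ^ 2) •
    (PreTrans.comp _ _ (S.t12 t) (S.t23 t) - PreTrans.comp _ _ (S.t23 t) (S.t12 t)))

/-- The braiding `γ e^{h t / 2} = γ (1 + (h / 2) t + (h² / 8) t²)`. -/
def braidOrder2 : PreTrans (S.C3.box S.C3) S.C3 S.T3.obj ((boxSwap S.C3 S.C3).comp S.T3).obj :=
  PreTrans.comp _ _ (S.braid.baseChange₂ (Trunc3 K))
    (PreTrans.one _ + (algebraMap K (Trunc3 K) (1 / 2) * hbar K) • S.t3 t +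
      (algebraMap K (Trunc3 K) (1 / 8) * hbar K ^ 2) • PreTrans.comp _ _ (S.t3 t) (S.t3 t))

end SymStrictMon

end Deformation

/-! Put k = h/2 and c = h²/24. Since h³ = 0, the only facts about scalars that matter are k² = 6c,
kc = 0 and c² = 0 (`IsOrderTwo`), and h²/8 = 3c. An endomorphism 1 + k a + c b is then a pair (a,
b), and composition adds both entries and contributes 6 a a' to the second one (`quad_c00_quad`).
Every equation of 1-cells thus becomes two equations in endomorphism algebras, written in the
operators t_ij that act on factors i and j of a product. Strictness says that t_{U(VX)} = t12 + t13
and t_{(UV)X} = t13 + t23, and permutations by γ move the t_ij around.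

The pentagon: at order c the two sides differ by [t12, t34] + [t13, t24]. Both commutators vanish on
the nose by interchange, the second after a transposition of the two middle factors, so no four-term
relation is needed and Π = 0 is possible (`pentagon`).

The hexagons: with x = t12, y = t13, z = t23, the two sides of the left hexagon agree at order k and
differ at order c by 2[x, y + z] + [z, x + y]; for the right hexagon the difference is [x, y + z] +
2[z, x + y], in each case followed by the braiding. The differential of t_{f ⊠ g} is a commutator
with t, whence ∂L = [x, y + z] and ∂R = [z, x + y]. This is the origin of the combinations 2L + R
and L + 2R (`hexL_d`, `hexR_d`).

The polyhedra: the hexagonators carry the factor c, and c annihilates the difference of α from the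
identity and of σ from γ. In each term that contains a hexagonator all other factors may therefore
be replaced by undeformed ones. Every other term contains Π or a homotopy component such as σ_{1 ⊠
α} or α_{σ ⊠ 1 ⊠ 1}. The former is zero because α is the identity modulo c and kc = c² = 0; the
latter is zero because α has homotopy components proportional to c, σ is γ modulo c, and t_{γ ⊠ 1} =
0. What remains is an identity for aL + bR. The homotopies L and R are additive in each of their
three arguments (`LR_o_right`, `LR_o_middle`, `LR_o_left`), so each polyhedron becomes a trivial
relation between sums over triples of factors out of four; for the left tetrahedron, 123 + 124 =
(124 + 134) + 123 - 134.

Homotopy components: equality of transformations and the modification axiom also involve the values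
at 1-cells. No separate computation is made for these. A 1-cell is an object of the category of
arrows `CochCat.arr`, whose 1-cells are squares filled by a homotopy and whose homotopies are pairs.
A transformation ξ at f is the square with sides ξ_U, ξ_{U'} and filling ξ_f, vertical composition
is pasting of squares, and the filling of an equation p - p' = ∂q is exactly the modification axiom
(`IsSquareOf.modification`). The computation is therefore made once, in the abstract setting
`WhiskMon`, which only involves whiskerings by objects, and is applied both to the given category
(`InfSym.whisk`) and to its category of arrows (`InfSym.arrWhisk`).

Scalars: all axioms are multilinear in the generating 1-cells and homotopies. They are collected in
`InfSym` in this form, free of equalities between functors, so that they pass to K[h]/(h³) by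
inspection of pure tensors (`InfSym.baseChange`). -/

section

/-! ### Identity 1-cells along equalities of objects -/

namespace CochCat

section IdOfEq

variable {R : Type u} [CommRing R] (C : CochCat.{u, v, w} R)

theorem idOfEq_self {X : C.Obj} (h : X = X) : C.idOfEq h = C.one X := rfl

/-- Products are associative only up to a propositional equality of objects, so rebracketings occur
as explicit 1-cells. By proof irrelevance a composite of rebracketings depends only on its two ends;
this takes the place of a coherence theorem. -/
theorem idOfEq_idOfEq {X Y Z : C.Obj} (h : X = Y) (h' : Y = Z) :
    C.c00 (C.idOfEq h') (C.idOfEq h) = C.idOfEq (h.trans h') := by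
  subst h h'; exact C.one_c00 _

theorem idOfEq_idOfEq_c00 {W X Y Z : C.Obj} (h : X = Y) (h' : Y = Z) (f : C.H0 W X) :
    C.c00 (C.idOfEq h') (C.c00 (C.idOfEq h) f) = C.c00 (C.idOfEq (h.trans h')) f := by
  rw [← C.assoc000, idOfEq_idOfEq]

theorem idOfEq_idOfEq_c01 {W X Y Z : C.Obj} (h : X = Y) (h' : Y = Z) (q : C.H1 W X) :
    C.c01 (C.idOfEq h') (C.c01 (C.idOfEq h) q) = C.c01 (C.idOfEq (h.trans h')) q := by
  rw [← C.assoc001, idOfEq_idOfEq]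

theorem idOfEq_symm_c00 {X Y Z : C.Obj} (h : X = Y) (h' : Y = X) (f : C.H0 Z X) :
    C.c00 (C.idOfEq h') (C.c00 (C.idOfEq h) f) = f := by
  subst h; simp only [idOfEq_self, C.one_c00]

theorem idOfEq_symm_c01 {X Y Z : C.Obj} (h : X = Y) (h' : Y = X) (f : C.H1 Z X) :
    C.c01 (C.idOfEq h') (C.c01 (C.idOfEq h) f) = f := by
  subst h; simp only [idOfEq_self, C.one_c01]

end IdOfEq

end CochCat

/-! ### Whiskered products, threefold products and the operators t12, t13, t23 -/

set_option linter.checkUnivs false in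
/-- A category enriched in cochain complexes concentrated in degrees `-1, 0` with a strictly
associative product, given by its left and right whiskerings, with a symmetric braiding `γ` and an
infinitesimal braiding with components `ta`; `tl W f` and `tr W f` stand for the homotopies
`t_{f ⊠ 1_W}` and `t_{1_W ⊠ f}`. -/
structure WhiskMon (R : Type u) [CommRing R] where
  C : CochCat.{u, v, w} R
  o : C.Obj → C.Obj → C.Obj
  assoc : ∀ U V W, o (o U V) W = o U (o V W)
  l0 : ∀ (U : C.Obj) {X Y : C.Obj}, C.H0 X Y →ₗ[R] C.H0 (o U X) (o U Y)
  l1 : ∀ (U : C.Obj) {X Y : C.Obj}, C.H1 X Y →ₗ[R] C.H1 (o U X) (o U Y)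
  r0 : ∀ (U : C.Obj) {X Y : C.Obj}, C.H0 X Y →ₗ[R] C.H0 (o X U) (o Y U)
  r1 : ∀ (U : C.Obj) {X Y : C.Obj}, C.H1 X Y →ₗ[R] C.H1 (o X U) (o Y U)
  l0_one : ∀ U X, l0 U (C.one X) = C.one (o U X)
  r0_one : ∀ U X, r0 U (C.one X) = C.one (o X U)
  l0_c00 : ∀ U {X Y Z : C.Obj} (f : C.H0 Y Z) (g : C.H0 X Y),
    l0 U (C.c00 f g) = C.c00 (l0 U f) (l0 U g)
  r0_c00 : ∀ U {X Y Z : C.Obj} (f : C.H0 Y Z) (g : C.H0 X Y),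
    r0 U (C.c00 f g) = C.c00 (r0 U f) (r0 U g)
  l1_c01 : ∀ U {X Y Z : C.Obj} (f : C.H0 Y Z) (q : C.H1 X Y),
    l1 U (C.c01 f q) = C.c01 (l0 U f) (l1 U q)
  r1_c01 : ∀ U {X Y Z : C.Obj} (f : C.H0 Y Z) (q : C.H1 X Y),
    r1 U (C.c01 f q) = C.c01 (r0 U f) (r1 U q)
  l1_c10 : ∀ U {X Y Z : C.Obj} (q : C.H1 Y Z) (g : C.H0 X Y),
    l1 U (C.c10 q g) = C.c10 (l1 U q) (l0 U g)
  r1_c10 : ∀ U {X Y Z : C.Obj} (q : C.H1 Y Z) (g : C.H0 X Y),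
    r1 U (C.c10 q g) = C.c10 (r1 U q) (r0 U g)
  exch : ∀ {U U' V V' : C.Obj} (f : C.H0 U U') (g : C.H0 V V'),
    C.c00 (r0 V' f) (l0 U g) = C.c00 (l0 U' g) (r0 V f)
  rr0 : ∀ {U U' : C.Obj} (V W : C.Obj) (f : C.H0 U U'),
    C.c00 (C.idOfEq (assoc U' V W)) (r0 W (r0 V f)) = C.c00 (r0 (o V W) f) (C.idOfEq (assoc U V W))
  lr0 : ∀ {V V' : C.Obj} (U W : C.Obj) (f : C.H0 V V'),
    C.c00 (C.idOfEq (assoc U V' W)) (r0 W (l0 U f)) = C.c00 (l0 U (r0 W f)) (C.idOfEq (assoc U V W))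
  ll0 : ∀ {W W' : C.Obj} (U V : C.Obj) (f : C.H0 W W'),
    C.c00 (C.idOfEq (assoc U V W')) (l0 (o U V) f) = C.c00 (l0 U (l0 V f)) (C.idOfEq (assoc U V W))
  rr1 : ∀ {U U' : C.Obj} (V W : C.Obj) (f : C.H1 U U'),
    C.c01 (C.idOfEq (assoc U' V W)) (r1 W (r1 V f)) = C.c10 (r1 (o V W) f) (C.idOfEq (assoc U V W))
  lr1 : ∀ {V V' : C.Obj} (U W : C.Obj) (f : C.H1 V V'),
    C.c01 (C.idOfEq (assoc U V' W)) (r1 W (l1 U f)) = C.c10 (l1 U (r1 W f)) (C.idOfEq (assoc U V W))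
  ll1 : ∀ {W W' : C.Obj} (U V : C.Obj) (f : C.H1 W W'),
    C.c01 (C.idOfEq (assoc U V W')) (l1 (o U V) f) = C.c10 (l1 U (l1 V f)) (C.idOfEq (assoc U V W))
  γ : ∀ U V, C.H0 (o U V) (o V U)
  γ_r0 : ∀ {U U' : C.Obj} (V : C.Obj) (f : C.H0 U U'),
    C.c00 (γ U' V) (r0 V f) = C.c00 (l0 V f) (γ U V)
  γ_l0 : ∀ {V V' : C.Obj} (U : C.Obj) (f : C.H0 V V'),
    C.c00 (γ U V') (l0 U f) = C.c00 (r0 U f) (γ U V)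
  γ_r1 : ∀ {U U' : C.Obj} (V : C.Obj) (f : C.H1 U U'),
    C.c01 (γ U' V) (r1 V f) = C.c10 (l1 V f) (γ U V)
  γ_l1 : ∀ {V V' : C.Obj} (U : C.Obj) (f : C.H1 V V'),
    C.c01 (γ U V') (l1 U f) = C.c10 (r1 U f) (γ U V)
  γ_γ : ∀ U V, C.c00 (γ V U) (γ U V) = C.one (o U V)
  hex : ∀ U V W,
    C.c00 (C.idOfEq (assoc V W U)) (C.c00 (γ U (o V W)) (C.idOfEq (assoc U V W))) =
      C.c00 (l0 V (γ U W)) (C.c00 (C.idOfEq (assoc V U W)) (r0 W (γ U V)))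
  ta : ∀ U V, C.H0 (o U V) (o U V)
  tl : ∀ (W : C.Obj) {X Y : C.Obj}, C.H0 X Y →ₗ[R] C.H1 (o X W) (o Y W)
  tr : ∀ (W : C.Obj) {X Y : C.Obj}, C.H0 X Y →ₗ[R] C.H1 (o W X) (o W Y)
  d_tl : ∀ (W : C.Obj) {X Y : C.Obj} (f : C.H0 X Y),
    C.c00 (r0 W f) (ta X W) - C.c00 (ta Y W) (r0 W f) = C.d (tl W f)
  d_tr : ∀ (W : C.Obj) {X Y : C.Obj} (f : C.H0 X Y),
    C.c00 (l0 W f) (ta W X) - C.c00 (ta W Y) (l0 W f) = C.d (tr W f)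
  tl_one : ∀ W X, tl W (C.one X) = 0
  tr_one : ∀ W X, tr W (C.one X) = 0
  tl_c00 : ∀ W {X Y Z : C.Obj} (g : C.H0 Y Z) (f : C.H0 X Y),
    tl W (C.c00 g f) = C.c10 (tl W g) (r0 W f) + C.c01 (r0 W g) (tl W f)
  tr_c00 : ∀ W {X Y Z : C.Obj} (g : C.H0 Y Z) (f : C.H0 X Y),
    tr W (C.c00 g f) = C.c10 (tr W g) (l0 W f) + C.c01 (l0 W g) (tr W f)
  γ_ta : ∀ U V, C.c00 (γ U V) (ta U V) = C.c00 (ta V U) (γ U V)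
  tl_γ : ∀ U V W, tl W (γ U V) = 0
  tr_γ : ∀ U V W, tr W (γ U V) = 0
  ta_left : ∀ U V W,
    C.c00 (ta U (o V W)) (C.idOfEq (assoc U V W)) = C.c00 (C.idOfEq (assoc U V W))
      (r0 W (ta U V) + C.c00 (r0 W (γ V U)) (C.c00 (C.idOfEq (assoc V U W).symm)
        (C.c00 (l0 V (ta U W)) (C.c00 (C.idOfEq (assoc V U W)) (r0 W (γ U V))))))
  ta_right : ∀ U V W,
    C.c00 (C.idOfEq (assoc U V W)) (ta (o U V) W) =
      C.c00 (l0 U (ta V W) + C.c00 (l0 U (γ W V)) (C.c00 (C.idOfEq (assoc U W V))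
        (C.c00 (r0 V (ta U W)) (C.c00 (C.idOfEq (assoc U W V).symm) (l0 U (γ V W))))))
        (C.idOfEq (assoc U V W))
  tl_o : ∀ {U U' : C.Obj} (V W : C.Obj) (f : C.H0 U U'),
    C.c10 (tl (o V W) f) (C.idOfEq (assoc U V W)) = C.c01 (C.idOfEq (assoc U' V W))
      (r1 W (tl V f) + C.c01 (r0 W (γ V U')) (C.c01 (C.idOfEq (assoc V U' W).symm)
        (C.c10 (l1 V (tl W f)) (C.c00 (C.idOfEq (assoc V U W)) (r0 W (γ U V))))))
  tr_r0 : ∀ {V V' : C.Obj} (U W : C.Obj) (f : C.H0 V V'),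
    C.c10 (tr U (r0 W f)) (C.idOfEq (assoc U V W)) =
      C.c01 (C.idOfEq (assoc U V' W)) (r1 W (tr U f))
  tr_l0 : ∀ {W W' : C.Obj} (U V : C.Obj) (f : C.H0 W W'),
    C.c10 (tr U (l0 V f)) (C.idOfEq (assoc U V W)) = C.c01 (C.idOfEq (assoc U V W'))
      (C.c01 (r0 W' (γ V U)) (C.c01 (C.idOfEq (assoc V U W').symm)
        (C.c10 (l1 V (tr U f)) (C.c00 (C.idOfEq (assoc V U W)) (r0 W (γ U V))))))
  tl_r0 : ∀ {U U' : C.Obj} (V W : C.Obj) (f : C.H0 U U'),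
    C.c01 (C.idOfEq (assoc U' V W)) (tl W (r0 V f)) =
      C.c10 (C.c01 (l0 U' (γ W V)) (C.c01 (C.idOfEq (assoc U' W V))
        (C.c10 (r1 V (tl W f)) (C.c00 (C.idOfEq (assoc U W V).symm) (l0 U (γ V W))))))
        (C.idOfEq (assoc U V W))
  tl_l0 : ∀ {V V' : C.Obj} (U W : C.Obj) (f : C.H0 V V'),
    C.c01 (C.idOfEq (assoc U V' W)) (tl W (l0 U f)) =
      C.c10 (l1 U (tl W f)) (C.idOfEq (assoc U V W))
  tr_o : ∀ {W W' : C.Obj} (U V : C.Obj) (f : C.H0 W W'),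
    C.c01 (C.idOfEq (assoc U V W')) (tr (o U V) f) =
      C.c10 (l1 U (tr V f) + C.c01 (l0 U (γ W' V)) (C.c01 (C.idOfEq (assoc U W' V))
        (C.c10 (r1 V (tr U f)) (C.c00 (C.idOfEq (assoc U W V).symm) (l0 U (γ V W))))))
        (C.idOfEq (assoc U V W))

namespace WhiskMon

variable {R : Type u} [CommRing R] (W : WhiskMon.{u, v, w} R)

local notation "𝐢" => CochCat.one (WhiskMon.C W)
local notation "𝐞" => CochCat.idOfEq (WhiskMon.C W)
local notation:80 f:81 " ⬝ " g:80 => CochCat.c00 (WhiskMon.C W) f g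
local notation:80 f:81 " ◁ " q:80 => CochCat.c01 (WhiskMon.C W) f q
local notation:80 q:81 " ▷ " f:80 => CochCat.c10 (WhiskMon.C W) q f
local notation:90 U:90 " ⋆ " V:91 => WhiskMon.o W U V

/-- The identity 1-cell `(U V) X → U (V X)`. -/
@[reducible] def ac (U V X : W.C.Obj) : W.C.H0 (U ⋆ V ⋆ X) (U ⋆ (V ⋆ X)) := 𝐞 (W.assoc U V X)

/-- The identity 1-cell `U (V X) → (U V) X`. -/
@[reducible] def ac' (U V X : W.C.Obj) : W.C.H0 (U ⋆ (V ⋆ X)) (U ⋆ V ⋆ X) := 𝐞 (W.assoc U V X).symm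

theorem l0_idOfEq (U : W.C.Obj) {X Y : W.C.Obj} (h : X = Y) :
    W.l0 U (𝐞 h) = 𝐞 (congrArg (W.o U) h) := by subst h; exact W.l0_one U X

theorem r0_idOfEq (U : W.C.Obj) {X Y : W.C.Obj} (h : X = Y) :
    W.r0 U (𝐞 h) = 𝐞 (congrArg (fun X => W.o X U) h) := by subst h; exact W.r0_one U X

theorem tl_idOfEq (U : W.C.Obj) {X Y : W.C.Obj} (h : X = Y) : W.tl U (𝐞 h) = 0 := by
  subst h; exact W.tl_one U X

theorem tr_idOfEq (U : W.C.Obj) {X Y : W.C.Obj} (h : X = Y) : W.tr U (𝐞 h) = 0 := by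
  subst h; exact W.tr_one U X

theorem γ_γ_c00 {X : W.C.Obj} (U V : W.C.Obj) (f : W.C.H0 X (U ⋆ V)) :
    W.γ V U ⬝ (W.γ U V ⬝ f) = f := by rw [← W.C.assoc000, W.γ_γ, W.C.one_c00]

/-- The 1-cell `f ⊗ 1_X` between products bracketed to the right. -/
def R0 (X : W.C.Obj) {U V U' V' : W.C.Obj} :
    W.C.H0 (U ⋆ V) (U' ⋆ V') →ₗ[R] W.C.H0 (U ⋆ (V ⋆ X)) (U' ⋆ (V' ⋆ X)) :=
  (W.C.c00 (W.ac U' V' X)) ∘ₗ (W.C.c00.flip (W.ac' U V X)) ∘ₗ W.r0 X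

/-- The homotopy `q ⊗ 1_X` between products bracketed to the right. -/
def R1 (X : W.C.Obj) {U V U' V' : W.C.Obj} :
    W.C.H1 (U ⋆ V) (U' ⋆ V') →ₗ[R] W.C.H1 (U ⋆ (V ⋆ X)) (U' ⋆ (V' ⋆ X)) :=
  (W.C.c01 (W.ac U' V' X)) ∘ₗ (W.C.c10.flip (W.ac' U V X)) ∘ₗ W.r1 X

section Three

variable {U V X U' V' X' U'' V'' : W.C.Obj}

theorem R0_def (X : W.C.Obj) (f : W.C.H0 (U ⋆ V) (U' ⋆ V')) :
    W.R0 X f = W.ac U' V' X ⬝ (W.r0 X f ⬝ W.ac' U V X) := rfl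

theorem R1_def (X : W.C.Obj) (f : W.C.H1 (U ⋆ V) (U' ⋆ V')) :
    W.R1 X f = W.ac U' V' X ◁ (W.r1 X f ▷ W.ac' U V X) := rfl

theorem ac_r0 (X : W.C.Obj) (f : W.C.H0 (U ⋆ V) (U' ⋆ V')) :
    W.ac U' V' X ⬝ W.r0 X f = W.R0 X f ⬝ W.ac U V X := by
  simp only [R0_def, W.C.assoc000, idOfEq_idOfEq, idOfEq_self, W.C.c00_one]

theorem r0_ac' (X : W.C.Obj) (f : W.C.H0 (U ⋆ V) (U' ⋆ V')) :
    W.r0 X f ⬝ W.ac' U V X = W.ac' U' V' X ⬝ W.R0 X f := by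
  simp only [R0_def, idOfEq_symm_c00]

theorem R0_one (U V X : W.C.Obj) : W.R0 X (𝐢 (U ⋆ V)) = 𝐢 (U ⋆ (V ⋆ X)) := by
  simp only [R0_def, W.r0_one, W.C.one_c00, idOfEq_idOfEq, idOfEq_self]

theorem R0_c00 (X : W.C.Obj) (f : W.C.H0 (U' ⋆ V') (U'' ⋆ V'')) (g : W.C.H0 (U ⋆ V) (U' ⋆ V')) :
    W.R0 X (f ⬝ g) = W.R0 X f ⬝ W.R0 X g := by
  simp only [R0_def, W.r0_c00, W.C.assoc000, idOfEq_symm_c00]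

theorem R0_r0 (V X : W.C.Obj) (f : W.C.H0 U U') : W.R0 X (W.r0 V f) = W.r0 (V ⋆ X) f := by
  rw [R0_def, ← W.C.assoc000, W.rr0, W.C.assoc000, idOfEq_idOfEq, idOfEq_self, W.C.c00_one]

theorem R0_l0 (U X : W.C.Obj) (f : W.C.H0 V V') : W.R0 X (W.l0 U f) = W.l0 U (W.r0 X f) := by
  rw [R0_def, ← W.C.assoc000, W.lr0, W.C.assoc000, idOfEq_idOfEq, idOfEq_self, W.C.c00_one]

/-- The braiding `γ_{U(VX)}`, between products bracketed to the right. -/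
def γL (U V X : W.C.Obj) : W.C.H0 (U ⋆ (V ⋆ X)) (V ⋆ (X ⋆ U)) := W.ac V X U ⬝ W.γ U (V ⋆ X)

/-- The braiding `γ_{(UV)X}`, between products bracketed to the right. -/
def γR (U V X : W.C.Obj) : W.C.H0 (U ⋆ (V ⋆ X)) (X ⋆ (U ⋆ V)) := W.γ (U ⋆ V) X ⬝ W.ac' U V X

/-- This is the hexagon `hex`, with the rebracketings absorbed into `γL` and `R0`. -/
theorem γL_eq (U V X : W.C.Obj) : W.γL U V X = W.l0 V (W.γ U X) ⬝ W.R0 X (W.γ U V) := by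
  have := congrArg (fun f => f ⬝ W.ac' U V X) (W.hex U V X)
  simpa only [γL, R0_def, W.C.assoc000, idOfEq_idOfEq, idOfEq_self, W.C.c00_one] using this

theorem γL_γR (U V X : W.C.Obj) : W.γL X U V ⬝ W.γR U V X = 𝐢 _ := by
  simp only [γR, γL, W.C.assoc000, γ_γ_c00, idOfEq_idOfEq, idOfEq_self]

theorem l0_γ_γ (U V X : W.C.Obj) : W.l0 U (W.γ X V) ⬝ W.l0 U (W.γ V X) = 𝐢 _ := by
  rw [← W.l0_c00, W.γ_γ, W.l0_one]

theorem R0_γ_γ (U V X : W.C.Obj) : W.R0 X (W.γ V U) ⬝ W.R0 X (W.γ U V) = 𝐢 _ := by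
  rw [← W.R0_c00, W.γ_γ, W.R0_one]

theorem l0_γ_γ_c00 {Z : W.C.Obj} (U V X : W.C.Obj) (f : W.C.H0 Z (U ⋆ (V ⋆ X))) :
    W.l0 U (W.γ X V) ⬝ (W.l0 U (W.γ V X) ⬝ f) = f := by
  rw [← W.C.assoc000, l0_γ_γ, W.C.one_c00]

theorem R0_γ_γ_c00 {Z : W.C.Obj} (U V X : W.C.Obj) (f : W.C.H0 Z (U ⋆ (V ⋆ X))) :
    W.R0 X (W.γ V U) ⬝ (W.R0 X (W.γ U V) ⬝ f) = f := by
  rw [← W.C.assoc000, R0_γ_γ, W.C.one_c00]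

theorem l0_γ_γ_c01 {Z : W.C.Obj} (U V X : W.C.Obj) (f : W.C.H1 Z (U ⋆ (V ⋆ X))) :
    W.l0 U (W.γ X V) ◁ (W.l0 U (W.γ V X) ◁ f) = f := by
  rw [← W.C.assoc001, l0_γ_γ, W.C.one_c01]

/-- The second hexagon is not among the axioms. It follows from the first because γ_{X(UV)} is
inverse to γ_{(UV)X} and the two factors of γ_{X(UV)} are cancelled by the opposite braidings. -/
theorem γR_eq (U V X : W.C.Obj) : W.γR U V X = W.R0 V (W.γ U X) ⬝ W.l0 U (W.γ V X) := by
  have := congrArg (fun f => f ⬝ W.γR U V X) (W.γL_eq X U V)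
  simp only [γL_γR, W.C.assoc000] at this
  rw [← W.C.c00_one (W.l0 U _), this, l0_γ_γ_c00, R0_γ_γ_c00]

theorem γL_l0 (f : W.C.H0 (V ⋆ X) (V' ⋆ X')) :
    W.γL U V' X' ⬝ W.l0 U f = W.R0 U f ⬝ W.γL U V X := by
  simp only [γL, R0_def, W.C.assoc000, idOfEq_symm_c00, W.γ_l0]

theorem γL_l1 (f : W.C.H1 (V ⋆ X) (V' ⋆ X')) :
    W.γL U V' X' ◁ W.l1 U f = W.R1 U f ▷ W.γL U V X := by
  simp only [γL, R1_def, W.C.assoc001, W.C.assoc010, W.C.assoc100, idOfEq_symm_c00, W.γ_l1]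

theorem γR_R0 (f : W.C.H0 (U ⋆ V) (U' ⋆ V')) :
    W.γR U' V' X ⬝ W.R0 X f = W.l0 X f ⬝ W.γR U V X := by
  simp only [γR, R0_def, W.C.assoc000, idOfEq_symm_c00]
  simp only [← W.C.assoc000, W.γ_r0]

/-- Moving a 1-cell on the outer two of three factors past the middle factor, in two ways. -/
theorem swap_outer (f : W.C.H0 (U ⋆ X) (U' ⋆ X')) (V : W.C.Obj) :
    W.l0 U' (W.γ X' V) ⬝ (W.R0 V f ⬝ W.l0 U (W.γ V X)) =
      W.R0 X' (W.γ V U') ⬝ (W.l0 V f ⬝ W.R0 X (W.γ U V)) := by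
  have h := W.γL_l0 (U := V) f
  simp only [γL_eq, W.C.assoc000] at h
  have h2 := congrArg (fun k => W.l0 U' (W.γ X' V) ⬝ (k ⬝ W.R0 X (W.γ U V))) h
  simp only [W.C.assoc000, l0_γ_γ_c00, R0_γ_γ, W.C.c00_one] at h2
  exact h2.symm

/-- Naturality of γ_{V(UX)} with respect to a homotopy on the last two factors, with the braiding
expanded by `γL_eq` at both ends and one crossing cancelled on each side. -/
theorem swap_outer_hty (f : W.C.H1 (U ⋆ X) (U' ⋆ X')) (V : W.C.Obj) :
    W.l0 U' (W.γ X' V) ◁ (W.R1 V f ▷ W.l0 U (W.γ V X)) =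
      W.R0 X' (W.γ V U') ◁ (W.l1 V f ▷ W.R0 X (W.γ U V)) := by
  have h := W.γL_l1 (U := V) f
  simp only [γL_eq, W.C.assoc001] at h
  have h2 := congrArg (fun k => W.l0 U' (W.γ X' V) ◁ (k ▷ W.R0 X (W.γ U V))) h
  simp only [W.C.assoc000, W.C.assoc010, W.C.assoc100, l0_γ_γ_c01, R0_γ_γ, W.C.c00_one] at h2
  exact h2.symm

/-- `t₁₃`, on `U (V X)`. -/
def t13 (U V X : W.C.Obj) : W.C.H0 (U ⋆ (V ⋆ X)) (U ⋆ (V ⋆ X)) :=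
  W.R0 X (W.γ V U) ⬝ (W.l0 V (W.ta U X) ⬝ W.R0 X (W.γ U V))

/-- The middle factor may be moved out of the way to either side. The two forms of t13 are needed
because it has to be cancelled against a crossing of the first two factors in one place and of the
last two in another. -/
theorem t13_eq (U V X : W.C.Obj) :
    W.t13 U V X = W.l0 U (W.γ X V) ⬝ (W.R0 V (W.ta U X) ⬝ W.l0 U (W.γ V X)) :=
  (W.swap_outer _ _).symm

/-- Together with `ta_right_eq` this is the entry point of the infinitesimal hexagon relations for
the components of t: t_{U(VX)} = t12 + t13 and t_{(UV)X} = t23 + t13, all on the single object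
U(VX). -/
theorem ta_left_eq (U V X : W.C.Obj) : W.ta U (V ⋆ X) = W.R0 X (W.ta U V) + W.t13 U V X := by
  have := congrArg (fun f => f ⬝ W.ac' U V X) (W.ta_left U V X)
  simp only [W.C.assoc000, idOfEq_idOfEq, idOfEq_self, W.C.c00_one, map_add,
    LinearMap.add_apply] at this
  rw [this, t13]
  simp only [R0_def, W.C.assoc000]

theorem ta_right_eq (U V X : W.C.Obj) :
    W.ac U V X ⬝ (W.ta (U ⋆ V) X ⬝ W.ac' U V X) = W.l0 U (W.ta V X) + W.t13 U V X := by
  have := congrArg (fun f => f ⬝ W.ac' U V X) (W.ta_right U V X)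
  simp only [W.C.assoc000, idOfEq_idOfEq, idOfEq_self, W.C.c00_one, map_add,
    LinearMap.add_apply] at this
  rw [this, t13_eq]
  simp only [R0_def, W.C.assoc000]

end Three

end WhiskMon

end

/-! ### Second-order calculus; the deformed associator and braiding; the two hexagons -/

section

/-- The relations between `k = h / 2` and `c = h² / 24` when `h³ = 0`. -/
structure IsOrderTwo {R : Type u} [CommRing R] (k c : R) : Prop where
  mul_self : k * k = 6 * c
  mul : k * c = 0
  sq : c * c = 0

namespace CochCat

variable {R : Type u} [CommRing R] (C : CochCat.{u, v, w} R)

/-- The endomorphism `1 + k a + c b`. -/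
def quad (k c : R) {X : C.Obj} (a b : C.H0 X X) : C.H0 X X := C.one X + k • a + c • b

/-- The commutator of two endomorphisms. -/
def lieBr {X : C.Obj} (a b : C.H0 X X) : C.H0 X X := C.c00 a b - C.c00 b a

variable {C}

/-- Among the products of the non-constant terms only k² a a' survives, and k² = 6c moves it into
the second-order part. An equation between composites of such endomorphisms therefore splits into a
linear and a quadratic one. -/
theorem quad_c00_quad {k c : R} (hk : IsOrderTwo k c) {X : C.Obj} (a b a' b' : C.H0 X X) :
    C.c00 (C.quad k c a b) (C.quad k c a' b') =
      C.quad k c (a + a') (b + b' + (6 : R) • C.c00 a a') := by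
  have h1 : c * k = 0 := by rw [mul_comm, hk.mul]
  simp only [quad, map_add, map_smul, LinearMap.add_apply, LinearMap.smul_apply, C.one_c00,
    C.c00_one, smul_add, smul_smul, hk.mul_self, hk.mul, h1, hk.sq, zero_smul, mul_comm c 6]
  module

theorem quad_zero (k c : R) (X : C.Obj) : C.quad k c (0 : C.H0 X X) 0 = C.one X := by simp [quad]

theorem c00_quad (k c : R) {X Y : C.Obj} {f : C.H0 X Y} {a b : C.H0 X X} {a' b' : C.H0 Y Y}
    (ha : C.c00 f a = C.c00 a' f) (hb : C.c00 f b = C.c00 b' f) :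
    C.c00 f (C.quad k c a b) = C.c00 (C.quad k c a' b') f := by
  simp only [quad, map_add, map_smul, LinearMap.add_apply, LinearMap.smul_apply, C.one_c00,
    C.c00_one, ha, hb]

theorem c00_quad_zero (k c : R) {X Y : C.Obj} {f : C.H0 X Y} {b : C.H0 X X} {b' : C.H0 Y Y}
    (hb : C.c00 f b = C.c00 b' f) :
    C.c00 f (C.quad k c 0 b) = C.c00 (C.quad k c 0 b') f :=
  c00_quad k c (by simp) hb

theorem c00_c00_swap {X Y : C.Obj} {f : C.H0 X Y} {a b : C.H0 X X} {a' b' : C.H0 Y Y}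
    (ha : C.c00 f a = C.c00 a' f) (hb : C.c00 f b = C.c00 b' f) :
    C.c00 f (C.c00 a b) = C.c00 (C.c00 a' b') f := by
  rw [← C.assoc000, ha, C.assoc000, hb, C.assoc000]

theorem c00_lieBr {X Y : C.Obj} {f : C.H0 X Y} {a b : C.H0 X X} {a' b' : C.H0 Y Y}
    (ha : C.c00 f a = C.c00 a' f) (hb : C.c00 f b = C.c00 b' f) :
    C.c00 f (C.lieBr a b) = C.c00 (C.lieBr a' b') f := by
  simp only [lieBr, map_sub, LinearMap.sub_apply, c00_c00_swap ha hb, c00_c00_swap hb ha]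

end CochCat

namespace WhiskMon

variable {R : Type u} [CommRing R] (W : WhiskMon.{u, v, w} R)

local notation "𝐢" => CochCat.one (WhiskMon.C W)
local notation "𝐞" => CochCat.idOfEq (WhiskMon.C W)
local notation:80 f:81 " ⬝ " g:80 => CochCat.c00 (WhiskMon.C W) f g
local notation:80 f:81 " ◁ " q:80 => CochCat.c01 (WhiskMon.C W) f q
local notation:80 q:81 " ▷ " f:80 => CochCat.c10 (WhiskMon.C W) q f
local notation:90 U:90 " ⋆ " V:91 => WhiskMon.o W U V

section Maps

variable (k c : R)

theorem l0_quad (U : W.C.Obj) {X : W.C.Obj} (a b : W.C.H0 X X) :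
    W.l0 U (W.C.quad k c a b) = W.C.quad k c (W.l0 U a) (W.l0 U b) := by
  simp only [quad, map_add, map_smul, W.l0_one]

theorem R0_quad (X : W.C.Obj) {U V : W.C.Obj} (a b : W.C.H0 (U ⋆ V) (U ⋆ V)) :
    W.R0 X (W.C.quad k c a b) = W.C.quad k c (W.R0 X a) (W.R0 X b) := by
  simp only [quad, map_add, map_smul, W.R0_one]

theorem l0_lieBr (U : W.C.Obj) {X : W.C.Obj} (a b : W.C.H0 X X) :
    W.l0 U (W.C.lieBr a b) = W.C.lieBr (W.l0 U a) (W.l0 U b) := by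
  simp only [lieBr, map_sub, W.l0_c00]

theorem R0_lieBr (X : W.C.Obj) {U V : W.C.Obj} (a b : W.C.H0 (U ⋆ V) (U ⋆ V)) :
    W.R0 X (W.C.lieBr a b) = W.C.lieBr (W.R0 X a) (W.R0 X b) := by
  simp only [lieBr, map_sub, W.R0_c00]

end Maps

section Deform

variable (k c : R)

/-- The commutator `[t₁₂, t₂₃]`, on `(U V) X`. -/
def tc (U V X : W.C.Obj) : W.C.H0 (U ⋆ V ⋆ X) (U ⋆ V ⋆ X) :=
  W.r0 X (W.ta U V) ⬝ (W.ac' U V X ⬝ (W.l0 U (W.ta V X) ⬝ W.ac U V X)) -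
    (W.ac' U V X ⬝ (W.l0 U (W.ta V X) ⬝ W.ac U V X)) ⬝ W.r0 X (W.ta U V)

/-- The associator `1 + c [t₁₂, t₂₃]`. -/
def α (U V X : W.C.Obj) : W.C.H0 (U ⋆ V ⋆ X) (U ⋆ (V ⋆ X)) :=
  W.ac U V X ⬝ (𝐢 _ + c • W.tc U V X)

/-- The inverse associator `1 - c [t₁₂, t₂₃]`. -/
def α' (U V X : W.C.Obj) : W.C.H0 (U ⋆ (V ⋆ X)) (U ⋆ V ⋆ X) :=
  (𝐢 _ - c • W.tc U V X) ⬝ W.ac' U V X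

/-- The braiding `γ (1 + k t + 3 c t²)`. -/
def σ (U V : W.C.Obj) : W.C.H0 (U ⋆ V) (V ⋆ U) :=
  W.γ U V ⬝ (𝐢 _ + k • W.ta U V + (3 * c) • (W.ta U V ⬝ W.ta U V))

/-- The inverse braiding `(1 - k t + 3 c t²) γ`. -/
def σ' (U V : W.C.Obj) : W.C.H0 (V ⋆ U) (U ⋆ V) :=
  (𝐢 _ - k • W.ta U V + (3 * c) • (W.ta U V ⬝ W.ta U V)) ⬝ W.γ V U

/-- The commutator `[t₁₂, t₂₃]`, on `U (V X)`. -/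
def tC (U V X : W.C.Obj) : W.C.H0 (U ⋆ (V ⋆ X)) (U ⋆ (V ⋆ X)) :=
  W.C.lieBr (W.R0 X (W.ta U V)) (W.l0 U (W.ta V X))

theorem ac_tc (U V X : W.C.Obj) : W.ac U V X ⬝ W.tc U V X = W.tC U V X ⬝ W.ac U V X := by
  refine c00_lieBr (W.ac_r0 _ _) ?_
  rw [idOfEq_symm_c00]

theorem tc_ac' (U V X : W.C.Obj) : W.tc U V X ⬝ W.ac' U V X = W.ac' U V X ⬝ W.tC U V X := by
  have := congrArg (fun f => W.ac' U V X ⬝ (f ⬝ W.ac' U V X)) (W.ac_tc U V X)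
  simpa only [W.C.assoc000, idOfEq_symm_c00, idOfEq_idOfEq, idOfEq_self, W.C.c00_one] using this

/-- The first-order part is zero, so the value of k is irrelevant; it is kept as a parameter so that
the associator can be multiplied with the braiding by `quad_c00_quad`. -/
theorem α_eq (U V X : W.C.Obj) :
    W.α c U V X = W.C.quad k c 0 (W.tC U V X) ⬝ W.ac U V X := by
  simp only [α, quad, map_add, map_smul, LinearMap.add_apply, LinearMap.smul_apply, W.C.one_c00,
    W.C.c00_one, ac_tc, smul_zero, add_zero]

theorem α'_eq (U V X : W.C.Obj) :
    W.α' c U V X = W.ac' U V X ⬝ W.C.quad k c 0 (-W.tC U V X) := by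
  simp only [α', quad, map_sub, map_smul, LinearMap.sub_apply,
    LinearMap.smul_apply, W.C.one_c00, W.C.c00_one, tc_ac', smul_zero, add_zero, smul_neg,
    ← sub_eq_add_neg]

theorem σ_eq (U V : W.C.Obj) : W.σ k c U V =
    W.γ U V ⬝ W.C.quad k c (W.ta U V) ((3 : R) • (W.ta U V ⬝ W.ta U V)) := by
  rw [σ, quad, smul_smul, mul_comm c]

theorem σ'_eq (U V : W.C.Obj) : W.σ' k c U V =
    W.C.quad k c (-W.ta U V) ((3 : R) • (W.ta U V ⬝ W.ta U V)) ⬝ W.γ V U := by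
  rw [σ', quad, smul_smul, mul_comm c, smul_neg, ← sub_eq_add_neg]

variable {k c} (hk : IsOrderTwo k c)
include hk

theorem α_α' (U V X : W.C.Obj) : W.α c U V X ⬝ W.α' c U V X = 𝐢 _ := by
  rw [W.α_eq k, W.α'_eq k, W.C.assoc000, idOfEq_symm_c00, quad_c00_quad hk]
  simp [quad_zero]

theorem α'_α (U V X : W.C.Obj) : W.α' c U V X ⬝ W.α c U V X = 𝐢 _ := by
  rw [W.α_eq k, W.α'_eq k, W.C.assoc000, ← W.C.assoc000 (W.C.quad _ _ _ _), quad_c00_quad hk]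
  simp [quad_zero, idOfEq_self, W.C.one_c00, idOfEq_idOfEq]

/-- The second-order part of the product is (3 + 3 - 6) t² = 0, where the -6 comes from k² = 6c. -/
theorem σ'_σ (U V : W.C.Obj) : W.σ' k c U V ⬝ W.σ k c U V = 𝐢 _ := by
  rw [σ_eq, σ'_eq, W.C.assoc000, γ_γ_c00, quad_c00_quad hk, ← quad_zero k c]
  congr 1
  · simp
  · simp only [map_neg, LinearMap.neg_apply]
    module

theorem σ_σ' (U V : W.C.Obj) : W.σ k c U V ⬝ W.σ' k c U V = 𝐢 _ := by
  rw [σ_eq, σ'_eq, W.C.assoc000, ← W.C.assoc000 (W.C.quad _ _ _ _), quad_c00_quad hk]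
  have : (3 : R) • (W.ta U V ⬝ W.ta U V) + (3 : R) • (W.ta U V ⬝ W.ta U V) +
      (6 : R) • W.ta U V ⬝ (-W.ta U V) = 0 := by
    simp only [map_neg]
    module
  rw [this, add_neg_cancel, quad_zero, W.C.one_c00, W.γ_γ]

omit hk

/-- `L_{UVX} = t_{t_{UV} ⊠ 1_X}`, on `U (V X)`. -/
def hL (U V X : W.C.Obj) : W.C.H1 (U ⋆ (V ⋆ X)) (U ⋆ (V ⋆ X)) :=
  W.ac U V X ◁ (W.tl X (W.ta U V) ▷ W.ac' U V X)

/-- `R_{UVX} = t_{1_U ⊠ t_{VX}}`, on `U (V X)`. -/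
def hR (U V X : W.C.Obj) : W.C.H1 (U ⋆ (V ⋆ X)) (U ⋆ (V ⋆ X)) := W.tr U (W.ta V X)

/-- The combination `a L + b R` on `U (V X)`. -/
def LR (a b : R) (U V X : W.C.Obj) : W.C.H1 (U ⋆ (V ⋆ X)) (U ⋆ (V ⋆ X)) :=
  a • W.hL U V X + b • W.hR U V X

/-- `γ_{U(VX)} (2 L + R)_{UVX}`, on `(U V) X`. -/
def infHexL (U V X : W.C.Obj) : W.C.H1 (U ⋆ V ⋆ X) (V ⋆ (X ⋆ U)) :=
  (W.ac V X U ⬝ (W.γ U (V ⋆ X) ⬝ W.ac U V X)) ◁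
    ((2 : R) • W.tl X (W.ta U V) + W.ac' U V X ◁ (W.tr U (W.ta V X) ▷ W.ac U V X))

/-- `γ_{(UV)X} (L + 2 R)_{UVX}`, on `U (V X)`. -/
def infHexR (U V X : W.C.Obj) : W.C.H1 (U ⋆ (V ⋆ X)) (X ⋆ U ⋆ V) :=
  (W.ac' X U V ⬝ (W.γ (U ⋆ V) X ⬝ W.ac' U V X)) ◁
    (W.ac U V X ◁ (W.tl X (W.ta U V) ▷ W.ac' U V X) + (2 : R) • W.tr U (W.ta V X))

theorem infHexL_eq (U V X : W.C.Obj) : W.infHexL U V X =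
    (W.γL U V X ◁ W.LR 2 1 U V X) ▷ W.ac U V X := by
  simp only [infHexL, LR, one_smul, hL, hR, γL, W.C.assoc001, W.C.assoc010, W.C.assoc100, map_add,
      map_smul,
    idOfEq_symm_c01, LinearMap.add_apply, LinearMap.smul_apply, W.C.c10_one, idOfEq_idOfEq,
    idOfEq_self]

theorem infHexR_eq (U V X : W.C.Obj) : W.infHexR U V X =
    W.ac' X U V ◁ (W.γR U V X ◁ W.LR 1 2 U V X) := by
  simp only [infHexR, LR, one_smul, hL, hR, γR, W.C.assoc001]

/-- The differential of t_{f ⊠ 1} is the commutator of f ⊗ 1 with t_{(UV)X}, and `ta_right_eq`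
expands the latter. In `d_hR` the same argument uses t_{U(VX)} = t12 + t13. The four-term relations
thus hold only up to the homotopies L and R. -/
theorem d_hL (U V X : W.C.Obj) : W.C.d (W.hL U V X) =
    W.C.lieBr (W.R0 X (W.ta U V)) (W.l0 U (W.ta V X) + W.t13 U V X) := by
  rw [hL, W.C.d_c01, W.C.d_c10, ← W.d_tl, ← W.ta_right_eq]
  simp only [lieBr, R0_def, map_sub, LinearMap.sub_apply, W.C.assoc000, idOfEq_symm_c00]

theorem d_hR (U V X : W.C.Obj) : W.C.d (W.hR U V X) =
    W.C.lieBr (W.l0 U (W.ta V X)) (W.R0 X (W.ta U V) + W.t13 U V X) := by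
  rw [hR, ← W.d_tr, ← W.ta_left_eq, lieBr]

theorem d_infHexL (U V X : W.C.Obj) : W.C.d (W.infHexL U V X) =
    (W.γL U V X ⬝ ((2 : R) •
        W.C.lieBr (W.R0 X (W.ta U V)) (W.l0 U (W.ta V X) + W.t13 U V X) +
      W.C.lieBr (W.l0 U (W.ta V X)) (W.R0 X (W.ta U V) + W.t13 U V X))) ⬝ W.ac U V X := by
  rw [infHexL_eq, LR, one_smul, W.C.d_c10, W.C.d_c01, map_add, LinearMap.map_smul, d_hL, d_hR]

theorem d_infHexR (U V X : W.C.Obj) : W.C.d (W.infHexR U V X) =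
    W.ac' X U V ⬝ (W.γR U V X ⬝
      (W.C.lieBr (W.R0 X (W.ta U V)) (W.l0 U (W.ta V X) + W.t13 U V X) + (2 : R) •
      W.C.lieBr (W.l0 U (W.ta V X)) (W.R0 X (W.ta U V) + W.t13 U V X))) := by
  rw [infHexR_eq, LR, one_smul, W.C.d_c01, W.C.d_c01, map_add, LinearMap.map_smul, d_hL, d_hR]

/-- This and the next five lemmas describe the action of permutations of the three factors on the
operators t_ij. They serve to carry all factors of a hexagon back to its source. -/
theorem R0_γ_t13 (U V X : W.C.Obj) :
    W.R0 X (W.γ U V) ⬝ W.t13 U V X = W.l0 V (W.ta U X) ⬝ W.R0 X (W.γ U V) := by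
  rw [t13, R0_γ_γ_c00]

theorem l0_γ_t13 (U V X : W.C.Obj) :
    W.l0 U (W.γ V X) ⬝ W.t13 U V X = W.R0 V (W.ta U X) ⬝ W.l0 U (W.γ V X) := by
  rw [t13_eq, l0_γ_γ_c00]

theorem γL_t13 (U V X : W.C.Obj) :
    W.γL U V X ⬝ W.t13 U V X = W.l0 V (W.ta X U) ⬝ W.γL U V X := by
  rw [γL_eq, W.C.assoc000, R0_γ_t13, ← W.C.assoc000, ← W.l0_c00, W.γ_ta, W.l0_c00, W.C.assoc000]

theorem γR_t13 (U V X : W.C.Obj) :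
    W.γR U V X ⬝ W.t13 U V X = W.R0 V (W.ta X U) ⬝ W.γR U V X := by
  rw [γR_eq, W.C.assoc000, l0_γ_t13, ← W.C.assoc000, ← W.R0_c00, W.γ_ta, W.R0_c00, W.C.assoc000]

theorem R0_γ_R0_ta (U V X : W.C.Obj) :
    W.R0 X (W.γ U V) ⬝ W.R0 X (W.ta U V) = W.R0 X (W.ta V U) ⬝ W.R0 X (W.γ U V) := by
  rw [← W.R0_c00, W.γ_ta, W.R0_c00]

theorem l0_γ_l0_ta (U V X : W.C.Obj) :
    W.l0 U (W.γ V X) ⬝ W.l0 U (W.ta V X) = W.l0 U (W.ta X V) ⬝ W.l0 U (W.γ V X) := by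
  rw [← W.l0_c00, W.γ_ta, W.l0_c00]

theorem l0_σ (U V X : W.C.Obj) : W.l0 U (W.σ k c V X) =
    W.l0 U (W.γ V X) ⬝ W.C.quad k c (W.l0 U (W.ta V X))
      ((3 : R) • (W.l0 U (W.ta V X) ⬝ W.l0 U (W.ta V X))) := by
  rw [σ_eq, W.l0_c00, l0_quad, map_smul, W.l0_c00]

theorem R0_σ (U V X : W.C.Obj) : W.R0 X (W.σ k c U V) =
    W.R0 X (W.γ U V) ⬝ W.C.quad k c (W.R0 X (W.ta U V))
      ((3 : R) • (W.R0 X (W.ta U V) ⬝ W.R0 X (W.ta U V))) := by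
  rw [σ_eq, W.R0_c00, R0_quad, map_smul, W.R0_c00]

/-- All endomorphisms are slid through the total braiding to the source. Under it t23 and t13
correspond to the two operators in α_{VXU}, which becomes 1 + c [t23, t13]; the braiding contributes
the exponential of t12 + t13. -/
theorem hexL_source (U V X : W.C.Obj) :
    W.α c V X U ⬝ (W.σ k c U (V ⋆ X) ⬝ W.α c U V X) =
      (W.γL U V X ⬝ (W.C.quad k c 0 (W.C.lieBr (W.l0 U (W.ta V X)) (W.t13 U V X)) ⬝
        (W.C.quad k c (W.R0 X (W.ta U V) + W.t13 U V X)
            ((3 : R) • ((W.R0 X (W.ta U V) + W.t13 U V X) ⬝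
              (W.R0 X (W.ta U V) + W.t13 U V X))) ⬝
          W.C.quad k c 0 (W.tC U V X)))) ⬝ W.ac U V X := by
  have h := c00_quad_zero k c (c00_lieBr (W.γL_l0 (W.ta V X)) (W.γL_t13 U V X))
  rw [W.α_eq k, W.α_eq k, σ_eq, ta_left_eq, ← W.C.assoc000 (W.γL U V X), h]
  simp only [W.C.assoc000, γL]
  rfl

/-- The total braiding factors by `γL_eq`, and the factors are slid through its first crossing only:
γ_{UV} turns the exponential of t_{UX} into that of t13 and α_{VUX} into 1 + c [t12, t13]. -/
theorem hexL_target (U V X : W.C.Obj) :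
    W.l0 V (W.σ k c U X) ⬝ (W.α c V U X ⬝ W.r0 X (W.σ k c U V)) =
      (W.γL U V X ⬝ (W.C.quad k c (W.t13 U V X) ((3 : R) • (W.t13 U V X ⬝ W.t13 U V X)) ⬝
        (W.C.quad k c 0 (W.C.lieBr (W.R0 X (W.ta U V)) (W.t13 U V X)) ⬝
          W.C.quad k c (W.R0 X (W.ta U V))
            ((3 : R) • (W.R0 X (W.ta U V) ⬝ W.R0 X (W.ta U V)))))) ⬝ W.ac U V X := by
  have h1 := c00_quad_zero k c (c00_lieBr (W.R0_γ_R0_ta U V X) (W.R0_γ_t13 U V X))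
  have h2 := W.R0_γ_t13 U V X
  have h3 := c00_quad k c (b' := (3 : R) • (W.l0 V (W.ta U X) ⬝ W.l0 V (W.ta U X))) h2
    (b := (3 : R) • (W.t13 U V X ⬝ W.t13 U V X))
    (by simp only [map_smul, LinearMap.smul_apply, c00_c00_swap h2 h2])
  rw [W.α_eq k, W.C.assoc000, ac_r0, l0_σ, R0_σ, γL_eq]
  simp only [W.C.assoc000]
  congr 1
  rw [← W.C.assoc000 (W.R0 X (W.γ U V)) (W.C.quad _ _ (W.t13 U V X) _), h3, W.C.assoc000]
  congr 1
  rw [← W.C.assoc000 (W.R0 X (W.γ U V)) (W.C.quad _ _ 0 _), h1, W.C.assoc000]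
  rfl

-- At order k both sides give t12 + t13. Write x, y, z for t12, t13, t23. At order c the
-- exponentials differ by 3(x + y)² - 3x² - 3y² - 6yx = 3[x, y], and the associators add [z, y] +
-- [x, z] - [x, y]. The total [x, z] + [z, y] + 2[x, y] equals 2[x, y + z] + [z, x + y], which is 2
-- ∂L + ∂R.
include hk in
theorem hexL_d (U V X : W.C.Obj) :
    W.α c V X U ⬝ (W.σ k c U (V ⋆ X) ⬝ W.α c U V X) -
      W.l0 V (W.σ k c U X) ⬝ (W.α c V U X ⬝ W.r0 X (W.σ k c U V)) =
    W.C.d (c • W.infHexL U V X) := by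
  rw [hexL_source, hexL_target, map_smul, d_infHexL]
  simp only [quad_c00_quad hk, tC]
  -- From here on the three operators are arbitrary endomorphisms; the remaining identity uses only
  -- bilinearity of composition, and no relation between them.
  generalize W.R0 X (W.ta U V) = x
  generalize W.l0 U (W.ta V X) = z
  generalize W.t13 U V X = y
  simp only [quad, lieBr, map_add, map_sub, map_smul, LinearMap.add_apply,
    LinearMap.sub_apply, LinearMap.smul_apply, map_zero, LinearMap.zero_apply]
  module

/-- As on the left, but with inverse associators and the braiding γ_{(UV)X}. It carries t13 and t12
to the two operators in α⁻¹_{XUV}, which becomes 1 - c [t13, t12]. -/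
theorem hexR_source (U V X : W.C.Obj) :
    W.α' c X U V ⬝ (W.σ k c (U ⋆ V) X ⬝ W.α' c U V X) =
      W.ac' X U V ⬝ (W.γR U V X ⬝
        (W.C.quad k c 0 (-W.C.lieBr (W.t13 U V X) (W.R0 X (W.ta U V))) ⬝
        (W.C.quad k c (W.l0 U (W.ta V X) + W.t13 U V X)
            ((3 : R) • ((W.l0 U (W.ta V X) + W.t13 U V X) ⬝
              (W.l0 U (W.ta V X) + W.t13 U V X))) ⬝
          W.C.quad k c 0 (-W.tC U V X)))) := by
  have h := c00_quad_zero k c (b := -W.C.lieBr (W.t13 U V X) (W.R0 X (W.ta U V)))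
    (b' := -W.tC X U V) (f := W.γR U V X) (by
      simp only [map_neg, LinearMap.neg_apply, tC,
        c00_lieBr (W.γR_t13 U V X) (W.γR_R0 (X := X) (W.ta U V))])
  -- The operator t_{(UV)X} lives on (UV)X. It has to be moved across the rebracketing before it can
  -- be expanded as t23 + t13.
  have h1 : W.ac' U V X ⬝ (W.l0 U (W.ta V X) + W.t13 U V X) =
      W.ta (U ⋆ V) X ⬝ W.ac' U V X := by rw [← W.ta_right_eq, idOfEq_symm_c00]
  have h2 := c00_quad k c (b := (3 : R) • ((W.l0 U (W.ta V X) + W.t13 U V X) ⬝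
              (W.l0 U (W.ta V X) + W.t13 U V X)))
    (b' := (3 : R) • (W.ta (U ⋆ V) X ⬝ W.ta (U ⋆ V) X)) h1 (by
      rw [LinearMap.map_smul, LinearMap.map_smul, LinearMap.smul_apply, c00_c00_swap h1 h1])
  rw [W.α'_eq k, W.α'_eq k, σ_eq, ← W.C.assoc000 (W.γR U V X), h]
  simp only [W.C.assoc000, γR]
  rw [← W.C.assoc000 (W.ac' U V X) (W.C.quad _ _ (_ + _) _), h2, W.C.assoc000]

theorem hexR_target (U V X : W.C.Obj) :
    W.r0 V (W.σ k c U X) ⬝ (W.α' c U X V ⬝ W.l0 U (W.σ k c V X)) =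
      W.ac' X U V ⬝ (W.γR U V X ⬝
      (W.C.quad k c (W.t13 U V X) ((3 : R) • (W.t13 U V X ⬝ W.t13 U V X)) ⬝
        (W.C.quad k c 0 (-W.C.lieBr (W.t13 U V X) (W.l0 U (W.ta V X))) ⬝
          W.C.quad k c (W.l0 U (W.ta V X))
            ((3 : R) • (W.l0 U (W.ta V X) ⬝ W.l0 U (W.ta V X)))))) := by
  have h1 := c00_quad_zero k c (b := -W.C.lieBr (W.t13 U V X) (W.l0 U (W.ta V X)))
    (b' := -W.tC U X V) (f := W.l0 U (W.γ V X)) (by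
      simp only [map_neg, LinearMap.neg_apply, tC,
        c00_lieBr (W.l0_γ_t13 U V X) (W.l0_γ_l0_ta U V X)])
  have h2 := W.l0_γ_t13 U V X
  have h3 := c00_quad k c (b' := (3 : R) • (W.R0 V (W.ta U X) ⬝ W.R0 V (W.ta U X))) h2
    (b := (3 : R) • (W.t13 U V X ⬝ W.t13 U V X))
    (by simp only [map_smul, LinearMap.smul_apply, c00_c00_swap h2 h2])
  rw [W.α'_eq k, ← W.C.assoc000, ← W.C.assoc000, r0_ac', l0_σ, R0_σ, γR_eq]
  simp only [W.C.assoc000]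
  congr 2
  rw [← W.C.assoc000 (W.l0 U (W.γ V X)) (W.C.quad _ _ (W.t13 U V X) _), h3, W.C.assoc000]
  congr 1
  rw [← W.C.assoc000 (W.l0 U (W.γ V X)) (W.C.quad _ _ 0 _), h1, W.C.assoc000]

-- With x, y, z for t12, t13, t23: at order c the exponentials of z + y, and of y and z separately,
-- differ by 3[z, y], and the inverse associators contribute [x, y] + [z, x] - [z, y]. The total [x,
-- y] + [z, x] + 2[z, y] equals [x, y + z] + 2[z, x + y], which is ∂L + 2 ∂R.
include hk in
theorem hexR_d (U V X : W.C.Obj) :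
    W.α' c X U V ⬝ (W.σ k c (U ⋆ V) X ⬝ W.α' c U V X) -
      W.r0 V (W.σ k c U X) ⬝ (W.α' c U X V ⬝ W.l0 U (W.σ k c V X)) =
    W.C.d (c • W.infHexR U V X) := by
  rw [hexR_source, hexR_target, map_smul, d_infHexR]
  simp only [quad_c00_quad hk, tC]
  generalize W.R0 X (W.ta U V) = x
  generalize W.l0 U (W.ta V X) = z
  generalize W.t13 U V X = y
  simp only [quad, lieBr, map_add, map_sub, map_neg, map_smul, LinearMap.add_apply, map_zero,
    LinearMap.zero_apply]
  module

end Deform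

end WhiskMon

end

/-! ### Fourfold products bracketed to the right -/

section

namespace WhiskMon

variable {R : Type u} [CommRing R] (W : WhiskMon.{u, v, w} R)

local notation "𝐢" => CochCat.one (WhiskMon.C W)
local notation "𝐞" => CochCat.idOfEq (WhiskMon.C W)
local notation:80 f:81 " ⬝ " g:80 => CochCat.c00 (WhiskMon.C W) f g
local notation:80 f:81 " ◁ " q:80 => CochCat.c01 (WhiskMon.C W) f q
local notation:80 q:81 " ▷ " f:80 => CochCat.c10 (WhiskMon.C W) q f
local notation:90 U:90 " ⋆ " V:91 => WhiskMon.o W U V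

section Four

theorem assoc4 (U V X Y : W.C.Obj) : U ⋆ (V ⋆ X) ⋆ Y = U ⋆ (V ⋆ (X ⋆ Y)) :=
  (W.assoc U (V ⋆ X) Y).trans (congrArg (W.o U) (W.assoc V X Y))

variable {U V X U' V' X' U'' V'' X'' : W.C.Obj}

/-- The 1-cell `f ⊗ 1_Y` between fourfold products bracketed to the right. -/
def RR0 (Y : W.C.Obj) {U V X U' V' X' : W.C.Obj} :
    W.C.H0 (U ⋆ (V ⋆ X)) (U' ⋆ (V' ⋆ X')) →ₗ[R]
      W.C.H0 (U ⋆ (V ⋆ (X ⋆ Y))) (U' ⋆ (V' ⋆ (X' ⋆ Y))) :=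
  (W.C.c00 (𝐞 (W.assoc4 U' V' X' Y))) ∘ₗ (W.C.c00.flip (𝐞 (W.assoc4 U V X Y).symm)) ∘ₗ W.r0 Y

/-- The homotopy `q ⊗ 1_Y` between fourfold products bracketed to the right. -/
def RR1 (Y : W.C.Obj) {U V X U' V' X' : W.C.Obj} :
    W.C.H1 (U ⋆ (V ⋆ X)) (U' ⋆ (V' ⋆ X')) →ₗ[R]
      W.C.H1 (U ⋆ (V ⋆ (X ⋆ Y))) (U' ⋆ (V' ⋆ (X' ⋆ Y))) :=
  (W.C.c01 (𝐞 (W.assoc4 U' V' X' Y))) ∘ₗ (W.C.c10.flip (𝐞 (W.assoc4 U V X Y).symm)) ∘ₗ W.r1 Y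

theorem RR0_def (Y : W.C.Obj) (f : W.C.H0 (U ⋆ (V ⋆ X)) (U' ⋆ (V' ⋆ X'))) :
    W.RR0 Y f = 𝐞 (W.assoc4 U' V' X' Y) ⬝ (W.r0 Y f ⬝ 𝐞 (W.assoc4 U V X Y).symm) := rfl

theorem RR1_def (Y : W.C.Obj) (f : W.C.H1 (U ⋆ (V ⋆ X)) (U' ⋆ (V' ⋆ X'))) :
    W.RR1 Y f = 𝐞 (W.assoc4 U' V' X' Y) ◁ (W.r1 Y f ▷ 𝐞 (W.assoc4 U V X Y).symm) := rfl

theorem RR0_c00 (Y : W.C.Obj) (f : W.C.H0 (U' ⋆ (V' ⋆ X')) (U'' ⋆ (V'' ⋆ X'')))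
    (g : W.C.H0 (U ⋆ (V ⋆ X)) (U' ⋆ (V' ⋆ X'))) :
    W.RR0 Y (f ⬝ g) = W.RR0 Y f ⬝ W.RR0 Y g := by
  simp only [RR0_def, W.r0_c00, W.C.assoc000, idOfEq_symm_c00]

theorem RR1_c01 (Y : W.C.Obj) (f : W.C.H0 (U' ⋆ (V' ⋆ X')) (U'' ⋆ (V'' ⋆ X'')))
    (g : W.C.H1 (U ⋆ (V ⋆ X)) (U' ⋆ (V' ⋆ X'))) :
    W.RR1 Y (f ◁ g) = W.RR0 Y f ◁ W.RR1 Y g := by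
  simp only [RR0_def, RR1_def, W.r1_c01, W.C.assoc001, W.C.assoc010, idOfEq_symm_c01]

theorem RR0_R0 (X Y : W.C.Obj) (f : W.C.H0 (U ⋆ V) (U' ⋆ V')) :
    W.RR0 Y (W.R0 X f) = W.R0 (X ⋆ Y) f := by
  rw [RR0_def, W.R0_def (X ⋆ Y), ← R0_r0]
  simp only [R0_def, W.r0_c00, r0_idOfEq, W.C.assoc000, idOfEq_idOfEq, idOfEq_idOfEq_c00]

theorem RR0_l0 (U Y : W.C.Obj) (f : W.C.H0 (V ⋆ X) (V' ⋆ X')) :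
    W.RR0 Y (W.l0 U f) = W.l0 U (W.R0 Y f) := by
  simp only [RR0_def, W.R0_def Y f, W.l0_c00, ← R0_l0]
  simp only [R0_def, l0_idOfEq, W.C.assoc000, idOfEq_idOfEq, idOfEq_idOfEq_c00]

theorem ac_R0 (Y : W.C.Obj) (f : W.C.H0 (U ⋆ V ⋆ X) (U' ⋆ V' ⋆ X')) :
    W.ac U' V' (X' ⋆ Y) ⬝ W.R0 Y f =
      W.RR0 Y (W.ac U' V' X' ⬝ (f ⬝ W.ac' U V X)) ⬝ W.ac U V (X ⋆ Y) := by
  simp only [RR0_def, R0_def, W.r0_c00, r0_idOfEq, W.C.assoc000, idOfEq_idOfEq, idOfEq_idOfEq_c00]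

theorem ac_R1 (Y : W.C.Obj) (f : W.C.H1 (U ⋆ V ⋆ X) (U' ⋆ V' ⋆ X')) :
    W.ac U' V' (X' ⋆ Y) ◁ W.R1 Y f =
      W.RR1 Y (W.ac U' V' X' ◁ (f ▷ W.ac' U V X)) ▷ W.ac U V (X ⋆ Y) := by
  simp only [RR1_def, R1_def, W.r1_c01, W.r1_c10, r0_idOfEq, W.C.assoc010, W.C.assoc100,
    idOfEq_idOfEq, idOfEq_idOfEq_c01]

theorem l0_ac_R0 (Y : W.C.Obj) (f : W.C.H0 (U ⋆ (V ⋆ X)) (U' ⋆ (V' ⋆ X'))) :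
    W.l0 U' (W.ac V' X' Y) ⬝ W.R0 Y f = W.RR0 Y f ⬝ W.l0 U (W.ac V X Y) := by
  simp only [RR0_def, R0_def, l0_idOfEq, W.C.assoc000, idOfEq_idOfEq, idOfEq_idOfEq_c00]

theorem ac_l0 (U V : W.C.Obj) (f : W.C.H0 X X') :
    W.ac U V X' ⬝ W.l0 (U ⋆ V) f = W.l0 U (W.l0 V f) ⬝ W.ac U V X := W.ll0 U V f

/-- Strict interchange: 1-cells on the first two factors and on what follows them act on disjoint
factors, so they commute. This is the source of both vanishing commutators in the pentagon. -/
theorem R0_exch (f : W.C.H0 (U ⋆ V) (U' ⋆ V')) (g : W.C.H0 X X') :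
    W.R0 X' f ⬝ W.l0 U (W.l0 V g) = W.l0 U' (W.l0 V' g) ⬝ W.R0 X f := by
  have h : W.ac' U V X' ⬝ W.l0 U (W.l0 V g) = W.l0 (U ⋆ V) g ⬝ W.ac' U V X := by
    have := congrArg (fun k => W.ac' U V X' ⬝ (k ⬝ W.ac' U V X)) (W.ac_l0 U V g)
    simpa only [W.C.assoc000, idOfEq_symm_c00, idOfEq_idOfEq, idOfEq_self, W.C.c00_one]
      using this.symm
  rw [R0_def, W.C.assoc000, W.C.assoc000, h, ← W.C.assoc000 (W.r0 X' f), W.exch, W.C.assoc000,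
    ← W.C.assoc000, ac_l0, W.C.assoc000]
  rfl

end Four

/-! ### The pentagon -/

section Pentagon

variable (k c : R) (U V X Y : W.C.Obj)

theorem lieBr_t12_t34 :
    W.C.lieBr (W.R0 (X ⋆ Y) (W.ta U V)) (W.l0 U (W.l0 V (W.ta X Y))) = 0 := by
  rw [lieBr, R0_exch, sub_self]

/-- Both operators are obtained from t12 and t34 on U(X(VY)) by conjugation with the transposition
of the two middle factors: t13 by moving V past X, t24 likewise. There they act on disjoint factors,
so `R0_exch` applies. -/
theorem lieBr_t13_t24 :
    W.C.lieBr (W.RR0 Y (W.t13 U V X)) (W.l0 U (W.t13 V X Y)) = 0 := by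
  have h : ∀ {Z : W.C.Obj} (f : W.C.H0 Z _),
      W.l0 U (W.R0 Y (W.γ V X)) ⬝ (W.l0 U (W.R0 Y (W.γ X V)) ⬝ f) = f := fun f => by
    rw [← W.C.assoc000, ← W.l0_c00, R0_γ_γ, W.l0_one, W.C.one_c00]
  rw [t13_eq, t13, RR0_c00, RR0_c00, RR0_R0, RR0_l0, RR0_l0, W.l0_c00, W.l0_c00, lieBr]
  simp only [W.C.assoc000, h]
  rw [← W.C.assoc000 (W.R0 _ _), R0_exch, W.C.assoc000, sub_self]

-- Only order c matters, since there is no first-order part. One side is [t23, t34] + [t12 + t13,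
-- t24 + t34] + [t12, t23], the other [t12, t23 + t24] + [t13 + t23, t34]. Their difference is [t12,
-- t34] + [t13, t24], and both of these vanish on the nose.
variable {k c} in
theorem pentagon (hk : IsOrderTwo k c) :
    W.l0 U (W.α c V X Y) ⬝ (W.α c U (V ⋆ X) Y ⬝ W.r0 Y (W.α c U V X)) =
      W.α c U V (X ⋆ Y) ⬝ W.α c (U ⋆ V) X Y := by
  -- The equations `e1` to `e6` slide the rebracketings to the right, so that all factors become
  -- endomorphisms of U(V(XY)). There t_{U(VX)} ⊗ 1 is t12 + t13, 1 ⊗ t_{(VX)Y} is t34 + t24, and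
  -- t_{(UV)X} ⊗ 1 is t23 + t13.
  have e1 : W.l0 U (W.ac V X Y) ⬝ W.R0 Y (W.ta U (V ⋆ X)) =
      (W.R0 (X ⋆ Y) (W.ta U V) + W.RR0 Y (W.t13 U V X)) ⬝ W.l0 U (W.ac V X Y) := by
    rw [l0_ac_R0, ta_left_eq, map_add, RR0_R0]
  have e2 : W.l0 U (W.ac V X Y) ⬝ W.l0 U (W.ta (V ⋆ X) Y) =
      (W.l0 U (W.l0 V (W.ta X Y)) + W.l0 U (W.t13 V X Y)) ⬝ W.l0 U (W.ac V X Y) := by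
    rw [← map_add, ← ta_right_eq, ← W.l0_c00, ← W.l0_c00]
    simp only [W.C.assoc000, idOfEq_idOfEq, idOfEq_self, W.C.c00_one]
  have e3 := c00_quad_zero k c (c00_lieBr e1 e2)
  have e4 : W.l0 U (W.ac V X Y) ⬝ W.R0 Y (W.C.quad k c 0 (W.tC U V X)) =
      W.C.quad k c 0 (W.C.lieBr (W.R0 (X ⋆ Y) (W.ta U V)) (W.l0 U (W.R0 Y (W.ta V X)))) ⬝
        W.l0 U (W.ac V X Y) := by
    rw [R0_quad, map_zero]
    refine c00_quad_zero k c ?_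
    rw [tC, R0_lieBr]
    exact c00_lieBr (by rw [l0_ac_R0, RR0_R0]) (by rw [l0_ac_R0, RR0_l0])
  have e5 : W.ac U V (X ⋆ Y) ⬝ W.R0 Y (W.ta (U ⋆ V) X) =
      (W.l0 U (W.R0 Y (W.ta V X)) + W.RR0 Y (W.t13 U V X)) ⬝ W.ac U V (X ⋆ Y) := by
    rw [ac_R0, ta_right_eq, map_add, RR0_l0]
  have e6 := c00_quad_zero k c (c00_lieBr e5 (W.ac_l0 U V (W.ta X Y)))
  have e7 : W.tC U V (X ⋆ Y) = W.C.lieBr (W.R0 (X ⋆ Y) (W.ta U V))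
      (W.l0 U (W.R0 Y (W.ta V X)) + W.l0 U (W.t13 V X Y)) := by
    rw [tC, ta_left_eq, map_add]
  have l : W.l0 U (W.α c V X Y) ⬝ (W.α c U (V ⋆ X) Y ⬝ W.r0 Y (W.α c U V X)) =
      (W.l0 U (W.C.quad k c 0 (W.tC V X Y)) ⬝ (W.l0 U (W.ac V X Y) ⬝
        W.C.quad k c 0 (W.tC U (V ⋆ X) Y))) ⬝ ((W.ac U (V ⋆ X) Y ⬝
          W.r0 Y (W.C.quad k c 0 (W.tC U V X))) ⬝ W.r0 Y (W.ac U V X)) := by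
    rw [W.α_eq k, W.α_eq k, W.α_eq k, W.l0_c00, W.r0_c00]
    simp only [W.C.assoc000]
  have l' : W.l0 U (W.α c V X Y) ⬝ (W.α c U (V ⋆ X) Y ⬝ W.r0 Y (W.α c U V X)) =
      (W.l0 U (W.C.quad k c 0 (W.tC V X Y)) ⬝ (W.C.quad k c 0 (W.C.lieBr
        (W.R0 (X ⋆ Y) (W.ta U V) + W.RR0 Y (W.t13 U V X))
        (W.l0 U (W.l0 V (W.ta X Y)) + W.l0 U (W.t13 V X Y))) ⬝
        W.C.quad k c 0 (W.C.lieBr (W.R0 (X ⋆ Y) (W.ta U V)) (W.l0 U (W.R0 Y (W.ta V X)))))) ⬝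
      (W.l0 U (W.ac V X Y) ⬝ (W.ac U (V ⋆ X) Y ⬝ W.r0 Y (W.ac U V X))) := by
    rw [l, ac_r0]
    simp only [W.C.assoc000]
    congr 1
    rw [← W.C.assoc000 (W.l0 U (W.ac V X Y)), tC, e3, W.C.assoc000]
    congr 1
    rw [← W.C.assoc000 (W.l0 U (W.ac V X Y)), e4, W.C.assoc000]
  have r' : W.α c U V (X ⋆ Y) ⬝ W.α c (U ⋆ V) X Y =
      (W.C.quad k c 0 (W.tC U V (X ⋆ Y)) ⬝ W.C.quad k c 0 (W.C.lieBr
        (W.l0 U (W.R0 Y (W.ta V X)) + W.RR0 Y (W.t13 U V X)) (W.l0 U (W.l0 V (W.ta X Y))))) ⬝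
      (W.ac U V (X ⋆ Y) ⬝ W.ac (U ⋆ V) X Y) := by
    rw [W.α_eq k, W.α_eq k]
    simp only [W.C.assoc000]
    congr 1
    rw [← W.C.assoc000, tC, e6, W.C.assoc000]
  rw [l', r', l0_idOfEq, r0_idOfEq, idOfEq_idOfEq, idOfEq_idOfEq, idOfEq_idOfEq, l0_quad, tC,
    l0_lieBr, map_zero, quad_c00_quad hk, quad_c00_quad hk, quad_c00_quad hk, e7]
  simp only [add_zero, map_zero, smul_zero]
  congr 3
  have h1 := W.lieBr_t12_t34 U V X Y
  have h2 := W.lieBr_t13_t24 U V X Y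
  generalize W.R0 (X ⋆ Y) (W.ta U V) = x12 at *
  generalize W.RR0 Y (W.t13 U V X) = x13 at *
  generalize W.l0 U (W.R0 Y (W.ta V X)) = x23 at *
  generalize W.l0 U (W.t13 V X Y) = x24 at *
  generalize W.l0 U (W.l0 V (W.ta X Y)) = x34 at *
  rw [← sub_eq_zero]
  refine Eq.trans ?_ (show W.C.lieBr x12 x34 + W.C.lieBr x13 x24 = 0 by rw [h1, h2, add_zero])
  simp only [lieBr, map_add, LinearMap.add_apply]
  module

end Pentagon

/-! ### Additivity of the homotopies L and R in each argument -/

section Homotopies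

variable {U V X U' V' X' : W.C.Obj}

/-- The homotopy `t_{f ⊠ 1_Y}` between threefold products bracketed to the right. -/
def TL2 (Y : W.C.Obj) {U V U' V' : W.C.Obj} :
    W.C.H0 (U ⋆ V) (U' ⋆ V') →ₗ[R] W.C.H1 (U ⋆ (V ⋆ Y)) (U' ⋆ (V' ⋆ Y)) :=
  (W.C.c01 (W.ac U' V' Y)) ∘ₗ (W.C.c10.flip (W.ac' U V Y)) ∘ₗ W.tl Y

/-- The homotopy `t_{f ⊠ 1_Y}` between fourfold products bracketed to the right. -/
def TL3 (Y : W.C.Obj) {U V X U' V' X' : W.C.Obj} :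
    W.C.H0 (U ⋆ (V ⋆ X)) (U' ⋆ (V' ⋆ X')) →ₗ[R]
      W.C.H1 (U ⋆ (V ⋆ (X ⋆ Y))) (U' ⋆ (V' ⋆ (X' ⋆ Y))) :=
  (W.C.c01 (𝐞 (W.assoc4 U' V' X' Y))) ∘ₗ (W.C.c10.flip (𝐞 (W.assoc4 U V X Y).symm)) ∘ₗ W.tl Y

theorem TL2_def (Y : W.C.Obj) (f : W.C.H0 (U ⋆ V) (U' ⋆ V')) :
    W.TL2 Y f = W.ac U' V' Y ◁ (W.tl Y f ▷ W.ac' U V Y) := rfl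

theorem TL3_def (Y : W.C.Obj) (f : W.C.H0 (U ⋆ (V ⋆ X)) (U' ⋆ (V' ⋆ X'))) :
    W.TL3 Y f = 𝐞 (W.assoc4 U' V' X' Y) ◁ (W.tl Y f ▷ 𝐞 (W.assoc4 U V X Y).symm) := rfl

theorem TL2_γ (U V Y : W.C.Obj) : W.TL2 Y (W.γ U V) = 0 := by
  rw [TL2_def, W.tl_γ]; simp

theorem TL3_c00 {U'' V'' X'' : W.C.Obj} (Y : W.C.Obj)
    (f : W.C.H0 (U' ⋆ (V' ⋆ X')) (U'' ⋆ (V'' ⋆ X'')))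
    (g : W.C.H0 (U ⋆ (V ⋆ X)) (U' ⋆ (V' ⋆ X'))) :
    W.TL3 Y (f ⬝ g) = W.TL3 Y f ▷ W.RR0 Y g + W.RR0 Y f ◁ W.TL3 Y g := by
  simp only [TL3_def, RR0_def, W.tl_c00, map_add, LinearMap.add_apply, W.C.assoc100, W.C.assoc010,
    W.C.assoc001, idOfEq_symm_c00, idOfEq_symm_c01]

theorem TL3_l0 (U Y : W.C.Obj) (f : W.C.H0 (V ⋆ X) (V' ⋆ X')) :
    W.TL3 Y (W.l0 U f) = W.l1 U (W.TL2 Y f) := by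
  have := W.tl_l0 U Y f
  have h := congrArg (fun q => W.l0 U (W.ac V' X' Y) ◁ (q ▷ 𝐞 (W.assoc4 U V X Y).symm)) this
  simp only [W.C.assoc010, W.C.assoc100, l0_idOfEq, idOfEq_idOfEq_c01, idOfEq_idOfEq] at h
  rw [TL3_def, h, TL2_def, W.l1_c01, W.l1_c10, l0_idOfEq, l0_idOfEq]

/-- This is `tl_r0` brought to products bracketed to the right. The rebracketings inside the
argument of t contribute no homotopies because t vanishes on identities, so the whole proof consists
of matching brackets. -/
theorem TL3_R0 (X Y : W.C.Obj) (f : W.C.H0 (U ⋆ V) (U' ⋆ V')) :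
    W.TL3 Y (W.R0 X f) = W.l0 U' (W.l0 V' (W.γ Y X)) ◁
      (W.RR1 X (W.TL2 Y f) ▷ W.l0 U (W.l0 V (W.γ X Y))) := by
  have h0 : W.ac' U V (Y ⋆ X) ⬝ W.l0 U (W.l0 V (W.γ X Y)) =
      W.l0 (U ⋆ V) (W.γ X Y) ⬝ W.ac' U V (X ⋆ Y) := by
    have := congrArg (fun k => W.ac' U V (Y ⋆ X) ⬝ (k ⬝ W.ac' U V (X ⋆ Y))) (W.ac_l0 U V (W.γ X Y))
    simpa only [W.C.assoc000, idOfEq_symm_c00, idOfEq_idOfEq, idOfEq_self, W.C.c00_one]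
      using this.symm
  have h1 : W.RR1 X (W.TL2 Y f) =
      W.ac U' V' (Y ⋆ X) ◁ (W.R1 X (W.tl Y f) ▷ W.ac' U V (Y ⋆ X)) := by
    rw [← W.C.assoc010, ac_R1, W.C.assoc100, idOfEq_idOfEq, idOfEq_self, W.C.c10_one]
    rfl
  rw [h1, W.C.assoc010, W.C.assoc100, h0, ← W.C.assoc001, ← ac_l0, W.C.assoc001,
    ← W.C.assoc100]
  have h2 := congrArg (fun q => q ▷ W.ac' (U ⋆ V) X Y) (W.tl_r0 X Y f)
  simp only [W.C.assoc010, W.C.assoc100, idOfEq_idOfEq, idOfEq_self, W.C.assoc000,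
    W.C.c00_one] at h2
  simp only [R1_def, W.C.assoc010, W.C.assoc100]
  rw [TL3_def, R0_def, W.tl_c00, W.tl_c00, tl_idOfEq, tl_idOfEq]
  simp only [map_zero, LinearMap.zero_apply, zero_add, add_zero, r0_idOfEq, W.C.assoc010,
    W.C.assoc100, idOfEq_idOfEq, idOfEq_idOfEq_c01]
  have h3 := congrArg (fun q => W.ac U' V' (X ⋆ Y) ◁ (q ▷ W.ac' U V (X ⋆ Y))) h2
  simpa only [W.C.assoc010, W.C.assoc100, W.C.assoc000, idOfEq_idOfEq, idOfEq_idOfEq_c01] using h3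

theorem TL3_ac (Y : W.C.Obj) (f : W.C.H0 (U ⋆ V ⋆ X) (U' ⋆ V' ⋆ X')) :
    W.TL3 Y (W.ac U' V' X' ⬝ (f ⬝ W.ac' U V X)) =
      W.ac U' V' (X' ⋆ Y) ◁ (W.TL2 Y f ▷ W.ac' U V (X ⋆ Y)) := by
  rw [TL3_def, TL2_def, W.tl_c00, W.tl_c00, tl_idOfEq, tl_idOfEq]
  simp only [map_zero, LinearMap.zero_apply, zero_add, add_zero, r0_idOfEq, W.C.assoc010,
    W.C.assoc100, idOfEq_idOfEq, idOfEq_idOfEq_c01]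

/-- In `tl_o` the second term moves X past the argument Z. By `swap_outer_hty` it may instead be
moved past Y, which gives the shape of the homotopy on the first, second and fourth factor. -/
theorem tl_o_eq (X Y : W.C.Obj) {Z Z' : W.C.Obj} (f : W.C.H0 Z Z') :
    W.tl (X ⋆ Y) f = W.R1 Y (W.tl X f) +
      W.l0 Z' (W.γ Y X) ◁ (W.R1 X (W.tl Y f) ▷ W.l0 Z (W.γ X Y)) := by
  have := congrArg (fun q => q ▷ W.ac' Z X Y) (W.tl_o X Y f)
  simp only [map_add, LinearMap.add_apply, W.C.assoc010, W.C.assoc100, W.C.assoc000,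
    idOfEq_idOfEq, idOfEq_self, W.C.c10_one] at this
  rw [this, swap_outer_hty]
  simp only [R1_def, R0_def, W.C.assoc001]

/-- The counterpart of `tl_o_eq` for t_{1 ⊠ f}: the relation `tr_o` moves V past the argument, and
`swap_outer_hty` turns this into a crossing of U and V. -/
theorem tr_o_eq (U V : W.C.Obj) {Z Z' : W.C.Obj} (f : W.C.H0 Z Z') :
    W.ac U V Z' ◁ (W.tr (U ⋆ V) f ▷ W.ac' U V Z) = W.l1 U (W.tr V f) +
      W.R0 Z' (W.γ V U) ◁ (W.l1 V (W.tr U f) ▷ W.R0 Z (W.γ U V)) := by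
  have := congrArg (fun q => q ▷ W.ac' U V Z) (W.tr_o U V f)
  simp only [map_add, LinearMap.add_apply, W.C.assoc010, W.C.assoc100, W.C.assoc000,
    idOfEq_idOfEq, idOfEq_self, W.C.c10_one, W.C.c00_one] at this
  rw [this, ← swap_outer_hty]
  simp only [R1_def, W.C.assoc010, W.C.assoc100]

theorem tr_R0 (U Y : W.C.Obj) (f : W.C.H0 (V ⋆ X) (V' ⋆ X')) :
    W.tr U (W.R0 Y f) = W.RR1 Y (W.tr U f) := by
  rw [R0_def, W.tr_c00, W.tr_c00, tr_idOfEq, tr_idOfEq]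
  have := congrArg (fun q => W.l0 U (W.ac V' X' Y) ◁ (q ▷ 𝐞 (W.assoc4 U V X Y).symm))
    (W.tr_r0 U Y f)
  simp only [map_zero, LinearMap.zero_apply, zero_add, add_zero, l0_idOfEq, W.C.assoc010,
    W.C.assoc100, idOfEq_idOfEq, idOfEq_idOfEq_c01] at this ⊢
  exact this

theorem tr_l0_eq (U V : W.C.Obj) {Z Z' : W.C.Obj} (f : W.C.H0 Z Z') :
    W.tr U (W.l0 V f) = W.R0 Z' (W.γ V U) ◁ (W.l1 V (W.tr U f) ▷ W.R0 Z (W.γ U V)) := by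
  have := congrArg (fun q => q ▷ W.ac' U V Z) (W.tr_l0 U V f)
  simp only [W.C.assoc010, W.C.assoc100, W.C.assoc000, idOfEq_idOfEq, idOfEq_self,
    W.C.c10_one] at this
  rw [this]
  simp only [R0_def, W.C.assoc001]

theorem tr_l0_γ (U V X Y : W.C.Obj) : W.tr U (W.l0 V (W.γ X Y)) = 0 := by
  rw [tr_l0_eq, W.tr_γ]; simp

/-- The homotopy `a L + b R` on the first, second and fourth factor of `U (V (X Y))`. -/
def LR124 (a b : R) (U V X Y : W.C.Obj) :
    W.C.H1 (U ⋆ (V ⋆ (X ⋆ Y))) (U ⋆ (V ⋆ (X ⋆ Y))) :=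
  W.l0 U (W.l0 V (W.γ Y X)) ◁ (W.RR1 X (W.LR a b U V Y) ▷ W.l0 U (W.l0 V (W.γ X Y)))

/-- The homotopy `a L + b R` on the first, third and fourth factor of `U (V (X Y))`. -/
def LR134 (a b : R) (U V X Y : W.C.Obj) :
    W.C.H1 (U ⋆ (V ⋆ (X ⋆ Y))) (U ⋆ (V ⋆ (X ⋆ Y))) :=
  W.R0 (X ⋆ Y) (W.γ V U) ◁ (W.l1 V (W.LR a b U X Y) ▷ W.R0 (X ⋆ Y) (W.γ U V))

section Split

variable (U V X Y : W.C.Obj)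

theorem LR124_eq (a b : R) : W.LR124 a b U V X Y =
    a • (W.l0 U (W.l0 V (W.γ Y X)) ◁ (W.RR1 X (W.hL U V Y) ▷ W.l0 U (W.l0 V (W.γ X Y)))) +
    b • (W.l0 U (W.l0 V (W.γ Y X)) ◁ (W.RR1 X (W.hR U V Y) ▷ W.l0 U (W.l0 V (W.γ X Y)))) := by
  simp only [LR124, LR, map_add, map_smul, LinearMap.add_apply, LinearMap.smul_apply]

theorem LR134_eq (a b : R) : W.LR134 a b U V X Y =
    a • (W.R0 (X ⋆ Y) (W.γ V U) ◁ (W.l1 V (W.hL U X Y) ▷ W.R0 (X ⋆ Y) (W.γ U V))) +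
    b • (W.R0 (X ⋆ Y) (W.γ V U) ◁ (W.l1 V (W.hR U X Y) ▷ W.R0 (X ⋆ Y) (W.γ U V))) := by
  simp only [LR134, LR, map_add, map_smul, LinearMap.add_apply, LinearMap.smul_apply]

/-- Here begin the six splittings of L and R. If the divided object occurs in the inner t, as for R
here, the splitting comes from the hexagon relation for the components of t and linearity of t_{1 ⊠
f} or t_{f ⊠ 1} in f. If it occurs only in the outer t, as for L here, it is the hexagon relation
for homotopy components, applied to the 1-cell t_{UV}. -/
theorem hL_o_right : W.hL U V (X ⋆ Y) = W.RR1 Y (W.hL U V X) +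
    W.l0 U (W.l0 V (W.γ Y X)) ◁ (W.RR1 X (W.hL U V Y) ▷ W.l0 U (W.l0 V (W.γ X Y))) := by
  rw [hL, tl_o_eq, map_add, LinearMap.add_apply, map_add]
  congr 1
  · rw [← W.C.assoc010, ac_R1, W.C.assoc100, idOfEq_idOfEq, idOfEq_self, W.C.c10_one]
    rfl
  · rw [W.C.assoc010, W.C.assoc100, ← W.C.assoc001, ac_l0, W.C.assoc001,
      ← W.C.assoc010 (W.ac _ _ _),
      ac_R1, W.C.assoc100, ← W.C.assoc000, ac_l0, W.C.assoc000, idOfEq_idOfEq, idOfEq_self,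
      W.C.c00_one]
    rfl

/-- The map sending f to t_{1 ⊠ f} is a derivation and vanishes on the crossings by total symmetry,
so conjugation by crossings passes through it. In `TL3_t13` the same holds for t_{f ⊠ 1}. -/
theorem tr_t13 : W.tr U (W.t13 V X Y) =
    W.l0 U (W.l0 V (W.γ Y X)) ◁ (W.RR1 X (W.hR U V Y) ▷ W.l0 U (W.l0 V (W.γ X Y))) := by
  rw [t13_eq, W.tr_c00, W.tr_c00, tr_l0_γ, tr_l0_γ, tr_R0]
  simp only [map_zero, LinearMap.zero_apply, zero_add, add_zero]
  rfl

theorem hR_o_right : W.hR U V (X ⋆ Y) = W.RR1 Y (W.hR U V X) +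
    W.l0 U (W.l0 V (W.γ Y X)) ◁ (W.RR1 X (W.hR U V Y) ▷ W.l0 U (W.l0 V (W.γ X Y))) := by
  rw [hR, ta_left_eq, map_add, tr_t13, tr_R0]
  rfl

theorem TL3_t13 : W.TL3 Y (W.t13 U V X) =
    W.R0 (X ⋆ Y) (W.γ V U) ◁ (W.l1 V (W.hL U X Y) ▷ W.R0 (X ⋆ Y) (W.γ U V)) := by
  have h : ∀ U V : W.C.Obj, W.TL3 Y (W.R0 X (W.γ U V)) = 0 := fun U V => by
    rw [TL3_R0, TL2_γ]
    simp
  rw [t13, TL3_c00, TL3_c00, TL3_l0, h, h, RR0_R0, RR0_R0]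
  simp only [map_zero, LinearMap.zero_apply, zero_add, add_zero]
  rfl

theorem hL_o_middle : W.l0 U (W.ac V X Y) ◁ W.hL U (V ⋆ X) Y =
    (W.l0 U (W.l0 V (W.γ Y X)) ◁ (W.RR1 X (W.hL U V Y) ▷ W.l0 U (W.l0 V (W.γ X Y))) +
    W.R0 (X ⋆ Y) (W.γ V U) ◁ (W.l1 V (W.hL U X Y) ▷ W.R0 (X ⋆ Y) (W.γ U V))) ▷
      W.l0 U (W.ac V X Y) := by
  have h : W.TL3 Y (W.ta U (V ⋆ X)) ▷ W.l0 U (W.ac V X Y) =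
      W.l0 U (W.ac V X Y) ◁ W.hL U (V ⋆ X) Y := by
    simp only [TL3_def, hL, W.C.assoc010, W.C.assoc100, l0_idOfEq, idOfEq_idOfEq,
      idOfEq_idOfEq_c01]
  rw [← h, ta_left_eq, map_add, TL3_t13, TL3_R0]
  rfl

theorem hR_o_middle : W.l0 U (W.ac V X Y) ◁ W.hR U (V ⋆ X) Y =
    (W.l0 U (W.l0 V (W.γ Y X)) ◁ (W.RR1 X (W.hR U V Y) ▷ W.l0 U (W.l0 V (W.γ X Y))) +
    W.R0 (X ⋆ Y) (W.γ V U) ◁ (W.l1 V (W.hR U X Y) ▷ W.R0 (X ⋆ Y) (W.γ U V))) ▷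
      W.l0 U (W.ac V X Y) := by
  have h : W.tr U (W.ac V X Y ⬝ (W.ta (V ⋆ X) Y ⬝ W.ac' V X Y)) ▷ W.l0 U (W.ac V X Y) =
      W.l0 U (W.ac V X Y) ◁ W.hR U (V ⋆ X) Y := by
    rw [W.tr_c00, W.tr_c00, tr_idOfEq, tr_idOfEq]
    simp only [map_zero, LinearMap.zero_apply, zero_add, add_zero, hR, W.C.assoc010, W.C.assoc100,
      l0_idOfEq, idOfEq_idOfEq, idOfEq_self, W.C.c10_one]
  rw [← h, ta_right_eq, map_add, tr_t13, tr_l0_eq, add_comm]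
  rfl

theorem hL_o_left : W.ac U V (X ⋆ Y) ◁ W.hL (U ⋆ V) X Y =
    (W.R0 (X ⋆ Y) (W.γ V U) ◁ (W.l1 V (W.hL U X Y) ▷ W.R0 (X ⋆ Y) (W.γ U V)) +
      W.l1 U (W.hL V X Y)) ▷ W.ac U V (X ⋆ Y) := by
  have h : W.TL3 Y (W.ac U V X ⬝ (W.ta (U ⋆ V) X ⬝ W.ac' U V X)) ▷ W.ac U V (X ⋆ Y) =
      W.ac U V (X ⋆ Y) ◁ W.hL (U ⋆ V) X Y := by
    rw [TL3_ac, W.C.assoc010, W.C.assoc100, idOfEq_idOfEq, idOfEq_self, W.C.c10_one]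
    rfl
  rw [← h, ta_right_eq, map_add, TL3_t13, TL3_l0, add_comm]
  rfl

theorem hR_o_left : W.ac U V (X ⋆ Y) ◁ W.hR (U ⋆ V) X Y =
    (W.R0 (X ⋆ Y) (W.γ V U) ◁ (W.l1 V (W.hR U X Y) ▷ W.R0 (X ⋆ Y) (W.γ U V)) +
      W.l1 U (W.hR V X Y)) ▷ W.ac U V (X ⋆ Y) := by
  have h := congrArg (fun q => q ▷ W.ac U V (X ⋆ Y)) (W.tr_o_eq U V (W.ta X Y))
  simp only [W.C.assoc010, W.C.assoc100, idOfEq_idOfEq, idOfEq_self, W.C.c10_one] at h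
  rw [hR, h, add_comm]
  rfl

variable (a b : R)

/-- With the two lemmas that follow: on four factors, aL + bR behaves as a quantity attached to
triples of factors, and doubling up one argument gives the sum over two of the triples 123, 124,
134, 234. The coefficients play no role here; their values are forced only by the hexagons. -/
theorem LR_o_right : W.LR a b U V (X ⋆ Y) = W.RR1 Y (W.LR a b U V X) + W.LR124 a b U V X Y := by
  rw [LR124_eq, LR, hL_o_right, hR_o_right, LR, map_add, map_smul, map_smul]
  module

theorem LR_o_middle : W.l0 U (W.ac V X Y) ◁ W.LR a b U (V ⋆ X) Y =
    (W.LR124 a b U V X Y + W.LR134 a b U V X Y) ▷ W.l0 U (W.ac V X Y) := by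
  simp only [LR124_eq, LR134_eq, LR, map_add, map_smul, LinearMap.add_apply, LinearMap.smul_apply,
    hL_o_middle, hR_o_middle]
  module

theorem LR_o_left : W.ac U V (X ⋆ Y) ◁ W.LR a b (U ⋆ V) X Y =
    (W.LR134 a b U V X Y + W.l1 U (W.LR a b V X Y)) ▷ W.ac U V (X ⋆ Y) := by
  simp only [LR134_eq, LR, map_add, map_smul, LinearMap.add_apply, LinearMap.smul_apply,
    hL_o_left, hR_o_left]
  module

end Split

end Homotopies

end WhiskMon

end

/-! ### The tetrahedra and the hexahedron over the undeformed structure -/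

section

namespace WhiskMon

variable {R : Type u} [CommRing R] (W : WhiskMon.{u, v, w} R)

local notation "𝐢" => CochCat.one (WhiskMon.C W)
local notation "𝐞" => CochCat.idOfEq (WhiskMon.C W)
local notation:80 f:81 " ⬝ " g:80 => CochCat.c00 (WhiskMon.C W) f g
local notation:80 f:81 " ◁ " q:80 => CochCat.c01 (WhiskMon.C W) f q
local notation:80 q:81 " ▷ " f:80 => CochCat.c10 (WhiskMon.C W) q f
local notation:90 U:90 " ⋆ " V:91 => WhiskMon.o W U V

section Polyhedra

variable {U V X U' V' X' : W.C.Obj}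

theorem idOfEq_r1 (Y : W.C.Obj) (q : W.C.H1 (U ⋆ (V ⋆ X)) (U' ⋆ (V' ⋆ X'))) :
    𝐞 (W.assoc4 U' V' X' Y) ◁ W.r1 Y q = W.RR1 Y q ▷ 𝐞 (W.assoc4 U V X Y) := by
  simp only [RR1_def, W.C.assoc010, W.C.assoc100, idOfEq_idOfEq, idOfEq_self, W.C.c10_one]

theorem r1_idOfEq (Y : W.C.Obj) (q : W.C.H1 (U ⋆ (V ⋆ X)) (U' ⋆ (V' ⋆ X'))) :
    W.r1 Y q ▷ 𝐞 (W.assoc4 U V X Y).symm = 𝐞 (W.assoc4 U' V' X' Y).symm ◁ W.RR1 Y q := by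
  simp only [RR1_def, idOfEq_symm_c01]

theorem idOfEq_r0 (Y : W.C.Obj) (f : W.C.H0 (U ⋆ (V ⋆ X)) (U' ⋆ (V' ⋆ X'))) :
    𝐞 (W.assoc4 U' V' X' Y) ⬝ W.r0 Y f = W.RR0 Y f ⬝ 𝐞 (W.assoc4 U V X Y) := by
  simp only [RR0_def, W.C.assoc000, idOfEq_idOfEq, idOfEq_self, W.C.c00_one]

theorem r0_idOfEq_symm (Y : W.C.Obj) (f : W.C.H0 (U ⋆ (V ⋆ X)) (U' ⋆ (V' ⋆ X'))) :
    W.r0 Y f ⬝ 𝐞 (W.assoc4 U V X Y).symm = 𝐞 (W.assoc4 U' V' X' Y).symm ⬝ W.RR0 Y f := by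
  simp only [RR0_def, idOfEq_symm_c00]

theorem l0_ac_ac (U V X Y : W.C.Obj) :
    W.l0 U (W.ac V X Y) ⬝ W.ac U (V ⋆ X) Y = 𝐞 (W.assoc4 U V X Y) := by
  rw [l0_idOfEq, idOfEq_idOfEq]

theorem ac'_l0_ac' (U V X Y : W.C.Obj) :
    W.ac' U (V ⋆ X) Y ⬝ W.l0 U (W.ac' V X Y) = 𝐞 (W.assoc4 U V X Y).symm := by
  rw [l0_idOfEq, idOfEq_idOfEq]

theorem ac_ac (U V X Y : W.C.Obj) :
    W.ac U V (X ⋆ Y) ⬝ W.ac (U ⋆ V) X Y = 𝐞 (W.assoc4 U V X Y) ⬝ W.r0 Y (W.ac U V X) := by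
  rw [r0_idOfEq, idOfEq_idOfEq, idOfEq_idOfEq]

theorem idOfEq_r0_r0 (X Y : W.C.Obj) (f : W.C.H0 (U ⋆ V) (U' ⋆ V')) :
    (𝐞 (W.assoc4 U' V' X Y) ⬝ W.r0 Y (W.ac U' V' X)) ⬝ W.r0 Y (W.r0 X f) =
      W.R0 (X ⋆ Y) f ⬝ (𝐞 (W.assoc4 U V X Y) ⬝ W.r0 Y (W.ac U V X)) := by
  rw [W.C.assoc000, ← W.r0_c00, ac_r0, W.r0_c00, ← W.C.assoc000, idOfEq_r0, RR0_R0, W.C.assoc000]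

theorem r0_r0_idOfEq (X Y : W.C.Obj) (f : W.C.H0 (U ⋆ V) (U' ⋆ V')) :
    W.r0 Y (W.r0 X f) ⬝ (W.r0 Y (W.ac' U V X) ⬝ 𝐞 (W.assoc4 U V X Y).symm) =
      W.r0 Y (W.ac' U' V' X) ⬝ (𝐞 (W.assoc4 U' V' X Y).symm ⬝ W.R0 (X ⋆ Y) f) := by
  rw [← W.C.assoc000, ← W.r0_c00, r0_ac', W.r0_c00, W.C.assoc000, r0_idOfEq_symm, RR0_R0]

section Braids

variable (U V X Y : W.C.Obj)

/-- The braiding `γ_{U(VXY)}`, between products bracketed to the right. -/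
def γL3 : W.C.H0 (U ⋆ (V ⋆ (X ⋆ Y))) (V ⋆ (X ⋆ (Y ⋆ U))) :=
  W.l0 V (W.ac X Y U) ⬝ W.γL U V (X ⋆ Y)

/-- The braiding `γ_{(UVX)Y}`, between products bracketed to the right. -/
def γR3 : W.C.H0 (U ⋆ (V ⋆ (X ⋆ Y))) (Y ⋆ (U ⋆ (V ⋆ X))) :=
  W.γR U (V ⋆ X) Y ⬝ W.l0 U (W.ac' V X Y)

/-- The braiding `γ_{(UV)(XY)}`, between products bracketed to the right. -/
def γM : W.C.H0 (U ⋆ (V ⋆ (X ⋆ Y))) (X ⋆ (Y ⋆ (U ⋆ V))) :=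
  W.ac X Y (U ⋆ V) ⬝ W.γR U V (X ⋆ Y)

theorem γL3_eq : W.γL3 U V X Y = W.l0 V (W.γL U X Y) ⬝ W.R0 (X ⋆ Y) (W.γ U V) := by
  rw [γL3, γL_eq, γL, W.l0_c00, W.C.assoc000]

/-- The braiding of U past V, X, Y may be cut before or after X. The cut of `γL3_eq` suits the
hexagonator 1 ⊗ H on U, X, Y, which comes after the crossing with V; this one suits H ⊗ 1 on U, V,
X, which comes before the crossing with Y. -/
theorem γL3_eq' : W.γL3 U V X Y = W.l0 V (W.l0 X (W.γ U Y)) ⬝ W.RR0 Y (W.γL U V X) := by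
  rw [γL3_eq, γL_eq, γL_eq, RR0_c00, RR0_l0, RR0_R0, W.l0_c00, W.C.assoc000]

theorem γL3_γ : W.γL3 V U X Y ⬝ W.R0 (X ⋆ Y) (W.γ U V) = W.l0 U (W.γL V X Y) := by
  rw [γL3_eq, W.C.assoc000, R0_γ_γ, W.C.c00_one]

theorem γL3_l0_ac : W.ac V X (Y ⋆ U) ⬝ W.γL U (V ⋆ X) Y =
    W.γL3 U V X Y ⬝ W.l0 U (W.ac V X Y) := by
  rw [γL3, γL, γL, W.C.assoc000, W.C.assoc000, W.γ_l0, r0_idOfEq, l0_idOfEq]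
  simp only [idOfEq_idOfEq_c00]

theorem γR3_eq : W.γR3 U V X Y = W.R0 (V ⋆ X) (W.γ U Y) ⬝ W.l0 U (W.γR V X Y) := by
  rw [γR3, γR_eq, γR, W.l0_c00, W.C.assoc000]

theorem γR3_ac : W.γR (U ⋆ V) X Y ⬝ W.ac' U V (X ⋆ Y) =
    W.l0 Y (W.ac' U V X) ⬝ W.γR3 U V X Y := by
  rw [γR3, γR, γR, W.C.assoc000, ← W.C.assoc000 (W.l0 _ _), ← W.C.assoc000 (W.l0 _ _), ← W.γ_r0,
    r0_idOfEq, l0_idOfEq]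
  simp only [W.C.assoc000, idOfEq_idOfEq]

/-- Since γ is an involution, a crossing past U and V alone factors through a crossing past U, V and
X. For the latter, naturality with respect to homotopies on U(VX) is available as `γR3_RR1`. -/
theorem RR0_γR : W.RR0 X (W.γR U V Y) = W.γR3 U V X Y ⬝ W.l0 U (W.l0 V (W.γ Y X)) := by
  rw [γR3_eq, γR_eq, γR_eq, RR0_c00, RR0_R0, RR0_l0, W.C.assoc000, ← W.l0_c00, W.C.assoc000,
    l0_γ_γ, W.C.c00_one]

theorem γM_eq : W.γM U V X Y = W.l0 X (W.γR U V Y) ⬝ W.RR0 Y (W.γR U V X) := by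
  have h : W.γM U V X Y = W.γL (U ⋆ V) X Y ⬝ W.ac' U V (X ⋆ Y) := by
    rw [γM, γL, γR, W.C.assoc000]
  rw [h, γL_eq]
  simp only [R0_def, RR0_def, γR, W.r0_c00, W.l0_c00, l0_idOfEq, r0_idOfEq, W.C.assoc000,
    idOfEq_idOfEq, idOfEq_idOfEq_c00]

/-- The braiding of UV past XY can be divided along XY, as in `γM_eq`, or along UV, as here. In the
hexahedron the right hexagonators use the first division and the left hexagonators the second. -/
theorem γM_eq' : W.γM U V X Y = W.RR0 V (W.γL U X Y) ⬝ W.l0 U (W.γL V X Y) := by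
  rw [γM, γR_eq]
  simp only [R0_def, RR0_def, γL, W.r0_c00, W.l0_c00, l0_idOfEq, r0_idOfEq, W.C.assoc000,
    idOfEq_idOfEq_c00]

theorem γL3_l1 (q : W.C.H1 (V ⋆ (X ⋆ Y)) (V ⋆ (X ⋆ Y))) :
    W.γL3 U V X Y ◁ W.l1 U q = W.RR1 U q ▷ W.γL3 U V X Y := by
  have : W.γL3 U V X Y = 𝐞 (W.assoc4 V X Y U) ⬝ W.γ U (V ⋆ (X ⋆ Y)) := by
    rw [γL3, γL, ← W.C.assoc000, l0_ac_ac]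
  rw [this, W.C.assoc001, W.γ_l1, ← W.C.assoc010, idOfEq_r1, W.C.assoc100]

theorem γR3_RR1 (q : W.C.H1 (U ⋆ (V ⋆ X)) (U ⋆ (V ⋆ X))) :
    W.γR3 U V X Y ◁ W.RR1 Y q = W.l1 Y q ▷ W.γR3 U V X Y := by
  have : W.γR3 U V X Y = W.γ (U ⋆ (V ⋆ X)) Y ⬝ 𝐞 (W.assoc4 U V X Y).symm := by
    rw [γR3, γR, W.C.assoc000, ac'_l0_ac']
  rw [this, W.C.assoc001, ← r1_idOfEq, ← W.C.assoc010, W.γ_r1, W.C.assoc100]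

end Braids

variable (U V X) (Y : W.C.Obj)

theorem LR_o_left' (a b : R) : W.LR a b (U ⋆ V) X Y ▷ W.ac' U V (X ⋆ Y) =
    W.ac' U V (X ⋆ Y) ◁ (W.LR134 a b U V X Y + W.l1 U (W.LR a b V X Y)) := by
  have := congrArg (fun q => W.ac' U V (X ⋆ Y) ◁ (q ▷ W.ac' U V (X ⋆ Y))) (W.LR_o_left U V X Y a b)
  simpa only [W.C.assoc010, W.C.assoc100, idOfEq_symm_c01, idOfEq_idOfEq, idOfEq_self, W.C.c10_one]
    using this

theorem LR_o_middle' (a b : R) : W.LR a b U (V ⋆ X) Y ▷ W.l0 U (W.ac' V X Y) =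
    W.l0 U (W.ac' V X Y) ◁ (W.LR124 a b U V X Y + W.LR134 a b U V X Y) := by
  have := congrArg (fun q => W.l0 U (W.ac' V X Y) ◁ (q ▷ W.l0 U (W.ac' V X Y)))
    (W.LR_o_middle U V X Y a b)
  simpa only [l0_idOfEq, W.C.assoc010, W.C.assoc100, idOfEq_symm_c01, idOfEq_idOfEq, idOfEq_self,
    W.C.c10_one] using this

/-- Each term is the total braiding of U past V, X, Y, applied to a sum of homotopies 2L + R on
triples and preceded by one and the same rebracketing. In terms of triples the claim reads 123 + 124
= (124 + 134) + 123 - 134. -/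
theorem infHexL_left_tetrahedron :
    W.l0 V (W.ac X Y U) ◁ (W.infHexL U V (X ⋆ Y) ▷ W.ac (U ⋆ V) X Y) =
    W.ac V X (Y ⋆ U) ◁ (W.infHexL U (V ⋆ X) Y ▷ W.r0 Y (W.ac U V X)) +
    (W.l0 V (W.l0 X (W.γ U Y) ⬝ W.ac X U Y) ⬝ W.ac V (X ⋆ U) Y) ◁ W.r1 Y (W.infHexL U V X) -
    W.l1 V (W.infHexL U X Y) ▷ (W.ac V (U ⋆ X) Y ⬝ W.r0 Y (W.ac V U X ⬝ W.r0 X (W.γ U V))) := by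
  have h1 : W.l0 V (W.ac X Y U) ◁ (W.infHexL U V (X ⋆ Y) ▷ W.ac (U ⋆ V) X Y) =
      (W.γL3 U V X Y ◁ (W.RR1 Y (W.LR 2 1 U V X) + W.LR124 2 1 U V X Y)) ▷
        (𝐞 (W.assoc4 U V X Y) ⬝ W.r0 Y (W.ac U V X)) := by
    rw [infHexL_eq, W.C.assoc100, ac_ac, ← W.C.assoc010, ← W.C.assoc001, LR_o_right, γL3]
  have h2 : W.ac V X (Y ⋆ U) ◁ (W.infHexL U (V ⋆ X) Y ▷ W.r0 Y (W.ac U V X)) =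
      (W.γL3 U V X Y ◁ (W.LR124 2 1 U V X Y + W.LR134 2 1 U V X Y)) ▷
        (𝐞 (W.assoc4 U V X Y) ⬝ W.r0 Y (W.ac U V X)) := by
    rw [infHexL_eq, ← W.C.assoc010, ← W.C.assoc010, ← W.C.assoc001, γL3_l0_ac, W.C.assoc001,
      LR_o_middle, W.C.assoc100, ← W.C.assoc010, W.C.assoc100, ← W.C.assoc000, l0_ac_ac]
  have h3 : (W.l0 V (W.l0 X (W.γ U Y) ⬝ W.ac X U Y) ⬝ W.ac V (X ⋆ U) Y) ◁
      W.r1 Y (W.infHexL U V X) = (W.γL3 U V X Y ◁ W.RR1 Y (W.LR 2 1 U V X)) ▷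
        (𝐞 (W.assoc4 U V X Y) ⬝ W.r0 Y (W.ac U V X)) := by
    rw [infHexL_eq, W.r1_c10, W.l0_c00, W.C.assoc000, l0_ac_ac, W.C.assoc001, ← W.C.assoc010 (𝐞 _),
      idOfEq_r1, W.C.assoc100, RR1_c01, ← W.C.assoc010, ← W.C.assoc001, ← γL3_eq']
  have h4 : W.l1 V (W.infHexL U X Y) ▷
      (W.ac V (U ⋆ X) Y ⬝ W.r0 Y (W.ac V U X ⬝ W.r0 X (W.γ U V))) =
      (W.γL3 U V X Y ◁ W.LR134 2 1 U V X Y) ▷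
        (𝐞 (W.assoc4 U V X Y) ⬝ W.r0 Y (W.ac U V X)) := by
    rw [infHexL_eq, W.l1_c10, W.l1_c01, W.C.assoc100, ← W.C.assoc000, l0_ac_ac, W.r0_c00,
      ← W.C.assoc000, idOfEq_r0_r0, ← W.C.assoc100, LR134, ← W.C.assoc001, γL3_eq, W.C.assoc000,
      R0_γ_γ, W.C.c00_one, W.C.assoc010]
  rw [h1, h2, h3, h4]
  simp only [map_add, LinearMap.add_apply]
  abel

/-- As for the left tetrahedron, with L + 2R, the total braiding of UVX past Y, and a common
rebracketing on the left. In terms of triples the claim reads 134 + 234 = (124 + 134) + 234 - 124.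
-/
theorem infHexR_right_tetrahedron :
    W.r0 X (W.ac' Y U V) ◁ (W.infHexR (U ⋆ V) X Y ▷ W.ac' U V (X ⋆ Y)) =
    W.ac' (Y ⋆ U) V X ◁ (W.infHexR U (V ⋆ X) Y ▷ W.l0 U (W.ac' V X Y)) +
    (W.r0 X (W.r0 V (W.γ U Y) ⬝ W.ac' U Y V) ⬝ W.ac' U (Y ⋆ V) X) ◁ W.l1 U (W.infHexR V X Y) -
    W.r1 X (W.infHexR U V Y) ▷ (W.ac' U (V ⋆ Y) X ⬝
      W.l0 U (W.ac' V Y X ⬝ W.l0 V (W.γ X Y))) := by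
  have h1 : W.r0 X (W.ac' Y U V) ◁ (W.infHexR (U ⋆ V) X Y ▷ W.ac' U V (X ⋆ Y)) =
      (W.r0 X (W.ac' Y U V) ⬝ 𝐞 (W.assoc4 Y U V X).symm) ◁
        (W.γR3 U V X Y ◁ (W.LR134 1 2 U V X Y + W.l1 U (W.LR 1 2 V X Y))) := by
    rw [infHexR_eq, W.C.assoc010, W.C.assoc010, LR_o_left', ← W.C.assoc001 (W.γR _ _ _), γR3_ac,
      W.C.assoc001, W.C.assoc001, ← ac'_l0_ac', W.C.assoc001]
  have h2 : W.ac' (Y ⋆ U) V X ◁ (W.infHexR U (V ⋆ X) Y ▷ W.l0 U (W.ac' V X Y)) =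
      (W.r0 X (W.ac' Y U V) ⬝ 𝐞 (W.assoc4 Y U V X).symm) ◁
        (W.γR3 U V X Y ◁ (W.LR124 1 2 U V X Y + W.LR134 1 2 U V X Y)) := by
    rw [infHexR_eq, W.C.assoc010, W.C.assoc010, LR_o_middle', ← W.C.assoc001 (W.γR _ _ _), ← γR3,
      r0_idOfEq, idOfEq_idOfEq, idOfEq_idOfEq_c01]
  have h3 : (W.r0 X (W.r0 V (W.γ U Y) ⬝ W.ac' U Y V) ⬝ W.ac' U (Y ⋆ V) X) ◁
      W.l1 U (W.infHexR V X Y) =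
      (W.r0 X (W.ac' Y U V) ⬝ 𝐞 (W.assoc4 Y U V X).symm) ◁
        (W.γR3 U V X Y ◁ W.l1 U (W.LR 1 2 V X Y)) := by
    have h : W.r0 X (W.r0 V (W.γ U Y) ⬝ W.ac' U Y V) ⬝ (W.ac' U (Y ⋆ V) X ⬝ W.l0 U (W.ac' Y V X)) =
        (W.r0 X (W.ac' Y U V) ⬝ 𝐞 (W.assoc4 Y U V X).symm) ⬝ W.R0 (V ⋆ X) (W.γ U Y) := by
      rw [ac'_l0_ac', W.r0_c00, W.C.assoc000, r0_r0_idOfEq, W.C.assoc000]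
    rw [infHexR_eq, W.l1_c01, ← W.C.assoc001, W.C.assoc000, h, W.l1_c01, W.C.assoc001,
      ← W.C.assoc001 (W.R0 _ _), ← γR3_eq]
  have h4 : W.r1 X (W.infHexR U V Y) ▷ (W.ac' U (V ⋆ Y) X ⬝
      W.l0 U (W.ac' V Y X ⬝ W.l0 V (W.γ X Y))) =
      (W.r0 X (W.ac' Y U V) ⬝ 𝐞 (W.assoc4 Y U V X).symm) ◁
        (W.γR3 U V X Y ◁ W.LR124 1 2 U V X Y) := by
    rw [infHexR_eq, W.r1_c01, W.l0_c00, ← W.C.assoc000, ac'_l0_ac', W.C.assoc010, ← W.C.assoc100,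
      r1_idOfEq, W.C.assoc010, RR1_c01, W.C.assoc001, LR124, ← W.C.assoc001 (W.γR3 _ _ _ _),
      ← RR0_γR, ← W.C.assoc010 (W.RR0 _ _)]
  rw [h1, h2, h3, h4]
  simp only [map_add]
  abel

/-- All terms are brought to the total braiding of UV past XY. Both sides then consist of L + 2R on
the triples 123 and 124, minus 2L + R on the triples 134 and 234. -/
theorem infHex_hexahedron :
    (W.ac X (Y ⋆ U) V ⬝ W.r0 V (W.ac X Y U)) ◁
        (W.infHexR U V (X ⋆ Y) ▷ (W.l0 U (W.ac V X Y) ⬝ W.ac U (V ⋆ X) Y)) -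
      W.l0 X (W.ac' Y U V) ◁ (W.infHexL (U ⋆ V) X Y ▷ W.r0 Y (W.ac' U V X)) =
    (W.l1 X (W.infHexR U V Y) ▷ (W.ac X U (V ⋆ Y) ⬝ W.ac (X ⋆ U) V Y)) ▷
        W.r0 Y (W.ac' X U V ⬝ W.γ (U ⋆ V) X ⬝ W.ac' U V X) +
      (W.l0 X (W.r0 V (W.γ U Y) ⬝ W.ac' U Y V ⬝ W.l0 U (W.γ V Y)) ⬝ W.ac X U (V ⋆ Y)) ◁
        (W.ac (X ⋆ U) V Y ◁ W.r1 Y (W.infHexR U V X)) -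
      W.ac X (Y ⋆ U) V ◁ (W.r1 V (W.infHexL U X Y) ▷ (W.ac' (U ⋆ X) Y V ⬝ W.ac' U X (Y ⋆ V) ⬝
        W.l0 U (W.l0 X (W.γ V Y) ⬝ W.ac X V Y ⬝ W.r0 Y (W.γ V X)) ⬝ W.ac U (V ⋆ X) Y)) -
      (W.ac X (Y ⋆ U) V ⬝ W.r0 V (W.ac X Y U ⬝ W.γ U (X ⋆ Y) ⬝ W.ac U X Y) ⬝
        W.ac' (U ⋆ X) Y V ⬝ W.ac' U X (Y ⋆ V)) ◁
        (W.l1 U (W.infHexL V X Y) ▷ W.ac U (V ⋆ X) Y) := by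
  have h1 : (W.ac X (Y ⋆ U) V ⬝ W.r0 V (W.ac X Y U)) ◁
      (W.infHexR U V (X ⋆ Y) ▷ (W.l0 U (W.ac V X Y) ⬝ W.ac U (V ⋆ X) Y)) =
      W.l0 X (W.ac' Y U V) ◁ ((W.γM U V X Y ◁
        (W.RR1 Y (W.LR 1 2 U V X) + W.LR124 1 2 U V X Y)) ▷ 𝐞 (W.assoc4 U V X Y)) := by
    rw [infHexR_eq, l0_ac_ac, LR_o_right, γM]
    simp only [W.C.assoc010, W.C.assoc001, l0_idOfEq, r0_idOfEq, idOfEq_idOfEq_c01]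
  have h2 : W.l0 X (W.ac' Y U V) ◁ (W.infHexL (U ⋆ V) X Y ▷ W.r0 Y (W.ac' U V X)) =
      W.l0 X (W.ac' Y U V) ◁ ((W.γM U V X Y ◁
        (W.LR134 2 1 U V X Y + W.l1 U (W.LR 2 1 V X Y))) ▷ 𝐞 (W.assoc4 U V X Y)) := by
    have h : W.γL (U ⋆ V) X Y = W.γM U V X Y ⬝ W.ac U V (X ⋆ Y) := by
      simp only [γM, γL, γR, W.C.assoc000, idOfEq_idOfEq, idOfEq_self, W.C.c00_one]
    rw [infHexL_eq, h, W.C.assoc001, LR_o_left]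
    simp only [W.C.assoc010, W.C.assoc100, r0_idOfEq, idOfEq_idOfEq]
  have h3 : (W.l1 X (W.infHexR U V Y) ▷ (W.ac X U (V ⋆ Y) ⬝ W.ac (X ⋆ U) V Y)) ▷
      W.r0 Y (W.ac' X U V ⬝ W.γ (U ⋆ V) X ⬝ W.ac' U V X) =
      W.l0 X (W.ac' Y U V) ◁ ((W.γM U V X Y ◁ W.LR124 1 2 U V X Y) ▷ 𝐞 (W.assoc4 U V X Y)) := by
    have h : (W.ac X U (V ⋆ Y) ⬝ W.ac (X ⋆ U) V Y) ⬝
        W.r0 Y (W.ac' X U V ⬝ W.γ (U ⋆ V) X ⬝ W.ac' U V X) =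
        W.RR0 Y (W.γR U V X) ⬝ 𝐞 (W.assoc4 U V X Y) := by
      rw [← idOfEq_r0, ac_ac, W.C.assoc000, ← W.r0_c00, idOfEq_symm_c00, γR]
    -- The hexagonator on U, V, Y sits after X has crossed to the front. Writing this crossing as
    -- γ_{XY} followed by the crossing of UVY with X lets naturality of the latter move the homotopy
    -- to the source, where it is the one on 1, 2, 4.
    have h' : W.l0 X (W.γR U V Y) ⬝ W.γR3 U V Y X =
        W.γM U V X Y ⬝ W.l0 U (W.l0 V (W.γ Y X)) := by
      rw [γM_eq, RR0_γR, W.C.assoc000, W.C.assoc000, ← W.l0_c00, l0_γ_γ, W.l0_one, W.C.c00_one]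
    rw [infHexR_eq, W.C.assoc100, h, W.l1_c01, W.l1_c01, RR0_γR, LR124,
        ← W.C.assoc001 (W.γM _ _ _ _),
      ← h', W.C.assoc001]
    simp only [← W.C.assoc010, γR3_RR1]
    simp only [W.C.assoc100, W.C.assoc010]
  have h4 : (W.l0 X (W.r0 V (W.γ U Y) ⬝ W.ac' U Y V ⬝ W.l0 U (W.γ V Y)) ⬝ W.ac X U (V ⋆ Y)) ◁
      (W.ac (X ⋆ U) V Y ◁ W.r1 Y (W.infHexR U V X)) =
      W.l0 X (W.ac' Y U V) ◁ ((W.γM U V X Y ◁ W.RR1 Y (W.LR 1 2 U V X)) ▷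
        𝐞 (W.assoc4 U V X Y)) := by
    rw [← W.C.assoc000 (W.r0 V _), r0_ac', W.C.assoc000, ← γR_eq, W.l0_c00, ← W.C.assoc001,
      W.C.assoc000, ac_ac, infHexR_eq, W.r1_c01, W.C.assoc000, ← W.C.assoc001, W.C.assoc000,
      W.C.assoc000, W.C.assoc000, ← W.r0_c00, idOfEq_idOfEq, idOfEq_self, W.r0_one, W.C.c00_one,
      γM_eq]
    simp only [W.C.assoc001, idOfEq_r1, RR1_c01, W.C.assoc010]
  have h5 : W.ac X (Y ⋆ U) V ◁ (W.r1 V (W.infHexL U X Y) ▷ (W.ac' (U ⋆ X) Y V ⬝ W.ac' U X (Y ⋆ V) ⬝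
      W.l0 U (W.l0 X (W.γ V Y) ⬝ W.ac X V Y ⬝ W.r0 Y (W.γ V X)) ⬝ W.ac U (V ⋆ X) Y)) =
      W.l0 X (W.ac' Y U V) ◁ ((W.γM U V X Y ◁ W.LR134 2 1 U V X Y) ▷ 𝐞 (W.assoc4 U V X Y)) := by
    have h : W.l0 U (W.l0 X (W.γ V Y) ⬝ W.ac X V Y ⬝ W.r0 Y (W.γ V X)) ⬝ W.ac U (V ⋆ X) Y =
        W.l0 U (W.γL V X Y) ⬝ 𝐞 (W.assoc4 U V X Y) := by
      rw [ac_r0, ← W.C.assoc000 (W.l0 X _), ← γL_eq, W.l0_c00, W.C.assoc000, l0_ac_ac]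
    -- The same device with V: its crossing past XY is γ_{UV} followed by its crossing past UXY, and
    -- naturality of the latter turns the homotopy on U, X, Y into the one on 1, 3, 4.
    have h' : W.RR0 V (W.γL U X Y) ⬝ W.γL3 V U X Y = W.γM U V X Y ⬝ W.R0 (X ⋆ Y) (W.γ V U) := by
      rw [γM_eq', γL3_eq, W.C.assoc000]
    rw [h, infHexL_eq, LR134, ← W.C.assoc001 (W.γM _ _ _ _), ← h', W.C.assoc001]
    simp only [← W.C.assoc010 (W.γL3 _ _ _ _), γL3_l1]
    rw [W.C.assoc100 (W.RR1 _ _), γL3_γ, ← W.C.assoc010 (W.RR0 _ _), ← RR1_c01]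
    simp only [RR1_def, W.r1_c10, W.r1_c01, W.C.assoc100, W.C.assoc010, W.C.assoc000, r0_idOfEq,
      l0_idOfEq, idOfEq_idOfEq_c00, idOfEq_idOfEq_c01]
  have h6 : (W.ac X (Y ⋆ U) V ⬝ W.r0 V (W.ac X Y U ⬝ W.γ U (X ⋆ Y) ⬝ W.ac U X Y) ⬝
      W.ac' (U ⋆ X) Y V ⬝ W.ac' U X (Y ⋆ V)) ◁ (W.l1 U (W.infHexL V X Y) ▷ W.ac U (V ⋆ X) Y) =
      W.l0 X (W.ac' Y U V) ◁ ((W.γM U V X Y ◁ W.l1 U (W.LR 2 1 V X Y)) ▷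
        𝐞 (W.assoc4 U V X Y)) := by
    rw [infHexL_eq, γM_eq', W.l1_c10, W.C.assoc100, l0_ac_ac, W.l1_c01]
    simp only [RR0_def, γL, W.r0_c00, W.C.assoc000, W.C.assoc001, W.C.assoc010, r0_idOfEq,
      l0_idOfEq, idOfEq_idOfEq_c00, idOfEq_idOfEq_c01]
  rw [h1, h2, h3, h4, h5, h6]
  simp only [map_add, LinearMap.add_apply]
  abel

end Polyhedra

end WhiskMon

end

/-! ### Deformed 1-cells in the presence of the factor c -/

section

section SmulCongr

variable {R : Type u} [CommRing R] {c : R}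

/-- The relation c • x = c • x' is a congruence for sums, differences, linear maps and bilinear
maps. Hence, inside an expression multiplied by c, the deformed associators and braidings may be
replaced by undeformed ones. -/
theorem smul_add_congr {M : Type*} [AddCommGroup M] [Module R M] {x x' y y' : M}
    (h : c • x = c • x') (h' : c • y = c • y') : c • (x + y) = c • (x' + y') := by
  rw [smul_add, smul_add, h, h']

theorem smul_sub_congr {M : Type*} [AddCommGroup M] [Module R M] {x x' y y' : M}
    (h : c • x = c • x') (h' : c • y = c • y') : c • (x - y) = c • (x' - y') := by
  rw [smul_sub, smul_sub, h, h']

theorem smul_map_congr {M N : Type*} [AddCommGroup M] [Module R M] [AddCommGroup N] [Module R N]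
    (L : M →ₗ[R] N) {x x' : M} (h : c • x = c • x') : c • L x = c • L x' := by
  rw [← map_smul, h, map_smul]

theorem smul_map₂_congr {M N P : Type*} [AddCommGroup M] [Module R M] [AddCommGroup N] [Module R N]
    [AddCommGroup P] [Module R P] (L : M →ₗ[R] N →ₗ[R] P) {x x' : M} {y y' : N}
    (h : c • x = c • x') (h' : c • y = c • y') : c • L x y = c • L x' y' := by
  rw [← map_smul, h', map_smul, ← LinearMap.smul_apply, ← map_smul, h, map_smul,
    LinearMap.smul_apply]

end SmulCongr

namespace WhiskMon

variable {R : Type u} [CommRing R] (W : WhiskMon.{u, v, w} R)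

local notation "𝐢" => CochCat.one (WhiskMon.C W)
local notation "𝐞" => CochCat.idOfEq (WhiskMon.C W)
local notation:80 f:81 " ⬝ " g:80 => CochCat.c00 (WhiskMon.C W) f g
local notation:80 f:81 " ◁ " q:80 => CochCat.c01 (WhiskMon.C W) f q
local notation:80 q:81 " ▷ " f:80 => CochCat.c10 (WhiskMon.C W) q f
local notation:90 U:90 " ⋆ " V:91 => WhiskMon.o W U V

section Deformed

variable {k c : R} (hk : IsOrderTwo k c) (U V X Y : W.C.Obj)
include hk

theorem smul_α : c • W.α c U V X = c • W.ac U V X := by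
  simp only [α, map_add, map_smul, smul_add, smul_smul, hk.sq, zero_smul, add_zero, W.C.c00_one]

theorem smul_α' : c • W.α' c U V X = c • W.ac' U V X := by
  simp only [α', map_sub, map_smul, LinearMap.sub_apply, LinearMap.smul_apply, smul_sub, smul_smul,
    hk.sq, zero_smul, sub_zero, W.C.one_c00]

theorem smul_σ : c • W.σ k c U V = c • W.γ U V := by
  have h : c * (3 * c) = 0 := by linear_combination 3 * hk.sq
  simp only [σ, map_add, map_smul, smul_add, smul_smul, mul_comm c k, hk.mul, h, zero_smul,
      add_zero,
    W.C.c00_one]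

theorem left_tetrahedron :
    W.l0 V (W.α c X Y U) ◁ ((c • W.infHexL U V (X ⋆ Y)) ▷ W.α c (U ⋆ V) X Y) =
    W.α c V X (Y ⋆ U) ◁ ((c • W.infHexL U (V ⋆ X) Y) ▷ W.r0 Y (W.α c U V X)) +
    (W.l0 V (W.l0 X (W.σ k c U Y) ⬝ W.α c X U Y) ⬝ W.α c V (X ⋆ U) Y) ◁
      W.r1 Y (c • W.infHexL U V X) -
    W.l1 V (c • W.infHexL U X Y) ▷
      (W.α c V (U ⋆ X) Y ⬝ W.r0 Y (W.α c V U X ⬝ W.r0 X (W.σ k c U V))) := by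
  simp only [map_smul, LinearMap.smul_apply, ← smul_add, ← smul_sub]
  -- Both sides are now of the form c • (...). The undeformed identity is inserted in the middle,
  -- and the two comparisons left descend through the expression until they reach `smul_α` or
  -- `smul_σ`.
  refine Eq.trans ?_ ((congrArg (c • ·) (W.infHexL_left_tetrahedron U V X Y)).trans ?_)
  all_goals
    repeat' first
      | rfl
      | exact W.smul_α hk _ _ _
      | exact (W.smul_α hk _ _ _).symm
      | exact W.smul_σ hk _ _
      | exact (W.smul_σ hk _ _).symm
      | apply smul_add_congr
      | apply smul_sub_congr
      | apply smul_map₂_congr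
      | apply smul_map_congr

theorem right_tetrahedron :
    W.r0 X (W.α' c Y U V) ◁ ((c • W.infHexR (U ⋆ V) X Y) ▷ W.α' c U V (X ⋆ Y)) =
    W.α' c (Y ⋆ U) V X ◁ ((c • W.infHexR U (V ⋆ X) Y) ▷ W.l0 U (W.α' c V X Y)) +
    (W.r0 X (W.r0 V (W.σ k c U Y) ⬝ W.α' c U Y V) ⬝ W.α' c U (Y ⋆ V) X) ◁
      W.l1 U (c • W.infHexR V X Y) -
    W.r1 X (c • W.infHexR U V Y) ▷ (W.α' c U (V ⋆ Y) X ⬝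
      W.l0 U (W.α' c V Y X ⬝ W.l0 V (W.σ k c X Y))) := by
  simp only [map_smul, LinearMap.smul_apply, ← smul_add, ← smul_sub]
  refine Eq.trans ?_ ((congrArg (c • ·) (W.infHexR_right_tetrahedron U V X Y)).trans ?_)
  all_goals
    repeat' first
      | rfl
      | exact W.smul_α' hk _ _ _
      | exact (W.smul_α' hk _ _ _).symm
      | exact W.smul_σ hk _ _
      | exact (W.smul_σ hk _ _).symm
      | apply smul_add_congr
      | apply smul_sub_congr
      | apply smul_map₂_congr
      | apply smul_map_congr

theorem hexahedron :
    (W.α c X (Y ⋆ U) V ⬝ W.r0 V (W.α c X Y U)) ◁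
        ((c • W.infHexR U V (X ⋆ Y)) ▷ (W.l0 U (W.α c V X Y) ⬝ W.α c U (V ⋆ X) Y)) -
      W.l0 X (W.α' c Y U V) ◁ ((c • W.infHexL (U ⋆ V) X Y) ▷ W.r0 Y (W.α' c U V X)) =
    (W.l1 X (c • W.infHexR U V Y) ▷ (W.α c X U (V ⋆ Y) ⬝ W.α c (X ⋆ U) V Y)) ▷
        W.r0 Y (W.α' c X U V ⬝ W.σ k c (U ⋆ V) X ⬝ W.α' c U V X) +
      (W.l0 X (W.r0 V (W.σ k c U Y) ⬝ W.α' c U Y V ⬝ W.l0 U (W.σ k c V Y)) ⬝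
        W.α c X U (V ⋆ Y)) ◁ (W.α c (X ⋆ U) V Y ◁ W.r1 Y (c • W.infHexR U V X)) -
      W.α c X (Y ⋆ U) V ◁ (W.r1 V (c • W.infHexL U X Y) ▷
        (W.α' c (U ⋆ X) Y V ⬝ W.α' c U X (Y ⋆ V) ⬝
        W.l0 U (W.l0 X (W.σ k c V Y) ⬝ W.α c X V Y ⬝ W.r0 Y (W.σ k c V X)) ⬝
          W.α c U (V ⋆ X) Y)) -
      (W.α c X (Y ⋆ U) V ⬝ W.r0 V (W.α c X Y U ⬝ W.σ k c U (X ⋆ Y) ⬝ W.α c U X Y) ⬝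
        W.α' c (U ⋆ X) Y V ⬝ W.α' c U X (Y ⋆ V)) ◁
        (W.l1 U (c • W.infHexL V X Y) ▷ W.α c U (V ⋆ X) Y) := by
  simp only [map_smul, LinearMap.smul_apply, ← smul_add, ← smul_sub]
  refine Eq.trans ?_ ((congrArg (c • ·) (W.infHex_hexahedron U V X Y)).trans ?_)
  all_goals
    repeat' first
      | rfl
      | exact W.smul_α hk _ _ _
      | exact (W.smul_α hk _ _ _).symm
      | exact W.smul_α' hk _ _ _
      | exact (W.smul_α' hk _ _ _).symm
      | exact W.smul_σ hk _ _
      | exact (W.smul_σ hk _ _).symm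
      | apply smul_add_congr
      | apply smul_sub_congr
      | apply smul_map₂_congr
      | apply smul_map_congr

/-- Under the factor c the braiding σ becomes γ, and t_{γ ⊠ 1} = 0 by total symmetry. -/
theorem smul_tl_σ : c • W.tl X (W.σ k c U V) = 0 := by
  rw [← map_smul, W.smul_σ hk, map_smul, W.tl_γ, smul_zero]

theorem smul_tr_σ : c • W.tr X (W.σ k c U V) = 0 := by
  rw [← map_smul, W.smul_σ hk, map_smul, W.tr_γ, smul_zero]

/-- The associator is an identity 1-cell plus a multiple of c, so t_{1 ⊠ α} is itself a multiple of
c and is killed by kc = 0 and c² = 0. Both scalars are needed, because the braiding contains k t and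
a multiple of c t². -/
theorem smul_tr_α : k • W.tr Y (W.α c U V X) = 0 ∧ c • W.tr Y (W.α c U V X) = 0 := by
  constructor
  · rw [α, map_add, map_smul, W.C.c00_one, map_add, tr_idOfEq, zero_add, map_smul, smul_smul,
      hk.mul,
      zero_smul]
  · rw [← map_smul, W.smul_α hk, map_smul, tr_idOfEq, smul_zero]

theorem smul_tl_α' : k • W.tl Y (W.α' c U V X) = 0 ∧ c • W.tl Y (W.α' c U V X) = 0 := by
  constructor
  · rw [α', map_sub, map_smul, LinearMap.sub_apply, W.C.one_c00, LinearMap.smul_apply, map_sub,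
      tl_idOfEq, zero_sub, map_smul, smul_neg, smul_smul, hk.mul, zero_smul, neg_zero]
  · rw [← map_smul, W.smul_α' hk, map_smul, tl_idOfEq, smul_zero]

end Deformed

end WhiskMon

end

/-! ### The product as a family of bilinear maps -/

section

namespace CochCat.Func

variable {R : Type u} [CommRing R] {C : CochCat.{u, v, w} R} (T : Func (C.box C) C)

/-- The product `f ⊗ g` of 1-cells, as a bilinear map. -/
def m00 {U U' V V' : C.Obj} : C.H0 U U' →ₗ[R] C.H0 V V' →ₗ[R] C.H0 (T.o U V) (T.o U' V') :=
  TensorProduct.curry (T.map0 (X := (U, V)) (Y := (U', V')))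

/-- The product `q ⊗ g` of a homotopy and a 1-cell, as a bilinear map. -/
def m10 {U U' V V' : C.Obj} : C.H1 U U' →ₗ[R] C.H0 V V' →ₗ[R] C.H1 (T.o U V) (T.o U' V') :=
  TensorProduct.curry (T.map1 (X := (U, V)) (Y := (U', V')) ∘ₗ BoxH1.inl)

/-- The product `f ⊗ p` of a 1-cell and a homotopy, as a bilinear map. -/
def m01 {U U' V V' : C.Obj} : C.H0 U U' →ₗ[R] C.H1 V V' →ₗ[R] C.H1 (T.o U V) (T.o U' V') :=
  TensorProduct.curry (T.map1 (X := (U, V)) (Y := (U', V')) ∘ₗ BoxH1.inr)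

section

variable {U U' U'' V V' V'' : C.Obj}

theorem m00_one (U V : C.Obj) : T.m00 (C.one U) (C.one V) = C.one (T.o U V) := T.map_one (U, V)

theorem m00_c00 (f' : C.H0 U' U'') (f : C.H0 U U') (g' : C.H0 V' V'') (g : C.H0 V V') :
    T.m00 (C.c00 f' f) (C.c00 g' g) = C.c00 (T.m00 f' g') (T.m00 f g) :=
  T.map_c00 (X := (U, V)) (Y := (U', V')) (Z := (U'', V'')) (f' ⊗ₜ g') (f ⊗ₜ g)

theorem m10_c01 (f' : C.H0 U' U'') (q : C.H1 U U') (g' : C.H0 V' V'') (g : C.H0 V V') :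
    T.m10 (C.c01 f' q) (C.c00 g' g) = C.c01 (T.m00 f' g') (T.m10 q g) := by
  have := T.map_c01 (X := (U, V)) (Y := (U', V')) (Z := (U'', V'')) (f' ⊗ₜ g')
    (BoxH1.inl (q ⊗ₜ g))
  rw [boxC01_inl] at this
  exact this

theorem m01_c01 (f' : C.H0 U' U'') (f : C.H0 U U') (g' : C.H0 V' V'') (q : C.H1 V V') :
    T.m01 (C.c00 f' f) (C.c01 g' q) = C.c01 (T.m00 f' g') (T.m01 f q) := by
  have := T.map_c01 (X := (U, V)) (Y := (U', V')) (Z := (U'', V'')) (f' ⊗ₜ g')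
    (BoxH1.inr (f ⊗ₜ q))
  rw [boxC01_inr] at this
  exact this

theorem m10_c10 (q : C.H1 U' U'') (f : C.H0 U U') (g' : C.H0 V' V'') (g : C.H0 V V') :
    T.m10 (C.c10 q f) (C.c00 g' g) = C.c10 (T.m10 q g') (T.m00 f g) := by
  have := T.map_c10 (X := (U, V)) (Y := (U', V')) (Z := (U'', V'')) (BoxH1.inl (q ⊗ₜ g'))
    (f ⊗ₜ g)
  rw [boxC10_inl] at this
  exact this

theorem m01_c10 (f' : C.H0 U' U'') (f : C.H0 U U') (q : C.H1 V' V'') (g : C.H0 V V') :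
    T.m01 (C.c00 f' f) (C.c10 q g) = C.c10 (T.m01 f' q) (T.m00 f g) := by
  have := T.map_c10 (X := (U, V)) (Y := (U', V')) (Z := (U'', V'')) (BoxH1.inr (f' ⊗ₜ q))
    (f ⊗ₜ g)
  rw [boxC10_inr] at this
  exact this

theorem d_m10 (q : C.H1 U U') (g : C.H0 V V') : C.d (T.m10 q g) = T.m00 (C.d q) g := by
  have := T.map_d (X := (U, V)) (Y := (U', V')) (BoxH1.inl (q ⊗ₜ g))
  rw [boxD_inl] at this
  exact this.symm

theorem d_m01 (f : C.H0 U U') (q : C.H1 V V') : C.d (T.m01 f q) = T.m00 f (C.d q) := by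
  have := T.map_d (X := (U, V)) (Y := (U', V')) (BoxH1.inr (f ⊗ₜ q))
  rw [boxD_inr] at this
  exact this.symm

/-- The defining relation of the truncated tensor product, carried over by the functor. It is what
makes interchange hold for squares in the category of arrows. -/
theorem m10_d (q : C.H1 U U') (p : C.H1 V V') : T.m10 q (C.d p) = T.m01 (C.d q) p :=
  congrArg (T.map1 (X := (U, V)) (Y := (U', V'))) (BoxH1.inl_d q p)

theorem m00_c00_fst (b : C.H0 U' U'') (f : C.H0 U U') (g : C.H0 V V') :
    T.m00 (C.c00 b f) g = C.c00 (T.m00 b (C.one V')) (T.m00 f g) := by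
  rw [← m00_c00, C.one_c00]

theorem m00_c00_fst' (f : C.H0 U' U'') (a : C.H0 U U') (g : C.H0 V V') :
    T.m00 (C.c00 f a) g = C.c00 (T.m00 f g) (T.m00 a (C.one V)) := by
  rw [← m00_c00, C.c00_one]

theorem m00_c00_snd (f : C.H0 U U') (b : C.H0 V' V'') (g : C.H0 V V') :
    T.m00 f (C.c00 b g) = C.c00 (T.m00 (C.one U') b) (T.m00 f g) := by
  rw [← m00_c00, C.one_c00]

theorem m00_c00_snd' (f : C.H0 U U') (g : C.H0 V' V'') (a : C.H0 V V') :
    T.m00 f (C.c00 g a) = C.c00 (T.m00 f g) (T.m00 (C.one U) a) := by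
  rw [← m00_c00, C.c00_one]

theorem m10_c01_fst (b : C.H0 U' U'') (q : C.H1 U U') (g : C.H0 V V') :
    T.m10 (C.c01 b q) g = C.c01 (T.m00 b (C.one V')) (T.m10 q g) := by
  rw [← m10_c01, C.one_c00]

theorem m10_c10_fst (q : C.H1 U' U'') (a : C.H0 U U') (g : C.H0 V V') :
    T.m10 (C.c10 q a) g = C.c10 (T.m10 q g) (T.m00 a (C.one V)) := by
  rw [← m10_c10, C.c00_one]

theorem m10_c00_snd (q : C.H1 U U') (b : C.H0 V' V'') (g : C.H0 V V') :
    T.m10 q (C.c00 b g) = C.c01 (T.m00 (C.one U') b) (T.m10 q g) := by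
  rw [← m10_c01, C.one_c01]

theorem m10_c00_snd' (q : C.H1 U U') (g : C.H0 V' V'') (a : C.H0 V V') :
    T.m10 q (C.c00 g a) = C.c10 (T.m10 q g) (T.m00 (C.one U) a) := by
  rw [← m10_c10, C.c10_one]

theorem m01_c01_snd (f : C.H0 U U') (b : C.H0 V' V'') (q : C.H1 V V') :
    T.m01 f (C.c01 b q) = C.c01 (T.m00 (C.one U') b) (T.m01 f q) := by
  rw [← m01_c01, C.one_c00]

theorem m01_c10_snd (f : C.H0 U U') (q : C.H1 V' V'') (a : C.H0 V V') :
    T.m01 f (C.c10 q a) = C.c10 (T.m01 f q) (T.m00 (C.one U) a) := by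
  rw [← m01_c10, C.c00_one]

theorem m01_c00_fst (b : C.H0 U' U'') (f : C.H0 U U') (q : C.H1 V V') :
    T.m01 (C.c00 b f) q = C.c01 (T.m00 b (C.one V')) (T.m01 f q) := by
  rw [← m01_c01, C.one_c01]

theorem m01_c00_fst' (f : C.H0 U' U'') (a : C.H0 U U') (q : C.H1 V V') :
    T.m01 (C.c00 f a) q = C.c10 (T.m01 f q) (T.m00 a (C.one V)) := by
  rw [← m01_c10, C.c10_one]

end

variable {T}

/-- The component at `U, V` of a transformation from `U V` to `V U`. -/
def swapApp (b : PreTrans (C.box C) C T.obj ((boxSwap C C).comp T).obj) (U V : C.Obj) :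
    C.H0 (T.o U V) (T.o V U) := b.app (U, V)

/-- The component at `U, V` of a transformation from `U V` to `U V`. -/
def selfApp (t : PreTrans (C.box C) C T.obj T.obj) (U V : C.Obj) :
    C.H0 (T.o U V) (T.o U V) := t.app (U, V)

/-- The homotopy component of a transformation from `U V` to `U V`, as a bilinear map. -/
def selfHty (t : PreTrans (C.box C) C T.obj T.obj) {U V U' V' : C.Obj} :
    C.H0 U U' →ₗ[R] C.H0 V V' →ₗ[R] C.H1 (T.o U V) (T.o U' V') :=
  TensorProduct.curry (t.hty (U, V) (U', V'))

end CochCat.Func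

/-! ### The hypotheses as relations between generators -/

set_option linter.checkUnivs false in
/-- A category enriched in cochain complexes concentrated in degrees `-1, 0`, with a strictly
associative product, a symmetric braiding and a totally symmetric strict infinitesimal braiding.
The conditions are stated on generators. -/
structure InfSym (R : Type u) [CommRing R] where
  C : CochCat.{u, v, w} R
  T : Func (C.box C) C
  assoc : ∀ U V W, T.o (T.o U V) W = T.o U (T.o V W)
  assoc000 : ∀ {U V W U' V' W' : C.Obj} (f : C.H0 U U') (g : C.H0 V V') (k : C.H0 W W'),
    C.c00 (C.idOfEq (assoc U' V' W')) (T.m00 (T.m00 f g) k) =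
      C.c00 (T.m00 f (T.m00 g k)) (C.idOfEq (assoc U V W))
  assoc100 : ∀ {U V W U' V' W' : C.Obj} (f : C.H1 U U') (g : C.H0 V V') (k : C.H0 W W'),
    C.c01 (C.idOfEq (assoc U' V' W')) (T.m10 (T.m10 f g) k) =
      C.c10 (T.m10 f (T.m00 g k)) (C.idOfEq (assoc U V W))
  assoc010 : ∀ {U V W U' V' W' : C.Obj} (f : C.H0 U U') (g : C.H1 V V') (k : C.H0 W W'),
    C.c01 (C.idOfEq (assoc U' V' W')) (T.m10 (T.m01 f g) k) =
      C.c10 (T.m01 f (T.m10 g k)) (C.idOfEq (assoc U V W))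
  assoc001 : ∀ {U V W U' V' W' : C.Obj} (f : C.H0 U U') (g : C.H0 V V') (k : C.H1 W W'),
    C.c01 (C.idOfEq (assoc U' V' W')) (T.m01 (T.m00 f g) k) =
      C.c10 (T.m01 f (T.m01 g k)) (C.idOfEq (assoc U V W))
  braid : PreTrans (C.box C) C T.obj ((boxSwap C C).comp T).obj
  braid_pseudonat : IsPseudonat T ((boxSwap C C).comp T) braid
  braid_hty : ∀ X Y, braid.hty X Y = 0
  braid_braid : ∀ U V : C.Obj, C.c00 (Func.swapApp braid V U) (Func.swapApp braid U V) =
      C.one (T.o U V)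
  hex : ∀ U V W : C.Obj,
    C.c00 (C.idOfEq (assoc V W U))
        (C.c00 (Func.swapApp braid U (T.o V W)) (C.idOfEq (assoc U V W))) =
      C.c00 (T.m00 (C.one V) (Func.swapApp braid U W)) (C.c00 (C.idOfEq (assoc V U W))
        (T.m00 (Func.swapApp braid U V) (C.one W)))
  t : PreTrans (C.box C) C T.obj T.obj
  t_pseudonat : IsPseudonat T T t
  t_left_app : ∀ U V W : C.Obj,
    C.c00 (C.idOfEq (assoc U V W).symm) (C.c00 (Func.selfApp t U (T.o V W))
        (C.idOfEq (assoc U V W))) =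
      T.m00 (Func.selfApp t U V) (C.one W) + C.c00 (T.m00 (Func.swapApp braid V U) (C.one W))
        (C.c00 (C.idOfEq (assoc V U W).symm) (C.c00 (T.m00 (C.one V) (Func.selfApp t U W))
          (C.c00 (C.idOfEq (assoc V U W)) (T.m00 (Func.swapApp braid U V) (C.one W)))))
  t_left_hty : ∀ {U V W U' V' W' : C.Obj} (f : C.H0 U U') (g : C.H0 V V') (k : C.H0 W W'),
    C.c01 (C.idOfEq (assoc U' V' W').symm) (C.c10 (Func.selfHty t f (T.m00 g k))
        (C.idOfEq (assoc U V W))) =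
      T.m10 (Func.selfHty t f g) k +
        C.c01 (C.c00 (T.m00 (Func.swapApp braid V' U') (C.one W')) (C.idOfEq (assoc V' U' W').symm))
        (C.c10 (T.m01 g (Func.selfHty t f k))
          (C.c00 (C.idOfEq (assoc V U W)) (T.m00 (Func.swapApp braid U V) (C.one W))))
  t_right_app : ∀ U V W : C.Obj,
    C.c00 (C.idOfEq (assoc U V W)) (C.c00 (Func.selfApp t (T.o U V) W)
        (C.idOfEq (assoc U V W).symm)) =
      T.m00 (C.one U) (Func.selfApp t V W) + C.c00 (T.m00 (C.one U) (Func.swapApp braid W V))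
        (C.c00 (C.idOfEq (assoc U W V)) (C.c00 (T.m00 (Func.selfApp t U W) (C.one V))
          (C.c00 (C.idOfEq (assoc U W V).symm) (T.m00 (C.one U) (Func.swapApp braid V W)))))
  t_right_hty : ∀ {U V W U' V' W' : C.Obj} (f : C.H0 U U') (g : C.H0 V V') (k : C.H0 W W'),
    C.c01 (C.idOfEq (assoc U' V' W')) (C.c10 (Func.selfHty t (T.m00 f g) k)
        (C.idOfEq (assoc U V W).symm)) =
      T.m01 f (Func.selfHty t g k) +
        C.c01 (C.c00 (T.m00 (C.one U') (Func.swapApp braid W' V')) (C.idOfEq (assoc U' W' V')))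
        (C.c10 (T.m10 (Func.selfHty t f k) g)
          (C.c00 (C.idOfEq (assoc U W V).symm) (T.m00 (C.one U) (Func.swapApp braid V W))))
  symm_app : ∀ U V : C.Obj, C.c00 (Func.swapApp braid U V) (Func.selfApp t U V) =
    C.c00 (Func.selfApp t V U) (Func.swapApp braid U V)
  symm_hty : ∀ {U V U' V' : C.Obj} (f : C.H0 U U') (g : C.H0 V V'),
    C.c01 (Func.swapApp braid U' V') (Func.selfHty t f g) =
      C.c10 (Func.selfHty t g f) (Func.swapApp braid U V)
  total : ∀ U V W : C.Obj,
    Func.selfHty t (Func.swapApp braid U V) (C.one W) = 0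

namespace InfSym

variable {R : Type u} [CommRing R] (M : InfSym.{u, v, w} R)

local notation "𝐢" => CochCat.one (InfSym.C M)
local notation "𝐞" => CochCat.idOfEq (InfSym.C M)
local notation:80 f:81 " ⬝ " g:80 => CochCat.c00 (InfSym.C M) f g
local notation:80 f:81 " ◁ " q:80 => CochCat.c01 (InfSym.C M) f q
local notation:80 q:81 " ▷ " f:80 => CochCat.c10 (InfSym.C M) q f
local notation:90 U:90 " ⋆ " V:91 => Func.o (InfSym.T M) U V

/-- The component `γ_{UV}` of the symmetric braiding. -/
def γ (U V : M.C.Obj) : M.C.H0 (U ⋆ V) (V ⋆ U) := Func.swapApp M.braid U V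

/-- The component `t_{UV}`. -/
def ta (U V : M.C.Obj) : M.C.H0 (U ⋆ V) (U ⋆ V) := Func.selfApp M.t U V

/-- The homotopy component `t_{f ⊠ g}`, as a bilinear map. -/
def th {U V U' V' : M.C.Obj} :
    M.C.H0 U U' →ₗ[R] M.C.H0 V V' →ₗ[R] M.C.H1 (U ⋆ V) (U' ⋆ V') :=
  Func.selfHty M.t

section

variable {U U' U'' V V' V'' W W' : M.C.Obj}

theorem γ_nat (f : M.C.H0 U U') (g : M.C.H0 V V') :
    M.γ U' V' ⬝ M.T.m00 f g = M.T.m00 g f ⬝ M.γ U V := by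
  have := M.braid_pseudonat.d_hty (X := (U, V)) (Y := (U', V')) (f ⊗ₜ g)
  rw [M.braid_hty, LinearMap.zero_apply, map_zero, sub_eq_zero] at this
  exact this.symm

theorem γ_m10 (q : M.C.H1 U U') (g : M.C.H0 V V') :
    M.γ U' V' ◁ M.T.m10 q g = M.T.m01 g q ▷ M.γ U V := by
  have := M.braid_pseudonat.hty_d (X := (U, V)) (Y := (U', V')) (BoxH1.inl (q ⊗ₜ g))
  rw [M.braid_hty, LinearMap.zero_apply, sub_eq_zero] at this
  have e : ((boxSwap M.C M.C).comp M.T).map1 (X := (U, V)) (Y := (U', V')) (BoxH1.inl (q ⊗ₜ g))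
    = M.T.m01 g q := congrArg (M.T.map1 (X := (V, U)) (Y := (V', U'))) (boxSwap1_inl q g)
  rw [e] at this
  exact this.symm

theorem γ_m01 (f : M.C.H0 U U') (q : M.C.H1 V V') :
    M.γ U' V' ◁ M.T.m01 f q = M.T.m10 q f ▷ M.γ U V := by
  have := M.braid_pseudonat.hty_d (X := (U, V)) (Y := (U', V')) (BoxH1.inr (f ⊗ₜ q))
  rw [M.braid_hty, LinearMap.zero_apply, sub_eq_zero] at this
  have e : ((boxSwap M.C M.C).comp M.T).map1 (X := (U, V)) (Y := (U', V')) (BoxH1.inr (f ⊗ₜ q))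
    = M.T.m10 q f := congrArg (M.T.map1 (X := (V, U)) (Y := (V', U'))) (boxSwap1_inr f q)
  rw [e] at this
  exact this.symm

theorem d_th (f : M.C.H0 U U') (g : M.C.H0 V V') :
    M.T.m00 f g ⬝ M.ta U V - M.ta U' V' ⬝ M.T.m00 f g = M.C.d (M.th f g) :=
  M.t_pseudonat.d_hty (X := (U, V)) (Y := (U', V')) (f ⊗ₜ g)

theorem th_d_left (q : M.C.H1 U U') (g : M.C.H0 V V') :
    M.T.m10 q g ▷ M.ta U V - M.ta U' V' ◁ M.T.m10 q g = M.th (M.C.d q) g := by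
  have := M.t_pseudonat.hty_d (X := (U, V)) (Y := (U', V')) (BoxH1.inl (q ⊗ₜ g))
  rw [boxD_inl] at this
  exact this

theorem th_d_right (f : M.C.H0 U U') (q : M.C.H1 V V') :
    M.T.m01 f q ▷ M.ta U V - M.ta U' V' ◁ M.T.m01 f q = M.th f (M.C.d q) := by
  have := M.t_pseudonat.hty_d (X := (U, V)) (Y := (U', V')) (BoxH1.inr (f ⊗ₜ q))
  rw [boxD_inr] at this
  exact this

theorem th_one (U V : M.C.Obj) : M.th (𝐢 U) (𝐢 V) = 0 := M.t_pseudonat.hty_one (U, V)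

theorem th_c00 (f' : M.C.H0 U' U'') (f : M.C.H0 U U') (g' : M.C.H0 V' V'') (g : M.C.H0 V V') :
    M.th (f' ⬝ f) (g' ⬝ g) = M.th f' g' ▷ M.T.m00 f g + M.T.m00 f' g' ◁ M.th f g :=
  M.t_pseudonat.hty_comp (X := (U, V)) (Y := (U', V')) (Z := (U'', V'')) (f' ⊗ₜ g') (f ⊗ₜ g)

theorem th_c00_fst (b : M.C.H0 U' U'') (f : M.C.H0 U U') (g : M.C.H0 V V') :
    M.th (b ⬝ f) g = M.th b (𝐢 V') ▷ M.T.m00 f g + M.T.m00 b (𝐢 V') ◁ M.th f g := by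
  rw [← th_c00, M.C.one_c00]

theorem th_c00_fst' (f : M.C.H0 U' U'') (a : M.C.H0 U U') (g : M.C.H0 V V') :
    M.th (f ⬝ a) g = M.th f g ▷ M.T.m00 a (𝐢 V) + M.T.m00 f g ◁ M.th a (𝐢 V) := by
  rw [← th_c00, M.C.c00_one]

theorem th_c00_snd (f : M.C.H0 U U') (b : M.C.H0 V' V'') (g : M.C.H0 V V') :
    M.th f (b ⬝ g) = M.th (𝐢 U') b ▷ M.T.m00 f g + M.T.m00 (𝐢 U') b ◁ M.th f g := by
  rw [← th_c00, M.C.one_c00]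

theorem th_c00_snd' (f : M.C.H0 U U') (g : M.C.H0 V' V'') (a : M.C.H0 V V') :
    M.th f (g ⬝ a) = M.th f g ▷ M.T.m00 (𝐢 U) a + M.T.m00 f g ◁ M.th (𝐢 U) a := by
  rw [← th_c00, M.C.c00_one]

theorem γ_ta (U V : M.C.Obj) : M.γ U V ⬝ M.ta U V = M.ta V U ⬝ M.γ U V := M.symm_app U V

theorem γ_th (f : M.C.H0 U U') (g : M.C.H0 V V') :
    M.γ U' V' ◁ M.th f g = M.th g f ▷ M.γ U V := M.symm_hty f g

theorem γ_γ (U V : M.C.Obj) : M.γ V U ⬝ M.γ U V = 𝐢 _ := M.braid_braid U V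

theorem th_γ_one (U V W : M.C.Obj) : M.th (M.γ U V) (𝐢 W) = 0 := M.total U V W

/-- Total symmetry is assumed only in the first argument. The relation γ t_{f ⊠ g} = t_{g ⊠ f} γ
carries it to the second, as γ can be cancelled. -/
theorem th_one_γ (U V W : M.C.Obj) : M.th (𝐢 W) (M.γ U V) = 0 := by
  have h := congrArg (fun q => M.γ (V ⋆ U) W ◁ q) (M.γ_th (𝐢 W) (M.γ U V))
  simp only [th_γ_one, LinearMap.map_zero, LinearMap.zero_apply, ← M.C.assoc001, γ_γ,
    M.C.one_c01] at h
  exact h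

theorem t_left (U V W : M.C.Obj) :
    M.ta U (V ⋆ W) ⬝ 𝐞 (M.assoc U V W) = 𝐞 (M.assoc U V W) ⬝
      (M.T.m00 (M.ta U V) (𝐢 W) + M.T.m00 (M.γ V U) (𝐢 W) ⬝ (𝐞 (M.assoc V U W).symm ⬝
        (M.T.m00 (𝐢 V) (M.ta U W) ⬝ (𝐞 (M.assoc V U W) ⬝ M.T.m00 (M.γ U V) (𝐢 W))))) := by
  have := congrArg (fun f => 𝐞 (M.assoc U V W) ⬝ f) (M.t_left_app U V W)
  simp only [idOfEq_symm_c00] at this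
  exact this

theorem t_right (U V W : M.C.Obj) :
    𝐞 (M.assoc U V W) ⬝ M.ta (U ⋆ V) W =
      (M.T.m00 (𝐢 U) (M.ta V W) + M.T.m00 (𝐢 U) (M.γ W V) ⬝ (𝐞 (M.assoc U W V) ⬝
        (M.T.m00 (M.ta U W) (𝐢 V) ⬝ (𝐞 (M.assoc U W V).symm ⬝ M.T.m00 (𝐢 U) (M.γ V W))))) ⬝
      𝐞 (M.assoc U V W) := by
  have := congrArg (fun f => f ⬝ 𝐞 (M.assoc U V W)) (M.t_right_app U V W)
  simp only [M.C.assoc000, idOfEq_idOfEq, idOfEq_self, M.C.c00_one] at this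
  exact this

theorem th_left (f : M.C.H0 U U') (g : M.C.H0 V V') (k : M.C.H0 W W') :
    M.th f (M.T.m00 g k) ▷ 𝐞 (M.assoc U V W) = 𝐞 (M.assoc U' V' W') ◁
      (M.T.m10 (M.th f g) k + M.T.m00 (M.γ V' U') (𝐢 W') ◁ (𝐞 (M.assoc V' U' W').symm ◁
        (M.T.m01 g (M.th f k) ▷ (𝐞 (M.assoc V U W) ⬝ M.T.m00 (M.γ U V) (𝐢 W))))) := by
  have := congrArg (fun f => 𝐞 (M.assoc U' V' W') ◁ f) (M.t_left_hty f g k)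
  simp only [idOfEq_symm_c01, M.C.assoc001] at this
  exact this

theorem th_right (f : M.C.H0 U U') (g : M.C.H0 V V') (k : M.C.H0 W W') :
    𝐞 (M.assoc U' V' W') ◁ M.th (M.T.m00 f g) k =
      (M.T.m01 f (M.th g k) + M.T.m00 (𝐢 U') (M.γ W' V') ◁ (𝐞 (M.assoc U' W' V') ◁
        (M.T.m10 (M.th f k) g ▷ (𝐞 (M.assoc U W V).symm ⬝ M.T.m00 (𝐢 U) (M.γ V W))))) ▷
      𝐞 (M.assoc U V W) := by
  have := congrArg (fun f => f ▷ 𝐞 (M.assoc U V W)) (M.t_right_hty f g k)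
  simp only [M.C.assoc010, M.C.assoc100, M.C.assoc001, idOfEq_idOfEq, idOfEq_self,
    M.C.c10_one] at this
  exact this

end

/-- The whiskered form of the structure. -/
def whisk : WhiskMon.{u, v, w} R where
  C := M.C
  o U V := U ⋆ V
  assoc := M.assoc
  l0 U _ _ := M.T.m00 (𝐢 U)
  l1 U _ _ := M.T.m01 (𝐢 U)
  r0 U _ _ := M.T.m00.flip (𝐢 U)
  r1 U _ _ := M.T.m10.flip (𝐢 U)
  l0_one _ _ := M.T.m00_one _ _
  r0_one _ _ := M.T.m00_one _ _
  l0_c00 _ _ _ _ _ _ := M.T.m00_c00_snd _ _ _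
  r0_c00 _ _ _ _ _ _ := M.T.m00_c00_fst _ _ _
  l1_c01 _ _ _ _ _ _ := M.T.m01_c01_snd _ _ _
  r1_c01 _ _ _ _ _ _ := M.T.m10_c01_fst _ _ _
  l1_c10 _ _ _ _ _ _ := M.T.m01_c10_snd _ _ _
  r1_c10 _ _ _ _ _ _ := M.T.m10_c10_fst _ _ _
  exch f g := by
    simp only [LinearMap.flip_apply]
    rw [← M.T.m00_c00, ← M.T.m00_c00, M.C.one_c00, M.C.one_c00, M.C.c00_one, M.C.c00_one]
  rr0 V W f := by
    simp only [LinearMap.flip_apply]; rw [M.assoc000, M.T.m00_one]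
  lr0 U W f := by
    simp only [LinearMap.flip_apply]; rw [M.assoc000]
  ll0 U W f := by
    rw [← M.T.m00_one, M.assoc000]
  rr1 V W f := by
    simp only [LinearMap.flip_apply]; rw [M.assoc100, M.T.m00_one]
  lr1 U W f := by
    simp only [LinearMap.flip_apply]; rw [M.assoc010]
  ll1 U W f := by
    rw [← M.T.m00_one, M.assoc001]
  γ := M.γ
  γ_r0 V f := M.γ_nat _ _
  γ_l0 V f := M.γ_nat _ _
  γ_r1 V f := M.γ_m10 _ _
  γ_l1 V f := M.γ_m01 _ _
  γ_γ := M.γ_γ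
  hex := M.hex
  ta := M.ta
  tl W _ _ := M.th.flip (𝐢 W)
  tr W _ _ := M.th (𝐢 W)
  d_tl W _ _ f := M.d_th _ _
  d_tr W _ _ f := M.d_th _ _
  tl_one _ _ := M.th_one _ _
  tr_one _ _ := M.th_one _ _
  tl_c00 _ _ _ _ _ _ := M.th_c00_fst _ _ _
  tr_c00 _ _ _ _ _ _ := M.th_c00_snd _ _ _
  γ_ta := M.γ_ta
  tl_γ U V W := M.th_γ_one _ _ _
  tr_γ U V W := M.th_one_γ _ _ _
  ta_left := M.t_left
  ta_right := M.t_right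
  tl_o {U U'} V W f := by
    have := M.th_left f (𝐢 V) (𝐢 W)
    rw [M.T.m00_one] at this
    exact this
  -- From here on the hexagon relations for homotopy components are specialised to two identity
  -- 1-cells. In four of the resulting relations one of the two summands contains t_{1 ⊠ 1} and
  -- drops out.
  tr_r0 {V V'} U W f := by
    have := M.th_left (𝐢 U) f (𝐢 W)
    simp only [th_one, LinearMap.map_zero, LinearMap.zero_apply, add_zero] at this
    exact this
  tr_l0 {V V'} U W f := by
    have := M.th_left (𝐢 U) (𝐢 W) f
    simp only [th_one, LinearMap.map_zero, LinearMap.zero_apply, zero_add] at this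
    exact this
  tl_r0 {V V'} U W f := by
    have := M.th_right f (𝐢 U) (𝐢 W)
    simp only [th_one, LinearMap.map_zero, zero_add] at this
    exact this
  tl_l0 {V V'} U W f := by
    have := M.th_right (𝐢 U) f (𝐢 W)
    simp only [th_one, LinearMap.map_zero, LinearMap.zero_apply, add_zero] at this
    exact this
  tr_o {U U'} V W f := by
    have := M.th_right (𝐢 V) (𝐢 W) f
    rw [M.T.m00_one] at this
    exact this

end InfSym

end

/-! ### The category of arrows -/

section

namespace CochCat

variable {R : Type u} [CommRing R] (C : CochCat.{u, v, w} R)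

set_option linter.checkUnivs false in
/-- A 1-cell of `C`, as an object of the category of arrows. -/
structure Arrow where
  src : C.Obj
  tgt : C.Obj
  map : C.H0 src tgt

namespace Arrow

variable {C}

/-- Squares that commute up to a given homotopy: triples `(a, b, q)` with `∂q = y a - b x`. -/
def Sq (x y : C.Arrow) :
    Submodule R (C.H0 x.src y.src × C.H0 x.tgt y.tgt × C.H1 x.src y.tgt) :=
  LinearMap.ker (C.d ∘ₗ LinearMap.snd R _ _ ∘ₗ LinearMap.snd R _ _ -
    C.c00 y.map ∘ₗ LinearMap.fst R _ _ +
    C.c00.flip x.map ∘ₗ LinearMap.fst R _ _ ∘ₗ LinearMap.snd R _ _)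

theorem mem_sq {x y : C.Arrow} (p : C.H0 x.src y.src × C.H0 x.tgt y.tgt × C.H1 x.src y.tgt) :
    p ∈ Sq x y ↔ C.d p.2.2 = C.c00 y.map p.1 - C.c00 p.2.1 x.map := by
  rw [Sq, LinearMap.mem_ker, ← sub_eq_zero (a := C.d p.2.2), sub_sub_eq_add_sub, add_sub_right_comm]
  rfl

/-- Arrows whose ends are equal only propositionally cannot be compared directly. Compatibility with
the identity 1-cells is the usable form of equality, and is exactly what the associativity relation
provides for products of arrows. -/
theorem idOfEq_eq {x y : C.Arrow} (hs : x.src = y.src) (ht : x.tgt = y.tgt)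
    (h : C.c00 (C.idOfEq ht) x.map = C.c00 y.map (C.idOfEq hs)) : x = y := by
  obtain ⟨a, b, f⟩ := x
  obtain ⟨a', b', f'⟩ := y
  dsimp only at hs ht
  subst hs ht
  dsimp only at h
  rw [idOfEq_self, idOfEq_self, C.one_c00, C.c00_one] at h
  rw [h]

theorem Sq.ext {x y : C.Arrow} {p q : Sq x y} (h : p.1.1 = q.1.1) (h' : p.1.2.1 = q.1.2.1)
    (h'' : p.1.2.2 = q.1.2.2) : p = q :=
  Subtype.ext (Prod.ext h (Prod.ext h' h''))

/-- The square with given components. -/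
def Sq.mk {x y : C.Arrow} (a : C.H0 x.src y.src) (b : C.H0 x.tgt y.tgt) (q : C.H1 x.src y.tgt)
    (h : C.d q = C.c00 y.map a - C.c00 b x.map) : Sq x y := ⟨(a, b, q), (mem_sq _).2 h⟩

theorem Sq.d_eq {x y : C.Arrow} (p : Sq x y) :
    C.d p.1.2.2 = C.c00 y.map p.1.1 - C.c00 p.1.2.1 x.map := (mem_sq _).1 p.2


/-- The differential of a pair of homotopies. -/
def dSq {x y : C.Arrow} : C.H1 x.src y.src × C.H1 x.tgt y.tgt →ₗ[R] Sq x y where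
  toFun p := Sq.mk (C.d p.1) (C.d p.2) (C.c01 y.map p.1 - C.c10 p.2 x.map) (by
    rw [map_sub, C.d_c01, C.d_c10])
  map_add' _ _ := Sq.ext (map_add _ _ _) (map_add _ _ _)
    ((congrArg₂ (· - ·) (map_add _ _ _) (LinearMap.map_add₂ _ _ _ _)).trans
      (add_sub_add_comm _ _ _ _))
  map_smul' _ _ := Sq.ext (map_smul _ _ _) (map_smul _ _ _)
    ((congrArg₂ (· - ·) (map_smul _ _ _) (LinearMap.map_smul₂ _ _ _ _)).trans
      (smul_sub _ _ _).symm)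

/-- The horizontal pasting of squares. -/
def compSq {x y z : C.Arrow} : Sq y z →ₗ[R] Sq x y →ₗ[R] Sq x z :=
  LinearMap.mk₂ R (fun p q => Sq.mk (C.c00 p.1.1 q.1.1) (C.c00 p.1.2.1 q.1.2.1)
      (C.c10 p.1.2.2 q.1.1 + C.c01 p.1.2.1 q.1.2.2) (by
        rw [map_add, C.d_c10, C.d_c01, Sq.d_eq p, Sq.d_eq q, map_sub, map_sub,
          LinearMap.sub_apply, C.assoc000, C.assoc000, C.assoc000, sub_add_sub_cancel]))
    (fun _ _ _ => Sq.ext (LinearMap.map_add₂ _ _ _ _) (LinearMap.map_add₂ _ _ _ _)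
      ((congrArg₂ (· + ·) (LinearMap.map_add₂ _ _ _ _) (LinearMap.map_add₂ _ _ _ _)).trans
        (add_add_add_comm _ _ _ _)))
    (fun _ _ _ => Sq.ext (LinearMap.map_smul₂ _ _ _ _) (LinearMap.map_smul₂ _ _ _ _)
      ((congrArg₂ (· + ·) (LinearMap.map_smul₂ _ _ _ _) (LinearMap.map_smul₂ _ _ _ _)).trans
        (smul_add _ _ _).symm))
    (fun _ _ _ => Sq.ext (map_add _ _ _) (map_add _ _ _)
      ((congrArg₂ (· + ·) (map_add _ _ _) (map_add _ _ _)).trans (add_add_add_comm _ _ _ _)))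
    (fun _ _ _ => Sq.ext (map_smul _ _ _) (map_smul _ _ _)
      ((congrArg₂ (· + ·) (map_smul _ _ _) (map_smul _ _ _)).trans (smul_add _ _ _).symm))

/-- The composite of a pair of homotopies with a square applied last. -/
def compSq01 {x y z : C.Arrow} : Sq y z →ₗ[R] C.H1 x.src y.src × C.H1 x.tgt y.tgt →ₗ[R]
    C.H1 x.src z.src × C.H1 x.tgt z.tgt :=
  LinearMap.mk₂ R (fun p q => (C.c01 p.1.1 q.1, C.c01 p.1.2.1 q.2))
    (fun _ _ _ => Prod.ext (LinearMap.map_add₂ _ _ _ _) (LinearMap.map_add₂ _ _ _ _))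
    (fun _ _ _ => Prod.ext (LinearMap.map_smul₂ _ _ _ _) (LinearMap.map_smul₂ _ _ _ _))
    (fun _ _ _ => Prod.ext (map_add _ _ _) (map_add _ _ _))
    (fun _ _ _ => Prod.ext (map_smul _ _ _) (map_smul _ _ _))

/-- The composite of a pair of homotopies with a square applied first. -/
def compSq10 {x y z : C.Arrow} : C.H1 y.src z.src × C.H1 y.tgt z.tgt →ₗ[R] Sq x y →ₗ[R]
    C.H1 x.src z.src × C.H1 x.tgt z.tgt :=
  LinearMap.mk₂ R (fun p q => (C.c10 p.1 q.1.1, C.c10 p.2 q.1.2.1))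
    (fun _ _ _ => Prod.ext (LinearMap.map_add₂ _ _ _ _) (LinearMap.map_add₂ _ _ _ _))
    (fun _ _ _ => Prod.ext (LinearMap.map_smul₂ _ _ _ _) (LinearMap.map_smul₂ _ _ _ _))
    (fun _ _ _ => Prod.ext (map_add _ _ _) (map_add _ _ _))
    (fun _ _ _ => Prod.ext (map_smul _ _ _) (map_smul _ _ _))

end Arrow

/-- The category of arrows of `C`, with squares that commute up to a given homotopy. -/
def arr : CochCat.{u, max v w, w} R where
  Obj := C.Arrow
  H0 x y := Arrow.Sq x y
  H1 x y := C.H1 x.src y.src × C.H1 x.tgt y.tgt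
  d := Arrow.dSq
  one x := Arrow.Sq.mk (C.one _) (C.one _) 0 (by rw [map_zero, C.c00_one, C.one_c00, sub_self])
  c00 := Arrow.compSq
  c01 := Arrow.compSq01
  c10 := Arrow.compSq10
  one_c00 p := Arrow.Sq.ext (C.one_c00 _) (C.one_c00 _)
    ((congrArg₂ (· + ·) (LinearMap.map_zero₂ _ _) (C.one_c01 _)).trans (zero_add _))
  c00_one p := Arrow.Sq.ext (C.c00_one _) (C.c00_one _)
    ((congrArg₂ (· + ·) (C.c10_one _) (map_zero _)).trans (add_zero _))
  one_c01 p := Prod.ext (C.one_c01 _) (C.one_c01 _)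
  c10_one p := Prod.ext (C.c10_one _) (C.c10_one _)
  assoc000 f g k := Arrow.Sq.ext (C.assoc000 _ _ _) (C.assoc000 _ _ _) (by
    change C.c10 (C.c10 f.1.2.2 g.1.1 + C.c01 f.1.2.1 g.1.2.2) k.1.1 +
        C.c01 (C.c00 f.1.2.1 g.1.2.1) k.1.2.2 =
      C.c10 f.1.2.2 (C.c00 g.1.1 k.1.1) +
        C.c01 f.1.2.1 (C.c10 g.1.2.2 k.1.1 + C.c01 g.1.2.1 k.1.2.2)
    rw [map_add, map_add, LinearMap.add_apply, C.assoc100, C.assoc010, C.assoc001, add_assoc])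
  assoc001 f g k := Prod.ext (C.assoc001 _ _ _) (C.assoc001 _ _ _)
  assoc010 f g k := Prod.ext (C.assoc010 _ _ _) (C.assoc010 _ _ _)
  assoc100 f g k := Prod.ext (C.assoc100 _ _ _) (C.assoc100 _ _ _)
  d_c01 {x y z} p q := Arrow.Sq.ext (C.d_c01 _ _) (C.d_c01 _ _) (by
    change C.c01 z.map (C.c01 p.1.1 q.1) - C.c10 (C.c01 p.1.2.1 q.2) x.map =
      C.c10 p.1.2.2 (C.d q.1) + C.c01 p.1.2.1 (C.c01 y.map q.1 - C.c10 q.2 x.map)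
    -- The truncation relation replaces the filling of the square composed with a boundary by the
    -- boundary of the filling composed with the homotopy; that boundary is the defect of
    -- commutativity of the square. Without truncation, squares would not form such a category.
    rw [← C.trunc, Arrow.Sq.d_eq p, map_sub, map_sub, LinearMap.sub_apply, C.assoc001, C.assoc001,
      C.assoc010, sub_add_sub_cancel])
  d_c10 {x y z} q p := Arrow.Sq.ext (C.d_c10 _ _) (C.d_c10 _ _) (by
    change C.c01 z.map (C.c10 q.1 p.1.1) - C.c10 (C.c10 q.2 p.1.2.1) x.map =
      C.c10 (C.c01 z.map q.1 - C.c10 q.2 y.map) p.1.1 + C.c01 (C.d q.2) p.1.2.2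
    rw [C.trunc, Arrow.Sq.d_eq p, map_sub, map_sub, LinearMap.sub_apply, C.assoc100, C.assoc100,
      C.assoc010, sub_add_sub_cancel])
  trunc p q := Prod.ext (C.trunc _ _) (C.trunc _ _)

namespace Arrow

variable {C} {x y z : C.arr.Obj}

/-- The component of a square at the source. -/
def onSrc : C.arr.H0 x y →ₗ[R] C.H0 (Arrow.src x) (Arrow.src y) :=
  LinearMap.fst R _ _ ∘ₗ (Sq (C := C) x y).subtype

/-- The component of a square at the target. -/
def onTgt : C.arr.H0 x y →ₗ[R] C.H0 (Arrow.tgt x) (Arrow.tgt y) :=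
  LinearMap.fst R _ _ ∘ₗ LinearMap.snd R _ _ ∘ₗ (Sq (C := C) x y).subtype

/-- The homotopy that fills a square. -/
def fill : C.arr.H0 x y →ₗ[R] C.H1 (Arrow.src x) (Arrow.tgt y) :=
  LinearMap.snd R _ _ ∘ₗ LinearMap.snd R _ _ ∘ₗ (Sq (C := C) x y).subtype

theorem hom_ext {p q : C.arr.H0 x y} (h : onSrc p = onSrc q) (h' : onTgt p = onTgt q)
    (h'' : fill p = fill q) : p = q := Sq.ext h h' h''

theorem d_fill (p : C.arr.H0 x y) :
    C.d (fill p) = C.c00 (Arrow.map y) (onSrc p) - C.c00 (onTgt p) (Arrow.map x) := Sq.d_eq p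

theorem onSrc_idOfEq (h : x = y) :
    onSrc (C.arr.idOfEq h) = C.idOfEq (congrArg Arrow.src h) := by subst h; rfl

theorem onTgt_idOfEq (h : x = y) :
    onTgt (C.arr.idOfEq h) = C.idOfEq (congrArg Arrow.tgt h) := by subst h; rfl

theorem fill_idOfEq (h : x = y) : fill (C.arr.idOfEq h) = 0 := by subst h; rfl

theorem onSrc_c00 (f : C.arr.H0 y z) (g : C.arr.H0 x y) :
    onSrc (C.arr.c00 f g) = C.c00 (onSrc f) (onSrc g) := rfl

theorem onTgt_c00 (f : C.arr.H0 y z) (g : C.arr.H0 x y) :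
    onTgt (C.arr.c00 f g) = C.c00 (onTgt f) (onTgt g) := rfl

theorem fill_c00 (f : C.arr.H0 y z) (g : C.arr.H0 x y) :
    fill (C.arr.c00 f g) = C.c10 (fill f) (onSrc g) + C.c01 (onTgt f) (fill g) := rfl

theorem fill_d (q : C.arr.H1 x y) :
    fill (C.arr.d q) = C.c01 (Arrow.map y) q.1 - C.c10 q.2 (Arrow.map x) := rfl

theorem c10_fst (f : C.arr.H1 y z) (g : C.arr.H0 x y) :
    (C.arr.c10 f g).1 = C.c10 f.1 (onSrc g) := rfl

theorem c10_snd (f : C.arr.H1 y z) (g : C.arr.H0 x y) :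
    (C.arr.c10 f g).2 = C.c10 f.2 (onTgt g) := rfl

/-- The square with given components. -/
def sq (a : C.H0 (Arrow.src x) (Arrow.src y)) (b : C.H0 (Arrow.tgt x) (Arrow.tgt y))
    (q : C.H1 (Arrow.src x) (Arrow.tgt y))
    (h : C.d q = C.c00 (Arrow.map y) a - C.c00 b (Arrow.map x)) : C.arr.H0 x y := Sq.mk a b q h

end Arrow

end CochCat

end

/-! ### Product, braiding and infinitesimal braiding on the category of arrows -/

section

namespace CochCat.Arrow

variable {R : Type u} [CommRing R] {C : CochCat.{u, v, w} R} {x y z : C.arr.Obj}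

theorem fill_c00_of_left {f : C.arr.H0 y z} (hf : fill f = 0) (g : C.arr.H0 x y) :
    fill (C.arr.c00 f g) = C.c01 (onTgt f) (fill g) := by
  rw [fill_c00, hf, LinearMap.map_zero₂, zero_add]

theorem fill_c00_of_right (f : C.arr.H0 y z) {g : C.arr.H0 x y} (hg : fill g = 0) :
    fill (C.arr.c00 f g) = C.c10 (fill f) (onSrc g) := by
  rw [fill_c00, hg, map_zero, add_zero]

theorem fill_idOfEq_c00 (h : y = z) (g : C.arr.H0 x y) :
    fill (C.arr.c00 (C.arr.idOfEq h) g) = C.c01 (C.idOfEq (congrArg Arrow.tgt h)) (fill g) := by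
  rw [fill_c00_of_left (fill_idOfEq h), onTgt_idOfEq]

theorem fill_c00_idOfEq (f : C.arr.H0 y z) (h : x = y) :
    fill (C.arr.c00 f (C.arr.idOfEq h)) = C.c10 (fill f) (C.idOfEq (congrArg Arrow.src h)) := by
  rw [fill_c00_of_right f (fill_idOfEq h), onSrc_idOfEq]

end CochCat.Arrow

namespace InfSym

open CochCat.Arrow

variable {R : Type u} [CommRing R] (M : InfSym.{u, v, w} R)

local notation "𝐢" => CochCat.one (InfSym.C M)
local notation "𝐞" => CochCat.idOfEq (InfSym.C M)
local notation:80 f:81 " ⬝ " g:80 => CochCat.c00 (InfSym.C M) f g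
local notation:80 f:81 " ◁ " q:80 => CochCat.c01 (InfSym.C M) f q
local notation:80 q:81 " ▷ " f:80 => CochCat.c10 (InfSym.C M) q f
local notation:90 U:90 " ⋆ " V:91 => Func.o (InfSym.T M) U V

/-- The product of two arrows. -/
def arrO (x y : M.C.arr.Obj) : M.C.arr.Obj :=
  Arrow.mk (src x ⋆ src y) (tgt x ⋆ tgt y) (M.T.m00 (Arrow.map x) (Arrow.map y))

theorem arrO_assoc (x y z : M.C.arr.Obj) :
    M.arrO (M.arrO x y) z = M.arrO x (M.arrO y z) :=
  idOfEq_eq (M.assoc _ _ _) (M.assoc _ _ _) (M.assoc000 _ _ _)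

/-- Left multiplication of squares by an arrow. -/
def arrL0 (u : M.C.arr.Obj) {x y : M.C.arr.Obj} :
    M.C.arr.H0 x y →ₗ[R] M.C.arr.H0 (M.arrO u x) (M.arrO u y) where
  toFun p := sq (M.T.m00 (𝐢 _) (onSrc p)) (M.T.m00 (𝐢 _) (onTgt p)) (M.T.m01 (Arrow.map u) (fill p))
    ((M.T.d_m01 _ _).trans (by
      rw [d_fill, map_sub, Func.m00_c00_snd', Func.m00_c00_snd]
      rfl))
  map_add' _ _ := hom_ext (by simp only [map_add]; rfl) (by simp only [map_add]; rfl)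
    (by simp only [map_add]; rfl)
  map_smul' _ _ := hom_ext (by simp only [map_smul]; rfl) (by simp only [map_smul]; rfl)
    (by simp only [map_smul]; rfl)

/-- Right multiplication of squares by an arrow. -/
def arrR0 (u : M.C.arr.Obj) {x y : M.C.arr.Obj} :
    M.C.arr.H0 x y →ₗ[R] M.C.arr.H0 (M.arrO x u) (M.arrO y u) where
  toFun p := sq (M.T.m00 (onSrc p) (𝐢 _)) (M.T.m00 (onTgt p) (𝐢 _)) (M.T.m10 (fill p) (Arrow.map u))
    ((M.T.d_m10 _ _).trans (by
      rw [d_fill, LinearMap.map_sub₂, Func.m00_c00_fst', Func.m00_c00_fst]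
      rfl))
  map_add' _ _ := hom_ext (by simp only [map_add]; rfl) (by simp only [map_add]; rfl)
    (by simp only [map_add]; rfl)
  map_smul' _ _ := hom_ext (by simp only [map_smul]; rfl) (by simp only [map_smul]; rfl)
    (by simp only [map_smul]; rfl)

/-- Left multiplication of pairs of homotopies by an arrow. -/
def arrL1 (u : M.C.arr.Obj) {x y : M.C.arr.Obj} :
    M.C.arr.H1 x y →ₗ[R] M.C.arr.H1 (M.arrO u x) (M.arrO u y) :=
  LinearMap.prodMap (M.T.m01 (𝐢 (src u))) (M.T.m01 (𝐢 (tgt u)))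

/-- Right multiplication of pairs of homotopies by an arrow. -/
def arrR1 (u : M.C.arr.Obj) {x y : M.C.arr.Obj} :
    M.C.arr.H1 x y →ₗ[R] M.C.arr.H1 (M.arrO x u) (M.arrO y u) :=
  LinearMap.prodMap (M.T.m10.flip (𝐢 (src u))) (M.T.m10.flip (𝐢 (tgt u)))

/-- The symmetric braiding as a square. -/
def arrγ (x y : M.C.arr.Obj) : M.C.arr.H0 (M.arrO x y) (M.arrO y x) :=
  sq (M.γ _ _) (M.γ _ _) 0 (by
    rw [map_zero]; exact (sub_eq_zero.2 (M.γ_nat _ _).symm).symm)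

/-- The infinitesimal braiding as a square. -/
def arrTa (x y : M.C.arr.Obj) : M.C.arr.H0 (M.arrO x y) (M.arrO x y) :=
  sq (M.ta _ _) (M.ta _ _) (M.th (Arrow.map x) (Arrow.map y)) (M.d_th _ _).symm

/-- The homotopies `t_{f ⊠ 1}` for a square. -/
def arrTl (u : M.C.arr.Obj) {x y : M.C.arr.Obj} :
    M.C.arr.H0 x y →ₗ[R] M.C.arr.H1 (M.arrO x u) (M.arrO y u) :=
  LinearMap.prod (M.th.flip (𝐢 (src u)) ∘ₗ onSrc) (M.th.flip (𝐢 (tgt u)) ∘ₗ onTgt)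

/-- The homotopies `t_{1 ⊠ f}` for a square. -/
def arrTr (u : M.C.arr.Obj) {x y : M.C.arr.Obj} :
    M.C.arr.H0 x y →ₗ[R] M.C.arr.H1 (M.arrO u x) (M.arrO u y) :=
  LinearMap.prod (M.th (𝐢 (src u)) ∘ₗ onSrc) (M.th (𝐢 (tgt u)) ∘ₗ onTgt)

section

variable (u : M.C.arr.Obj) {x y : M.C.arr.Obj}

theorem fill_arrL0 (p : M.C.arr.H0 x y) :
    fill (M.arrL0 u p) = M.T.m01 (Arrow.map u) (fill p) := rfl

theorem fill_arrR0 (p : M.C.arr.H0 x y) :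
    fill (M.arrR0 u p) = M.T.m10 (fill p) (Arrow.map u) := rfl

theorem fill_arrγ (x y : M.C.arr.Obj) : fill (M.arrγ x y) = 0 := rfl

theorem fill_arrR0_arrγ (x y z : M.C.arr.Obj) : fill (M.arrR0 z (M.arrγ x y)) = 0 :=
  LinearMap.map_zero₂ M.T.m10 (Arrow.map z)

theorem fill_arrL0_arrγ (x y z : M.C.arr.Obj) : fill (M.arrL0 x (M.arrγ y z)) = 0 :=
  map_zero (M.T.m01 (Arrow.map x))

/-- The general pattern for squares: the components at source and target are instances of the
relation in the original category, and only the filling carries new content. Here it is the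
associativity relation `assoc100` for homotopies. -/
theorem arr_rr0 (v w : M.C.arr.Obj) (f : M.C.arr.H0 x y) :
    M.C.arr.c00 (M.C.arr.idOfEq (M.arrO_assoc y v w)) (M.arrR0 w (M.arrR0 v f)) =
      M.C.arr.c00 (M.arrR0 (M.arrO v w) f) (M.C.arr.idOfEq (M.arrO_assoc x v w)) := by
  refine hom_ext ?_ ?_ ?_
  · simp only [onSrc_c00, onSrc_idOfEq]
    exact M.whisk.rr0 _ _ (onSrc f)
  · simp only [onTgt_c00, onTgt_idOfEq]
    exact M.whisk.rr0 _ _ (onTgt f)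
  · rw [fill_idOfEq_c00, fill_c00_idOfEq]
    exact M.assoc100 _ _ _

theorem arr_lr0 (v w : M.C.arr.Obj) (f : M.C.arr.H0 x y) :
    M.C.arr.c00 (M.C.arr.idOfEq (M.arrO_assoc v y w)) (M.arrR0 w (M.arrL0 v f)) =
      M.C.arr.c00 (M.arrL0 v (M.arrR0 w f)) (M.C.arr.idOfEq (M.arrO_assoc v x w)) := by
  refine hom_ext ?_ ?_ ?_
  · simp only [onSrc_c00, onSrc_idOfEq]
    exact M.whisk.lr0 _ _ (onSrc f)
  · simp only [onTgt_c00, onTgt_idOfEq]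
    exact M.whisk.lr0 _ _ (onTgt f)
  · rw [fill_idOfEq_c00, fill_c00_idOfEq]
    exact M.assoc010 _ _ _

theorem arr_ll0 (v w : M.C.arr.Obj) (f : M.C.arr.H0 x y) :
    M.C.arr.c00 (M.C.arr.idOfEq (M.arrO_assoc v w y)) (M.arrL0 (M.arrO v w) f) =
      M.C.arr.c00 (M.arrL0 v (M.arrL0 w f)) (M.C.arr.idOfEq (M.arrO_assoc v w x)) := by
  refine hom_ext ?_ ?_ ?_
  · simp only [onSrc_c00, onSrc_idOfEq]
    exact M.whisk.ll0 _ _ (onSrc f)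
  · simp only [onTgt_c00, onTgt_idOfEq]
    exact M.whisk.ll0 _ _ (onTgt f)
  · rw [fill_idOfEq_c00, fill_c00_idOfEq]
    exact M.assoc001 _ _ _

theorem arr_l0_c00 {z : M.C.arr.Obj} (f : M.C.arr.H0 y z) (g : M.C.arr.H0 x y) :
    M.arrL0 u (M.C.arr.c00 f g) = M.C.arr.c00 (M.arrL0 u f) (M.arrL0 u g) := by
  refine hom_ext (M.whisk.l0_c00 _ (onSrc f) (onSrc g)) (M.whisk.l0_c00 _ (onTgt f) (onTgt g)) ?_
  rw [fill_arrL0, fill_c00, fill_c00, map_add, Func.m01_c10_snd, Func.m01_c01_snd]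
  rfl

theorem arr_r0_c00 {z : M.C.arr.Obj} (f : M.C.arr.H0 y z) (g : M.C.arr.H0 x y) :
    M.arrR0 u (M.C.arr.c00 f g) = M.C.arr.c00 (M.arrR0 u f) (M.arrR0 u g) := by
  refine hom_ext (M.whisk.r0_c00 _ (onSrc f) (onSrc g)) (M.whisk.r0_c00 _ (onTgt f) (onTgt g)) ?_
  rw [fill_arrR0, fill_c00, fill_c00, LinearMap.map_add₂, Func.m10_c10_fst, Func.m10_c01_fst]
  rfl

/-- The two fillings differ by q ⊗ ∂p - ∂q ⊗ p, where q and p are the fillings of the two squares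
and their boundaries are the defects of commutativity. This vanishes by the truncation relation
`m10_d`. -/
theorem arr_exch {x' y' : M.C.arr.Obj} (f : M.C.arr.H0 x x') (g : M.C.arr.H0 y y') :
    M.C.arr.c00 (M.arrR0 y' f) (M.arrL0 x g) = M.C.arr.c00 (M.arrL0 x' g) (M.arrR0 y f) := by
  refine hom_ext (M.whisk.exch (onSrc f) (onSrc g)) (M.whisk.exch (onTgt f) (onTgt g)) ?_
  have := M.T.m10_d (fill f) (fill g)
  rw [d_fill, d_fill, map_sub, LinearMap.map_sub₂, Func.m10_c00_snd',
    Func.m10_c00_snd, Func.m01_c00_fst', Func.m01_c00_fst, sub_eq_sub_iff_add_eq_add] at this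
  exact this

theorem arr_γ_r0 (v : M.C.arr.Obj) (f : M.C.arr.H0 x y) :
    M.C.arr.c00 (M.arrγ y v) (M.arrR0 v f) = M.C.arr.c00 (M.arrL0 v f) (M.arrγ x v) := by
  refine hom_ext (M.γ_nat _ _) (M.γ_nat _ _) ?_
  simp only [fill_c00, fill_arrγ, map_zero, LinearMap.zero_apply, zero_add, add_zero]
  exact M.γ_m10 _ _

theorem arr_γ_l0 (v : M.C.arr.Obj) (f : M.C.arr.H0 x y) :
    M.C.arr.c00 (M.arrγ v y) (M.arrL0 v f) = M.C.arr.c00 (M.arrR0 v f) (M.arrγ v x) := by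
  refine hom_ext (M.γ_nat _ _) (M.γ_nat _ _) ?_
  simp only [fill_c00, fill_arrγ, map_zero, LinearMap.zero_apply, zero_add, add_zero]
  exact M.γ_m01 _ _

theorem arr_hex (x y z : M.C.arr.Obj) :
    M.C.arr.c00 (M.C.arr.idOfEq (M.arrO_assoc y z x)) (M.C.arr.c00 (M.arrγ x (M.arrO y z))
      (M.C.arr.idOfEq (M.arrO_assoc x y z))) =
      M.C.arr.c00 (M.arrL0 y (M.arrγ x z)) (M.C.arr.c00 (M.C.arr.idOfEq (M.arrO_assoc y x z))
        (M.arrR0 z (M.arrγ x y))) := by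
  refine hom_ext ?_ ?_ ?_
  · simp only [onSrc_c00, onSrc_idOfEq]
    exact M.hex _ _ _
  · simp only [onTgt_c00, onTgt_idOfEq]
    exact M.hex _ _ _
  · rw [fill_idOfEq_c00, fill_c00_idOfEq, fill_arrγ, LinearMap.map_zero₂, map_zero,
      fill_c00_of_left (M.fill_arrL0_arrγ y x z), fill_idOfEq_c00, fill_arrR0_arrγ, map_zero,
      map_zero]

/-- For the filling, t_{∂q ⊠ g} is computed in two ways, with q the filling of the square: from the
compatibility of t with homotopies, and from ∂q being a difference of two composites, to which the
composition rule applies. In `arr_d_tr` the two arguments of t exchange roles. -/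
theorem arr_d_tl (v : M.C.arr.Obj) (f : M.C.arr.H0 x y) :
    M.C.arr.c00 (M.arrR0 v f) (M.arrTa x v) - M.C.arr.c00 (M.arrTa y v) (M.arrR0 v f) =
      M.C.arr.d (M.arrTl v f) := by
  refine hom_ext ?_ ?_ ?_
  · rw [map_sub]; exact M.d_th _ _
  · rw [map_sub]; exact M.d_th _ _
  · rw [map_sub, fill_c00, fill_c00, fill_d]
    have h := M.th_d_left (fill f) (Arrow.map v)
    rw [d_fill, LinearMap.map_sub₂, th_c00_fst', th_c00_fst] at h
    change M.T.m10 (fill f) (Arrow.map v) ▷ M.ta (src x) (src v) +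
        M.T.m00 (onTgt f) (𝐢 (tgt v)) ◁ M.th (Arrow.map x) (Arrow.map v) -
        (M.th (Arrow.map y) (Arrow.map v) ▷ M.T.m00 (onSrc f) (𝐢 (src v)) +
        M.ta (tgt y) (tgt v) ◁ M.T.m10 (fill f) (Arrow.map v)) =
      M.T.m00 (Arrow.map y) (Arrow.map v) ◁ M.th (onSrc f) (𝐢 (src v)) -
        M.th (onTgt f) (𝐢 (tgt v)) ▷ M.T.m00 (Arrow.map x) (Arrow.map v)
    rw [← sub_eq_zero] at h ⊢
    rw [← h]
    abel

theorem arr_d_tr (v : M.C.arr.Obj) (f : M.C.arr.H0 x y) :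
    M.C.arr.c00 (M.arrL0 v f) (M.arrTa v x) - M.C.arr.c00 (M.arrTa v y) (M.arrL0 v f) =
      M.C.arr.d (M.arrTr v f) := by
  refine hom_ext ?_ ?_ ?_
  · rw [map_sub]; exact M.d_th _ _
  · rw [map_sub]; exact M.d_th _ _
  · rw [map_sub, fill_c00, fill_c00, fill_d]
    have h := M.th_d_right (Arrow.map v) (fill f)
    rw [d_fill, map_sub, th_c00_snd', th_c00_snd] at h
    change M.T.m01 (Arrow.map v) (fill f) ▷ M.ta (src v) (src x) +
        M.T.m00 (𝐢 (tgt v)) (onTgt f) ◁ M.th (Arrow.map v) (Arrow.map x) -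
        (M.th (Arrow.map v) (Arrow.map y) ▷ M.T.m00 (𝐢 (src v)) (onSrc f) +
        M.ta (tgt v) (tgt y) ◁ M.T.m01 (Arrow.map v) (fill f)) =
      M.T.m00 (Arrow.map v) (Arrow.map y) ◁ M.th (𝐢 (src v)) (onSrc f) -
        M.th (𝐢 (tgt v)) (onTgt f) ▷ M.T.m00 (Arrow.map v) (Arrow.map x)
    rw [← sub_eq_zero] at h ⊢
    rw [← h]
    abel

/-- The filling is the left infinitesimal hexagon relation for homotopy components at arbitrary
1-cells f, g, k, since the filling of the infinitesimal braiding at two arrows is t_{f ⊠ g}. -/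
theorem arr_ta_left (x y z : M.C.arr.Obj) :
    M.C.arr.c00 (M.arrTa x (M.arrO y z)) (M.C.arr.idOfEq (M.arrO_assoc x y z)) =
      M.C.arr.c00 (M.C.arr.idOfEq (M.arrO_assoc x y z))
      (M.arrR0 z (M.arrTa x y) + M.C.arr.c00 (M.arrR0 z (M.arrγ y x))
        (M.C.arr.c00 (M.C.arr.idOfEq (M.arrO_assoc y x z).symm)
        (M.C.arr.c00 (M.arrL0 y (M.arrTa x z)) (M.C.arr.c00 (M.C.arr.idOfEq (M.arrO_assoc y x z))
          (M.arrR0 z (M.arrγ x y)))))) := by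
  refine hom_ext ?_ ?_ ?_
  · simp only [onSrc_c00, onSrc_idOfEq, map_add onSrc]
    exact M.t_left _ _ _
  · simp only [onTgt_c00, onTgt_idOfEq, map_add onTgt]
    exact M.t_left _ _ _
  · rw [fill_c00_idOfEq, fill_idOfEq_c00, map_add fill, fill_c00_of_left (M.fill_arrR0_arrγ y x z),
      fill_idOfEq_c00, fill_c00_of_right, onSrc_c00, onSrc_idOfEq]
    · exact M.th_left _ _ _
    · rw [fill_idOfEq_c00, fill_arrR0_arrγ, map_zero]

theorem arr_ta_right (x y z : M.C.arr.Obj) :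
    M.C.arr.c00 (M.C.arr.idOfEq (M.arrO_assoc x y z)) (M.arrTa (M.arrO x y) z) =
      M.C.arr.c00 (M.arrL0 x (M.arrTa y z) + M.C.arr.c00 (M.arrL0 x (M.arrγ z y))
        (M.C.arr.c00 (M.C.arr.idOfEq (M.arrO_assoc x z y))
        (M.C.arr.c00 (M.arrR0 y (M.arrTa x z))
          (M.C.arr.c00 (M.C.arr.idOfEq (M.arrO_assoc x z y).symm) (M.arrL0 x (M.arrγ y z))))))
        (M.C.arr.idOfEq (M.arrO_assoc x y z)) := by
  refine hom_ext ?_ ?_ ?_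
  · simp only [onSrc_c00, onSrc_idOfEq, map_add onSrc]
    exact M.t_right _ _ _
  · simp only [onTgt_c00, onTgt_idOfEq, map_add onTgt]
    exact M.t_right _ _ _
  · rw [fill_c00_idOfEq, fill_idOfEq_c00, map_add fill, fill_c00_of_left (M.fill_arrL0_arrγ x z y),
      fill_idOfEq_c00, fill_c00_of_right, onSrc_c00, onSrc_idOfEq]
    · exact M.th_right _ _ _
    · rw [fill_idOfEq_c00, fill_arrL0_arrγ, map_zero]

/-- Here the filling is the relation γ t_{f ⊠ g} = t_{g ⊠ f} γ. -/
theorem arr_γ_ta (x y : M.C.arr.Obj) :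
    M.C.arr.c00 (M.arrγ x y) (M.arrTa x y) = M.C.arr.c00 (M.arrTa y x) (M.arrγ x y) := by
  refine hom_ext (M.γ_ta _ _) (M.γ_ta _ _) ?_
  rw [fill_c00_of_left (M.fill_arrγ x y), fill_c00_of_right _ (M.fill_arrγ x y)]
  exact M.γ_th _ _

theorem arr_γ_γ (x y : M.C.arr.Obj) :
    M.C.arr.c00 (M.arrγ y x) (M.arrγ x y) = M.C.arr.one (M.arrO x y) := by
  refine hom_ext (M.γ_γ _ _) (M.γ_γ _ _) ?_
  rw [fill_c00_of_left (M.fill_arrγ y x), fill_arrγ, map_zero]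
  rfl

theorem arrL0_one (u x : M.C.arr.Obj) : M.arrL0 u (M.C.arr.one x) = M.C.arr.one (M.arrO u x) :=
  hom_ext (M.T.m00_one _ _) (M.T.m00_one _ _) (map_zero (M.T.m01 (Arrow.map u)))

theorem arrR0_one (u x : M.C.arr.Obj) : M.arrR0 u (M.C.arr.one x) = M.C.arr.one (M.arrO x u) :=
  hom_ext (M.T.m00_one _ _) (M.T.m00_one _ _) (LinearMap.map_zero₂ M.T.m10 (Arrow.map u))

theorem pair_idOfEq_c01 {x y z : M.C.arr.Obj} (h : y = z) (q : M.C.arr.H1 x y) :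
    M.C.arr.c01 (M.C.arr.idOfEq h) q = (𝐞 (congrArg Arrow.src h) ◁ q.1,
      𝐞 (congrArg Arrow.tgt h) ◁ q.2) := by
  subst h; rfl

theorem pair_c10_idOfEq {x y z : M.C.arr.Obj} (q : M.C.arr.H1 y z) (h : x = y) :
    M.C.arr.c10 q (M.C.arr.idOfEq h) = (q.1 ▷ 𝐞 (congrArg Arrow.src h),
      q.2 ▷ 𝐞 (congrArg Arrow.tgt h)) := by
  subst h; rfl

end

/-- The whiskered form of the structure, on arrows. -/
def arrWhisk : WhiskMon.{u, max v w, w} R where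
  C := M.C.arr
  o := M.arrO
  assoc := M.arrO_assoc
  l0 U _ _ := M.arrL0 U
  l1 U _ _ := M.arrL1 U
  r0 U _ _ := M.arrR0 U
  r1 U _ _ := M.arrR1 U
  l0_one := M.arrL0_one
  r0_one := M.arrR0_one
  l0_c00 := M.arr_l0_c00
  r0_c00 := M.arr_r0_c00
  l1_c01 U _ _ _ f q := Prod.ext (M.whisk.l1_c01 _ (onSrc f) q.1) (M.whisk.l1_c01 _ (onTgt f) q.2)
  r1_c01 U _ _ _ f q := Prod.ext (M.whisk.r1_c01 _ (onSrc f) q.1) (M.whisk.r1_c01 _ (onTgt f) q.2)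
  l1_c10 U _ _ _ q f := Prod.ext (M.whisk.l1_c10 _ q.1 (onSrc f)) (M.whisk.l1_c10 _ q.2 (onTgt f))
  r1_c10 U _ _ _ q f := Prod.ext (M.whisk.r1_c10 _ q.1 (onSrc f)) (M.whisk.r1_c10 _ q.2 (onTgt f))
  exch := M.arr_exch
  rr0 := M.arr_rr0
  lr0 := M.arr_lr0
  ll0 := M.arr_ll0
  rr1 V W f := by
    rw [pair_idOfEq_c01, pair_c10_idOfEq]
    exact Prod.ext (M.whisk.rr1 _ _ f.1) (M.whisk.rr1 _ _ f.2)
  lr1 V W f := by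
    rw [pair_idOfEq_c01, pair_c10_idOfEq]
    exact Prod.ext (M.whisk.lr1 _ _ f.1) (M.whisk.lr1 _ _ f.2)
  ll1 V W f := by
    rw [pair_idOfEq_c01, pair_c10_idOfEq]
    exact Prod.ext (M.whisk.ll1 _ _ f.1) (M.whisk.ll1 _ _ f.2)
  γ := M.arrγ
  γ_r0 := M.arr_γ_r0
  γ_l0 := M.arr_γ_l0
  γ_r1 V f := Prod.ext (M.whisk.γ_r1 _ f.1) (M.whisk.γ_r1 _ f.2)
  γ_l1 V f := Prod.ext (M.whisk.γ_l1 _ f.1) (M.whisk.γ_l1 _ f.2)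
  γ_γ := M.arr_γ_γ
  hex := M.arr_hex
  ta := M.arrTa
  tl W _ _ := M.arrTl W
  tr W _ _ := M.arrTr W
  d_tl _ _ _ := M.arr_d_tl _
  d_tr _ _ _ := M.arr_d_tr _
  tl_one _ _ := Prod.ext (M.th_one _ _) (M.th_one _ _)
  tr_one _ _ := Prod.ext (M.th_one _ _) (M.th_one _ _)
  tl_c00 W _ _ _ g f :=
    Prod.ext (M.whisk.tl_c00 _ (onSrc g) (onSrc f)) (M.whisk.tl_c00 _ (onTgt g) (onTgt f))
  tr_c00 W _ _ _ g f :=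
    Prod.ext (M.whisk.tr_c00 _ (onSrc g) (onSrc f)) (M.whisk.tr_c00 _ (onTgt g) (onTgt f))
  γ_ta := M.arr_γ_ta
  tl_γ _ _ _ := Prod.ext (M.th_γ_one _ _ _) (M.th_γ_one _ _ _)
  tr_γ _ _ _ := Prod.ext (M.th_one_γ _ _ _) (M.th_one_γ _ _ _)
  ta_left := M.arr_ta_left
  ta_right := M.arr_ta_right
  tl_o V W f := by
    simp only [pair_idOfEq_c01, pair_c10_idOfEq]
    refine Prod.ext ?_ ?_
    · simp only [c10_fst, onSrc_c00, onSrc_idOfEq]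
      exact M.whisk.tl_o (src V) (src W) (onSrc f)
    · simp only [c10_snd, onTgt_c00, onTgt_idOfEq]
      exact M.whisk.tl_o (tgt V) (tgt W) (onTgt f)
  tr_r0 V W f := by
    simp only [pair_idOfEq_c01, pair_c10_idOfEq]
    exact Prod.ext (M.whisk.tr_r0 (src V) (src W) (onSrc f)) (M.whisk.tr_r0 (tgt V) (tgt W)
        (onTgt f))
  tr_l0 V W f := by
    simp only [pair_idOfEq_c01, pair_c10_idOfEq]
    refine Prod.ext ?_ ?_
    · simp only [c10_fst, onSrc_c00, onSrc_idOfEq]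
      exact M.whisk.tr_l0 (src V) (src W) (onSrc f)
    · simp only [c10_snd, onTgt_c00, onTgt_idOfEq]
      exact M.whisk.tr_l0 (tgt V) (tgt W) (onTgt f)
  tl_r0 V W f := by
    simp only [pair_idOfEq_c01, pair_c10_idOfEq]
    refine Prod.ext ?_ ?_
    · simp only [c10_fst, onSrc_c00, onSrc_idOfEq]
      exact M.whisk.tl_r0 (src V) (src W) (onSrc f)
    · simp only [c10_snd, onTgt_c00, onTgt_idOfEq]
      exact M.whisk.tl_r0 (tgt V) (tgt W) (onTgt f)
  tl_l0 V W f := by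
    simp only [pair_idOfEq_c01, pair_c10_idOfEq]
    exact Prod.ext (M.whisk.tl_l0 (src V) (src W) (onSrc f)) (M.whisk.tl_l0 (tgt V) (tgt W)
        (onTgt f))
  tr_o V W f := by
    simp only [pair_idOfEq_c01, pair_c10_idOfEq]
    refine Prod.ext ?_ ?_
    · simp only [c10_fst, onSrc_c00, onSrc_idOfEq]
      exact M.whisk.tr_o (src V) (src W) (onSrc f)
    · simp only [c10_snd, onTgt_c00, onTgt_idOfEq]
      exact M.whisk.tr_o (tgt V) (tgt W) (onTgt f)

end InfSym

end

/-! ### Closure properties of pseudonatural transformations -/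

section

namespace CochCat

variable {R : Type u} [CommRing R]

section

variable {B C D : CochCat.{u, v, w} R} (F : Func C D) {U U' : C.Obj} {V V' : B.Obj}

theorem boxMap1_id_inl (q : C.H1 U U') (g : B.H0 V V') :
    (boxMap1 F (Func.id B) U U' V V' (BoxH1.inl (q ⊗ₜ g)) :
      BoxH1 D B (F.obj U) (F.obj U') V V') = BoxH1.inl (F.map1 q ⊗ₜ g) :=
  BoxH1.lift_inl _ _ _ _

theorem boxMap1_id_inr (f : C.H0 U U') (q : B.H1 V V') :
    (boxMap1 F (Func.id B) U U' V V' (BoxH1.inr (f ⊗ₜ q)) :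
      BoxH1 D B (F.obj U) (F.obj U') V V') = BoxH1.inr (F.map0 f ⊗ₜ q) :=
  BoxH1.lift_inr _ _ _ _

theorem id_boxMap1_inl (q : B.H1 V V') (f : C.H0 U U') :
    (boxMap1 (Func.id B) F V V' U U' (BoxH1.inl (q ⊗ₜ f)) :
      BoxH1 B D V V' (F.obj U) (F.obj U')) = BoxH1.inl (q ⊗ₜ F.map0 f) :=
  BoxH1.lift_inl _ _ _ _

theorem id_boxMap1_inr (g : B.H0 V V') (q : C.H1 U U') :
    (boxMap1 (Func.id B) F V V' U U' (BoxH1.inr (g ⊗ₜ q)) :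
      BoxH1 B D V V' (F.obj U) (F.obj U')) = BoxH1.inr (g ⊗ₜ F.map1 q) :=
  BoxH1.lift_inr _ _ _ _

end

namespace IsPseudonat

section Vertical

variable {C : CochCat.{u, v, w} R} {D : CochCat.{u, v, w} R} {F G H : Func C D}

theorem of_natural {ξ : PreTrans C D F.obj G.obj} (h : ∀ X Y, ξ.hty X Y = 0)
    (h0 : ∀ {X Y : C.Obj} (f : C.H0 X Y), D.c00 (ξ.app Y) (F.map0 f) = D.c00 (G.map0 f) (ξ.app X))
    (h1 : ∀ {X Y : C.Obj} (q : C.H1 X Y),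
      D.c01 (ξ.app Y) (F.map1 q) = D.c10 (G.map1 q) (ξ.app X)) : IsPseudonat F G ξ where
  d_hty f := by rw [h, h0, sub_self, LinearMap.zero_apply, map_zero]
  hty_d q := by rw [h, h1, sub_self, LinearMap.zero_apply]
  hty_one X := by rw [h, LinearMap.zero_apply]
  hty_comp g f := by simp only [h, LinearMap.zero_apply, map_zero, add_zero]

theorem one (F : Func C D) : IsPseudonat F F (PreTrans.one F.obj) :=
  of_natural (fun _ _ => rfl) (fun _ => (D.one_c00 _).trans (D.c00_one _).symm)
    (fun _ => (D.one_c01 _).trans (D.c10_one _).symm)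

theorem add {ξ θ : PreTrans C D F.obj G.obj} (hξ : IsPseudonat F G ξ) (hθ : IsPseudonat F G θ) :
    IsPseudonat F G (ξ + θ) where
  d_hty {X Y} f := by
    change D.c00 (G.map0 f) (ξ.app X + θ.app X) - D.c00 (ξ.app Y + θ.app Y) (F.map0 f) =
      D.d (ξ.hty X Y f + θ.hty X Y f)
    rw [map_add, map_add, map_add, LinearMap.add_apply, ← hξ.d_hty, ← hθ.d_hty,
      add_sub_add_comm]
  hty_d {X Y} q := by
    change D.c10 (G.map1 q) (ξ.app X + θ.app X) - D.c01 (ξ.app Y + θ.app Y) (F.map1 q) =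
      ξ.hty X Y (C.d q) + θ.hty X Y (C.d q)
    rw [map_add, map_add, LinearMap.add_apply, ← hξ.hty_d, ← hθ.hty_d, add_sub_add_comm]
  hty_one X := (congrArg₂ (· + ·) (hξ.hty_one X) (hθ.hty_one X)).trans (add_zero _)
  hty_comp {X Y Z} g f := by
    change ξ.hty X Z (C.c00 g f) + θ.hty X Z (C.c00 g f) =
      D.c10 (ξ.hty Y Z g + θ.hty Y Z g) (F.map0 f) + D.c01 (G.map0 g) (ξ.hty X Y f + θ.hty X Y f)
    rw [map_add, map_add, LinearMap.add_apply, hξ.hty_comp, hθ.hty_comp, add_add_add_comm]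

theorem smul (r : R) {ξ : PreTrans C D F.obj G.obj} (hξ : IsPseudonat F G ξ) :
    IsPseudonat F G (r • ξ) where
  d_hty {X Y} f := by
    change D.c00 (G.map0 f) (r • ξ.app X) - D.c00 (r • ξ.app Y) (F.map0 f) =
      D.d (r • ξ.hty X Y f)
    rw [map_smul, map_smul, map_smul, LinearMap.smul_apply, ← hξ.d_hty, smul_sub]
  hty_d {X Y} q := by
    change D.c10 (G.map1 q) (r • ξ.app X) - D.c01 (r • ξ.app Y) (F.map1 q) =
      r • ξ.hty X Y (C.d q)
    rw [map_smul, map_smul, LinearMap.smul_apply, ← hξ.hty_d, smul_sub]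
  hty_one X := (congrArg (r • ·) (hξ.hty_one X)).trans (smul_zero _)
  hty_comp {X Y Z} g f := by
    change r • ξ.hty X Z (C.c00 g f) =
      D.c10 (r • ξ.hty Y Z g) (F.map0 f) + D.c01 (G.map0 g) (r • ξ.hty X Y f)
    rw [map_smul, map_smul, LinearMap.smul_apply, hξ.hty_comp, smul_add]

theorem sub {ξ θ : PreTrans C D F.obj G.obj} (hξ : IsPseudonat F G ξ) (hθ : IsPseudonat F G θ) :
    IsPseudonat F G (ξ - θ) where
  d_hty {X Y} f := by
    change D.c00 (G.map0 f) (ξ.app X - θ.app X) - D.c00 (ξ.app Y - θ.app Y) (F.map0 f) =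
      D.d (ξ.hty X Y f - θ.hty X Y f)
    rw [map_sub, map_sub, map_sub, LinearMap.sub_apply, ← hξ.d_hty, ← hθ.d_hty,
      sub_sub_sub_comm]
  hty_d {X Y} q := by
    change D.c10 (G.map1 q) (ξ.app X - θ.app X) - D.c01 (ξ.app Y - θ.app Y) (F.map1 q) =
      ξ.hty X Y (C.d q) - θ.hty X Y (C.d q)
    rw [map_sub, map_sub, LinearMap.sub_apply, ← hξ.hty_d, ← hθ.hty_d, sub_sub_sub_comm]
  hty_one X := (congrArg₂ (· - ·) (hξ.hty_one X) (hθ.hty_one X)).trans (sub_zero _)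
  hty_comp {X Y Z} g f := by
    change ξ.hty X Z (C.c00 g f) - θ.hty X Z (C.c00 g f) =
      D.c10 (ξ.hty Y Z g - θ.hty Y Z g) (F.map0 f) + D.c01 (G.map0 g) (ξ.hty X Y f - θ.hty X Y f)
    rw [map_sub, map_sub, LinearMap.sub_apply, hξ.hty_comp, hθ.hty_comp, add_sub_add_comm]

theorem comp {θ : PreTrans C D G.obj H.obj} {ξ : PreTrans C D F.obj G.obj}
    (hθ : IsPseudonat G H θ) (hξ : IsPseudonat F G ξ) :
    IsPseudonat F H (PreTrans.comp C D θ ξ) where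
  d_hty {X Y} f := by
    change D.c00 (H.map0 f) (D.c00 (θ.app X) (ξ.app X)) -
        D.c00 (D.c00 (θ.app Y) (ξ.app Y)) (F.map0 f) =
      D.d (D.c10 (θ.hty X Y f) (ξ.app X) + D.c01 (θ.app Y) (ξ.hty X Y f))
    rw [map_add, D.d_c10, D.d_c01, ← hθ.d_hty, ← hξ.d_hty, map_sub, map_sub, LinearMap.sub_apply,
      D.assoc000, D.assoc000, D.assoc000, sub_add_sub_cancel]
  hty_d {X Y} q := by
    change D.c10 (H.map1 q) (D.c00 (θ.app X) (ξ.app X)) -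
        D.c01 (D.c00 (θ.app Y) (ξ.app Y)) (F.map1 q) =
      D.c10 (θ.hty X Y (C.d q)) (ξ.app X) + D.c01 (θ.app Y) (ξ.hty X Y (C.d q))
    rw [← hθ.hty_d, ← hξ.hty_d, map_sub, map_sub, LinearMap.sub_apply, D.assoc001, D.assoc010,
      D.assoc100, sub_add_sub_cancel]
  hty_one X := by
    change D.c10 (θ.hty X X (C.one X)) (ξ.app X) + D.c01 (θ.app X) (ξ.hty X X (C.one X)) = 0
    rw [hθ.hty_one, hξ.hty_one, LinearMap.map_zero₂, map_zero, add_zero]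
  hty_comp {X Y Z} g f := by
    change D.c10 (θ.hty X Z (C.c00 g f)) (ξ.app X) + D.c01 (θ.app Z) (ξ.hty X Z (C.c00 g f)) =
      D.c10 (D.c10 (θ.hty Y Z g) (ξ.app Y) + D.c01 (θ.app Z) (ξ.hty Y Z g)) (F.map0 f) +
        D.c01 (H.map0 g) (D.c10 (θ.hty X Y f) (ξ.app X) + D.c01 (θ.app Y) (ξ.hty X Y f))
    -- Moving ξ past f and θ past g produces the two discrepancies θ_g ∂ξ_f and (∂θ_g) ξ_f, which
    -- sit on opposite sides of the equation and agree by truncation.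
    have e1 : D.c00 (G.map0 f) (ξ.app X) = D.c00 (ξ.app Y) (F.map0 f) + D.d (ξ.hty X Y f) :=
      eq_add_of_sub_eq' (hξ.d_hty f)
    have e2 : D.c00 (H.map0 g) (θ.app Y) = D.c00 (θ.app Z) (G.map0 g) + D.d (θ.hty Y Z g) :=
      eq_add_of_sub_eq' (hθ.d_hty g)
    rw [hθ.hty_comp, hξ.hty_comp]
    simp only [map_add, LinearMap.add_apply, D.assoc100, D.assoc010]
    rw [e1, ← D.assoc001 (H.map0 g) (θ.app Y), e2]
    simp only [map_add, LinearMap.add_apply, D.assoc001, D.trunc]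
    abel

end Vertical

section Whisker

variable {B C D E : CochCat.{u, v, w} R}

theorem pre {F G : Func C D} {ξ : PreTrans C D F.obj G.obj} (hξ : IsPseudonat F G ξ)
    (P : Func B C) : IsPseudonat (P.comp F) (P.comp G) (ξ.pre P) where
  d_hty f := hξ.d_hty (P.map0 f)
  hty_d q := (hξ.hty_d (P.map1 q)).trans (congrArg _ (P.map_d q).symm)
  hty_one X := (congrArg _ (P.map_one X)).trans (hξ.hty_one _)
  hty_comp g f := (congrArg _ (P.map_c00 g f)).trans (hξ.hty_comp _ _)

theorem post {F G : Func C D} {ξ : PreTrans C D F.obj G.obj} (hξ : IsPseudonat F G ξ)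
    (Q : Func D E) : IsPseudonat (F.comp Q) (G.comp Q) (ξ.post Q) where
  d_hty {X Y} f := by
    change E.c00 (Q.map0 (G.map0 f)) (Q.map0 (ξ.app X)) -
      E.c00 (Q.map0 (ξ.app Y)) (Q.map0 (F.map0 f)) = E.d (Q.map1 (ξ.hty X Y f))
    rw [← Q.map_c00, ← Q.map_c00, ← map_sub, hξ.d_hty, Q.map_d]
  hty_d {X Y} q := by
    change E.c10 (Q.map1 (G.map1 q)) (Q.map0 (ξ.app X)) -
      E.c01 (Q.map0 (ξ.app Y)) (Q.map1 (F.map1 q)) = Q.map1 (ξ.hty X Y (C.d q))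
    rw [← Q.map_c10, ← Q.map_c01, ← map_sub, hξ.hty_d]
  hty_one X := (congrArg Q.map1 (hξ.hty_one X)).trans (map_zero _)
  hty_comp {X Y Z} g f := by
    change Q.map1 (ξ.hty X Z (C.c00 g f)) = E.c10 (Q.map1 (ξ.hty Y Z g)) (Q.map0 (F.map0 f)) +
      E.c01 (Q.map0 (G.map0 g)) (Q.map1 (ξ.hty X Y f))
    rw [← Q.map_c10, ← Q.map_c01, ← map_add, hξ.hty_comp]

/-- All conditions are additive in each 1-cell and homotopy, so they need to be verified only on the
generators of the truncated tensor product. -/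
theorem of_tmul {F G : Func (C.box D) E} {ξ : PreTrans (C.box D) E F.obj G.obj}
    (h00 : ∀ {X Y : C.Obj × D.Obj} (f : C.H0 X.1 Y.1) (g : D.H0 X.2 Y.2),
      E.c00 (G.map0 (X := X) (Y := Y) (f ⊗ₜ g)) (ξ.app X) -
        E.c00 (ξ.app Y) (F.map0 (X := X) (Y := Y) (f ⊗ₜ g)) = E.d (ξ.hty X Y (f ⊗ₜ g)))
    (h10 : ∀ {X Y : C.Obj × D.Obj} (q : C.H1 X.1 Y.1) (g : D.H0 X.2 Y.2),
      E.c10 (G.map1 (X := X) (Y := Y) (BoxH1.inl (q ⊗ₜ g))) (ξ.app X) -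
        E.c01 (ξ.app Y) (F.map1 (X := X) (Y := Y) (BoxH1.inl (q ⊗ₜ g))) =
      ξ.hty X Y (C.d q ⊗ₜ g))
    (h01 : ∀ {X Y : C.Obj × D.Obj} (f : C.H0 X.1 Y.1) (q : D.H1 X.2 Y.2),
      E.c10 (G.map1 (X := X) (Y := Y) (BoxH1.inr (f ⊗ₜ q))) (ξ.app X) -
        E.c01 (ξ.app Y) (F.map1 (X := X) (Y := Y) (BoxH1.inr (f ⊗ₜ q))) =
      ξ.hty X Y (f ⊗ₜ D.d q))
    (hone : ∀ X : C.Obj × D.Obj, ξ.hty X X (C.one X.1 ⊗ₜ D.one X.2) = 0)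
    (hcomp : ∀ {X Y Z : C.Obj × D.Obj} (f' : C.H0 Y.1 Z.1) (g' : D.H0 Y.2 Z.2)
      (f : C.H0 X.1 Y.1) (g : D.H0 X.2 Y.2), ξ.hty X Z (C.c00 f' f ⊗ₜ D.c00 g' g) =
        E.c10 (ξ.hty Y Z (f' ⊗ₜ g')) (F.map0 (X := X) (Y := Y) (f ⊗ₜ g)) +
        E.c01 (G.map0 (X := Y) (Y := Z) (f' ⊗ₜ g')) (ξ.hty X Y (f ⊗ₜ g))) :
    IsPseudonat F G ξ where
  d_hty {X Y} f := by
    induction f using TensorProduct.induction_on with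
    | zero => simp only [map_zero, LinearMap.zero_apply, sub_zero]
    | add x y hx hy =>
      simp only [map_add, LinearMap.add_apply]
      rw [← hx, ← hy, add_sub_add_comm]
    | tmul f b => exact h00 f b
  hty_d {X Y} q := by
    induction q using BoxH1.ind with
    | ha x y hx hy =>
      simp only [map_add, LinearMap.add_apply]
      rw [← hx, ← hy, add_sub_add_comm]
    | hl q b => rw [boxD_inl]; exact h10 q b
    | hr f p => rw [boxD_inr]; exact h01 f p
  hty_one := hone
  hty_comp {X Y Z} g f := by
    induction f using TensorProduct.induction_on with
    | zero => simp only [map_zero, add_zero]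
    | add x y hx hy =>
      simp only [map_add]
      rw [hx, hy, add_add_add_comm]
    | tmul f b =>
      induction g using TensorProduct.induction_on with
      | zero => simp only [map_zero, LinearMap.zero_apply, add_zero]
      | add x y hx hy =>
        simp only [map_add, LinearMap.add_apply]
        rw [hx, hy, add_add_add_comm]
      | tmul f' b' => exact hcomp f' b' f b

variable {F G : Func C D} {ξ : PreTrans C D F.obj G.obj}

/-- The one case that is not formal is a homotopy p in the untouched factor: the defect of
naturality is ∂ξ_f ⊠ p, while the homotopy component is ξ_f ⊠ ∂p. These are identified in the
truncated tensor product. In `oneBox` the same happens with the factors exchanged. -/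
theorem boxOne (hξ : IsPseudonat F G ξ) :
    IsPseudonat (F.box (Func.id B)) (G.box (Func.id B)) (ξ.boxOne B) := by
  refine of_tmul (fun {X Y} f g => ?_) (fun {X Y} q g => ?_) (fun {X Y} f p => ?_)
    (fun X => ?_) (fun {X Y Z} f' g' f g => ?_)
  · change D.c00 (G.map0 f) (ξ.app X.1) ⊗ₜ[R] B.c00 g (B.one X.2) -
        D.c00 (ξ.app Y.1) (F.map0 f) ⊗ₜ[R] B.c00 (B.one Y.2) g =
      boxD D B _ _ _ _ (BoxH1.inl (ξ.hty X.1 Y.1 f ⊗ₜ g))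
    rw [boxD_inl, B.c00_one, B.one_c00, ← TensorProduct.sub_tmul, hξ.d_hty]
  · change boxC10 D B (F.obj X.1) (G.obj X.1) (G.obj Y.1) X.2 X.2 Y.2
        (boxMap1 G (Func.id B) _ _ _ _ (BoxH1.inl (q ⊗ₜ g))) (ξ.app X.1 ⊗ₜ B.one X.2) -
      boxC01 D B (F.obj X.1) (F.obj Y.1) (G.obj Y.1) X.2 Y.2 Y.2 (ξ.app Y.1 ⊗ₜ B.one Y.2)
        (boxMap1 F (Func.id B) _ _ _ _ (BoxH1.inl (q ⊗ₜ g))) =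
            BoxH1.inl (ξ.hty X.1 Y.1 (C.d q) ⊗ₜ g)
    rw [boxMap1_id_inl, boxMap1_id_inl, boxC10_inl, boxC01_inl, ← map_sub, ← hξ.hty_d,
      TensorProduct.sub_tmul, B.c00_one, B.one_c00]
  · change boxC10 D B (F.obj X.1) (G.obj X.1) (G.obj Y.1) X.2 X.2 Y.2
        (boxMap1 G (Func.id B) _ _ _ _ (BoxH1.inr (f ⊗ₜ p))) (ξ.app X.1 ⊗ₜ B.one X.2) -
      boxC01 D B (F.obj X.1) (F.obj Y.1) (G.obj Y.1) X.2 Y.2 Y.2 (ξ.app Y.1 ⊗ₜ B.one Y.2)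
        (boxMap1 F (Func.id B) _ _ _ _ (BoxH1.inr (f ⊗ₜ p))) = BoxH1.inl (ξ.hty X.1 Y.1 f ⊗ₜ B.d p)
    rw [boxMap1_id_inr, boxMap1_id_inr, boxC10_inr, boxC01_inr, ← map_sub, BoxH1.inl_d,
      ← hξ.d_hty, TensorProduct.sub_tmul, B.c10_one, B.one_c01]
  · exact congrArg BoxH1.inl ((congrArg (· ⊗ₜ[R] B.one X.2) (hξ.hty_one X.1)).trans
      (TensorProduct.zero_tmul _ _))
  · change BoxH1.inl (ξ.hty X.1 Z.1 (C.c00 f' f) ⊗ₜ B.c00 g' g) =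
      boxC10 D B (F.obj X.1) (F.obj Y.1) (G.obj Z.1) X.2 Y.2 Z.2
        (BoxH1.inl (ξ.hty Y.1 Z.1 f' ⊗ₜ g')) (F.map0 f ⊗ₜ g) +
      boxC01 D B (F.obj X.1) (G.obj Y.1) (G.obj Z.1) X.2 Y.2 Z.2 (G.map0 f' ⊗ₜ g')
        (BoxH1.inl (ξ.hty X.1 Y.1 f ⊗ₜ g))
    rw [boxC10_inl, boxC01_inl, hξ.hty_comp, TensorProduct.add_tmul, map_add]

theorem oneBox (hξ : IsPseudonat F G ξ) :
    IsPseudonat ((Func.id B).box F) ((Func.id B).box G) (ξ.oneBox B) := by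
  refine of_tmul (fun {X Y} g f => ?_) (fun {X Y} p f => ?_) (fun {X Y} g q => ?_)
    (fun X => ?_) (fun {X Y Z} g' f' g f => ?_)
  · change B.c00 g (B.one X.1) ⊗ₜ[R] D.c00 (G.map0 f) (ξ.app X.2) -
        B.c00 (B.one Y.1) g ⊗ₜ[R] D.c00 (ξ.app Y.2) (F.map0 f) =
      boxD B D _ _ _ _ (BoxH1.inr (g ⊗ₜ ξ.hty X.2 Y.2 f))
    rw [boxD_inr, B.c00_one, B.one_c00, ← TensorProduct.tmul_sub, hξ.d_hty]
  · change boxC10 B D X.1 X.1 Y.1 (F.obj X.2) (G.obj X.2) (G.obj Y.2)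
        (boxMap1 (Func.id B) G _ _ _ _ (BoxH1.inl (p ⊗ₜ f))) (B.one X.1 ⊗ₜ ξ.app X.2) -
      boxC01 B D X.1 Y.1 Y.1 (F.obj X.2) (F.obj Y.2) (G.obj Y.2) (B.one Y.1 ⊗ₜ ξ.app Y.2)
        (boxMap1 (Func.id B) F _ _ _ _ (BoxH1.inl (p ⊗ₜ f))) = BoxH1.inr (B.d p ⊗ₜ ξ.hty X.2 Y.2 f)
    rw [id_boxMap1_inl, id_boxMap1_inl, boxC10_inl, boxC01_inl, ← map_sub, ← BoxH1.inl_d,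
      ← hξ.d_hty, TensorProduct.tmul_sub, B.c10_one, B.one_c01]
  · change boxC10 B D X.1 X.1 Y.1 (F.obj X.2) (G.obj X.2) (G.obj Y.2)
        (boxMap1 (Func.id B) G _ _ _ _ (BoxH1.inr (g ⊗ₜ q))) (B.one X.1 ⊗ₜ ξ.app X.2) -
      boxC01 B D X.1 Y.1 Y.1 (F.obj X.2) (F.obj Y.2) (G.obj Y.2) (B.one Y.1 ⊗ₜ ξ.app Y.2)
        (boxMap1 (Func.id B) F _ _ _ _ (BoxH1.inr (g ⊗ₜ q))) =
            BoxH1.inr (g ⊗ₜ ξ.hty X.2 Y.2 (C.d q))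
    rw [id_boxMap1_inr, id_boxMap1_inr, boxC10_inr, boxC01_inr, ← map_sub, ← hξ.hty_d,
      TensorProduct.tmul_sub, B.c00_one, B.one_c00]
  · exact congrArg BoxH1.inr ((congrArg (B.one X.1 ⊗ₜ[R] ·) (hξ.hty_one X.2)).trans
      (TensorProduct.tmul_zero _ _))
  · change BoxH1.inr (B.c00 g' g ⊗ₜ ξ.hty X.2 Z.2 (C.c00 f' f)) =
      boxC10 B D X.1 Y.1 Z.1 (F.obj X.2) (F.obj Y.2) (G.obj Z.2)
        (BoxH1.inr (g' ⊗ₜ ξ.hty Y.2 Z.2 f')) (g ⊗ₜ F.map0 f) +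
      boxC01 B D X.1 Y.1 Z.1 (F.obj X.2) (G.obj Y.2) (G.obj Z.2) (g' ⊗ₜ G.map0 f')
        (BoxH1.inr (g ⊗ₜ ξ.hty X.2 Y.2 f))
    rw [boxC10_inr, boxC01_inr, hξ.hty_comp, TensorProduct.tmul_add, map_add]

end Whisker

end IsPseudonat

end CochCat

end

/-! ### The deformed associator and braiding as pseudonatural transformations -/

section

namespace CochCat

variable {R : Type u} [CommRing R] {C : CochCat.{u, v, w} R} {X Y X' Y' : C.Obj}

theorem idOfEq_symm_natural00 (h : X = Y) (h' : X' = Y') {f : C.H0 X X'} {g : C.H0 Y Y'}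
    (e : C.c00 (C.idOfEq h') f = C.c00 g (C.idOfEq h)) :
    C.c00 (C.idOfEq h'.symm) g = C.c00 f (C.idOfEq h.symm) := by
  subst h h'
  simpa only [idOfEq_self, C.one_c00, C.c00_one] using e.symm

theorem idOfEq_symm_natural01 (h : X = Y) (h' : X' = Y') {f : C.H1 X X'} {g : C.H1 Y Y'}
    (e : C.c01 (C.idOfEq h') f = C.c10 g (C.idOfEq h)) :
    C.c01 (C.idOfEq h'.symm) g = C.c10 f (C.idOfEq h.symm) := by
  subst h h'
  simpa only [idOfEq_self, C.one_c01, C.c10_one] using e.symm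

end CochCat

namespace CochCat.Func

variable {R : Type u} [CommRing R] {C : CochCat.{u, v, w} R} (T : Func (C.box C) C)

/-- This lemma and the next five evaluate the two threefold products on the three kinds of
generating homotopies. They translate between functors on the triple truncated tensor product and
the relations stated for generators. -/
theorem left3_map1_inl_inl {U V W U' V' W' : C.Obj} (f : C.H1 U U') (g : C.H0 V V')
    (k : C.H0 W W') :
    T.left3.map1 (X := ((U, V), W)) (Y := ((U', V'), W')) (BoxH1.inl (BoxH1.inl (f ⊗ₜ g) ⊗ₜ k)) =
      T.m10 (T.m10 f g) k :=
  congrArg (T.map1 (X := (T.o U V, W)) (Y := (T.o U' V', W')))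
    (boxMap1_id_inl T (U := (U, V)) (U' := (U', V')) _ k)

theorem left3_map1_inl_inr {U V W U' V' W' : C.Obj} (f : C.H0 U U') (g : C.H1 V V')
    (k : C.H0 W W') :
    T.left3.map1 (X := ((U, V), W)) (Y := ((U', V'), W')) (BoxH1.inl (BoxH1.inr (f ⊗ₜ g) ⊗ₜ k)) =
      T.m10 (T.m01 f g) k :=
  congrArg (T.map1 (X := (T.o U V, W)) (Y := (T.o U' V', W')))
    (boxMap1_id_inl T (U := (U, V)) (U' := (U', V')) _ k)

theorem left3_map1_inr {U V W U' V' W' : C.Obj} (f : C.H0 U U') (g : C.H0 V V')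
    (k : C.H1 W W') :
    T.left3.map1 (X := ((U, V), W)) (Y := ((U', V'), W')) (BoxH1.inr ((f ⊗ₜ g) ⊗ₜ k)) =
      T.m01 (T.m00 f g) k :=
  congrArg (T.map1 (X := (T.o U V, W)) (Y := (T.o U' V', W')))
    (boxMap1_id_inr T (U := (U, V)) (U' := (U', V')) _ k)

theorem right3_map1_inl_inl {U V W U' V' W' : C.Obj} (f : C.H1 U U') (g : C.H0 V V')
    (k : C.H0 W W') :
    T.right3.map1 (X := ((U, V), W)) (Y := ((U', V'), W')) (BoxH1.inl (BoxH1.inl (f ⊗ₜ g) ⊗ₜ k)) =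
      T.m10 f (T.m00 g k) := by
  change T.map1 (X := (U, T.o V W)) (Y := (U', T.o V' W')) (boxMap1 (Func.id C) T U U' (V, W)
    (V', W') (boxAssoc1 C C C (U, V) (U', V') W W' (BoxH1.inl (BoxH1.inl (f ⊗ₜ g) ⊗ₜ k)))) = _
  have e := boxAssoc1_inl_inl (X := (U, V)) (X' := (U', V')) f g k
  have e' := congrArg (boxMap1 (Func.id C) T U U' (V, W) (V', W')) e
  exact congrArg (T.map1 (X := (U, T.o V W)) (Y := (U', T.o V' W')))
    (e'.trans (id_boxMap1_inl T (U := (V, W)) (U' := (V', W')) f _))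

theorem right3_map1_inl_inr {U V W U' V' W' : C.Obj} (f : C.H0 U U') (g : C.H1 V V')
    (k : C.H0 W W') :
    T.right3.map1 (X := ((U, V), W)) (Y := ((U', V'), W')) (BoxH1.inl (BoxH1.inr (f ⊗ₜ g) ⊗ₜ k)) =
      T.m01 f (T.m10 g k) := by
  change T.map1 (X := (U, T.o V W)) (Y := (U', T.o V' W')) (boxMap1 (Func.id C) T U U' (V, W)
    (V', W') (boxAssoc1 C C C (U, V) (U', V') W W' (BoxH1.inl (BoxH1.inr (f ⊗ₜ g) ⊗ₜ k)))) = _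
  have e := boxAssoc1_inl_inr (X := (U, V)) (X' := (U', V')) f g k
  have e' := congrArg (boxMap1 (Func.id C) T U U' (V, W) (V', W')) e
  exact congrArg (T.map1 (X := (U, T.o V W)) (Y := (U', T.o V' W')))
    (e'.trans (id_boxMap1_inr T (U := (V, W)) (U' := (V', W')) f _))

theorem right3_map1_inr {U V W U' V' W' : C.Obj} (f : C.H0 U U') (g : C.H0 V V')
    (k : C.H1 W W') :
    T.right3.map1 (X := ((U, V), W)) (Y := ((U', V'), W')) (BoxH1.inr ((f ⊗ₜ g) ⊗ₜ k)) =
      T.m01 f (T.m01 g k) := by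
  change T.map1 (X := (U, T.o V W)) (Y := (U', T.o V' W')) (boxMap1 (Func.id C) T U U' (V, W)
    (V', W') (boxAssoc1 C C C (U, V) (U', V') W W' (BoxH1.inr ((f ⊗ₜ g) ⊗ₜ k)))) = _
  have e := boxAssoc1_inr (X := (U, V)) (X' := (U', V')) f g k
  have e' := congrArg (boxMap1 (Func.id C) T U U' (V, W) (V', W')) e
  exact congrArg (T.map1 (X := (U, T.o V W)) (Y := (U', T.o V' W')))
    (e'.trans (id_boxMap1_inr T (U := (V, W)) (U' := (V', W')) f _))

end CochCat.Func

namespace InfSym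

open CochCat.Arrow

variable {R : Type u} [CommRing R] (M : InfSym.{u, v, w} R)

local notation "𝐢" => CochCat.one (InfSym.C M)
local notation "𝐞" => CochCat.idOfEq (InfSym.C M)
local notation:80 f:81 " ⬝ " g:80 => CochCat.c00 (InfSym.C M) f g
local notation:80 f:81 " ◁ " q:80 => CochCat.c01 (InfSym.C M) f q
local notation:80 q:81 " ▷ " f:80 => CochCat.c10 (InfSym.C M) q f
local notation:90 U:90 " ⋆ " V:91 => Func.o (InfSym.T M) U V

/-- The identity transformation from `(U V) W` to `U (V W)`. -/
def assocHom : PreTrans ((M.C.box M.C).box M.C) M.C M.T.left3.obj M.T.right3.obj :=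
  PreTrans.ofEq fun X => M.assoc X.1.1 X.1.2 X.2

/-- The identity transformation from `U (V W)` to `(U V) W`. -/
def assocInv : PreTrans ((M.C.box M.C).box M.C) M.C M.T.right3.obj M.T.left3.obj :=
  PreTrans.ofEq fun X => (M.assoc X.1.1 X.1.2 X.2).symm

theorem assoc_map0 {X Y : (M.C.Obj × M.C.Obj) × M.C.Obj}
    (f : ((M.C.box M.C).box M.C).H0 X Y) :
    M.assocHom.app Y ⬝ M.T.left3.map0 f =
      M.T.right3.map0 f ⬝ M.assocHom.app X := by
  induction f using TensorProduct.induction_on with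
  | zero => simp only [map_zero, LinearMap.zero_apply]
  | add x y hx hy => rw [map_add, map_add, map_add, map_add, LinearMap.add_apply, hx, hy]
  | tmul f k =>
    induction f using TensorProduct.induction_on with
    | zero => simp only [TensorProduct.zero_tmul, map_zero, LinearMap.zero_apply]
    | add x y hx hy =>
      rw [TensorProduct.add_tmul, map_add, map_add, map_add, map_add, LinearMap.add_apply, hx, hy]
    | tmul f g => exact M.assoc000 f g k

theorem assoc_map1 {X Y : (M.C.Obj × M.C.Obj) × M.C.Obj}
    (q : ((M.C.box M.C).box M.C).H1 X Y) :
    M.assocHom.app Y ◁ M.T.left3.map1 q =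
      M.T.right3.map1 q ▷ M.assocHom.app X := by
  induction q using BoxH1.ind with
  | ha x y hx hy => rw [map_add, map_add, map_add, map_add, LinearMap.add_apply, hx, hy]
  | hl q k =>
    induction q using BoxH1.ind with
    | ha x y hx hy =>
      rw [TensorProduct.add_tmul, map_add, map_add, map_add, map_add, map_add, LinearMap.add_apply,
          hx, hy]
    | hl q g =>
      refine (congrArg _ (M.T.left3_map1_inl_inl q g k)).trans ((M.assoc100 q g k).trans ?_)
      exact congrArg (· ▷ _) (M.T.right3_map1_inl_inl q g k).symm
    | hr f q =>
      refine (congrArg _ (M.T.left3_map1_inl_inr f q k)).trans ((M.assoc010 f q k).trans ?_)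
      exact congrArg (· ▷ _) (M.T.right3_map1_inl_inr f q k).symm
  | hr f q =>
    induction f using TensorProduct.induction_on with
    | zero => simp only [TensorProduct.zero_tmul, map_zero, LinearMap.zero_apply]
    | add x y hx hy =>
      rw [TensorProduct.add_tmul, map_add, map_add, map_add, map_add, map_add, LinearMap.add_apply,
          hx, hy]
    | tmul f g =>
      refine (congrArg _ (M.T.left3_map1_inr f g q)).trans ((M.assoc001 f g q).trans ?_)
      exact congrArg (· ▷ _) (M.T.right3_map1_inr f g q).symm

theorem assocHom_pseudonat : IsPseudonat M.T.left3 M.T.right3 M.assocHom :=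
  .of_natural (fun _ _ => rfl) M.assoc_map0 M.assoc_map1

theorem assocInv_pseudonat : IsPseudonat M.T.right3 M.T.left3 M.assocInv :=
  .of_natural (fun _ _ => rfl) (fun f => idOfEq_symm_natural00 _ _ (M.assoc_map0 f))
    (fun q => idOfEq_symm_natural01 _ _ (M.assoc_map1 q))

/-- The inverse `γ_{VU}` of the symmetric braiding. -/
def braidInv : PreTrans (M.C.box M.C) M.C ((boxSwap M.C M.C).comp M.T).obj M.T.obj where
  app X := M.γ X.2 X.1
  hty _ _ := 0

theorem braidInv_pseudonat : IsPseudonat ((boxSwap M.C M.C).comp M.T) M.T M.braidInv := by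
  refine .of_tmul (fun {X Y} f g => ?_) (fun {X Y} q g => ?_) (fun {X Y} f q => ?_)
    (fun _ => rfl) (fun {X Y Z} f' g' f g => ?_)
  · exact (sub_eq_zero.2 (M.γ_nat g f).symm).trans (map_zero _).symm
  · have e : ((boxSwap M.C M.C).comp M.T).map1 (X := X) (Y := Y) (BoxH1.inl (q ⊗ₜ g))
      = M.T.m01 g q := congrArg (M.T.map1 (X := (X.2, X.1)) (Y := (Y.2, Y.1))) (boxSwap1_inl q g)
    rw [e]
    exact sub_eq_zero.2 (M.γ_m01 g q).symm
  · have e : ((boxSwap M.C M.C).comp M.T).map1 (X := X) (Y := Y) (BoxH1.inr (f ⊗ₜ q))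
      = M.T.m10 q f := congrArg (M.T.map1 (X := (X.2, X.1)) (Y := (Y.2, Y.1))) (boxSwap1_inr f q)
    rw [e]
    exact sub_eq_zero.2 (M.γ_m10 q f).symm
  · change 0 = M.C.c10 0 _ + M.C.c01 _ 0
    rw [LinearMap.map_zero₂, map_zero, add_zero]

/-- `t₁₂ = t ⊗ 1`, on `(U V) W`. -/
def t12 : PreTrans ((M.C.box M.C).box M.C) M.C M.T.left3.obj M.T.left3.obj :=
  (M.t.boxOne M.C).post M.T

/-- `t₂₃ = 1 ⊗ t`, on `(U V) W`. -/
def t23 : PreTrans ((M.C.box M.C).box M.C) M.C M.T.left3.obj M.T.left3.obj :=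
  PreTrans.comp _ _ M.assocInv
    (PreTrans.comp _ _ (((M.t.oneBox M.C).post M.T).pre (boxAssoc M.C M.C M.C)) M.assocHom)

/-- The commutator `[t₁₂, t₂₃]`. -/
def t12t23 : PreTrans ((M.C.box M.C).box M.C) M.C M.T.left3.obj M.T.left3.obj :=
  PreTrans.comp _ _ M.t12 M.t23 - PreTrans.comp _ _ M.t23 M.t12

variable (k c : R)

/-- The associator `1 + c [t₁₂, t₂₃]`. -/
def αHom : PreTrans ((M.C.box M.C).box M.C) M.C M.T.left3.obj M.T.right3.obj :=
  PreTrans.comp _ _ M.assocHom (PreTrans.one _ + c • M.t12t23)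

/-- The inverse associator `1 - c [t₁₂, t₂₃]`. -/
def αInv : PreTrans ((M.C.box M.C).box M.C) M.C M.T.right3.obj M.T.left3.obj :=
  PreTrans.comp _ _ (PreTrans.one _ - c • M.t12t23) M.assocInv

/-- The braiding `γ (1 + k t + 3 c t²)`. -/
def σHom : PreTrans (M.C.box M.C) M.C M.T.obj ((boxSwap M.C M.C).comp M.T).obj :=
  PreTrans.comp _ _ M.braid
    (PreTrans.one _ + k • M.t + (3 * c) • PreTrans.comp _ _ M.t M.t)

/-- The inverse braiding `(1 - k t + 3 c t²) γ`. -/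
def σInv : PreTrans (M.C.box M.C) M.C ((boxSwap M.C M.C).comp M.T).obj M.T.obj :=
  PreTrans.comp _ _ (PreTrans.one _ - k • M.t + (3 * c) • PreTrans.comp _ _ M.t M.t) M.braidInv

theorem t12_pseudonat : IsPseudonat M.T.left3 M.T.left3 M.t12 := M.t_pseudonat.boxOne.post M.T

theorem t23_pseudonat : IsPseudonat M.T.left3 M.T.left3 M.t23 :=
  M.assocInv_pseudonat.comp (((M.t_pseudonat.oneBox.post M.T).pre (boxAssoc M.C M.C M.C)).comp
    M.assocHom_pseudonat)

theorem t12t23_pseudonat : IsPseudonat M.T.left3 M.T.left3 M.t12t23 :=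
  (M.t12_pseudonat.comp M.t23_pseudonat).sub (M.t23_pseudonat.comp M.t12_pseudonat)

theorem αHom_pseudonat : IsPseudonat M.T.left3 M.T.right3 (M.αHom c) :=
  M.assocHom_pseudonat.comp ((IsPseudonat.one _).add (M.t12t23_pseudonat.smul c))

theorem αInv_pseudonat : IsPseudonat M.T.right3 M.T.left3 (M.αInv c) :=
  ((IsPseudonat.one _).sub (M.t12t23_pseudonat.smul c)).comp M.assocInv_pseudonat

theorem σHom_pseudonat : IsPseudonat M.T ((boxSwap M.C M.C).comp M.T) (M.σHom k c) :=
  M.braid_pseudonat.comp (((IsPseudonat.one _).add (M.t_pseudonat.smul k)).add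
    ((M.t_pseudonat.comp M.t_pseudonat).smul (3 * c)))

theorem σInv_pseudonat : IsPseudonat ((boxSwap M.C M.C).comp M.T) M.T (M.σInv k c) :=
  (((IsPseudonat.one _).sub (M.t_pseudonat.smul k)).add
    ((M.t_pseudonat.comp M.t_pseudonat).smul (3 * c))).comp M.braidInv_pseudonat

end InfSym

end

/-! ### Transformations at a 1-cell as squares -/

section

namespace CochCat.Arrow

variable {R : Type u} [CommRing R] {C D : CochCat.{u, v, w} R} {F G H : C.Obj → D.Obj}

/-- A 1-cell, as an object of the category of arrows. -/
def of {X Y : D.Obj} (f : D.H0 X Y) : D.arr.Obj := Arrow.mk X Y f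

/-- The square `p` consists of the components of `ξ` at `f` and at its source and target. -/
structure IsSquareOf (ξ : PreTrans C D F G) {X Y : C.Obj} (f : C.H0 X Y) {a : D.H0 (F X) (F Y)}
    {b : D.H0 (G X) (G Y)} (p : D.arr.H0 (Arrow.of a) (Arrow.of b)) : Prop where
  onSrc_eq : onSrc p = ξ.app X
  onTgt_eq : onTgt p = ξ.app Y
  fill_eq : fill p = ξ.hty X Y f

namespace IsSquareOf

variable {X Y : C.Obj} {f : C.H0 X Y} {a : D.H0 (F X) (F Y)} {b : D.H0 (G X) (G Y)}
  {c : D.H0 (H X) (H Y)}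

theorem one (F : C.Obj → D.Obj) (f : C.H0 X Y) (a : D.H0 (F X) (F Y)) :
    IsSquareOf (PreTrans.one F) f (D.arr.one (Arrow.of a)) := ⟨rfl, rfl, rfl⟩

variable {ξ : PreTrans C D F G} {p : D.arr.H0 (Arrow.of a) (Arrow.of b)}

/-- The homotopy component θ_f ξ_U + θ_{U'} ξ_f of a vertical composite is precisely the filling of
the pasted square. -/
theorem comp {θ : PreTrans C D G H} {q : D.arr.H0 (Arrow.of b) (Arrow.of c)}
    (hq : IsSquareOf θ f q) (hp : IsSquareOf ξ f p) :
    IsSquareOf (PreTrans.comp C D θ ξ) f (D.arr.c00 q p) where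
  onSrc_eq := congrArg₂ (fun x y => D.c00 x y) hq.onSrc_eq hp.onSrc_eq
  onTgt_eq := congrArg₂ (fun x y => D.c00 x y) hq.onTgt_eq hp.onTgt_eq
  fill_eq := congrArg₂ (· + ·) (congrArg₂ (fun x y => D.c10 x y) hq.fill_eq hp.onSrc_eq)
    (congrArg₂ (fun x y => D.c01 x y) hq.onTgt_eq hp.fill_eq)

theorem add {θ : PreTrans C D F G} {q : D.arr.H0 (Arrow.of a) (Arrow.of b)}
    (hp : IsSquareOf ξ f p) (hq : IsSquareOf θ f q) : IsSquareOf (ξ + θ) f (p + q) where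
  onSrc_eq := (map_add onSrc p q).trans (congrArg₂ (· + ·) hp.onSrc_eq hq.onSrc_eq)
  onTgt_eq := (map_add onTgt p q).trans (congrArg₂ (· + ·) hp.onTgt_eq hq.onTgt_eq)
  fill_eq := (map_add fill p q).trans (congrArg₂ (· + ·) hp.fill_eq hq.fill_eq)

theorem sub {θ : PreTrans C D F G} {q : D.arr.H0 (Arrow.of a) (Arrow.of b)}
    (hp : IsSquareOf ξ f p) (hq : IsSquareOf θ f q) : IsSquareOf (ξ - θ) f (p - q) where
  onSrc_eq := (map_sub onSrc p q).trans (congrArg₂ (· - ·) hp.onSrc_eq hq.onSrc_eq)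
  onTgt_eq := (map_sub onTgt p q).trans (congrArg₂ (· - ·) hp.onTgt_eq hq.onTgt_eq)
  fill_eq := (map_sub fill p q).trans (congrArg₂ (· - ·) hp.fill_eq hq.fill_eq)

theorem smul (r : R) (hp : IsSquareOf ξ f p) : IsSquareOf (r • ξ) f (r • p) where
  onSrc_eq := (map_smul onSrc r p).trans (congrArg (r • ·) hp.onSrc_eq)
  onTgt_eq := (map_smul onTgt r p).trans (congrArg (r • ·) hp.onTgt_eq)
  fill_eq := (map_smul fill r p).trans (congrArg (r • ·) hp.fill_eq)

theorem pre {B : CochCat.{u, v, w} R} {P : Func B C} {X Y : B.Obj} {f : B.H0 X Y}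
    {a : D.H0 (F (P.obj X)) (F (P.obj Y))} {b : D.H0 (G (P.obj X)) (G (P.obj Y))}
    {p : D.arr.H0 (Arrow.of a) (Arrow.of b)} (hp : IsSquareOf ξ (P.map0 f) p) :
    IsSquareOf (ξ.pre P) f p := ⟨hp.onSrc_eq, hp.onTgt_eq, hp.fill_eq⟩

end IsSquareOf

end CochCat.Arrow

namespace InfSym

open CochCat.Arrow

variable {R : Type u} [CommRing R] (M : InfSym.{u, v, w} R)

local notation "𝐢" => CochCat.one (InfSym.C M)
local notation "𝐞" => CochCat.idOfEq (InfSym.C M)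
local notation:80 f:81 " ⬝ " g:80 => CochCat.c00 (InfSym.C M) f g
local notation:80 f:81 " ◁ " q:80 => CochCat.c01 (InfSym.C M) f q
local notation:80 q:81 " ▷ " f:80 => CochCat.c10 (InfSym.C M) q f
local notation:90 U:90 " ⋆ " V:91 => Func.o (InfSym.T M) U V

section

variable {B : CochCat.{u, v, w} R} {F G : B.Obj → M.C.Obj} {ξ : PreTrans B M.C F G} {X Y : B.Obj}
  {f : B.H0 X Y} {a : M.C.H0 (F X) (F Y)} {b : M.C.H0 (G X) (G Y)}
  {p : M.C.arr.H0 (Arrow.of a) (Arrow.of b)} {U U' : M.C.Obj} (g : M.C.H0 U U')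

/-- Tensoring a transformation with the identity and evaluating at f ⊠ g amounts to whiskering a
square by g, regarded as an object of the category of arrows. This is why whiskerings suffice for
the abstract computation. -/
theorem isSquareOf_boxOne (hp : IsSquareOf ξ f p) :
    IsSquareOf ((ξ.boxOne M.C).post M.T) (X := (X, U)) (Y := (Y, U')) (f ⊗ₜ g)
      (M.arrWhisk.r0 (Arrow.of g) p) where
  onSrc_eq := congrArg (fun x => M.T.m00 x (𝐢 _)) hp.onSrc_eq
  onTgt_eq := congrArg (fun x => M.T.m00 x (𝐢 _)) hp.onTgt_eq
  fill_eq := congrArg (fun x => M.T.m10 x g) hp.fill_eq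

theorem isSquareOf_oneBox (hp : IsSquareOf ξ f p) :
    IsSquareOf ((ξ.oneBox M.C).post M.T) (X := (U, X)) (Y := (U', Y)) (g ⊗ₜ f)
      (M.arrWhisk.l0 (Arrow.of g) p) where
  onSrc_eq := congrArg (fun x => M.T.m00 (𝐢 _) x) hp.onSrc_eq
  onTgt_eq := congrArg (fun x => M.T.m00 (𝐢 _) x) hp.onTgt_eq
  fill_eq := congrArg (fun x => M.T.m01 g x) hp.fill_eq

end

section

variable {U V W U' V' W' : M.C.Obj} (f : M.C.H0 U U') (g : M.C.H0 V V') (k : M.C.H0 W W')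

theorem isSquareOf_assocHom :
    IsSquareOf M.assocHom (X := ((U, V), W)) (Y := ((U', V'), W')) ((f ⊗ₜ g) ⊗ₜ k)
      (M.arrWhisk.ac (Arrow.of f) (Arrow.of g) (Arrow.of k)) :=
  ⟨onSrc_idOfEq _, onTgt_idOfEq _, fill_idOfEq _⟩

theorem isSquareOf_assocInv :
    IsSquareOf M.assocInv (X := ((U, V), W)) (Y := ((U', V'), W')) ((f ⊗ₜ g) ⊗ₜ k)
      (M.arrWhisk.ac' (Arrow.of f) (Arrow.of g) (Arrow.of k)) :=
  ⟨onSrc_idOfEq _, onTgt_idOfEq _, fill_idOfEq _⟩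

theorem isSquareOf_braid :
    IsSquareOf M.braid (X := (U, V)) (Y := (U', V')) (f ⊗ₜ g)
      (M.arrWhisk.γ (Arrow.of f) (Arrow.of g)) :=
  ⟨rfl, rfl, (LinearMap.congr_fun (M.braid_hty (U, V) (U', V')) (f ⊗ₜ g)).symm⟩

theorem isSquareOf_braidInv :
    IsSquareOf M.braidInv (X := (U, V)) (Y := (U', V')) (f ⊗ₜ g)
      (M.arrWhisk.γ (Arrow.of g) (Arrow.of f)) :=
  ⟨rfl, rfl, rfl⟩

theorem isSquareOf_t :
    IsSquareOf M.t (X := (U, V)) (Y := (U', V')) (f ⊗ₜ g)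
      (M.arrWhisk.ta (Arrow.of f) (Arrow.of g)) :=
  ⟨rfl, rfl, rfl⟩

theorem isSquareOf_t12 :
    IsSquareOf M.t12 (X := ((U, V), W)) (Y := ((U', V'), W')) ((f ⊗ₜ g) ⊗ₜ k)
      (M.arrWhisk.r0 (Arrow.of k) (M.arrWhisk.ta (Arrow.of f) (Arrow.of g))) :=
  M.isSquareOf_boxOne k (M.isSquareOf_t f g)

theorem isSquareOf_t23 :
    IsSquareOf M.t23 (X := ((U, V), W)) (Y := ((U', V'), W')) ((f ⊗ₜ g) ⊗ₜ k)
      (M.arrWhisk.C.c00 (M.arrWhisk.ac' (Arrow.of f) (Arrow.of g) (Arrow.of k))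
        (M.arrWhisk.C.c00 (M.arrWhisk.l0 (Arrow.of f)
          (M.arrWhisk.ta (Arrow.of g) (Arrow.of k)))
        (M.arrWhisk.ac (Arrow.of f) (Arrow.of g) (Arrow.of k)))) :=
  (M.isSquareOf_assocInv f g k).comp (.comp (.pre (M.isSquareOf_oneBox f (M.isSquareOf_t g k)))
    (M.isSquareOf_assocHom f g k))

theorem isSquareOf_t12t23 :
    IsSquareOf M.t12t23 (X := ((U, V), W)) (Y := ((U', V'), W')) ((f ⊗ₜ g) ⊗ₜ k)
      (M.arrWhisk.tc (Arrow.of f) (Arrow.of g) (Arrow.of k)) :=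
  .sub (.comp (M.isSquareOf_t12 f g k) (M.isSquareOf_t23 f g k))
    (.comp (M.isSquareOf_t23 f g k) (M.isSquareOf_t12 f g k))

variable (h c : R)

theorem isSquareOf_αHom :
    IsSquareOf (M.αHom c) (X := ((U, V), W)) (Y := ((U', V'), W')) ((f ⊗ₜ g) ⊗ₜ k)
      (M.arrWhisk.α c (Arrow.of f) (Arrow.of g) (Arrow.of k)) :=
  .comp (M.isSquareOf_assocHom f g k)
    (.add (.one M.T.left3.obj _ _) (.smul c (M.isSquareOf_t12t23 f g k)))

theorem isSquareOf_αInv :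
    IsSquareOf (M.αInv c) (X := ((U, V), W)) (Y := ((U', V'), W')) ((f ⊗ₜ g) ⊗ₜ k)
      (M.arrWhisk.α' c (Arrow.of f) (Arrow.of g) (Arrow.of k)) :=
  .comp (.sub (.one M.T.left3.obj _ _) (.smul c (M.isSquareOf_t12t23 f g k)))
    (M.isSquareOf_assocInv f g k)

theorem isSquareOf_σHom :
    IsSquareOf (M.σHom h c) (X := (U, V)) (Y := (U', V')) (f ⊗ₜ g)
      (M.arrWhisk.σ h c (Arrow.of f) (Arrow.of g)) :=
  .comp (M.isSquareOf_braid f g) (.add (.add (.one M.T.obj _ _) (.smul h (M.isSquareOf_t f g)))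
    (.smul (3 * c) (.comp (M.isSquareOf_t f g) (M.isSquareOf_t f g))))

theorem isSquareOf_σInv :
    IsSquareOf (M.σInv h c) (X := (U, V)) (Y := (U', V')) (f ⊗ₜ g)
      (M.arrWhisk.σ' h c (Arrow.of f) (Arrow.of g)) :=
  .comp (.add (.sub (.one M.T.obj _ _) (.smul h (M.isSquareOf_t f g)))
    (.smul (3 * c) (.comp (M.isSquareOf_t f g) (M.isSquareOf_t f g)))) (M.isSquareOf_braidInv f g)

end

end InfSym

end

/-! ### Assembly of the braided structure -/

section

namespace CochCat.Arrow

variable {R : Type u} [CommRing R] {C D : CochCat.{u, v, w} R}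

/-- The filling of ∂(q₁, q₂) is b q₁ - q₂ a, so the filling of the equation p - p' = ∂q says ξ_f -
ξ'_f = b q₁ - q₂ a. Hence the differential formula for a hexagon over arrows contains the
modification axiom. -/
theorem IsSquareOf.modification {F G : C.Obj → D.Obj} {ξ ξ' : PreTrans C D F G} {X Y : C.Obj}
    {f : C.H0 X Y} {a : D.H0 (F X) (F Y)} {b : D.H0 (G X) (G Y)} {p p' : D.arr.H0 (of a) (of b)}
    (hp : IsSquareOf ξ f p) (hp' : IsSquareOf ξ' f p') {q : D.arr.H1 (of a) (of b)}
    {q₁ : D.H1 (F X) (G X)} {q₂ : D.H1 (F Y) (G Y)}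
    (h : p - p' = D.arr.d q) (h₁ : q.1 = q₁) (h₂ : q.2 = q₂) :
    D.c10 q₂ a + ξ.hty X Y f = ξ'.hty X Y f + D.c01 b q₁ := by
  subst h₁ h₂
  have h := congrArg fill h
  rw [map_sub, hp.fill_eq, hp'.fill_eq] at h
  refine (add_comm _ _).trans ((sub_eq_sub_iff_add_eq_add.1 h).trans (add_comm _ _))

end CochCat.Arrow

/-- The axiom is linear in the 1-cell, so triple products f ⊠ g ⊠ l suffice. The values of the two
functors at such products are passed as `a` and `b`, so that composites of permutation and product
functors are described once by simple formulas. -/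
theorem CochCat.app_hty_of_tmul {R : Type u} [CommRing R] {C D : CochCat.{u, v, w} R}
    {F G : Func ((C.box C).box C) D} {ξ ξ' : PreTrans ((C.box C).box C) D F.obj G.obj}
    {X Y : (C.Obj × C.Obj) × C.Obj} {p : D.H1 (F.obj X) (G.obj X)} {q : D.H1 (F.obj Y) (G.obj Y)}
    {a : C.H0 X.1.1 Y.1.1 → C.H0 X.1.2 Y.1.2 → C.H0 X.2 Y.2 → D.H0 (F.obj X) (F.obj Y)}
    {b : C.H0 X.1.1 Y.1.1 → C.H0 X.1.2 Y.1.2 → C.H0 X.2 Y.2 → D.H0 (G.obj X) (G.obj Y)}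
    (ha : ∀ f g l, F.map0 (X := X) (Y := Y) ((f ⊗ₜ g) ⊗ₜ l) = a f g l)
    (hb : ∀ f g l, G.map0 (X := X) (Y := Y) ((f ⊗ₜ g) ⊗ₜ l) = b f g l)
    (h : ∀ f g l, D.c10 q (a f g l) + ξ.hty X Y ((f ⊗ₜ g) ⊗ₜ l) =
        ξ'.hty X Y ((f ⊗ₜ g) ⊗ₜ l) + D.c01 (b f g l) p)
    (f : ((C.box C).box C).H0 X Y) :
    D.c10 q (F.map0 f) + ξ.hty X Y f = ξ'.hty X Y f + D.c01 (G.map0 f) p := by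
  have e : D.c10 q ∘ₗ F.map0 (X := X) (Y := Y) + ξ.hty X Y =
      ξ'.hty X Y + D.c01.flip p ∘ₗ G.map0 (X := X) (Y := Y) :=
    TensorProduct.ext_threefold fun f g l => by
      have := h f g l
      rw [← ha, ← hb] at this
      exact this
  exact LinearMap.congr_fun e f

namespace InfSym

open CochCat.Arrow

variable {R : Type u} [CommRing R] (M : InfSym.{u, v, w} R)

local notation "𝐢" => CochCat.one (InfSym.C M)
local notation "𝐞" => CochCat.idOfEq (InfSym.C M)
local notation:80 f:81 " ⬝ " g:80 => CochCat.c00 (InfSym.C M) f g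
local notation:80 f:81 " ◁ " q:80 => CochCat.c01 (InfSym.C M) f q
local notation:80 q:81 " ▷ " f:80 => CochCat.c10 (InfSym.C M) q f
local notation:90 U:90 " ⋆ " V:91 => Func.o (InfSym.T M) U V

variable {k c : R} (hk : IsOrderTwo k c)

section

variable {U V W X U' V' W' X' : M.C.Obj} (f : M.C.H0 U U') (g : M.C.H0 V V') (l : M.C.H0 W W')
  (m : M.C.H0 X X')

theorem isSquareOf_pentagonSource :
    IsSquareOf (pentagonSource (M.αHom c)) (X := (((U, V), W), X)) (Y := (((U', V'), W'), X'))
      (((f ⊗ₜ g) ⊗ₜ l) ⊗ₜ m)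
      (M.arrWhisk.C.c00 (M.arrWhisk.l0 (of f) (M.arrWhisk.α c (of g) (of l) (of m)))
        (M.arrWhisk.C.c00 (M.arrWhisk.α c (of f) (M.arrWhisk.o (of g) (of l)) (of m))
          (M.arrWhisk.r0 (of m) (M.arrWhisk.α c (of f) (of g) (of l))))) :=
  .comp (.pre (M.isSquareOf_oneBox f (M.isSquareOf_αHom g l m c)))
    (.comp (.pre (M.isSquareOf_αHom f (M.T.m00 g l) m c))
      (M.isSquareOf_boxOne m (M.isSquareOf_αHom f g l c)))

theorem isSquareOf_pentagonTarget :
    IsSquareOf (pentagonTarget (M.αHom c)) (X := (((U, V), W), X)) (Y := (((U', V'), W'), X'))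
      (((f ⊗ₜ g) ⊗ₜ l) ⊗ₜ m)
      (M.arrWhisk.C.c00 (M.arrWhisk.α c (of f) (of g) (M.arrWhisk.o (of l) (of m)))
        (M.arrWhisk.α c (M.arrWhisk.o (of f) (of g)) (of l) (of m))) :=
  .comp (.pre (M.isSquareOf_αHom f g (M.T.m00 l m) c))
    (.pre (M.isSquareOf_αHom (M.T.m00 f g) l m c))

theorem isSquareOf_hexLSource :
    IsSquareOf (hexLSource (M.αHom c) (M.σHom k c)) (X := ((U, V), W)) (Y := ((U', V'), W'))
      ((f ⊗ₜ g) ⊗ₜ l)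
      (M.arrWhisk.C.c00 (M.arrWhisk.α c (of g) (of l) (of f))
        (M.arrWhisk.C.c00 (M.arrWhisk.σ k c (of f) (M.arrWhisk.o (of g) (of l)))
          (M.arrWhisk.α c (of f) (of g) (of l)))) :=
  .comp (.pre (M.isSquareOf_αHom g l f c))
    (.comp (.pre (M.isSquareOf_σHom f (M.T.m00 g l) k c)) (M.isSquareOf_αHom f g l c))

theorem isSquareOf_hexLTarget :
    IsSquareOf (hexLTarget (M.αHom c) (M.σHom k c)) (X := ((U, V), W)) (Y := ((U', V'), W'))
      ((f ⊗ₜ g) ⊗ₜ l)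
      (M.arrWhisk.C.c00 (M.arrWhisk.l0 (of g) (M.arrWhisk.σ k c (of f) (of l)))
        (M.arrWhisk.C.c00 (M.arrWhisk.α c (of g) (of f) (of l))
          (M.arrWhisk.r0 (of l) (M.arrWhisk.σ k c (of f) (of g))))) :=
  .comp (.pre (M.isSquareOf_oneBox g (M.isSquareOf_σHom f l k c)))
    (.comp (.pre (M.isSquareOf_αHom g f l c))
      (M.isSquareOf_boxOne l (M.isSquareOf_σHom f g k c)))

theorem isSquareOf_hexRSource :
    IsSquareOf (hexRSource (M.αInv c) (M.σHom k c)) (X := ((U, V), W)) (Y := ((U', V'), W'))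
      ((f ⊗ₜ g) ⊗ₜ l)
      (M.arrWhisk.C.c00 (M.arrWhisk.α' c (of l) (of f) (of g))
        (M.arrWhisk.C.c00 (M.arrWhisk.σ k c (M.arrWhisk.o (of f) (of g)) (of l))
          (M.arrWhisk.α' c (of f) (of g) (of l)))) :=
  .comp (.pre (M.isSquareOf_αInv l f g c))
    (.comp (.pre (M.isSquareOf_σHom (M.T.m00 f g) l k c)) (M.isSquareOf_αInv f g l c))

theorem isSquareOf_hexRTarget :
    IsSquareOf (hexRTarget (M.αInv c) (M.σHom k c)) (X := ((U, V), W)) (Y := ((U', V'), W'))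
      ((f ⊗ₜ g) ⊗ₜ l)
      (M.arrWhisk.C.c00 (M.arrWhisk.r0 (of g) (M.arrWhisk.σ k c (of f) (of l)))
        (M.arrWhisk.C.c00 (M.arrWhisk.α' c (of f) (of l) (of g))
          (M.arrWhisk.l0 (of f) (M.arrWhisk.σ k c (of g) (of l))))) :=
  .comp (.pre (M.isSquareOf_boxOne g (M.isSquareOf_σHom f l k c)))
    (.comp (.pre (M.isSquareOf_αInv f l g c))
      (.pre (M.isSquareOf_oneBox f (M.isSquareOf_σHom g l k c))))

end

/-- Everything except the rebracketings projects definitionally from the category of arrows. These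
are therefore abstracted as variables and compared by `onSrc_idOfEq`; the three companions work in
the same way. -/
theorem infHexL_fst (x y z : M.C.arr.Obj) :
    (M.arrWhisk.infHexL x y z).1 = M.whisk.infHexL (src x) (src y) (src z) :=
  congr (congrArg₂ (fun (p : M.C.H0 ((src x ⋆ src y) ⋆ src z) (src x ⋆ (src y ⋆ src z)))
      (q : M.C.H0 (src x ⋆ (src y ⋆ src z)) ((src x ⋆ src y) ⋆ src z))
      (r : M.C.H0 ((src y ⋆ src z) ⋆ src x) (src y ⋆ (src z ⋆ src x))) =>
      (r ⬝ (M.γ _ _ ⬝ p)) ◁ ((2 : R) • M.th (M.ta (src x) (src y)) (𝐢 (src z)) +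
        q ◁ (M.th (𝐢 (src x)) (M.ta (src y) (src z)) ▷ p)))
    (onSrc_idOfEq _) (onSrc_idOfEq _)) (onSrc_idOfEq _)

theorem infHexL_snd (x y z : M.C.arr.Obj) :
    (M.arrWhisk.infHexL x y z).2 = M.whisk.infHexL (tgt x) (tgt y) (tgt z) :=
  congr (congrArg₂ (fun (p : M.C.H0 ((tgt x ⋆ tgt y) ⋆ tgt z) (tgt x ⋆ (tgt y ⋆ tgt z)))
      (q : M.C.H0 (tgt x ⋆ (tgt y ⋆ tgt z)) ((tgt x ⋆ tgt y) ⋆ tgt z))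
      (r : M.C.H0 ((tgt y ⋆ tgt z) ⋆ tgt x) (tgt y ⋆ (tgt z ⋆ tgt x))) =>
      (r ⬝ (M.γ _ _ ⬝ p)) ◁ ((2 : R) • M.th (M.ta (tgt x) (tgt y)) (𝐢 (tgt z)) +
        q ◁ (M.th (𝐢 (tgt x)) (M.ta (tgt y) (tgt z)) ▷ p)))
    (onTgt_idOfEq _) (onTgt_idOfEq _)) (onTgt_idOfEq _)

theorem infHexR_fst (x y z : M.C.arr.Obj) :
    (M.arrWhisk.infHexR x y z).1 = M.whisk.infHexR (src x) (src y) (src z) :=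
  congr (congrArg₂ (fun (p : M.C.H0 ((src x ⋆ src y) ⋆ src z) (src x ⋆ (src y ⋆ src z)))
      (q : M.C.H0 (src x ⋆ (src y ⋆ src z)) ((src x ⋆ src y) ⋆ src z))
      (r : M.C.H0 (src z ⋆ (src x ⋆ src y)) ((src z ⋆ src x) ⋆ src y)) =>
      (r ⬝ (M.γ _ _ ⬝ q)) ◁ (p ◁ (M.th (M.ta (src x) (src y)) (𝐢 (src z)) ▷ q) +
        (2 : R) • M.th (𝐢 (src x)) (M.ta (src y) (src z))))
    (onSrc_idOfEq _) (onSrc_idOfEq _)) (onSrc_idOfEq _)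

theorem infHexR_snd (x y z : M.C.arr.Obj) :
    (M.arrWhisk.infHexR x y z).2 = M.whisk.infHexR (tgt x) (tgt y) (tgt z) :=
  congr (congrArg₂ (fun (p : M.C.H0 ((tgt x ⋆ tgt y) ⋆ tgt z) (tgt x ⋆ (tgt y ⋆ tgt z)))
      (q : M.C.H0 (tgt x ⋆ (tgt y ⋆ tgt z)) ((tgt x ⋆ tgt y) ⋆ tgt z))
      (r : M.C.H0 (tgt z ⋆ (tgt x ⋆ tgt y)) ((tgt z ⋆ tgt x) ⋆ tgt y)) =>
      (r ⬝ (M.γ _ _ ⬝ q)) ◁ (p ◁ (M.th (M.ta (tgt x) (tgt y)) (𝐢 (tgt z)) ▷ q) +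
        (2 : R) • M.th (𝐢 (tgt x)) (M.ta (tgt y) (tgt z))))
    (onTgt_idOfEq _) (onTgt_idOfEq _)) (onTgt_idOfEq _)

section

variable {X Y : (M.C.Obj × M.C.Obj) × M.C.Obj} (f : M.C.H0 X.1.1 Y.1.1) (g : M.C.H0 X.1.2 Y.1.2)
  (l : M.C.H0 X.2 Y.2)

theorem left3_map0 : M.T.left3.map0 (X := X) (Y := Y) ((f ⊗ₜ g) ⊗ₜ l) = M.T.m00 (M.T.m00 f g) l :=
  rfl

theorem right3_map0 :
    M.T.right3.map0 (X := X) (Y := Y) ((f ⊗ₜ g) ⊗ₜ l) = M.T.m00 f (M.T.m00 g l) := rfl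

theorem perm231_map0 : ((perm231 M.C).comp M.T.right3).map0 (X := X) (Y := Y) ((f ⊗ₜ g) ⊗ₜ l) =
    M.T.m00 g (M.T.m00 l f) := rfl

theorem perm312_map0 : ((perm312 M.C).comp M.T.left3).map0 (X := X) (Y := Y) ((f ⊗ₜ g) ⊗ₜ l) =
    M.T.m00 (M.T.m00 l f) g := rfl

end

include hk

/-- The associator, as a pseudonatural isomorphism. -/
def αIso : PseudonatIso M.T.left3 M.T.right3 where
  hom := M.αHom c
  inv := M.αInv c
  hom_pseudonat := M.αHom_pseudonat c
  inv_pseudonat := M.αInv_pseudonat c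
  -- The same identity is used twice: over the original category it gives the components, and over
  -- the category of arrows its filling gives the homotopy components.
  inv_hom := PreTrans.ext (funext fun _ => M.whisk.α'_α hk _ _ _) (funext fun _ => funext fun _ =>
    TensorProduct.ext_threefold fun f g l =>
      (IsSquareOf.fill_eq (.comp (M.isSquareOf_αInv f g l c)
        (M.isSquareOf_αHom f g l c))).symm.trans
        (congrArg fill (M.arrWhisk.α'_α hk (of f) (of g) (of l))))
  hom_inv := PreTrans.ext (funext fun _ => M.whisk.α_α' hk _ _ _) (funext fun _ => funext fun _ =>
    TensorProduct.ext_threefold fun f g l =>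
      (IsSquareOf.fill_eq (.comp (M.isSquareOf_αHom f g l c)
        (M.isSquareOf_αInv f g l c))).symm.trans
        (congrArg fill (M.arrWhisk.α_α' hk (of f) (of g) (of l))))

/-- The braiding, as a pseudonatural isomorphism. -/
def σIso : PseudonatIso M.T ((boxSwap M.C M.C).comp M.T) where
  hom := M.σHom k c
  inv := M.σInv k c
  hom_pseudonat := M.σHom_pseudonat k c
  inv_pseudonat := M.σInv_pseudonat k c
  inv_hom := PreTrans.ext (funext fun _ => M.whisk.σ'_σ hk _ _) (funext fun _ => funext fun _ =>
    TensorProduct.ext' fun f g =>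
      (IsSquareOf.fill_eq (.comp (M.isSquareOf_σInv f g k c)
        (M.isSquareOf_σHom f g k c))).symm.trans
        (congrArg fill (M.arrWhisk.σ'_σ hk (of f) (of g))))
  hom_inv := PreTrans.ext (funext fun _ => M.whisk.σ_σ' hk _ _) (funext fun _ => funext fun _ =>
    TensorProduct.ext' fun f g =>
      (IsSquareOf.fill_eq (.comp (M.isSquareOf_σHom f g k c)
        (M.isSquareOf_σInv f g k c))).symm.trans
        (congrArg fill (M.arrWhisk.σ_σ' hk (of f) (of g))))

/-- The left hexagonator `c γ (2 L + R)`. -/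
def hexLMod : Modification M.T.left3 ((perm231 M.C).comp M.T.right3)
    (hexLSource (M.αHom c) (M.σHom k c)) (hexLTarget (M.αHom c) (M.σHom k c)) where
  app X := c • M.whisk.infHexL X.1.1 X.1.2 X.2
  d_app _ := M.whisk.hexL_d hk _ _ _
  app_hty := app_hty_of_tmul (M.left3_map0) (M.perm231_map0) fun f g l =>
    (M.isSquareOf_hexLSource f g l).modification (M.isSquareOf_hexLTarget f g l)
      (M.arrWhisk.hexL_d hk (of f) (of g) (of l))
      (congrArg (c • ·) (M.infHexL_fst (of f) (of g) (of l)))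
      (congrArg (c • ·) (M.infHexL_snd (of f) (of g) (of l)))

theorem hexR_hty {U V W U' V' W' : M.C.Obj} (f : M.C.H0 U U') (g : M.C.H0 V V')
    (l : M.C.H0 W W') :
    (show M.C.H1 (M.T.right3.obj ((U, V), W)) (((perm312 M.C).comp M.T.left3).obj ((U', V'), W'))
        from (c • M.whisk.infHexR U' V' W') ▷ M.T.m00 f (M.T.m00 g l)) +
        (hexRSource (M.αInv c) (M.σHom k c)).hty ((U, V), W) ((U', V'), W') ((f ⊗ₜ g) ⊗ₜ l) =
      (hexRTarget (M.αInv c) (M.σHom k c)).hty ((U, V), W) ((U', V'), W') ((f ⊗ₜ g) ⊗ₜ l) +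
        (show M.C.H1 (M.T.right3.obj ((U, V), W)) (((perm312 M.C).comp M.T.left3).obj ((U', V'),
            W'))
          from M.T.m00 (M.T.m00 l f) g ◁ (c • M.whisk.infHexR U V W)) :=
  (M.isSquareOf_hexRSource f g l).modification (M.isSquareOf_hexRTarget f g l)
    (M.arrWhisk.hexR_d hk (of f) (of g) (of l))
    (congrArg (c • ·) (M.infHexR_fst (of f) (of g) (of l)))
    (congrArg (c • ·) (M.infHexR_snd (of f) (of g) (of l)))

/-- The right hexagonator `c γ (L + 2 R)`. -/
def hexRMod : Modification M.T.right3 ((perm312 M.C).comp M.T.left3)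
    (hexRSource (M.αInv c) (M.σHom k c)) (hexRTarget (M.αInv c) (M.σHom k c)) where
  app X := c • M.whisk.infHexR X.1.1 X.1.2 X.2
  d_app _ := M.whisk.hexR_d hk _ _ _
  app_hty {X Y} := by
    obtain ⟨⟨U, V⟩, W⟩ := X
    obtain ⟨⟨U', V'⟩, W'⟩ := Y
    refine app_hty_of_tmul M.right3_map0 M.perm312_map0 ?_
    intro f g l
    exact M.hexR_hty hk f g l

/-- The homotopy components of both sides are fillings of squares, and the pentagon over the
category of arrows is an equality of these squares. -/
theorem pentagonSource_hty {U V W X U' V' W' X' : M.C.Obj} (f : M.C.H0 U U') (g : M.C.H0 V V')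
    (l : M.C.H0 W W') (m : M.C.H0 X X') :
    (pentagonSource (M.αHom c)).hty (((U, V), W), X) (((U', V'), W'), X')
        (((f ⊗ₜ g) ⊗ₜ l) ⊗ₜ m) =
      (pentagonTarget (M.αHom c)).hty (((U, V), W), X) (((U', V'), W'), X')
        (((f ⊗ₜ g) ⊗ₜ l) ⊗ₜ m) :=
  (M.isSquareOf_pentagonSource f g l m).fill_eq.symm.trans
    ((congrArg fill (M.arrWhisk.pentagon (of f) (of g) (of l) (of m) hk)).trans
      (M.isSquareOf_pentagonTarget f g l m).fill_eq)

theorem pentagonSource_app (U V W X : M.C.Obj) :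
    (pentagonSource (M.αHom c)).app (((U, V), W), X) =
      (pentagonTarget (M.αHom c)).app (((U, V), W), X) :=
  M.whisk.pentagon U V W X hk

theorem pentagonSource_eq : pentagonSource (M.αHom c) = pentagonTarget (M.αHom c) := by
  apply PreTrans.ext
  · funext ⟨⟨⟨U, V⟩, W⟩, X⟩
    exact M.pentagonSource_app hk U V W X
  · funext ⟨⟨⟨U, V⟩, W⟩, X⟩ ⟨⟨⟨U', V'⟩, W'⟩, X'⟩
    refine TensorProduct.ext (TensorProduct.ext_threefold ?_)
    intro f g l
    refine LinearMap.ext ?_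
    intro m
    exact M.pentagonSource_hty hk f g l m

/-- The trivial pentagonator. -/
def pentMod : Modification ((M.T.left3.box (Func.id M.C)).comp M.T)
    (((boxAssoc (M.C.box M.C) M.C M.C).comp ((Func.id (M.C.box M.C)).box M.T)).comp M.T.right3)
    (pentagonSource (M.αHom c)) (pentagonTarget (M.αHom c)) where
  app _ := 0
  d_app _ := by rw [M.pentagonSource_eq hk, sub_self, map_zero]
  app_hty _ := by rw [M.pentagonSource_eq hk, LinearMap.map_zero₂, map_zero, zero_add, add_zero]

/-- The braided structure on the deformation. -/
def braided : BraidedData M.T where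
  assoc := M.αIso hk
  pent := M.pentMod hk
  braid := M.σIso hk
  hexL := M.hexLMod hk
  hexR := M.hexRMod hk

end InfSym

end

/-! ### Vanishing of the terms with homotopy components, and the three axioms -/

section

theorem CochCat.PreTrans.smul_comp_hty {R : Type u} [CommRing R] {C D : CochCat.{u, v, w} R}
    {F G K : C.Obj → D.Obj} {θ : PreTrans C D G K} {ξ : PreTrans C D F G} {X Y : C.Obj}
    {f : C.H0 X Y} {r : R} (hθ : r • θ.hty X Y f = 0) (hξ : r • ξ.hty X Y f = 0) :
    r • (PreTrans.comp C D θ ξ).hty X Y f = 0 := by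
  change r • (D.c10 (θ.hty X Y f) (ξ.app X) + D.c01 (θ.app Y) (ξ.hty X Y f)) = 0
  rw [smul_add, ← LinearMap.smul_apply, ← map_smul, hθ, ← map_smul, hξ, map_zero, map_zero,
    LinearMap.zero_apply, add_zero]

theorem CochCat.PreTrans.smul_hty_eq_zero {R : Type u} [CommRing R] {C D : CochCat.{u, v, w} R}
    {F G : C.Obj → D.Obj} {ξ : PreTrans C D F G} {X Y : C.Obj} {f : C.H0 X Y} (r : R)
    (h : ξ.hty X Y f = 0) : r • ξ.hty X Y f = 0 := by
  rw [h, smul_zero]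

theorem CochCat.PreTrans.comp_hty_eq_zero {R : Type u} [CommRing R] {C D : CochCat.{u, v, w} R}
    {F G K : C.Obj → D.Obj} {θ : PreTrans C D G K} {ξ : PreTrans C D F G} {X Y : C.Obj}
    {f : C.H0 X Y} (hθ : θ.hty X Y f = 0) (hξ : ξ.hty X Y f = 0) :
    (PreTrans.comp C D θ ξ).hty X Y f = 0 := by
  rw [← one_smul R ((PreTrans.comp C D θ ξ).hty X Y f)]
  exact smul_comp_hty ((one_smul R _).trans hθ) ((one_smul R _).trans hξ)

namespace InfSym

variable {R : Type u} [CommRing R] (M : InfSym.{u, v, w} R) {k c : R}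

section

variable {U V W U' V' W' : M.C.Obj} {f : M.C.H0 U U'} {g : M.C.H0 V V'} {l : M.C.H0 W W'}

theorem smul_t12_hty (h : c • M.th f g = 0) :
    c • M.t12.hty ((U, V), W) ((U', V'), W') ((f ⊗ₜ g) ⊗ₜ l) = 0 := by
  change c • M.T.m10 (M.th f g) l = 0
  rw [← LinearMap.smul_apply, ← map_smul, h, map_zero, LinearMap.zero_apply]

theorem smul_t23_hty (h : c • M.th g l = 0) :
    c • M.t23.hty ((U, V), W) ((U', V'), W') ((f ⊗ₜ g) ⊗ₜ l) = 0 := by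
  refine PreTrans.smul_comp_hty (PreTrans.smul_hty_eq_zero c rfl)
    (PreTrans.smul_comp_hty ?_ (PreTrans.smul_hty_eq_zero c rfl))
  change c • M.T.m01 f (M.th g l) = 0
  rw [← map_smul, h, map_zero]

theorem smul_t12t23_hty (h₁ : c • M.th f g = 0) (h₂ : c • M.th g l = 0) :
    c • M.t12t23.hty ((U, V), W) ((U', V'), W') ((f ⊗ₜ g) ⊗ₜ l) = 0 := by
  have e₁ := PreTrans.smul_comp_hty (M.smul_t12_hty (l := l) h₁) (M.smul_t23_hty (f := f) h₂)
  have e₂ := PreTrans.smul_comp_hty (M.smul_t23_hty (f := f) h₂) (M.smul_t12_hty (l := l) h₁)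
  exact (smul_sub c _ _).trans ((congrArg₂ (· - ·) e₁ e₂).trans (sub_zero _))

/-- The homotopy component is c times that of [t12, t23], in which every summand has a factor t_{f ⊠
g} or t_{g ⊠ l}. So it is enough that c kills these two homotopies, which is weaker than their
vanishing and is what holds for the deformed braiding. -/
theorem αHom_hty (h₁ : c • M.th f g = 0) (h₂ : c • M.th g l = 0) :
    (M.αHom c).hty ((U, V), W) ((U', V'), W') ((f ⊗ₜ g) ⊗ₜ l) = 0 :=
  PreTrans.comp_hty_eq_zero rfl ((zero_add _).trans (M.smul_t12t23_hty h₁ h₂))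

theorem αInv_hty (h₁ : c • M.th f g = 0) (h₂ : c • M.th g l = 0) :
    (M.αInv c).hty ((U, V), W) ((U', V'), W') ((f ⊗ₜ g) ⊗ₜ l) = 0 :=
  PreTrans.comp_hty_eq_zero ((zero_sub _).trans
    ((congrArg (- ·) (M.smul_t12t23_hty h₁ h₂)).trans neg_zero)) rfl

/-- The undeformed braiding has no homotopy components. The remaining contribution is k t_{f ⊠ g}
plus 3c times that of t², each summand of which contains t_{f ⊠ g} once. -/
theorem σHom_hty (h₁ : k • M.th f g = 0) (h₂ : c • M.th f g = 0) :
    (M.σHom k c).hty (U, V) (U', V') (f ⊗ₜ g) = 0 := by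
  have e : c • (PreTrans.comp _ _ M.t M.t).hty (U, V) (U', V') (f ⊗ₜ g) = 0 :=
    PreTrans.smul_comp_hty h₂ h₂
  have e' : (3 * c) • (PreTrans.comp _ _ M.t M.t).hty (U, V) (U', V') (f ⊗ₜ g) = 0 := by
    rw [mul_smul, e, smul_zero]
  refine PreTrans.comp_hty_eq_zero (congrArg (fun L => L (f ⊗ₜ g)) (M.braid_hty (U, V) (U', V'))) ?_
  exact (congrArg₂ (· + ·) ((zero_add _).trans h₁) e').trans (add_zero _)

end

variable (hk : IsOrderTwo k c)

include hk in
theorem smul_th_σ (U V W : M.C.Obj) : c • M.th (M.whisk.σ k c U V) (M.C.one W) = 0 :=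
  M.whisk.smul_tl_σ hk U V W

include hk in
theorem smul_th_σ' (U V W : M.C.Obj) : c • M.th (M.C.one W) (M.whisk.σ k c U V) = 0 :=
  M.whisk.smul_tr_σ hk U V W

theorem smul_th_one (U V : M.C.Obj) : c • M.th (M.C.one U) (M.C.one V) = 0 := by
  rw [M.th_one, smul_zero]

theorem braided_p (U V W X : M.C.Obj) : (M.braided hk).p U V W X = 0 := rfl

theorem braided_p' (U V W X : M.C.Obj) : (M.braided hk).p' U V W X = 0 := by
  rw [BraidedData.p', braided_p, map_zero, LinearMap.zero_apply, map_zero, neg_zero]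

/-- The associator is an identity modulo c, so t_{1 ⊠ α} is killed by both scalars that occur in the
braiding. -/
theorem braided_sh_one_a (U V W X : M.C.Obj) :
    (M.braided hk).sh (M.C.one U) ((M.braided hk).a V W X) = 0 :=
  M.σHom_hty (M.whisk.smul_tr_α hk V W X U).1 (M.whisk.smul_tr_α hk V W X U).2

theorem braided_sh_a'_one (U V W X : M.C.Obj) :
    (M.braided hk).sh ((M.braided hk).a' U V W) (M.C.one X) = 0 :=
  M.σHom_hty (M.whisk.smul_tl_α' hk U V W X).1 (M.whisk.smul_tl_α' hk U V W X).2

/-- This and the five lemmas after it rest on total symmetry: the associator and its inverse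
contribute a factor c, modulo which σ is γ. The other homotopy involved, if not of this kind too, is
t at two identities. -/
theorem braided_ah_s_one_one (U V W X : M.C.Obj) :
    (M.braided hk).ah ((M.braided hk).s U V) (M.C.one W) (M.C.one X) = 0 :=
  M.αHom_hty (M.smul_th_σ hk U V W) (M.smul_th_one W X)

theorem braided_ah_one_s_one (U V W X : M.C.Obj) :
    (M.braided hk).ah (M.C.one U) ((M.braided hk).s V W) (M.C.one X) = 0 :=
  M.αHom_hty (M.smul_th_σ' hk V W U) (M.smul_th_σ hk V W X)

theorem braided_ah_one_one_s (U V W X : M.C.Obj) :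
    (M.braided hk).ah (M.C.one U) (M.C.one V) ((M.braided hk).s W X) = 0 :=
  M.αHom_hty (M.smul_th_one U V) (M.smul_th_σ' hk W X V)

theorem braided_a'h_s_one_one (U V W X : M.C.Obj) :
    (M.braided hk).a'h ((M.braided hk).s U V) (M.C.one W) (M.C.one X) = 0 :=
  M.αInv_hty (M.smul_th_σ hk U V W) (M.smul_th_one W X)

theorem braided_a'h_one_s_one (U V W X : M.C.Obj) :
    (M.braided hk).a'h (M.C.one U) ((M.braided hk).s V W) (M.C.one X) = 0 :=
  M.αInv_hty (M.smul_th_σ' hk V W U) (M.smul_th_σ hk V W X)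

theorem braided_a'h_one_one_s (U V W X : M.C.Obj) :
    (M.braided hk).a'h (M.C.one U) (M.C.one V) ((M.braided hk).s W X) = 0 :=
  M.αInv_hty (M.smul_th_one U V) (M.smul_th_σ' hk W X V)

/-- All terms with the pentagonator or with homotopy components at associators and braidings vanish.
Only the hexagonator terms are left, and these are settled modulo the annihilator of c; the right
tetrahedron and the hexahedron go the same way. -/
theorem braided_leftTetrahedron : (M.braided hk).LeftTetrahedron := fun U V W X => by
  simp only [braided_p, braided_sh_one_a, braided_ah_s_one_one, braided_ah_one_s_one,
    braided_ah_one_one_s, map_zero, LinearMap.zero_apply, zero_add, add_zero, sub_zero]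
  exact M.whisk.left_tetrahedron hk U V W X

theorem braided_rightTetrahedron : (M.braided hk).RightTetrahedron := fun U V W X => by
  simp only [braided_p', braided_sh_a'_one, braided_a'h_s_one_one, braided_a'h_one_s_one,
    braided_a'h_one_one_s, map_zero, LinearMap.zero_apply, zero_add, add_zero, sub_zero]
  exact M.whisk.right_tetrahedron hk U V W X

theorem braided_hexahedron : (M.braided hk).Hexahedron := fun U V W X => by
  simp only [braided_p, braided_p', braided_ah_s_one_one, braided_ah_one_s_one,
    braided_ah_one_one_s, braided_a'h_s_one_one, braided_a'h_one_one_s, map_zero,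
    LinearMap.zero_apply, zero_add, add_zero, sub_zero]
  exact M.whisk.hexahedron hk U V W X

end InfSym

end

/-! ### From an equality of functors to relations between generators -/

section

namespace CochCat.Func

variable {R : Type u} [CommRing R] {C D : CochCat.{u, v, w} R} {F G : Func C D}

/-- Strict associativity is given as an equality of functors, whose values on 1-cells have different
types. Composing with identity 1-cells turns it into an honest equation, and this is the only form
in which it is used on 1-cells. -/
theorem idOfEq_natural00 (h : F = G) {X Y : C.Obj} (hX : F.obj X = G.obj X)
    (hY : F.obj Y = G.obj Y) (f : C.H0 X Y) :
    D.c00 (D.idOfEq hY) (F.map0 f) = D.c00 (G.map0 f) (D.idOfEq hX) := by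
  subst h
  simp only [idOfEq_self, D.one_c00, D.c00_one]

theorem idOfEq_natural01 (h : F = G) {X Y : C.Obj} (hX : F.obj X = G.obj X)
    (hY : F.obj Y = G.obj Y) (q : C.H1 X Y) :
    D.c01 (D.idOfEq hY) (F.map1 q) = D.c10 (G.map1 q) (D.idOfEq hX) := by
  subst h
  simp only [idOfEq_self, D.one_c01, D.c10_one]

end CochCat.Func

/-- A symmetric strict monoidal category with a totally symmetric strict infinitesimal braiding, by
conditions on generators. -/
def SymStrictMon.infSym {R : Type u} [CommRing R] (S : SymStrictMon.{u, v, w} R)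
    (t : PreTrans (S.C.box S.C) S.C S.T.obj S.T.obj) (ht : IsPseudonat S.T S.T t)
    (hstrict : S.IsStrict t) (hsymm : S.IsTotallySymmetric t) : InfSym.{u, v, w} R where
  C := S.C
  T := S.T
  assoc U V W := S.assoc_obj ((U, V), W)
  assoc000 {U V W U' V' W'} f g k := Func.idOfEq_natural00 S.assoc (X := ((U, V), W))
    (Y := ((U', V'), W')) (S.assoc_obj ((U, V), W)) (S.assoc_obj ((U', V'), W')) ((f ⊗ₜ g) ⊗ₜ k)
  assoc100 {U V W U' V' W'} f g k := by
    rw [← S.T.left3_map1_inl_inl, ← S.T.right3_map1_inl_inl]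
    exact Func.idOfEq_natural01 S.assoc (X := ((U, V), W)) (Y := ((U', V'), W'))
      (S.assoc_obj ((U, V), W)) (S.assoc_obj ((U', V'), W')) _
  assoc010 {U V W U' V' W'} f g k := by
    rw [← S.T.left3_map1_inl_inr, ← S.T.right3_map1_inl_inr]
    exact Func.idOfEq_natural01 S.assoc (X := ((U, V), W)) (Y := ((U', V'), W'))
      (S.assoc_obj ((U, V), W)) (S.assoc_obj ((U', V'), W')) _
  assoc001 {U V W U' V' W'} f g k := by
    rw [← S.T.left3_map1_inr, ← S.T.right3_map1_inr]
    exact Func.idOfEq_natural01 S.assoc (X := ((U, V), W)) (Y := ((U', V'), W'))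
      (S.assoc_obj ((U, V), W)) (S.assoc_obj ((U', V'), W')) _
  braid := S.braid
  braid_pseudonat := S.braid_pseudonat
  braid_hty := S.braid_hty
  braid_braid := S.braid_braid
  hex U V W := congrFun (congrArg PreTrans.app S.hexagon) ((U, V), W)
  t := t
  t_pseudonat := ht
  t_left_app := hstrict.left_app
  t_left_hty := hstrict.left_hty
  t_right_app := hstrict.right_app
  t_right_hty := hstrict.right_hty
  symm_app := hsymm.symm_app
  symm_hty := hsymm.symm_hty
  total := hsymm.total

theorem CochCat.baseChange_idOfEq {R : Type u} [CommRing R] {C : CochCat.{u, v, w} R} (A : Type u)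
    [CommRing A] [Algebra R A] {X Y : C.Obj} (h : X = Y) :
    (C.baseChange A).idOfEq h = 1 ⊗ₜ C.idOfEq h := by
  subst h
  rfl

end

/-! ### Extension of scalars -/

section

namespace CochCat

variable {R : Type u} [CommRing R] {C : CochCat.{u, v, w} R} (A : Type u) [CommRing A] [Algebra R A]
  (T : Func (C.box C) C) {U V U' V' : C.Obj}

/-- The degree -1 part of the extended product is defined by lifting from the quotient. This and the
next lemma identify it on generators with the bilinear extension, on which the relations below are
checked. -/
theorem tensorBC_m10 : (tensorBC A T).m10 (U := U) (U' := U') (V := V) (V' := V') =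
    bilinBC A T.m10 := by
  refine LinearMap.ext fun q => LinearMap.ext fun g => ?_
  change tensorBC1 A T U U' V V' (BoxH1.inl (q ⊗ₜ g)) = _
  rw [tensorBC1, BoxH1.lift_inl]
  rfl

theorem tensorBC_m01 : (tensorBC A T).m01 (U := U) (U' := U') (V := V) (V' := V') =
    bilinBC A T.m01 := by
  refine LinearMap.ext fun f => LinearMap.ext fun q => ?_
  change tensorBC1 A T U U' V V' (BoxH1.inr (f ⊗ₜ q)) = _
  rw [tensorBC1, BoxH1.lift_inr]
  rfl

end CochCat

namespace InfSym

variable {R : Type u} [CommRing R] (M : InfSym.{u, v, w} R) (A : Type u) [CommRing A] [Algebra R A]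

local notation "𝐢" => CochCat.one (InfSym.C M)
local notation "𝐞" => CochCat.idOfEq (InfSym.C M)
local notation "𝐇₀" => CochCat.H0 (InfSym.C M)
local notation "𝐇₁" => CochCat.H1 (InfSym.C M)
local notation:80 f:81 " ⬝ " g:80 => bilinBC A (CochCat.c00 (InfSym.C M)) f g
local notation:80 f:81 " ◁ " q:80 => bilinBC A (CochCat.c01 (InfSym.C M)) f q
local notation:80 q:81 " ▷ " f:80 => bilinBC A (CochCat.c10 (InfSym.C M)) q f
local notation:90 f:90 " ⊛ " g:91 => bilinBC A (Func.m00 (InfSym.T M)) f g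
local notation:90 q:90 " ⊛l " g:91 => bilinBC A (Func.m10 (InfSym.T M)) q g
local notation:90 f:90 " ⊛r " q:91 => bilinBC A (Func.m01 (InfSym.T M)) f q

variable {U U' U'' V V' V'' W W' : M.C.Obj}

/-- The pattern for all lemmas up to `baseChange_t_right_hty`: the relation is additive in each
argument, so pure tensors suffice; there the scalars collect into one coefficient and the relation
over the base ring remains. -/
theorem baseChange_assoc000 (f : A ⊗[R] 𝐇₀ U U') (g : A ⊗[R] 𝐇₀ V V') (k : A ⊗[R] 𝐇₀ W W') :
    (1 ⊗ₜ 𝐞 (M.assoc U' V' W')) ⬝ ((f ⊛ g) ⊛ k) =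
      (f ⊛ (g ⊛ k)) ⬝ (1 ⊗ₜ 𝐞 (M.assoc U V W)) := by
  induction f using TensorProduct.induction_on with
  | zero => simp only [map_zero, LinearMap.zero_apply]
  | add x y hx hy => simp only [map_add, LinearMap.add_apply, hx, hy]
  | tmul a f =>
    induction g using TensorProduct.induction_on with
    | zero => simp only [map_zero, LinearMap.zero_apply]
    | add x y hx hy => simp only [map_add, LinearMap.add_apply, hx, hy]
    | tmul b g =>
      induction k using TensorProduct.induction_on with
      | zero => simp only [map_zero, LinearMap.zero_apply]
      | add x y hx hy => simp only [map_add, LinearMap.add_apply, hx, hy]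
      | tmul c k =>
        simp only [bilinBC_tmul, mul_one, one_mul, M.assoc000, mul_assoc]

theorem baseChange_assoc100 (f : A ⊗[R] 𝐇₁ U U') (g : A ⊗[R] 𝐇₀ V V') (k : A ⊗[R] 𝐇₀ W W') :
    (1 ⊗ₜ 𝐞 (M.assoc U' V' W')) ◁ ((f ⊛l g) ⊛l k) =
      (f ⊛l (g ⊛ k)) ▷ (1 ⊗ₜ 𝐞 (M.assoc U V W)) := by
  induction f using TensorProduct.induction_on with
  | zero => simp only [map_zero, LinearMap.zero_apply]
  | add x y hx hy => simp only [map_add, LinearMap.add_apply, hx, hy]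
  | tmul a f =>
    induction g using TensorProduct.induction_on with
    | zero => simp only [map_zero, LinearMap.zero_apply]
    | add x y hx hy => simp only [map_add, LinearMap.add_apply, hx, hy]
    | tmul b g =>
      induction k using TensorProduct.induction_on with
      | zero => simp only [map_zero, LinearMap.zero_apply]
      | add x y hx hy => simp only [map_add, LinearMap.add_apply, hx, hy]
      | tmul c k =>
        simp only [bilinBC_tmul, mul_one, one_mul, M.assoc100, mul_assoc]

theorem baseChange_assoc010 (f : A ⊗[R] 𝐇₀ U U') (g : A ⊗[R] 𝐇₁ V V') (k : A ⊗[R] 𝐇₀ W W') :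
    (1 ⊗ₜ 𝐞 (M.assoc U' V' W')) ◁ ((f ⊛r g) ⊛l k) =
      (f ⊛r (g ⊛l k)) ▷ (1 ⊗ₜ 𝐞 (M.assoc U V W)) := by
  induction f using TensorProduct.induction_on with
  | zero => simp only [map_zero, LinearMap.zero_apply]
  | add x y hx hy => simp only [map_add, LinearMap.add_apply, hx, hy]
  | tmul a f =>
    induction g using TensorProduct.induction_on with
    | zero => simp only [map_zero, LinearMap.zero_apply]
    | add x y hx hy => simp only [map_add, LinearMap.add_apply, hx, hy]
    | tmul b g =>
      induction k using TensorProduct.induction_on with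
      | zero => simp only [map_zero, LinearMap.zero_apply]
      | add x y hx hy => simp only [map_add, LinearMap.add_apply, hx, hy]
      | tmul c k =>
        simp only [bilinBC_tmul, mul_one, one_mul, M.assoc010, mul_assoc]

theorem baseChange_assoc001 (f : A ⊗[R] 𝐇₀ U U') (g : A ⊗[R] 𝐇₀ V V') (k : A ⊗[R] 𝐇₁ W W') :
    (1 ⊗ₜ 𝐞 (M.assoc U' V' W')) ◁ ((f ⊛ g) ⊛r k) =
      (f ⊛r (g ⊛r k)) ▷ (1 ⊗ₜ 𝐞 (M.assoc U V W)) := by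
  induction f using TensorProduct.induction_on with
  | zero => simp only [map_zero, LinearMap.zero_apply]
  | add x y hx hy => simp only [map_add, LinearMap.add_apply, hx, hy]
  | tmul a f =>
    induction g using TensorProduct.induction_on with
    | zero => simp only [map_zero, LinearMap.zero_apply]
    | add x y hx hy => simp only [map_add, LinearMap.add_apply, hx, hy]
    | tmul b g =>
      induction k using TensorProduct.induction_on with
      | zero => simp only [map_zero, LinearMap.zero_apply]
      | add x y hx hy => simp only [map_add, LinearMap.add_apply, hx, hy]
      | tmul c k =>
        simp only [bilinBC_tmul, mul_one, one_mul, M.assoc001, mul_assoc]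

theorem baseChange_γ_m00 (f : A ⊗[R] 𝐇₀ U U') (g : A ⊗[R] 𝐇₀ V V') :
    (g ⊛ f) ⬝ (1 ⊗ₜ M.γ U V) = (1 ⊗ₜ M.γ U' V') ⬝ (f ⊛ g) := by
  induction f using TensorProduct.induction_on with
  | zero => simp only [map_zero, LinearMap.zero_apply]
  | add x y hx hy => simp only [map_add, LinearMap.add_apply, hx, hy]
  | tmul a f =>
    induction g using TensorProduct.induction_on with
    | zero => simp only [map_zero, LinearMap.zero_apply]
    | add x y hx hy => simp only [map_add, LinearMap.add_apply, hx, hy]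
    | tmul b g =>
      simp only [bilinBC_tmul, mul_one, one_mul, M.γ_nat, mul_comm b a]

theorem baseChange_γ_m10 (q : A ⊗[R] 𝐇₁ U U') (g : A ⊗[R] 𝐇₀ V V') :
    (g ⊛r q) ▷ (1 ⊗ₜ M.γ U V) = (1 ⊗ₜ M.γ U' V') ◁ (q ⊛l g) := by
  induction q using TensorProduct.induction_on with
  | zero => simp only [map_zero, LinearMap.zero_apply]
  | add x y hx hy => simp only [map_add, LinearMap.add_apply, hx, hy]
  | tmul a q =>
    induction g using TensorProduct.induction_on with
    | zero => simp only [map_zero, LinearMap.zero_apply]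
    | add x y hx hy => simp only [map_add, LinearMap.add_apply, hx, hy]
    | tmul b g =>
      simp only [bilinBC_tmul, mul_one, one_mul, M.γ_m10, mul_comm b a]

theorem baseChange_γ_m01 (f : A ⊗[R] 𝐇₀ U U') (q : A ⊗[R] 𝐇₁ V V') :
    (q ⊛l f) ▷ (1 ⊗ₜ M.γ U V) = (1 ⊗ₜ M.γ U' V') ◁ (f ⊛r q) := by
  induction f using TensorProduct.induction_on with
  | zero => simp only [map_zero, LinearMap.zero_apply]
  | add x y hx hy => simp only [map_add, LinearMap.add_apply, hx, hy]
  | tmul a f =>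
    induction q using TensorProduct.induction_on with
    | zero => simp only [map_zero, LinearMap.zero_apply]
    | add x y hx hy => simp only [map_add, LinearMap.add_apply, hx, hy]
    | tmul b q =>
      simp only [bilinBC_tmul, mul_one, one_mul, M.γ_m01, mul_comm b a]

theorem baseChange_γ_th (f : A ⊗[R] 𝐇₀ U U') (g : A ⊗[R] 𝐇₀ V V') :
    (1 ⊗ₜ M.γ U' V') ◁ bilinBC A M.th f g = bilinBC A M.th g f ▷ (1 ⊗ₜ M.γ U V) := by
  induction f using TensorProduct.induction_on with
  | zero => simp only [map_zero, LinearMap.zero_apply]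
  | add x y hx hy => simp only [map_add, LinearMap.add_apply, hx, hy]
  | tmul a f =>
    induction g using TensorProduct.induction_on with
    | zero => simp only [map_zero, LinearMap.zero_apply]
    | add x y hx hy => simp only [map_add, LinearMap.add_apply, hx, hy]
    | tmul b g =>
      simp only [bilinBC_tmul, mul_one, one_mul, M.γ_th, mul_comm b a]

theorem baseChange_d_th (f : A ⊗[R] 𝐇₀ U U') (g : A ⊗[R] 𝐇₀ V V') :
    (f ⊛ g) ⬝ (1 ⊗ₜ M.ta U V) =
      M.C.d.baseChange A (bilinBC A M.th f g) + (1 ⊗ₜ M.ta U' V') ⬝ (f ⊛ g) := by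
  induction f using TensorProduct.induction_on with
  | zero => simp only [map_zero, LinearMap.zero_apply, add_zero]
  | add x y hx hy => simp only [map_add, LinearMap.add_apply, hx, hy]; abel
  | tmul a f =>
    induction g using TensorProduct.induction_on with
    | zero => simp only [map_zero, LinearMap.zero_apply, add_zero]
    | add x y hx hy => simp only [map_add, LinearMap.add_apply, hx, hy]; abel
    | tmul b g =>
      simp only [bilinBC_tmul, mul_one, one_mul, LinearMap.baseChange_tmul, ← M.d_th,
        TensorProduct.tmul_sub, sub_add_cancel]

theorem baseChange_th_d_left (q : A ⊗[R] 𝐇₁ U U') (g : A ⊗[R] 𝐇₀ V V') :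
    (q ⊛l g) ▷ (1 ⊗ₜ M.ta U V) =
      bilinBC A M.th (M.C.d.baseChange A q) g + (1 ⊗ₜ M.ta U' V') ◁ (q ⊛l g) := by
  induction q using TensorProduct.induction_on with
  | zero => simp only [map_zero, LinearMap.zero_apply, add_zero]
  | add x y hx hy => simp only [map_add, LinearMap.add_apply, hx, hy]; abel
  | tmul a q =>
    induction g using TensorProduct.induction_on with
    | zero => simp only [map_zero, LinearMap.zero_apply, add_zero]
    | add x y hx hy => simp only [map_add, LinearMap.add_apply, hx, hy]; abel
    | tmul b g =>
      simp only [bilinBC_tmul, mul_one, one_mul, LinearMap.baseChange_tmul, ← M.th_d_left,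
        TensorProduct.tmul_sub, sub_add_cancel]

theorem baseChange_th_d_right (f : A ⊗[R] 𝐇₀ U U') (q : A ⊗[R] 𝐇₁ V V') :
    (f ⊛r q) ▷ (1 ⊗ₜ M.ta U V) =
      bilinBC A M.th f (M.C.d.baseChange A q) + (1 ⊗ₜ M.ta U' V') ◁ (f ⊛r q) := by
  induction f using TensorProduct.induction_on with
  | zero => simp only [map_zero, LinearMap.zero_apply, add_zero]
  | add x y hx hy => simp only [map_add, LinearMap.add_apply, hx, hy]; abel
  | tmul a f =>
    induction q using TensorProduct.induction_on with
    | zero => simp only [map_zero, LinearMap.zero_apply, add_zero]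
    | add x y hx hy => simp only [map_add, LinearMap.add_apply, hx, hy]; abel
    | tmul b q =>
      simp only [bilinBC_tmul, mul_one, one_mul, LinearMap.baseChange_tmul, ← M.th_d_right,
        TensorProduct.tmul_sub, sub_add_cancel]

theorem baseChange_th_c00 (f' : A ⊗[R] 𝐇₀ U' U'') (f : A ⊗[R] 𝐇₀ U U') (g' : A ⊗[R] 𝐇₀ V' V'')
    (g : A ⊗[R] 𝐇₀ V V') :
    bilinBC A M.th (f' ⬝ f) (g' ⬝ g) =
      bilinBC A M.th f' g' ▷ (f ⊛ g) + (f' ⊛ g') ◁ bilinBC A M.th f g := by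
  induction f' using TensorProduct.induction_on with
  | zero => simp only [map_zero, LinearMap.zero_apply, add_zero]
  | add x y hx hy => simp only [map_add, LinearMap.add_apply, hx, hy]; abel
  | tmul a f' =>
    induction f using TensorProduct.induction_on with
    | zero => simp only [map_zero, LinearMap.zero_apply, add_zero]
    | add x y hx hy => simp only [map_add, LinearMap.add_apply, hx, hy]; abel
    | tmul b f =>
      induction g' using TensorProduct.induction_on with
      | zero => simp only [map_zero, LinearMap.zero_apply, add_zero]
      | add x y hx hy => simp only [map_add, LinearMap.add_apply, hx, hy]; abel
      | tmul c g' =>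
        induction g using TensorProduct.induction_on with
        | zero => simp only [map_zero, add_zero]
        | add x y hx hy => simp only [map_add, hx, hy]; abel
        | tmul d g =>
          simp only [bilinBC_tmul, M.th_c00, TensorProduct.tmul_add, mul_mul_mul_comm a b c d]

theorem baseChange_t_left_hty (f : A ⊗[R] 𝐇₀ U U') (g : A ⊗[R] 𝐇₀ V V') (k : A ⊗[R] 𝐇₀ W W') :
    (1 ⊗ₜ 𝐞 (M.assoc U' V' W').symm) ◁
        (bilinBC A M.th f (g ⊛ k) ▷ (1 ⊗ₜ 𝐞 (M.assoc U V W))) =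
      bilinBC A M.th f g ⊛l k +
        (((1 ⊗ₜ M.γ V' U') ⊛ (1 ⊗ₜ 𝐢 W')) ⬝ (1 ⊗ₜ 𝐞 (M.assoc V' U' W').symm)) ◁
        ((g ⊛r bilinBC A M.th f k) ▷
          ((1 ⊗ₜ 𝐞 (M.assoc V U W)) ⬝ ((1 ⊗ₜ M.γ U V) ⊛ (1 ⊗ₜ 𝐢 W)))) := by
  simp only [bilinBC_tmul, mul_one]
  induction f using TensorProduct.induction_on with
  | zero => simp only [map_zero, LinearMap.zero_apply, add_zero]
  | add x y hx hy => simp only [map_add, LinearMap.add_apply, hx, hy]; abel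
  | tmul a f =>
    induction g using TensorProduct.induction_on with
    | zero => simp only [map_zero, LinearMap.zero_apply, add_zero]
    | add x y hx hy => simp only [map_add, LinearMap.add_apply, hx, hy]; abel
    | tmul b g =>
      induction k using TensorProduct.induction_on with
      | zero => simp only [map_zero, LinearMap.zero_apply, add_zero]
      | add x y hx hy => simp only [map_add, LinearMap.add_apply, hx, hy]; abel
      | tmul c k =>
        -- In the term in which g passes in front of f the scalars appear in the order b, a, c. They
        -- are reordered so that both summands share one coefficient.
        simp only [bilinBC_tmul, mul_one, one_mul, mul_assoc, mul_left_comm b a c,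
          ← TensorProduct.tmul_add]
        exact congrArg _ (M.t_left_hty f g k)

theorem baseChange_t_right_hty (f : A ⊗[R] 𝐇₀ U U') (g : A ⊗[R] 𝐇₀ V V') (k : A ⊗[R] 𝐇₀ W W') :
    (1 ⊗ₜ 𝐞 (M.assoc U' V' W')) ◁
        (bilinBC A M.th (f ⊛ g) k ▷ (1 ⊗ₜ 𝐞 (M.assoc U V W).symm)) =
      f ⊛r bilinBC A M.th g k +
        (((1 ⊗ₜ 𝐢 U') ⊛ (1 ⊗ₜ M.γ W' V')) ⬝ (1 ⊗ₜ 𝐞 (M.assoc U' W' V'))) ◁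
        ((bilinBC A M.th f k ⊛l g) ▷
          ((1 ⊗ₜ 𝐞 (M.assoc U W V).symm) ⬝ ((1 ⊗ₜ 𝐢 U) ⊛ (1 ⊗ₜ M.γ V W)))) := by
  simp only [bilinBC_tmul, mul_one]
  induction f using TensorProduct.induction_on with
  | zero => simp only [map_zero, LinearMap.zero_apply, add_zero]
  | add x y hx hy => simp only [map_add, LinearMap.add_apply, hx, hy]; abel
  | tmul a f =>
    induction g using TensorProduct.induction_on with
    | zero => simp only [map_zero, LinearMap.zero_apply, add_zero]
    | add x y hx hy => simp only [map_add, LinearMap.add_apply, hx, hy]; abel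
    | tmul b g =>
      induction k using TensorProduct.induction_on with
      | zero => simp only [map_zero, LinearMap.zero_apply, add_zero]
      | add x y hx hy => simp only [map_add, LinearMap.add_apply, hx, hy]; abel
      | tmul c k =>
        simp only [bilinBC_tmul, mul_one, one_mul, mul_assoc, mul_comm c b,
          ← TensorProduct.tmul_add]
        exact congrArg _ (M.t_right_hty f g k)

theorem baseChange_hex (U V W : M.C.Obj) :
    (1 ⊗ₜ 𝐞 (M.assoc V W U)) ⬝ ((1 ⊗ₜ M.γ U (M.T.o V W)) ⬝ (1 ⊗ₜ 𝐞 (M.assoc U V W))) =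
      ((1 ⊗ₜ 𝐢 V) ⊛ (1 ⊗ₜ M.γ U W)) ⬝ ((1 ⊗ₜ 𝐞 (M.assoc V U W)) ⬝
        ((1 ⊗ₜ M.γ U V) ⊛ (1 ⊗ₜ[R] 𝐢 W))) := by
  simp only [bilinBC_tmul, mul_one]
  exact congrArg _ (M.hex U V W)

theorem baseChange_t_left_app (U V W : M.C.Obj) :
    (1 ⊗ₜ 𝐞 (M.assoc U V W).symm) ⬝ ((1 ⊗ₜ M.ta U (M.T.o V W)) ⬝ (1 ⊗ₜ 𝐞 (M.assoc U V W))) =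
      (1 ⊗ₜ M.ta U V) ⊛ (1 ⊗ₜ 𝐢 W) + ((1 ⊗ₜ M.γ V U) ⊛ (1 ⊗ₜ 𝐢 W)) ⬝
        ((1 ⊗ₜ 𝐞 (M.assoc V U W).symm) ⬝ (((1 ⊗ₜ 𝐢 V) ⊛ (1 ⊗ₜ M.ta U W)) ⬝
          ((1 ⊗ₜ 𝐞 (M.assoc V U W)) ⬝ ((1 ⊗ₜ M.γ U V) ⊛ (1 ⊗ₜ[R] 𝐢 W))))) := by
  simp only [bilinBC_tmul, mul_one, ← TensorProduct.tmul_add]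
  exact congrArg _ (M.t_left_app U V W)

theorem baseChange_t_right_app (U V W : M.C.Obj) :
    (1 ⊗ₜ 𝐞 (M.assoc U V W)) ⬝ ((1 ⊗ₜ M.ta (M.T.o U V) W) ⬝ (1 ⊗ₜ 𝐞 (M.assoc U V W).symm)) =
      (1 ⊗ₜ 𝐢 U) ⊛ (1 ⊗ₜ M.ta V W) + ((1 ⊗ₜ 𝐢 U) ⊛ (1 ⊗ₜ M.γ W V)) ⬝
        ((1 ⊗ₜ 𝐞 (M.assoc U W V)) ⬝ (((1 ⊗ₜ M.ta U W) ⊛ (1 ⊗ₜ 𝐢 V)) ⬝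
          ((1 ⊗ₜ 𝐞 (M.assoc U W V).symm) ⬝ ((1 ⊗ₜ 𝐢 U) ⊛ (1 ⊗ₜ[R] M.γ V W))))) := by
  simp only [bilinBC_tmul, mul_one, ← TensorProduct.tmul_add]
  exact congrArg _ (M.t_right_app U V W)

theorem baseChange_γ_ta (U V : M.C.Obj) :
    (1 ⊗ₜ M.γ U V) ⬝ (1 ⊗ₜ M.ta U V) = (1 ⊗ₜ M.ta V U) ⬝ (1 ⊗ₜ[R] M.γ U V) := by
  simp only [bilinBC_tmul, mul_one]
  exact congrArg _ (M.γ_ta U V)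

end InfSym

end

/-! ### The extended braiding and infinitesimal braiding -/

section

namespace InfSym

variable {R : Type u} [CommRing R] (M : InfSym.{u, v, w} R) (A : Type u) [CommRing A] [Algebra R A]

theorem baseChange_braid_hty (X Y : M.C.Obj × M.C.Obj) :
    (M.braid.baseChange₂ A).hty X Y = 0 := by
  refine TensorProduct.ext' fun f g => ?_
  change bilinBC A (TensorProduct.curry (M.braid.hty X Y)) f g = 0
  rw [M.braid_hty]
  induction f using TensorProduct.induction_on with
  | zero => simp only [map_zero, LinearMap.zero_apply]
  | add x y hx hy => rw [map_add, LinearMap.add_apply, hx, hy, add_zero]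
  | tmul a f =>
    induction g using TensorProduct.induction_on with
    | zero => simp only [map_zero]
    | add x y hx hy => rw [map_add, hx, hy, add_zero]
    | tmul b g => exact (bilinBC_tmul ..).trans (TensorProduct.tmul_zero _ _)

theorem baseChange_braid_pseudonat :
    IsPseudonat (C := (M.C.baseChange A).box (M.C.baseChange A)) (D := M.C.baseChange A)
      (tensorBC A M.T) ((boxSwap (M.C.baseChange A) (M.C.baseChange A)).comp (tensorBC A M.T))
      (M.braid.baseChange₂ A) := by
  have z : ∀ {X Y : M.C.Obj × M.C.Obj} (f : ((M.C.baseChange A).box (M.C.baseChange A)).H0 X Y),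
      (M.braid.baseChange₂ A).hty X Y f = 0 := fun {X Y} f => by
    rw [M.baseChange_braid_hty]; rfl
  refine .of_tmul (fun {X Y} f g => ?_) (fun {X Y} q g => ?_) (fun {X Y} f q => ?_)
    (fun _ => z _) (fun {X Y Z} f' g' f g => ?_)
  · refine (sub_eq_zero.2 (M.baseChange_γ_m00 A f g)).trans ?_
    exact ((congrArg (M.C.baseChange A).d (z (X := X) (Y := Y) (f ⊗ₜ g))).trans (map_zero _)).symm
  · have e : ((boxSwap (M.C.baseChange A) (M.C.baseChange A)).comp (tensorBC A M.T)).map1 (X := X)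
        (Y := Y) (BoxH1.inl (q ⊗ₜ g)) = (tensorBC A M.T).m01 g q :=
      congrArg ((tensorBC A M.T).map1 (X := (X.2, X.1)) (Y := (Y.2, Y.1))) (boxSwap1_inl q g)
    have e' : (tensorBC A M.T).map1 (X := X) (Y := Y) (BoxH1.inl (q ⊗ₜ g)) =
      (tensorBC A M.T).m10 q g := rfl
    rw [e, e', tensorBC_m01, tensorBC_m10]
    exact (sub_eq_zero.2 (M.baseChange_γ_m10 A q g)).trans (z (X := X) (Y := Y) _).symm
  · have e : ((boxSwap (M.C.baseChange A) (M.C.baseChange A)).comp (tensorBC A M.T)).map1 (X := X)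
        (Y := Y) (BoxH1.inr (f ⊗ₜ q)) = (tensorBC A M.T).m10 q f :=
      congrArg ((tensorBC A M.T).map1 (X := (X.2, X.1)) (Y := (Y.2, Y.1))) (boxSwap1_inr f q)
    have e' : (tensorBC A M.T).map1 (X := X) (Y := Y) (BoxH1.inr (f ⊗ₜ q)) =
      (tensorBC A M.T).m01 f q := rfl
    rw [e, e', tensorBC_m01, tensorBC_m10]
    exact (sub_eq_zero.2 (M.baseChange_γ_m01 A f q)).trans (z (X := X) (Y := Y) _).symm
  · refine (z (X := X) (Y := Z) _).trans (Eq.symm ?_)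
    refine (congrArg₂ (· + ·) ?_ ?_).trans (add_zero 0)
    · exact (congrArg (fun q => (M.C.baseChange A).c10 q _) (z (X := Y) (Y := Z) _)).trans
        (LinearMap.map_zero₂ _ _)
    · exact (congrArg ((M.C.baseChange A).c01 _) (z (X := X) (Y := Y) _)).trans (map_zero _)

theorem baseChange_t_pseudonat :
    IsPseudonat (C := (M.C.baseChange A).box (M.C.baseChange A)) (D := M.C.baseChange A)
      (tensorBC A M.T) (tensorBC A M.T) (M.t.baseChange₂ A) := by
  refine .of_tmul (fun {X Y} f g => ?_) (fun {X Y} q g => ?_) (fun {X Y} f q => ?_)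
    (fun X => ?_) (fun {X Y Z} f' g' f g => ?_)
  · exact sub_eq_of_eq_add (M.baseChange_d_th A f g)
  · have e' : (tensorBC A M.T).map1 (X := X) (Y := Y) (BoxH1.inl (q ⊗ₜ g)) =
      (tensorBC A M.T).m10 q g := rfl
    rw [e', tensorBC_m10]
    exact sub_eq_of_eq_add (M.baseChange_th_d_left A q g)
  · have e' : (tensorBC A M.T).map1 (X := X) (Y := Y) (BoxH1.inr (f ⊗ₜ q)) =
      (tensorBC A M.T).m01 f q := rfl
    rw [e', tensorBC_m01]
    exact sub_eq_of_eq_add (M.baseChange_th_d_right A f q)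
  · refine (bilinBC_tmul A M.th 1 1 (M.C.one X.1) (M.C.one X.2)).trans ?_
    rw [M.th_one, TensorProduct.tmul_zero]
    rfl
  · exact M.baseChange_th_c00 A f' f g' g

/-- Extension of scalars. -/
def baseChange : InfSym.{u, v, max u w} A where
  C := M.C.baseChange A
  T := tensorBC A M.T
  assoc := M.assoc
  assoc000 f g k := by
    have e := M.baseChange_assoc000 A f g k
    simp only [← baseChange_idOfEq] at e
    exact e
  assoc100 f g k := by
    have e := M.baseChange_assoc100 A f g k
    simp only [← baseChange_idOfEq] at e
    simp only [tensorBC_m10]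
    exact e
  assoc010 f g k := by
    have e := M.baseChange_assoc010 A f g k
    simp only [← baseChange_idOfEq] at e
    simp only [tensorBC_m10, tensorBC_m01]
    exact e
  assoc001 f g k := by
    have e := M.baseChange_assoc001 A f g k
    simp only [← baseChange_idOfEq] at e
    simp only [tensorBC_m01]
    exact e
  braid := M.braid.baseChange₂ A
  braid_pseudonat := M.baseChange_braid_pseudonat A
  braid_hty := M.baseChange_braid_hty A
  braid_braid U V := by
    refine (bilinBC_tmul A M.C.c00 1 1 (M.γ V U) (M.γ U V)).trans ?_
    rw [M.γ_γ, mul_one]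
    rfl
  hex U V W := by
    have e := M.baseChange_hex A U V W
    simp only [← baseChange_idOfEq] at e
    exact e
  t := M.t.baseChange₂ A
  t_pseudonat := M.baseChange_t_pseudonat A
  t_left_app U V W := by
    have e := M.baseChange_t_left_app A U V W
    simp only [← baseChange_idOfEq] at e
    exact e
  t_left_hty f g k := by
    have e := M.baseChange_t_left_hty A f g k
    simp only [← baseChange_idOfEq] at e
    simp only [tensorBC_m10, tensorBC_m01]
    exact e
  t_right_app U V W := by
    have e := M.baseChange_t_right_app A U V W
    simp only [← baseChange_idOfEq] at e
    exact e
  t_right_hty f g k := by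
    have e := M.baseChange_t_right_hty A f g k
    simp only [← baseChange_idOfEq] at e
    simp only [tensorBC_m10, tensorBC_m01]
    exact e
  symm_app := M.baseChange_γ_ta A
  symm_hty f g := M.baseChange_γ_th A f g
  total U V W := by
    refine (bilinBC_tmul A M.th 1 1 (M.γ U V) (M.C.one W)).trans ?_
    rw [M.th_γ_one, TensorProduct.tmul_zero]
    rfl

end InfSym

end

/-! ### Hexagonators after extension of scalars, the ring K[h]/(h³), and the conclusion -/

section

namespace InfSym

variable {R : Type u} [CommRing R] (M : InfSym.{u, v, w} R) (A : Type u) [CommRing A] [Algebra R A]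

local notation "𝐢" => CochCat.one (InfSym.C M)
local notation "𝐞" => CochCat.idOfEq (InfSym.C M)
local notation:80 f:81 " ⬝ " g:80 => bilinBC A (CochCat.c00 (InfSym.C M)) f g
local notation:80 f:81 " ◁ " q:80 => bilinBC A (CochCat.c01 (InfSym.C M)) f q
local notation:80 q:81 " ▷ " f:80 => bilinBC A (CochCat.c10 (InfSym.C M)) q f
local notation:90 U:90 " ⋆ " V:91 => Func.o (InfSym.T M) U V

theorem two_smul_one_tmul {N : Type w} [AddCommGroup N] [Module R N] (x : N) :
    (2 : A) • ((1 : A) ⊗ₜ[R] x) = 1 ⊗ₜ ((2 : R) • x) := by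
  rw [two_smul, two_smul, TensorProduct.tmul_add]

theorem smul_one_tmul {N : Type w} [AddCommGroup N] [Module R N] (c : A) (x : N) :
    c • ((1 : A) ⊗ₜ[R] x) = c ⊗ₜ x := by
  rw [TensorProduct.smul_tmul', smul_eq_mul, mul_one]

theorem baseChange_infHexL (U V W : M.C.Obj) :
    (M.baseChange A).whisk.infHexL U V W = 1 ⊗ₜ M.whisk.infHexL U V W := by
  have e : ((1 ⊗ₜ 𝐞 (M.assoc V W U)) ⬝ ((1 ⊗ₜ M.γ U (V ⋆ W)) ⬝ (1 ⊗ₜ 𝐞 (M.assoc U V W)))) ◁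
      ((2 : A) • bilinBC A M.th (1 ⊗ₜ M.ta U V) (1 ⊗ₜ[R] 𝐢 W) + (1 ⊗ₜ 𝐞 (M.assoc U V W).symm) ◁
        (bilinBC A M.th (1 ⊗ₜ 𝐢 U) (1 ⊗ₜ M.ta V W) ▷ (1 ⊗ₜ[R] 𝐞 (M.assoc U V W)))) =
      1 ⊗ₜ M.whisk.infHexL U V W := by
    simp only [bilinBC_tmul, mul_one, two_smul_one_tmul, ← TensorProduct.tmul_add]
    rfl
  simp only [← baseChange_idOfEq] at e
  exact e

theorem baseChange_infHexR (U V W : M.C.Obj) :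
    (M.baseChange A).whisk.infHexR U V W = 1 ⊗ₜ M.whisk.infHexR U V W := by
  have e : ((1 ⊗ₜ 𝐞 (M.assoc W U V).symm) ⬝ ((1 ⊗ₜ M.γ (U ⋆ V) W) ⬝
      (1 ⊗ₜ 𝐞 (M.assoc U V W).symm))) ◁
      ((1 ⊗ₜ 𝐞 (M.assoc U V W)) ◁
        (bilinBC A M.th (1 ⊗ₜ M.ta U V) (1 ⊗ₜ 𝐢 W) ▷ (1 ⊗ₜ[R] 𝐞 (M.assoc U V W).symm)) +
          (2 : A) • bilinBC A M.th (1 ⊗ₜ 𝐢 U) (1 ⊗ₜ[R] M.ta V W)) =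
      1 ⊗ₜ M.whisk.infHexR U V W := by
    simp only [bilinBC_tmul, mul_one, two_smul_one_tmul, ← TensorProduct.tmul_add]
    rfl
  simp only [← baseChange_idOfEq] at e
  exact e

theorem braided_baseChange_hL {k c : A} (hk : IsOrderTwo k c) (U V W : M.C.Obj) :
    ((M.baseChange A).braided hk).hL U V W = c ⊗ₜ[R] M.whisk.infHexL U V W :=
  (congrArg (c • ·) (M.baseChange_infHexL A U V W)).trans
    (smul_one_tmul A c _)

theorem braided_baseChange_hR {k c : A} (hk : IsOrderTwo k c) (U V W : M.C.Obj) :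
    ((M.baseChange A).braided hk).hR U V W = c ⊗ₜ[R] M.whisk.infHexR U V W :=
  (congrArg (c • ·) (M.baseChange_infHexR A U V W)).trans
    (smul_one_tmul A c _)

end InfSym

theorem hbar_pow_three (K : Type u) [Field K] : hbar K ^ 3 = 0 := by
  rw [hbar, ← map_pow]
  exact Ideal.Quotient.eq_zero_iff_mem.2 (Ideal.subset_span rfl)

/-- For k = h/2 and c = h²/24: k² = h²/4 = 6c since 1/4 = 6/24, while kc and c² are multiples of h³.
-/
theorem isOrderTwo_hbar (K : Type u) [Field K] [CharZero K] :
    IsOrderTwo (algebraMap K (Trunc3 K) (1 / 2) * hbar K)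
      (algebraMap K (Trunc3 K) (1 / 24) * hbar K ^ 2) where
  mul_self := by
    have e : algebraMap K (Trunc3 K) (1 / 2) * algebraMap K (Trunc3 K) (1 / 2) =
        6 * algebraMap K (Trunc3 K) (1 / 24) := by
      rw [← map_mul, ← map_ofNat (algebraMap K (Trunc3 K)) 6, ← map_mul]
      norm_num
    linear_combination hbar K ^ 2 * e
  mul := by
    linear_combination algebraMap K (Trunc3 K) (1 / 2) * algebraMap K (Trunc3 K) (1 / 24) *
      hbar_pow_three K
  sq := by
    linear_combination algebraMap K (Trunc3 K) (1 / 24) * algebraMap K (Trunc3 K) (1 / 24) *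
      hbar K * hbar_pow_three K

theorem algebraMap_one_div_eight (K : Type u) [Field K] [CharZero K] :
    algebraMap K (Trunc3 K) (1 / 8) * hbar K ^ 2 =
      3 * (algebraMap K (Trunc3 K) (1 / 24) * hbar K ^ 2) := by
  rw [← mul_assoc, ← map_ofNat (algebraMap K (Trunc3 K)) 3, ← map_mul]
  norm_num

/-- The coefficient h²/8 of the exponential is 3c. Apart from this the two transformations agree
definitionally; for the associator no such adjustment is needed, as its coefficient is already c. -/
theorem SymStrictMon.braidOrder2_eq {K : Type u} [Field K] [CharZero K]
    (S : SymStrictMon.{u, v, w} K) (t : PreTrans (S.C.box S.C) S.C S.T.obj S.T.obj)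
    (ht : IsPseudonat S.T S.T t) (hstrict : S.IsStrict t) (hsymm : S.IsTotallySymmetric t) :
    S.braidOrder2 t = ((S.infSym t ht hstrict hsymm).baseChange (Trunc3 K)).σHom
      (algebraMap K (Trunc3 K) (1 / 2) * hbar K)
      (algebraMap K (Trunc3 K) (1 / 24) * hbar K ^ 2) := by
  rw [SymStrictMon.braidOrder2, algebraMap_one_div_eight]
  rfl

end

theorem mainTheorem2 {K : Type u} [Field K] [CharZero K] (S : SymStrictMon.{u, v, w} K)
    (t : PreTrans (S.C.box S.C) S.C S.T.obj S.T.obj) (ht : IsPseudonat S.T S.T t)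
    (hstrict : S.IsStrict t) (hsymm : S.IsTotallySymmetric t) :
    ∃ B : BraidedData S.T3,
      B.assoc.hom = S.assocOrder2 t ∧
      B.braid.hom = S.braidOrder2 t ∧
      (∀ U V W X : S.C.Obj, B.p U V W X = 0) ∧
      (∀ U V W : S.C.Obj,
        B.hL U V W = (algebraMap K (Trunc3 K) (1 / 24) * hbar K ^ 2) ⊗ₜ[K] S.infHexL t U V W) ∧
      (∀ U V W : S.C.Obj,
        B.hR U V W = (algebraMap K (Trunc3 K) (1 / 24) * hbar K ^ 2) ⊗ₜ[K] S.infHexR t U V W) ∧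
      B.LeftTetrahedron ∧ B.RightTetrahedron ∧ B.Hexahedron :=
  let M := S.infSym t ht hstrict hsymm
  let N := M.baseChange (Trunc3 K)
  have hk := isOrderTwo_hbar K
  ⟨N.braided hk, rfl, (S.braidOrder2_eq t ht hstrict hsymm).symm, fun _ _ _ _ => rfl,
    fun U V W => M.braided_baseChange_hL (Trunc3 K) hk U V W,
    fun U V W => M.braided_baseChange_hR (Trunc3 K) hk U V W, N.braided_leftTetrahedron hk,
    N.braided_rightTetrahedron hk, N.braided_hexahedron hk⟩
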